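/- Let $n\ge 2$, let $U$ be a $2n$-dimensional vector space over $\mathbb F_2$ and let $\xi_-$ be a non-singular quadratic form on $U$ of $-$type (its Arf invariant, the value taken by the majority of the vectors, is $1$). Let $S(U^*)$ be the symmetric algebra on the dual of $U$, with its Steenrod squares $Sq^i$ (the total square $\sum_i Sq^i$ is the ring homomorphism with $x\mapsto x+x^2$ for $x\in U^*$); quadratic forms are identified with elements of degree two of $S(U^*)$. Let $O^-$ be the group of automorphisms of $U$ preserving $\xi_-$. **Notation.** For a $2m$-dimensional $\mathbb F_2$-space with a non-degenerate alternating form $b$, let $\xi_0$ be a quadratic form polarizing to $b$, let $\xi_{i+1}=Sq^{2^i}\xi_i$ (for $i\ge1$, $\xi_i$ depends only on $b$), let the Dickson invariants $c_j$ be given by $\prod_{x}(X+x)=\sum_{j=0}^{2m}c_jX^{2^j}$ ($x$ running over the dual space), and let $Q^-(X)=\prod(X+r)$ over the quadratic forms $r$ of $-$type that polarize to $b$. In the abstract ring $\mathbb F_2[X,\xi_1,\xi_2,\dots]$ let $\Omega^-_{2m}(X)$ be the unique polynomial in $X,\xi_1,\dots,\xi_{2m}$ that becomes $c_0Q^-(X)$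 on the $2m$-space, and let $\alpha^-_m$, $m\ge0$, be the unique polynomials, $\alpha_m^-$ in $X,\xi_1,\dots,\xi_{2m}$, such that $Q^-(X)=\sum_{\ell=0}^m c_{m+\ell}\,\alpha^-_\ell(X)^{2^{m-\ell}}$ on the $2m$-space for each $m$. For a matrix $M$, $M^{*2}$ and $\sqrt M$ denote the entrywise square and square root, and $M'$ is $M$ without its first row. Let $(m_{ij})_{0\le i,j<2m}$ be the symmetric matrix with $m_{ii}=0$ and $m_{ij}=\xi_{j-i}^{2^i}$ for $i<j$; $\mathbf L_m$ and $\mathbf R_m$ are the left and right $m\times m$ halves of its first $m$ rows. The $m\times m$ matrices $\mathbf K_m$ and columns $\mathbf E_m$ of polynomials in the $\xi_i$, $i\ge1$, are determined by $$\mathbf K_m=\begin{pmatrix}0&0\\ \mathbf K_{m-1}^{*2}&\mathbf E_{m-1}^{*2}\end{pmatrix},\qquad \begin{pmatrix}c_0\\ \vdots\\ c_{m-1}\end{pmatrix}=\mathbf K_m\begin{pmatrix}c_m\\ \vdots\\ c_{2m-1}\end{pmatrix}+\mathbf E_m$$ on the $2m$-space, with $\mathbf K_0$, $\mathbf E_0$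 empty. For $0\le k,\ell<n$ let $(\mathbf U_n)_{k\ell}$ be the $2^{n-1-\ell}$-th power of the coefficient of $t^{2^{k+\ell}-2^\ell}$ in $\alpha^-_\ell(t^2+\xi_0)$ (zero if $k>\ell$; an upper unitriangular matrix), and let $(\mathbf V_n)_k$ be the coefficient of $t^{2^{n+k}-2^n}$ in $\alpha_n^-(t^2+\xi_0)$; put $\mathbf J_n=\mathbf U_n^{-1}$ and $\mathbf F_n=\mathbf J_n^{*2}\mathbf V_n$. Let $\mathbf T_{n-1}$ be the $(n-1)\times(n-1)$ matrix obtained by deleting the first column of $$\left(\left(\mathbf L_{n-1}\mathbf K_{n-1}\ \ \ \mathbf L_{n-1}\mathbf E_{n-1}\right)+\sqrt{\mathbf R_n'}\right)\mathbf J_n .$$ **Theorem.** Let $T^\dagger$ be the polynomial ring over $\mathbb F_2$ on generators $$\xi_0,\dots,\xi_{2n-2},\,d_{2n-1},\dots,d_{n+1},\qquad \deg\xi_i=2^i+1,\quad \deg d_j=2^{2n-1}-2^{j-1},$$ and let $T^\dagger\to S(U^*)$ send $\xi_0$ to $\xi_-$, $\xi_i$ to $Sq^{2^{i-1}}\cdots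 Sq^2Sq^1\xi_-$ and $d_j$ to the elementary symmetric polynomial of degree $2^{2n-1}-2^{j-1}$ in the vectors $x\in U^*$ such that $\xi_-+x^2$ is of $-$type. Then: 1. The map preserves degrees and its image is the ring of invariants $S(U^*)^{O^-}$. 2. The polynomials $\alpha^-_m$ and the columns $\mathbf E_m$ exist, and every entry of $\mathbf L_n'\mathbf E_n+(\mathbf L_n'\mathbf K_n+\mathbf R_n')\mathbf F_n$ is the square of a polynomial in $\xi_0,\dots,\xi_{2n-1}$. Adjoin a redundant generator $\xi_{2n-1}$ to $T^\dagger$, mapping to $Sq^{2^{2n-2}}\cdots Sq^1\xi_-$. The kernel of the resulting map $T^\dagger[\xi_{2n-1}]\to S(U^*)$ is generated by the regular sequence $r_1,\dots,r_{n-1}$ of entries of the column $$\mathbf T_{n-1}\begin{pmatrix}d_{n+1}\\ \vdots\\ d_{2n-1}\end{pmatrix}+\begin{pmatrix}\xi_{2n-1}\\ \vdots\\ \xi_{n+1}^{2^{n-2}}\end{pmatrix}+\sqrt{\mathbf L_n'\mathbf E_n+(\mathbf L_n'\mathbf K_n+\mathbf R_n')\mathbf F_n},$$ whose second summand has $i$-th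 entry $\xi_{2n-i}^{2^{i-1}}$. The entry $r_i$ is homogeneous of degree $2^{2n-1}+2^{i-1}$; $r_i-\xi_{2n-i}^{2^{i-1}}$ has degree less than $2^{i-1}$ in $\xi_{2n-i}$; and $r_i$ does not lie in the ideal generated by the other $r_k$. In particular $r_1$ expresses $\xi_{2n-1}$ through the generators of $T^\dagger$. 3. The matrix $\mathbf T_{n-1}$ involves only $\xi_0,\dots,\xi_{2n-2}$ and $\det\mathbf T_{n-1}=\Omega^-_{2n-2}(\xi_0)$ (hence $\Omega^-_{2n-2}(\xi_-)$ in $S(U^*)$). 4. Eliminating $\xi_{2n-1}$ by means of $r_1$ turns $r_2,\dots,r_{n-1}$ into a regular sequence of $n-2$ elements of $T^\dagger$, homogeneous of degrees $2^{2n-1}+2^j$ for $1\le j\le n-2$, which generates the kernel of $T^\dagger\to S(U^*)$. 5. This regular sequence is extended by the $2n$ elements $\xi_0,\dots,\xi_n,d_{2n-1},\dots,d_{n+1}$ to a regular sequence of length $3n-2$, the Krull dimension of $T^\dagger$. Likewise $r_1,\dots,r_{n-1}$ is extended by the same $2n$ elements to a regular sequence of length $3n-1$, the Krull dimension of $T^\dagger[\xi_{2n-1}]$.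 6. The ring of invariants $S(U^*)^{O^-}$ is a complete intersection. -/

import Mathlib

noncomputable section

namespace OrthInv

/-! ### The symmetric algebra and the Steenrod squares -/

section SymmetricAlgebra

variable {U : Type*} [AddCommGroup U] [Module (ZMod 2) U]

/-- `S(U^*)`, the symmetric algebra on the dual of `U`, over the field with two elements. -/
abbrev Sym (U : Type*) [AddCommGroup U] [Module (ZMod 2) U] : Type _ :=
  SymmetricAlgebra (ZMod 2) (Module.Dual (ZMod 2) U)

/-- The inclusion of `U^*` in `S(U^*)`. -/
abbrev vec (x : Module.Dual (ZMod 2) U) : Sym U :=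
  SymmetricAlgebra.ι (ZMod 2) (Module.Dual (ZMod 2) U) x

/-- The homogeneous part of degree `d` of `S(U^*)`: the span of the `d`-fold products of elements
of `U^*`. -/
def degreePart (U : Type*) [AddCommGroup U] [Module (ZMod 2) U] (d : ℕ) :
    Submodule (ZMod 2) (Sym U) :=
  LinearMap.range (SymmetricAlgebra.ι (ZMod 2) (Module.Dual (ZMod 2) U)) ^ d

theorem add_self_eq_zero_of_algebra {A : Type*} [CommRing A] [Algebra (ZMod 2) A] (a : A) :
    a + a = 0 := by
  have h : (2 : ZMod 2) = 0 := rfl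
  rw [← two_smul (ZMod 2) a, h, zero_smul]

/-- The linear map `x ↦ x + x² t` from `U^*` to `S(U^*)[t]`. -/
def steenrodLinear (U : Type*) [AddCommGroup U] [Module (ZMod 2) U] :
    Module.Dual (ZMod 2) U →ₗ[ZMod 2] Polynomial (Sym U) :=
  AddMonoidHom.toZModLinearMap 2
    { toFun := fun x => Polynomial.C (vec x) + Polynomial.C (vec x ^ 2) * Polynomial.X
      map_zero' := by simp
      map_add' := fun x y => by
        have h : vec (x + y) ^ 2 = vec x ^ 2 + vec y ^ 2 := by
          have h2 := add_self_eq_zero_of_algebra (vec x * vec y)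
          have h3 : vec (x + y) = vec x + vec y := map_add _ x y
          rw [h3]
          linear_combination h2
        have h3 : vec (x + y) = vec x + vec y := map_add _ x y
        rw [h, h3, Polynomial.C_add, Polynomial.C_add]
        ring }

/-- The total Steenrod operation `∑ Sq^i t^i`, the ring homomorphism with `x ↦ x + x² t` for
`x ∈ U^*`. -/
def steenrodTotal (U : Type*) [AddCommGroup U] [Module (ZMod 2) U] :
    Sym U →ₐ[ZMod 2] Polynomial (Sym U) :=
  SymmetricAlgebra.lift (steenrodLinear U)

/-- The Steenrod square `Sq^i` on `S(U^*)`. -/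
def Sq (i : ℕ) (s : Sym U) : Sym U := (steenrodTotal U s).coeff i

end SymmetricAlgebra

/-! ### Quadratic forms, the elements `ξ_i`, `d_j`, `c_j`, and the orthogonal group -/

section Forms

variable {U : Type*} [AddCommGroup U] [Module (ZMod 2) U]

/-- A form on an even-dimensional space is of `-`type if it is non-singular and its Arf invariant
(the value taken by a majority of the vectors) is `1`. -/
def IsMinusType (q : QuadraticForm (ZMod 2) U) : Prop :=
  q.radical = ⊥ ∧ Nat.card {u : U // q u = 0} < Nat.card {u : U // q u = 1}

/-- The quadratic form `q + x²`, for `x ∈ U^*`. -/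
def addSq (q : QuadraticForm (ZMod 2) U) (x : Module.Dual (ZMod 2) U) :
    QuadraticForm (ZMod 2) U :=
  q + (QuadraticMap.sq (R := ZMod 2)).comp x

/-- The orthogonal group of `(U, q)`. -/
def orthogonalGroup (q : QuadraticForm (ZMod 2) U) : Subgroup (U ≃ₗ[ZMod 2] U) where
  carrier := {g | ∀ u, q (g u) = q u}
  one_mem' := fun _ => rfl
  mul_mem' := fun {a b} ha hb u => by
    rw [LinearEquiv.mul_apply, ha, hb]
  inv_mem' := fun {a} ha u => by
    have h := ha (a⁻¹ u)
    rw [← LinearEquiv.mul_apply, mul_inv_cancel] at h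
    exact h.symm

/-- The automorphism of `S(U^*)` induced by `g`, determined by `x ↦ x ∘ g⁻¹` on `U^*`. -/
def symAction (g : U ≃ₗ[ZMod 2] U) : Sym U →ₐ[ZMod 2] Sym U :=
  SymmetricAlgebra.lift
    ((SymmetricAlgebra.ι (ZMod 2) (Module.Dual (ZMod 2) U)).comp
      (g⁻¹ : U ≃ₗ[ZMod 2] U).toLinearMap.dualMap)

/-- The ring of invariants of the orthogonal group of `(U, q)` on `S(U^*)`. -/
def invariants (q : QuadraticForm (ZMod 2) U) : Subalgebra (ZMod 2) (Sym U) :=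
  ⨅ g ∈ orthogonalGroup q, AlgHom.equalizer (symAction g) (AlgHom.id (ZMod 2) (Sym U))

variable [FiniteDimensional (ZMod 2) U]

theorem finite_dual : Finite (Module.Dual (ZMod 2) U) :=
  Module.finite_of_finite (ZMod 2)

instance dualFintype : Fintype (Module.Dual (ZMod 2) U) :=
  @Fintype.ofFinite _ finite_dual

/-- The homogeneous element of degree two of `S(U^*)` that induces the quadratic form `q`, written
in the coordinates of a basis (the element does not depend on the basis). -/
def formElem (q : QuadraticForm (ZMod 2) U) : Sym U :=
  let e := Module.finBasis (ZMod 2) U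
  (∑ i, algebraMap (ZMod 2) (Sym U) (q (e i)) * vec (e.coord i) ^ 2) +
    ∑ i, ∑ j ∈ Finset.univ.filter (fun j => i < j),
      algebraMap (ZMod 2) (Sym U) (QuadraticMap.polar q (e i) (e j)) *
        (vec (e.coord i) * vec (e.coord j))

/-- `ξ_0 = q` and `ξ_{i+1} = Sq^{2^i} ξ_i`. -/
def xi (q : QuadraticForm (ZMod 2) U) : ℕ → Sym U
  | 0 => formElem q
  | i + 1 => Sq (2 ^ i) (xi q i)

open Classical in
/-- The set of all `x ∈ U^*` such that `q + x²` is of `-`type. -/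
def minusVectors (q : QuadraticForm (ZMod 2) U) : Finset (Module.Dual (ZMod 2) U) :=
  Finset.univ.filter fun x => IsMinusType (addSq q x)

/-- `d_j`, for `dim U = 2n`: the elementary symmetric polynomial of degree
`2^{2n-1} - 2^{j-1}` in the vectors `x ∈ U^*` such that `q + x²` is of `-`type. -/
def dInv (q : QuadraticForm (ZMod 2) U) (n j : ℕ) : Sym U :=
  ((minusVectors q).val.map vec).esymm (2 ^ (2 * n - 1) - 2 ^ (j - 1))

/-- The Dickson invariant `c_j`: the coefficient of `X^{2^j}` in `∏_{x ∈ U^*} (X + x)`. -/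
def dickson (U : Type*) [AddCommGroup U] [Module (ZMod 2) U] [FiniteDimensional (ZMod 2) U]
    (j : ℕ) : Sym U :=
  (∏ x : Module.Dual (ZMod 2) U, (Polynomial.X + Polynomial.C (vec x))).coeff (2 ^ j)

/-- The quadratic Chern polynomial `Q^-(X)`: the product of `X + r` over the `-`type forms `r`
with the same polarization as `q`; these forms are the `q + x²` with `x ∈ U^*`. -/
def Qminus (q : QuadraticForm (ZMod 2) U) : Polynomial (Sym U) :=
  ∏ x ∈ minusVectors q, (Polynomial.X + Polynomial.C (formElem (addSq q x)))

end Forms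

/-! ### Polynomials in the `ξ`'s

`XiRing` is the polynomial ring on symbols `ξ_0, ξ_1, ξ_2, …`; the symbol `ξ_0` also serves as the
indeterminate `X` of polynomials such as `Ω^-_{2m}(X)`. -/

section Abstract

/-- The abstract polynomial ring `𝔽₂[ξ_0, ξ_1, ξ_2, …]`, where `ξ_0` is also written `X`. -/
abbrev XiRing : Type := MvPolynomial ℕ (ZMod 2)

/-- The standard symplectic space of dimension `2m`. -/
abbrev Std (m : ℕ) : Type :=
  Module.Dual (ZMod 2) (Fin m → ZMod 2) × (Fin m → ZMod 2)

/-- The standard non-singular quadratic form `(f, v) ↦ f v` on the standard `2m`-space. -/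
abbrev stdForm (m : ℕ) : QuadraticForm (ZMod 2) (Std m) :=
  QuadraticForm.dualProd (ZMod 2) (Fin m → ZMod 2)

/-- The specialization to the symmetric algebra of the standard `2m`-space: `ξ_i` goes to the
invariant `ξ_i` for `i ≥ 1`, and `ξ_0` goes to the indeterminate `X`. -/
def spec (m : ℕ) : XiRing →ₐ[ZMod 2] Polynomial (Sym (Std m)) :=
  MvPolynomial.aeval fun i =>
    if i = 0 then Polynomial.X else Polynomial.C (xi (stdForm m) i)

/-- `p` is an expression of `s` as a polynomial in `X, ξ_1, …, ξ_{2m}`, in the symmetric algebra of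
the standard `2m`-space. There is at most one, as `ξ_1, …, ξ_{2m}` are algebraically
independent. -/
def IsXiExpression (m : ℕ) (s : Polynomial (Sym (Std m))) (p : XiRing) : Prop :=
  p ∈ MvPolynomial.supported (ZMod 2) (Set.Iic (2 * m)) ∧ spec m p = s

open Classical in
/-- The expression of `s` as a polynomial in `X, ξ_1, …, ξ_{2m}` (zero if there is none). -/
def xiExpression (m : ℕ) (s : Polynomial (Sym (Std m))) : XiRing :=
  if h : ∃ p, IsXiExpression m s p then h.choose else 0

/-- `p = Ω^-_{2m}(X)`, i.e. `p` is the polynomial in `X, ξ_1, …, ξ_{2m}` that becomes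
`c_0 Q^-(X)` in the symmetric algebra of a symplectic `2m`-space. -/
def IsOmegaMinus (m : ℕ) (p : XiRing) : Prop :=
  IsXiExpression m (Polynomial.C (dickson (Std m) 0) * Qminus (stdForm m)) p

/-- The `(i, j)` entry (counting from `0`) of the symmetric matrix with zero diagonal and
`ξ_{j-i}^{2^i}` for `i < j`. -/
def symEntry (i j : ℕ) : XiRing :=
  if i = j then 0 else MvPolynomial.X (max i j - min i j) ^ 2 ^ min i j

/-- The left half `L_n` of the first `n` rows of the `2n × 2n` matrix of the `symEntry`s. -/
def L (n : ℕ) : Matrix (Fin n) (Fin n) XiRing :=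
  Matrix.of fun i j => symEntry i j

/-- `L'_n`: the matrix `L_n` without its first row. -/
def L' (n : ℕ) : Matrix (Fin (n - 1)) (Fin n) XiRing :=
  Matrix.of fun i j => symEntry (i + 1) j

/-- `R'_n`: the matrix `R_n` without its first row, where `R_n` is the right half of the first `n`
rows of the `2n × 2n` matrix of the `symEntry`s. -/
def R' (n : ℕ) : Matrix (Fin (n - 1)) (Fin n) XiRing :=
  Matrix.of fun i j => symEntry (i + 1) (n + j)

/-- One step of the recursion for `K`: the block matrix with a first row of zeros, below it the
entrywise squares of `K` and, as last column, those of `E`. -/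
def stepK {n : ℕ} (K : Matrix (Fin n) (Fin n) XiRing) (E : Fin n → XiRing) :
    Matrix (Fin (n + 1)) (Fin (n + 1)) XiRing :=
  Matrix.of fun i j =>
    Fin.cases 0 (fun i' => Fin.lastCases (E i' ^ 2) (fun j' => K i' j' ^ 2) j) i

/-- The element `c_i - ∑_j K_{ij} c_{n+j}` of the symmetric algebra of the standard `2n`-space. -/
def dicksonRemainder (n : ℕ) (K : Matrix (Fin n) (Fin n) XiRing) (i : Fin n) :
    Polynomial (Sym (Std n)) :=
  Polynomial.C (dickson (Std n) i) -
    ∑ j : Fin n, spec n (K i j) * Polynomial.C (dickson (Std n) (n + j))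

/-- The matrix `K_n` and the column `E_n`, with
`(c_0, …, c_{n-1}) = K_n (c_n, …, c_{2n-1}) + E_n`. -/
def KE : (n : ℕ) → Matrix (Fin n) (Fin n) XiRing × (Fin n → XiRing)
  | 0 => (0, 0)
  | n + 1 =>
    let K := stepK (KE n).1 (KE n).2
    (K, fun i => xiExpression (n + 1) (dicksonRemainder (n + 1) K i))

/-- The matrix `K_n`. -/
def K (n : ℕ) : Matrix (Fin n) (Fin n) XiRing := (KE n).1

/-- The column `E_n`. -/
def E (n : ℕ) : Fin n → XiRing := (KE n).2

/-- The polynomials `α^-_m(X)`, with `Q^-(X) = ∑_{ℓ ≤ m} c_{m+ℓ} α^-_ℓ(X)^{2^{m-ℓ}}` on the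
`2m`-space for every `m` (here `c_{2m} = 1`). -/
def alpha (m : ℕ) : XiRing :=
  xiExpression m (Qminus (stdForm m) -
    ∑ l : Fin m, Polynomial.C (dickson (Std m) (m + l)) * spec m (alpha l) ^ 2 ^ (m - l))
termination_by m
decreasing_by exact l.2

/-- `α^-_m(t² + ξ_0)`, a polynomial in `t`. -/
def alphaT (m : ℕ) : Polynomial XiRing :=
  MvPolynomial.aeval (fun i : ℕ =>
    if i = 0 then Polynomial.X ^ 2 + Polynomial.C (MvPolynomial.X 0 : XiRing)
    else Polynomial.C (MvPolynomial.X i)) (alpha m)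

/-- The upper unitriangular matrix `U_n`; with the column `V_n` it satisfies
`d_{n+k}² = ∑_ℓ (U_n)_{kℓ}² c_{n+ℓ} + (V_n)_k`, the comparison of the coefficients of
`t^{2^{n+k} - 2^n}` in `P^-(t)² = ∑_{ℓ ≤ n} c_{n+ℓ} α^-_ℓ(t² + ξ_0)^{2^{n-ℓ}}`. -/
def Umat (n : ℕ) : Matrix (Fin n) (Fin n) XiRing :=
  Matrix.of fun k l =>
    (alphaT l).coeff (2 ^ ((k : ℕ) + l) - 2 ^ (l : ℕ)) ^ 2 ^ (n - 1 - (l : ℕ))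

/-- The column `V_n`. -/
def Vvec (n : ℕ) : Fin n → XiRing :=
  fun k => (alphaT n).coeff (2 ^ (n + (k : ℕ)) - 2 ^ n)

/-- `J_n = U_n⁻¹`. -/
def J (n : ℕ) : Matrix (Fin n) (Fin n) XiRing := (Umat n)⁻¹

/-- `F_n`, so that `(c_n, …, c_{2n-1}) = J_n^{*2} (d_n², …, d_{2n-1}²) + F_n`. -/
def F (n : ℕ) : Fin n → XiRing := ((J n).map fun a => a ^ 2).mulVec (Vvec n)

/-- The block matrix `(L_{n-1} K_{n-1}  L_{n-1} E_{n-1})`. -/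
def LKE (n : ℕ) : Matrix (Fin (n - 1)) (Fin n) XiRing :=
  Matrix.of fun i j =>
    if h : (j : ℕ) < n - 1 then (L (n - 1) * K (n - 1)) i ⟨j, h⟩
    else (L (n - 1)).mulVec (E (n - 1)) i

open Classical in
/-- The square root of a polynomial that is a square (zero otherwise); it is unique in
characteristic two. -/
def sqrtXi (p : XiRing) : XiRing :=
  if h : ∃ r, r ^ 2 = p then h.choose else 0

/-- The matrix `((L_{n-1} K_{n-1}  L_{n-1} E_{n-1}) + √R'_n) J_n`. -/
def relMatrix (n : ℕ) : Matrix (Fin (n - 1)) (Fin n) XiRing :=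
  (LKE n + (R' n).map sqrtXi) * J n

/-- `T_{n-1}`: the preceding matrix without its first column. -/
def T (n : ℕ) : Matrix (Fin (n - 1)) (Fin (n - 1)) XiRing :=
  Matrix.of fun i j => relMatrix n i ⟨j + 1, by omega⟩

/-- The column `L'_n E_n + (L'_n K_n + R'_n) F_n`. -/
def squareColumn (n : ℕ) : Fin (n - 1) → XiRing :=
  (L' n).mulVec (E n) + (L' n * K n + R' n).mulVec (F n)

/-- The column `√(L'_n E_n + (L'_n K_n + R'_n) F_n)`. -/
def rootColumn (n : ℕ) : Fin (n - 1) → XiRing := fun i => sqrtXi (squareColumn n i)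

end Abstract

/-! ### The presentation -/

section Presentation

/-- The polynomial ring on `ξ_0, …, ξ_{k-1}` (the symbols `inl i`) and `d_{n+1}, …, d_{2n-1}`
(where `inr j` is `d_{n+1+j}`). -/
abbrev GenRing (k n : ℕ) : Type := MvPolynomial (Fin k ⊕ Fin (n - 1)) (ZMod 2)

/-- The polynomial ring on the generators `ξ_0, …, ξ_{2n-2}, d_{2n-1}, …, d_{n+1}`. -/
abbrev TDagger (n : ℕ) : Type := GenRing (2 * n - 1) n

/-- The same ring with the redundant generator `ξ_{2n-1}` added. -/
abbrev TStar (n : ℕ) : Type := GenRing (2 * n) n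

/-- The generator `ξ_i`, for `i < k`. -/
def genXi (k n : ℕ) (i : Fin k) : GenRing k n := MvPolynomial.X (Sum.inl i)

/-- The generator `d_{n+1+j}`. -/
def genD (k n : ℕ) (j : Fin (n - 1)) : GenRing k n := MvPolynomial.X (Sum.inr j)

/-- The degrees of the generators: `2^i + 1` for `ξ_i` and `2^{2n-1} - 2^{j-1}` for `d_j`. -/
def wt (k n : ℕ) : Fin k ⊕ Fin (n - 1) → ℕ :=
  Sum.elim (fun i => 2 ^ (i : ℕ) + 1) (fun j => 2 ^ (2 * n - 1) - 2 ^ (n + (j : ℕ)))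

/-- The map to `S(U^*)` sending the generators to the elements of the same names, with `ξ_0` sent
to `q`. -/
def presMap {U : Type*} [AddCommGroup U] [Module (ZMod 2) U] [FiniteDimensional (ZMod 2) U]
    (q : QuadraticForm (ZMod 2) U) (k n : ℕ) : GenRing k n →ₐ[ZMod 2] Sym U :=
  MvPolynomial.aeval (Sum.elim (fun i => xi q i) (fun j => dInv q n (n + 1 + j)))

/-- The homomorphism that reads a polynomial in `ξ_0, …, ξ_{k-1}` as an element of
`GenRing k n` (it is only applied to polynomials that do not involve `ξ_i` for `i ≥ k`). -/
def ofXi (k n : ℕ) : XiRing →ₐ[ZMod 2] GenRing k n :=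
  MvPolynomial.aeval fun i => if h : i < k then genXi k n ⟨i, h⟩ else 0

/-- The power `ξ_{2n-i}^{2^{i-1}}`, with `i` counted from `1` (in the code, from `0`). -/
def leadPower (n : ℕ) (i : Fin (n - 1)) : TStar n :=
  genXi (2 * n) n ⟨2 * n - 1 - i, by omega⟩ ^ 2 ^ (i : ℕ)

/-- The `i`-th entry of
`T_{n-1} (d_{n+1}, …, d_{2n-1}) + (ξ_{2n-1}, …, ξ_{n+1}^{2^{n-2}}) + √(…)`. -/
def relator (n : ℕ) (i : Fin (n - 1)) : TStar n :=
  (∑ j : Fin (n - 1), ofXi (2 * n) n (T n i j) * genD (2 * n) n j) + leadPower n i +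
    ofXi (2 * n) n (rootColumn n i)

/-- The elimination of `ξ_{2n-1}`: the homomorphism that fixes the other generators and sends
`ξ_{2n-1}` to `g`. -/
def elim (n : ℕ) (g : TDagger n) : TStar n →ₐ[ZMod 2] TDagger n :=
  MvPolynomial.aeval
    (Sum.elim (fun i => if h : (i : ℕ) < 2 * n - 1 then genXi (2 * n - 1) n ⟨i, h⟩ else g)
      (fun j => genD (2 * n - 1) n j))

/-- The remaining `n - 2` relations: the second to the last entry of the column of relations, with
`ξ_{2n-1}` replaced by the expression for it that the first entry provides. -/
def reducedRelator (n : ℕ) (i : Fin (n - 2)) : TDagger n :=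
  elim n (elim n 0 (relator n ⟨0, by have := i.isLt; omega⟩)) (relator n ⟨i + 1, by omega⟩)

/-- The list `ξ_0, …, ξ_n, d_{2n-1}, …, d_{n+1}` of `2n` generators (for `n < k`). -/
def parameterList (k n : ℕ) (h : n < k) : List (GenRing k n) :=
  List.ofFn (fun i : Fin (n + 1) => genXi k n (Fin.castLE h i)) ++
    List.ofFn (fun j : Fin (n - 1) => genD k n j.rev)

end Presentation

/-! ### Complete intersections -/

universe u

/-- A Noetherian ring is a complete intersection if each of its local rings is the quotient of a
regular local ring by a regular sequence. (For rings essentially of finite type over a field, as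
here, this is the same as asking it of the completed local rings.) -/
def IsCompleteIntersection (R : Type u) [CommRing R] : Prop :=
  IsNoetherianRing R ∧ ∀ (p : Ideal R) [p.IsPrime],
    ∃ (B : Type u) (_ : CommRing B) (_ : IsRegularLocalRing B) (rs : List B),
      RingTheory.Sequence.IsRegular B rs ∧
        Nonempty (Localization.AtPrime p ≃+* B ⧸ Ideal.ofList rs)

end OrthInv

end

noncomputable section

namespace OrthInv

set_option linter.unusedSectionVars false
set_option linter.unusedSimpArgs false
set_option linter.unusedDecidableInType false
set_option linter.unusedFintypeInType false
set_option linter.style.haveILetI false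

open Polynomial
open MvPolynomial (comp_aeval isHomogeneous_X X_prime supported C_surjective supported_mono
  rename_C rename_X aeval_rename rename_injective optionEquivLeft mem_vars_iff_mem_support
  weightedHomogeneousSubmodule monomial_mul)
open Finset (sum_add_distrib sum_eq_single prod_congr univ prod_pair range sum_congr
  sum_range_succ' sum_range_succ mul_sum prod_eq_zero mem_univ sum_eq_zero sum_range sum_comm
  sum_mul mem_filter prod_filter prod_mul_distrib sum_sub_distrib sum_insert sum_const_zero
  prod_const)
open Matrix (of_apply det_mul det_transpose fromBlocks det mulVec map_apply)
open Fintype (prod_equiv sum_equiv sum_option card card_option card_fin card_sum sum_sum_type)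
open Algebra (adjoin smul_def adjoin_le_iff)
open Ideal (subset_span span ofList span_le mul_mem_left)
open Submodule (smul_mem)
open Finsupp (weight weight_apply single single_eq_same single_eq_of_ne weight_single)
open Function (Injective Surjective)
open AlgHom (comp_apply map_det)
open Set (Iic Iio)
open LinearMap (BilinForm mem_ker mulLeft)
open QuadraticMap (polar polar_comm)
open CharTwo (neg_eq sq_injective)
open Nat (pow_lt_pow_right pow_le_pow_right sub_le)
open Sum (inl inr elim_inl elim_inr)
open Fin (val_succ val_last castLE)
open Module (Dual Basis finrank)
open List (mem_ofFn')
open Option (some_injective)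
open AlgEquiv (trans_apply symm_apply_eq)
open Equiv (sumCongr)
open Module.Basis (dualBasis_apply reindex_apply)
open LinearEquiv (apply_symm_apply)
open RingTheory.Sequence renaming IsRegular → IsRegSeq
open DFunLike renaming congr_fun → dcongr_fun
open Polynomial renaming map_mul → pmap_mul, map_add → pmap_add, map_pow → pmap_pow, map_sum →
  pmap_sum, map_prod → pmap_prod
open MvPolynomial renaming isWeightedHomogeneous_zero → isWH_zero, isWeightedHomogeneous_one →
  isWH_one, isWeightedHomogeneous_X → isWH_X, IsWeightedHomogeneous → IsWH, X → mX, aeval → maeval,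
  aeval_X → maeval_X, C → mC, algHom_ext → malgHom_ext, monomial → mmonomial, induction_on →
  minduction_on, X_pow_eq_monomial → mX_pow_eq, mem_support_iff → mmem_support, coeff_monomial →
  mcoeff_monomial

local notation "F₂" => ZMod 2
local notation "Poly" σ:max => MvPolynomial σ (ZMod 2)

/-- The polynomial ring in the coordinates. -/
abbrev CoordRing (ι : Type*) : Type _ := Poly ι

local notation "PairRing" κ:max => CoordRing (κ ⊕ κ)

theorem two_pow_le {a b : ℕ} (h : a ≤ b) : 2 ^ a ≤ 2 ^ b := pow_le_pow_right two_pos h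

/-- The entries of the column under the square root are squares. -/
abbrev HasRoots (n : ℕ) : Prop := ∀ i, IsSquare (squareColumn n i)

section Dickson
variable {A : Type*} [CommRing A] [Algebra F₂ A]
variable {ι ι' : Type*} [Fintype ι] [Fintype ι'] [DecidableEq ι] [DecidableEq ι']

/-- The linear combination of the family `x` with coefficients `v`. -/
def lin (x : ι → A) (v : ι → F₂) : A := ∑ i, v i • x i

theorem lin_add (x : ι → A) (v w : ι → F₂) : lin x (v + w) = lin x v + lin x w := by
  simp [lin, add_smul, sum_add_distrib]

@[simp] theorem lin_zero (x : ι → A) : lin x 0 = 0 := by simp [lin]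

theorem lin_single (x : ι → A) (i : ι) : lin x (Pi.single i 1) = x i := by
  rw [lin, sum_eq_single i]
  · simp
  · intro j _ hj; simp [hj]
  · simp

theorem map_lin {B : Type*} [CommRing B] [Algebra F₂ B] (f : A →ₐ[F₂] B) (x : ι → A)
    (v : ι → F₂) : f (lin x v) = lin (fun i => f (x i)) v := by
  simp [lin, map_sum]

/-- The Dickson polynomial of a family: the product of `X + y` over all linear combinations `y`. -/
def dick (x : ι → A) : A[X] := ∏ v : ι → F₂, (X + C (lin x v))

/-- The Dickson coefficients of a family. -/
def dk (x : ι → A) (j : ℕ) : A := (dick x).coeff (2 ^ j)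

theorem dick_map {B : Type*} [CommRing B] [Algebra F₂ B] (f : A →ₐ[F₂] B) (x : ι → A) :
    (dick x).map (f : A →+* B) = dick (fun i => f (x i)) := by
  rw [dick, pmap_prod]
  simp only [pmap_add, map_X, map_C]
  refine prod_congr rfl fun v _ => ?_
  rw [← map_lin]; rfl

theorem map_dk {B : Type*} [CommRing B] [Algebra F₂ B] (f : A →ₐ[F₂] B) (x : ι → A)
    (j : ℕ) : f (dk x j) = dk (fun i => f (x i)) j := by
  rw [dk, dk, ← dick_map, coeff_map]; rfl

theorem dick_reindex (e : ι' ≃ ι) (x : ι → A) : dick (fun i => x (e i)) = dick x := by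
  rw [dick, dick]
  refine prod_equiv (e.arrowCongr (Equiv.refl _)) _ _ fun v => ?_
  congr 2
  simp only [lin]
  refine sum_equiv e _ _ fun i => ?_
  simp

theorem dk_reindex (e : ι' ≃ ι) (x : ι → A) (j : ℕ) : dk (fun i => x (e i)) j = dk x j := by
  rw [dk, dk, dick_reindex]

theorem lin_option (x : Option ι → A) (v : Option ι → F₂) :
    lin x v = v none • x none + lin (fun i => x (some i)) (fun i => v (some i)) := by
  simp [lin, sum_option]

theorem dick_option_comp (x : Option ι → A) :
    dick x = dick (fun i => x (some i)) * (dick (fun i => x (some i))).comp (X + C (x none)) := by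
  rw [dick, ← prod_equiv (Equiv.piOptionEquivProd (β := fun _ : Option ι => F₂)).symm
    (fun p => X + C (p.1 • x none + lin (fun i => x (some i)) p.2)) _
    (fun p => by rw [lin_option]; simp [Equiv.piOptionEquivProd]), Fintype.prod_prod_type]
  rw [show (univ : Finset F₂) = {0, 1} from rfl, prod_pair (by decide)]
  rw [dick, prod_comp]
  congr 1
  · simp
  · refine prod_congr rfl fun v _ => ?_
    simp [add_assoc]

/-- A polynomial in which only the exponents `2 ^ j` occur, monic of degree `2 ^ N`. -/
def IsTwoPoly (P : A[X]) (N : ℕ) : Prop :=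
  ∃ c : ℕ → A, c N = 1 ∧ P = ∑ j ∈ range (N + 1), C (c j) * X ^ 2 ^ j

theorem IsTwoPoly.coeff_eq {P : A[X]} {N : ℕ} (h : IsTwoPoly P N) :
    P = ∑ j ∈ range (N + 1), C (P.coeff (2 ^ j)) * X ^ 2 ^ j ∧ P.coeff (2 ^ N) = 1 ∧
      ∀ j, N < j → P.coeff (2 ^ j) = 0 := by
  obtain ⟨c, hc, rfl⟩ := h
  have key : ∀ i, (∑ j ∈ range (N + 1), C (c j) * X ^ 2 ^ j).coeff (2 ^ i) =
      if i < N + 1 then c i else 0 := by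
    intro i
    simp only [finsetSum_coeff, coeff_C_mul, coeff_X_pow,
      (Nat.pow_right_injective (le_refl 2)).eq_iff, mul_ite, mul_one, mul_zero]
    rw [Finset.sum_ite_eq]
    simp
  refine ⟨?_, ?_, ?_⟩
  · refine sum_congr rfl fun j hj => ?_
    rw [key, if_pos (Finset.mem_range.mp hj)]
  · rw [key, if_pos (Nat.lt_succ_self N), hc]
  · intro j hj
    rw [key, if_neg (by omega)]

variable [CharP A 2]

theorem twoPoly_comp (c : ℕ → A) (N : ℕ) (y : A) :
    (∑ j ∈ range (N + 1), C (c j) * X ^ 2 ^ j).comp (X + C y) =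
      (∑ j ∈ range (N + 1), C (c j) * X ^ 2 ^ j) +
        C ((∑ j ∈ range (N + 1), C (c j) * X ^ 2 ^ j).eval y) := by
  simp only [sum_comp, mul_comp, C_comp, pow_comp, X_comp, eval_finsetSum,
    eval_mul, eval_C, eval_pow, eval_X, map_sum, ← sum_add_distrib]
  refine sum_congr rfl fun j _ => ?_
  rw [add_pow_char_pow, mul_add, C_mul, C_pow]

theorem dick_isTwoPoly (x : ι → A) : IsTwoPoly (dick x) (card ι) ∧
    ∀ y, (dick x).comp (X + C y) = dick x + C ((dick x).eval y) := by
  classical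
  suffices h : IsTwoPoly (dick x) (card ι) by
    refine ⟨h, fun y => ?_⟩
    obtain ⟨c, -, hc⟩ := h
    rw [hc, twoPoly_comp]
  refine Fintype.induction_empty_option (P := fun ι _ => ∀ (x : ι → A),
    ∀ [DecidableEq ι], IsTwoPoly (dick x) (card ι)) ?_ ?_ ?_ ι x
  · intro α β _ e ih x _
    haveI : DecidableEq α := Classical.decEq _
    letI : Fintype α := Fintype.ofEquiv β e.symm
    have := ih (fun i => x (e i))
    rw [dick_reindex e x] at this
    rwa [← Fintype.card_congr e]
  · intro x _
    refine ⟨fun _ => 1, rfl, ?_⟩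
    simp [dick, lin]
  · intro α _ ih x inst
    letI : DecidableEq α := Classical.decEq _
    obtain rfl : inst = (Option.instDecidableEq) := Subsingleton.elim _ _
    obtain ⟨c, hcN, hc⟩ := ih (fun i => x (some i))
    have hstep : dick x = dick (fun i => x (some i)) ^ 2 +
        C ((dick (fun i => x (some i))).eval (x none)) * dick (fun i => x (some i)) := by
      have := dick_option_comp x
      rw [hc, twoPoly_comp, ← hc] at this
      rw [this]
      ring
    set N := card α
    set w := (dick (fun i => x (some i))).eval (x none)
    refine ⟨fun j => (if j = 0 then 0 else c (j - 1) ^ 2) + (if j < N + 1 then w * c j else 0),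
      ?_, ?_⟩
    · rw [card_option]; simp [hcN, N]
    · have : dick x = (∑ j ∈ range (N + 1), C (c j) * X ^ 2 ^ j) ^ 2 +
          C w * (∑ j ∈ range (N + 1), C (c j) * X ^ 2 ^ j) := by rw [← hc]; exact hstep
      have h2 : dick x = (∑ j ∈ range (N + 1), (C (c j) * X ^ 2 ^ j) ^ 2) +
          C w * (∑ j ∈ range (N + 1), C (c j) * X ^ 2 ^ j) := by
        rw [this, sum_pow_char 2]
      rw [card_option, h2]
      simp only [map_add, add_mul, sum_add_distrib]
      congr 1
      · rw [sum_range_succ' _ (N + 1)]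
        simp only [Nat.add_eq_zero_iff, one_ne_zero, and_false, if_false, if_true,
          Nat.add_sub_cancel, map_zero, zero_mul, add_zero]
        refine sum_congr rfl fun j _ => ?_
        rw [C_pow]; ring
      · rw [sum_range_succ _ (N + 1), mul_sum]
        simp only [lt_irrefl, if_false, map_zero, zero_mul, add_zero]
        refine sum_congr rfl fun j hj => ?_
        rw [if_pos (Finset.mem_range.mp hj), C_mul, mul_assoc]

theorem dick_eq_sum (x : ι → A) :
    dick x = ∑ j ∈ range (card ι + 1), C (dk x j) * X ^ 2 ^ j :=
  (dick_isTwoPoly x).1.coeff_eq.1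

theorem dk_card (x : ι → A) : dk x (card ι) = 1 := (dick_isTwoPoly x).1.coeff_eq.2.1

theorem dk_of_lt (x : ι → A) {j : ℕ} (h : card ι < j) : dk x j = 0 :=
  (dick_isTwoPoly x).1.coeff_eq.2.2 j h

theorem dick_option (x : Option ι → A) : dick x = dick (fun i => x (some i)) ^ 2 +
    C ((dick (fun i => x (some i))).eval (x none)) * dick (fun i => x (some i)) := by
  rw [dick_option_comp, (dick_isTwoPoly _).2]; ring

theorem eval_dick_lin (x : ι → A) (v : ι → F₂) : (dick x).eval (lin x v) = 0 := by
  rw [dick, eval_prod]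
  refine prod_eq_zero (mem_univ v) ?_
  simp [add_self_eq_zero_of_algebra]

theorem sum_dk_mul_pow (x : ι → A) (i : ι) :
    ∑ j ∈ range (card ι + 1), dk x j * x i ^ 2 ^ j = 0 := by
  have h := eval_dick_lin x (Pi.single i 1)
  rw [lin_single, dick_eq_sum] at h
  simpa [eval_finsetSum] using h

theorem eval_dick (x : ι → A) (y : A) :
    (dick x).eval y = ∑ j ∈ range (card ι + 1), dk x j * y ^ 2 ^ j := by
  rw [dick_eq_sum]; simp [eval_finsetSum]

/-- Squaring a polynomial with exponents powers of two. -/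
theorem dick_sq (x : ι → A) :
    dick x ^ 2 = ∑ j ∈ range (card ι + 1), C (dk x j ^ 2) * X ^ 2 ^ (j + 1) := by
  conv_lhs => rw [dick_eq_sum x, sum_pow_char 2]
  refine sum_congr rfl fun j _ => ?_
  rw [C_pow]; ring

theorem dk_option_zero (x : Option ι → A) :
    dk x 0 = (dick (fun i => x (some i))).eval (x none) * dk (fun i => x (some i)) 0 := by
  rw [dk, dick_option, coeff_add, coeff_C_mul, dick_sq]
  simp only [finsetSum_coeff, coeff_C_mul, coeff_X_pow,
    (Nat.pow_right_injective (le_refl 2)).eq_iff, mul_ite, mul_one, mul_zero]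
  rw [sum_eq_zero (fun j _ => by simp), zero_add]
  rfl

theorem dk_zero_eq_prod (x : ι → A) :
    dk x 0 = ∏ v ∈ Finset.univ.filter (fun v : ι → F₂ => v ≠ 0), lin x v := by
  rw [dk, pow_zero, dick, ← Finset.prod_filter_mul_prod_filter_not univ (fun v => v ≠ 0)]
  simp only [ne_eq, not_not]
  rw [Finset.filter_eq' univ (0 : ι → F₂), if_pos (mem_univ _),
    Finset.prod_singleton, lin_zero, map_zero, add_zero]
  refine (coeff_mul_X _ 0).trans ?_
  rw [coeff_zero_prod]
  simp

theorem dick_monic (x : ι → A) : (dick x).Monic := by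
  rw [dick]; exact monic_prod_of_monic _ _ fun v _ => monic_X_add_C _

/-- The Moore determinant is the product of the non-zero linear combinations. -/
theorem det_moore : ∀ (N : ℕ) (x : Fin N → A),
    (Matrix.of fun i j : Fin N => x j ^ 2 ^ (i : ℕ)).det = dk x 0
  | 0, x => by
    rw [Matrix.det_isEmpty, ← dk_card x]; simp
  | N + 1, x => by
    set M : Matrix (Fin (N + 1)) (Fin (N + 1)) A := Matrix.of fun i j => x j ^ 2 ^ (i : ℕ)
    set x' : Fin N → A := fun i => x i.castSucc
    have h1 := Matrix.det_updateRow_sum M (Fin.last N) (fun i => dk x' i)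
    have hc : dk x' (Fin.last N : ℕ) = 1 := by
      have := dk_card x'
      rwa [card_fin] at this
    rw [hc, one_smul] at h1
    rw [← h1, Matrix.det_succ_row _ (Fin.last N), sum_eq_single (Fin.last N)]
    · rw [← dk_reindex (finSuccEquivLast (n := N)).symm x, dk_option_zero]
      simp only [finSuccEquivLast_symm_some, finSuccEquivLast_symm_none]
      rw [← det_moore N x']
      have hs : (-1 : A) ^ ((Fin.last N : ℕ) + (Fin.last N : ℕ)) = 1 := by
        rw [← two_mul, pow_mul]; simp
      rw [hs, one_mul]
      congr 1
      · simp only [Matrix.updateRow_self, Finset.sum_apply, Pi.smul_apply, smul_eq_mul]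
        rw [eval_dick, card_fin, sum_range]
        rfl
      · congr 1
        ext i j
        simp [Matrix.submatrix, Matrix.updateRow_apply, M, x', Fin.succAbove_last,
          (Fin.castSucc_lt_last i).ne]
    · intro j _ hj
      obtain ⟨j, rfl⟩ := Fin.exists_castSucc_eq.mpr hj
      have : (M.updateRow (Fin.last N) (∑ k : Fin (N + 1), dk x' k • M k)) (Fin.last N)
          j.castSucc = 0 := by
        simp only [Matrix.updateRow_self, Finset.sum_apply, Pi.smul_apply, smul_eq_mul]
        have := sum_dk_mul_pow x' j
        rw [card_fin, sum_range] at this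
        exact this
      rw [this]; simp
    · simp

end Dickson

section Symplectic
variable {A : Type*} [CommRing A] [Algebra F₂ A]
variable {B : Type*} [CommRing B] [Algebra F₂ B]
variable {κ : Type*} [Fintype κ] [DecidableEq κ]

/-- The value of `ξ_k`, `k ≥ 1`, at the vector with symplectic coordinates `a, b`. -/
def gram (a b : κ → A) (k : ℕ) : A := ∑ i, (a i * b i ^ 2 ^ k + a i ^ 2 ^ k * b i)

/-- The split quadratic form at the vector with symplectic coordinates `a, b`. -/
def qf (a b : κ → A) : A := ∑ i, a i * b i

/-- Evaluation of polynomials in the `ξ`'s at a vector, with `ξ_0` going to `z`. -/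
def evXi (a b : κ → A) (z : A) : XiRing →ₐ[F₂] A :=
  maeval fun i => if i = 0 then z else gram a b i

/-- The Dickson coefficients of the coordinates. -/
def cf (a b : κ → A) (j : ℕ) : A := dk (Sum.elim a b) j

/-- The Arf invariant of `qf + x²`, for `x` the linear form with coefficients `v`. -/
def arf (v : κ ⊕ κ → F₂) : F₂ := ∑ i, v (inl i) * v (inr i)

/-- The product of `X + r` over the quadratic forms `r = qf + x²` of Arf invariant `ε`. -/
def Qp (ε : F₂) (a b : κ → A) : A[X] :=
  ∏ v ∈ Finset.univ.filter (fun v : κ ⊕ κ → F₂ => arf v = ε),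
    (X + C (qf a b + lin (Sum.elim a b) v ^ 2))

/-- The product of `X + r` over all quadratic forms `r = qf + x²`. -/
def Qall (a b : κ → A) : A[X] :=
  ∏ v : κ ⊕ κ → F₂, (X + C (qf a b + lin (Sum.elim a b) v ^ 2))

theorem map_gram (f : A →ₐ[F₂] B) (a b : κ → A) (k : ℕ) :
    f (gram a b k) = gram (fun i => f (a i)) (fun i => f (b i)) k := by
  simp [gram]

theorem map_qf (f : A →ₐ[F₂] B) (a b : κ → A) :
    f (qf a b) = qf (fun i => f (a i)) (fun i => f (b i)) := by
  simp [qf]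

theorem comp_sumElim (f : A → B) (a b : κ → A) :
    (fun i => f (Sum.elim a b i)) = Sum.elim (fun i => f (a i)) (fun i => f (b i)) := by
  ext i; cases i <;> rfl

theorem map_cf (f : A →ₐ[F₂] B) (a b : κ → A) (j : ℕ) :
    f (cf a b j) = cf (fun i => f (a i)) (fun i => f (b i)) j := by
  rw [cf, map_dk, cf, comp_sumElim]

theorem map_evXi (f : A →ₐ[F₂] B) (a b : κ → A) (z : A) (p : XiRing) :
    f (evXi a b z p) = evXi (fun i => f (a i)) (fun i => f (b i)) (f z) p := by
  have : f.comp (evXi a b z) = evXi (fun i => f (a i)) (fun i => f (b i)) (f z) := by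
    apply malgHom_ext
    intro i
    simp only [evXi, comp_apply, maeval_X]
    split_ifs
    · rfl
    · exact map_gram f a b i
  exact dcongr_fun this p

theorem map_Qp (f : A →ₐ[F₂] B) (ε : F₂) (a b : κ → A) :
    (Qp ε a b).map (f : A →+* B) = Qp ε (fun i => f (a i)) (fun i => f (b i)) := by
  rw [Qp, pmap_prod, Qp]
  refine prod_congr rfl fun v _ => ?_
  rw [pmap_add, map_X, map_C, ← map_qf f, ← comp_sumElim,
    ← map_lin f]
  simp

theorem evXi_X_zero (a b : κ → A) (z : A) : evXi a b z (mX 0) = z := by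
  simp [evXi]

theorem evXi_X (a b : κ → A) (z : A) {k : ℕ} (hk : k ≠ 0) :
    evXi a b z (mX k) = gram a b k := by
  simp [evXi, hk]

theorem symEntry_comm (i j : ℕ) : symEntry i j = symEntry j i := by
  rw [symEntry, symEntry, max_comm, min_comm]
  split_ifs with h1 h2 h2 <;> first | rfl | (exfalso; omega)

theorem symEntry_succ (i j : ℕ) : symEntry (i + 1) (j + 1) = symEntry i j ^ 2 := by
  rw [symEntry, symEntry]
  split_ifs with h1 h2 h2
  · simp
  · omega
  · omega
  · rw [← pow_mul, ← pow_succ]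
    congr 1
    · congr 1; omega
    · congr 1; omega

theorem symEntry_self (i : ℕ) : symEntry i i = 0 := by simp [symEntry]

variable [CharP A 2]

theorem symEntry_of_lt {i j : ℕ} (h : i < j) :
    symEntry i j = mX (j - i) ^ 2 ^ i := by
  rw [symEntry, if_neg h.ne, max_eq_right h.le, min_eq_left h.le]

theorem evXi_symEntry_aux (a b : κ → A) (z : A) {i j : ℕ} (h : i < j) :
    evXi a b z (symEntry i j) = ∑ k, (a k ^ 2 ^ i * b k ^ 2 ^ j + a k ^ 2 ^ j * b k ^ 2 ^ i) := by
  rw [symEntry_of_lt h, map_pow, evXi_X _ _ _ (by omega), gram, sum_pow_char_pow]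
  refine sum_congr rfl fun k _ => ?_
  rw [add_pow_char_pow, mul_pow, mul_pow, ← pow_mul, ← pow_mul, ← pow_add, Nat.sub_add_cancel h.le]

theorem evXi_symEntry (a b : κ → A) (z : A) (i j : ℕ) :
    evXi a b z (symEntry i j) = ∑ k, (a k ^ 2 ^ i * b k ^ 2 ^ j + a k ^ 2 ^ j * b k ^ 2 ^ i) := by
  rcases lt_trichotomy i j with h | rfl | h
  · exact evXi_symEntry_aux a b z h
  · rw [symEntry_self, map_zero]
    refine (sum_eq_zero fun k _ => ?_).symm
    exact add_self_eq_zero_of_algebra _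
  · rw [symEntry_comm, evXi_symEntry_aux a b z h]
    refine sum_congr rfl fun k _ => ?_
    rw [add_comm]

theorem sum_cf_mul_pow (a b : κ → A) {m : ℕ} (hm : card κ = m) (k : κ) :
    ∑ j ∈ range (2 * m + 1), cf a b j * a k ^ 2 ^ j = 0 ∧
    ∑ j ∈ range (2 * m + 1), cf a b j * b k ^ 2 ^ j = 0 := by
  have h1 := sum_dk_mul_pow (Sum.elim a b) (inl k)
  have h2 := sum_dk_mul_pow (Sum.elim a b) (inr k)
  rw [card_sum, hm, ← two_mul] at h1 h2
  exact ⟨h1, h2⟩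

/-- The relation `∑ c_j φ^j u = 0`, paired with `φ^i u`. -/
theorem sum_cf_mul_symEntry (a b : κ → A) (z : A) {m : ℕ} (hm : card κ = m) (i : ℕ) :
    ∑ j ∈ range (2 * m + 1), cf a b j * evXi a b z (symEntry i j) = 0 := by
  simp only [evXi_symEntry, mul_sum]
  rw [sum_comm]
  refine sum_eq_zero fun k _ => ?_
  obtain ⟨h1, h2⟩ := sum_cf_mul_pow a b hm k
  calc _ = a k ^ 2 ^ i * ∑ j ∈ range (2 * m + 1), cf a b j * b k ^ 2 ^ j +
      b k ^ 2 ^ i * ∑ j ∈ range (2 * m + 1), cf a b j * a k ^ 2 ^ j := by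
        rw [mul_sum, mul_sum, ← sum_add_distrib]
        refine sum_congr rfl fun j _ => ?_
        ring
    _ = 0 := by rw [h1, h2]; simp

theorem cf_top (a b : κ → A) {m : ℕ} (hm : card κ = m) : cf a b (2 * m) = 1 := by
  have := dk_card (Sum.elim a b)
  rwa [card_sum, hm, ← two_mul] at this

theorem cf_of_lt (a b : κ → A) {m : ℕ} (hm : card κ = m) {j : ℕ} (hj : 2 * m < j) :
    cf a b j = 0 := by
  apply dk_of_lt
  rwa [card_sum, hm, ← two_mul]

/-- The determinant of the Gram matrix is the square of `c_0`. -/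
theorem det_symEntry (a b : κ → A) (z : A) {m : ℕ} (hm : card κ = m) :
    (Matrix.of fun i j : Fin (2 * m) => evXi a b z (symEntry i j)).det = cf a b 0 ^ 2 := by
  have hc : card (κ ⊕ κ) = 2 * m := by rw [card_sum, hm, two_mul]
  let e : Fin (2 * m) ≃ κ ⊕ κ := (Fintype.equivFinOfCardEq hc).symm
  let x : Fin (2 * m) → A := fun s => Sum.elim a b (e s)
  let M : Matrix (Fin (2 * m)) (Fin (2 * m)) A := Matrix.of fun i j => x j ^ 2 ^ (i : ℕ)
  let σ : Equiv.Perm (Fin (2 * m)) := (e.trans (Equiv.sumComm κ κ)).trans e.symm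
  have hM : M.det = cf a b 0 := by
    rw [det_moore, cf, ← dk_reindex e]
  have h : (Matrix.of fun i j : Fin (2 * m) => evXi a b z (symEntry i j)) =
      M * (M.submatrix id σ).transpose := by
    ext i j
    rw [Matrix.mul_apply, of_apply, evXi_symEntry]
    have : ∀ s, M i s * (M.submatrix id σ).transpose s j =
        (fun t : κ ⊕ κ => Sum.elim a b t ^ 2 ^ (i : ℕ) *
          Sum.elim a b (Equiv.sumComm κ κ t) ^ 2 ^ (j : ℕ)) (e s) := by
      intro s
      simp [M, x, σ]
    rw [sum_congr rfl fun s _ => this s, Equiv.sum_comp e (fun t : κ ⊕ κ =>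
      Sum.elim a b t ^ 2 ^ (i : ℕ) * Sum.elim a b (Equiv.sumComm κ κ t) ^ 2 ^ (j : ℕ)),
      sum_sum_type,
      ← sum_add_distrib]
    refine sum_congr rfl fun k _ => ?_
    simp; ring
  rw [h, det_mul, det_transpose, Matrix.det_permute', hM, sq]
  rcases Int.units_eq_one_or (Equiv.Perm.sign σ) with hs | hs
  · rw [hs]; simp
  · rw [hs]; simp [neg_eq]

/-- The polynomial `∏ (Y + x²)`. -/
theorem prod_sq (a b : κ → A) {m : ℕ} (hm : card κ = m) :
    ∏ v : κ ⊕ κ → F₂, (X + C (lin (Sum.elim a b) v ^ 2)) =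
      ∑ j ∈ range (2 * m + 1), C (cf a b j ^ 2) * X ^ 2 ^ j := by
  have h := congrArg (Polynomial.map (frobenius A 2)) (dick_eq_sum (Sum.elim a b))
  rw [dick, pmap_prod, pmap_sum, card_sum, hm, ← two_mul] at h
  simpa [frobenius_def, cf] using h

theorem prod_sq_comp (a b : κ → A) {m : ℕ} (hm : card κ = m) (s : A) :
    ∏ v : κ ⊕ κ → F₂, (X + C (s + lin (Sum.elim a b) v ^ 2)) =
      ∑ j ∈ range (2 * m + 1), C (cf a b j ^ 2) * X ^ 2 ^ j +
        C (∑ j ∈ range (2 * m + 1), cf a b j ^ 2 * s ^ 2 ^ j) := by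
  have h := congrArg (fun P => P.comp (X + C s)) (prod_sq a b hm)
  rw [prod_comp] at h
  simp only [sum_comp, mul_comp, C_comp, pow_comp, X_comp, add_comp,
    add_pow_char_pow, mul_add, sum_add_distrib] at h
  rw [map_sum]
  simp only [C_mul, C_pow] at h ⊢
  rw [← h]
  refine prod_congr rfl fun v _ => ?_
  rw [C_add, add_assoc, C_pow]

theorem sum_mul_sum_eq {A : Type*} [CommRing A] (N : ℕ) (f g : ℕ → A) :
    (∑ i ∈ range N, f i) * (∑ j ∈ range N, g j) =
      ∑ i ∈ range N, f i * g i +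
        ∑ j ∈ range N, ∑ i ∈ range j, (f i * g j + f j * g i) := by
  induction N with
  | zero => simp
  | succ N ih =>
    rw [sum_range_succ, sum_range_succ, sum_range_succ,
      sum_range_succ, sum_add_distrib, ← sum_mul, ← mul_sum]
    linear_combination ih

theorem sum_cf_sq_mul_qf (a b : κ → A) (z : A) {m : ℕ} (hm : card κ = m) :
    ∑ j ∈ range (2 * m + 1), cf a b j ^ 2 * qf a b ^ 2 ^ j =
      ∑ j ∈ range (2 * m + 1), ∑ i ∈ range j,
        cf a b i * cf a b j * evXi a b z (symEntry i j) := by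
  have h : ∑ k, (∑ i ∈ range (2 * m + 1), cf a b i * a k ^ 2 ^ i) *
      (∑ j ∈ range (2 * m + 1), cf a b j * b k ^ 2 ^ j) = 0 :=
    sum_eq_zero fun k _ => by rw [(sum_cf_mul_pow a b hm k).1, zero_mul]
  simp only [sum_mul_sum_eq] at h
  rw [sum_add_distrib] at h
  have h1 : ∑ j ∈ range (2 * m + 1), cf a b j ^ 2 * qf a b ^ 2 ^ j =
      ∑ k, ∑ i ∈ range (2 * m + 1),
        (cf a b i * a k ^ 2 ^ i) * (cf a b i * b k ^ 2 ^ i) := by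
    rw [sum_comm]
    refine sum_congr rfl fun j _ => ?_
    rw [qf, sum_pow_char_pow, mul_sum]
    refine sum_congr rfl fun k _ => ?_
    ring
  have h2 : ∑ j ∈ range (2 * m + 1), ∑ i ∈ range j,
        cf a b i * cf a b j * evXi a b z (symEntry i j) =
      ∑ k, ∑ j ∈ range (2 * m + 1), ∑ i ∈ range j,
        ((cf a b i * a k ^ 2 ^ i) * (cf a b j * b k ^ 2 ^ j) +
          (cf a b j * a k ^ 2 ^ j) * (cf a b i * b k ^ 2 ^ i)) := by
    rw [sum_comm]
    refine sum_congr rfl fun j _ => ?_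
    rw [sum_comm]
    refine sum_congr rfl fun i _ => ?_
    rw [evXi_symEntry, mul_sum]
    refine sum_congr rfl fun k _ => ?_
    ring
  rw [h1, h2]
  exact CharTwo.add_eq_zero.mp h

theorem Qall_eq (a b : κ → A) (z : A) {m : ℕ} (hm : card κ = m) :
    Qall a b = ∑ j ∈ range (2 * m + 1), C (cf a b j ^ 2) * X ^ 2 ^ j +
      C (∑ j ∈ range (2 * m + 1), ∑ i ∈ range j,
        cf a b i * cf a b j * evXi a b z (symEntry i j)) := by
  rw [Qall, prod_sq_comp a b hm, sum_cf_sq_mul_qf a b z hm]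

theorem Qp_mul_Qp (a b : κ → A) : Qp 1 a b * Qp 0 a b = Qall a b := by
  rw [Qp, Qp, Qall, ← Finset.prod_filter_mul_prod_filter_not univ
    (fun v : κ ⊕ κ → F₂ => arf v = 1)]
  congr 1
  refine prod_congr ?_ fun _ _ => rfl
  ext v
  simp only [mem_filter, mem_univ, true_and]
  generalize arf v = t
  revert t; decide

theorem Qp_monic (ε : F₂) (a b : κ → A) : (Qp ε a b).Monic :=
  monic_prod_of_monic _ _ fun _ _ => monic_X_add_C _

end Symplectic

section Step
variable {A : Type*} [CommRing A] [Algebra F₂ A] [CharP A 2]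
variable {κ : Type*} [Fintype κ] [DecidableEq κ]

/-- Splitting off a hyperbolic pair of coordinates. -/
def splitEquiv (κ : Type*) : Option (Option (κ ⊕ κ)) ≃ Option κ ⊕ Option κ where
  toFun
    | none => inl none
    | some none => inr none
    | some (some (inl i)) => inl (some i)
    | some (some (inr i)) => inr (some i)
  invFun
    | inl none => none
    | inr none => some none
    | inl (some i) => some (some (inl i))
    | inr (some i) => some (some (inr i))
  left_inv := by rintro (_ | _ | _ | _) <;> rfl
  right_inv := by rintro ((_ | _) | (_ | _)) <;> rfl

/-- Splitting off a hyperbolic pair of coefficients. -/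
def splitPi (κ : Type*) :
    (F₂ × F₂) × (κ ⊕ κ → F₂) ≃ (Option κ ⊕ Option κ → F₂) where
  toFun p := Sum.elim (fun o => o.elim p.1.1 fun i => p.2 (inl i))
    (fun o => o.elim p.1.2 fun i => p.2 (inr i))
  invFun v := ((v (inl none), v (inr none)),
    Sum.elim (fun i => v (inl (some i))) (fun i => v (inr (some i))))
  left_inv := by
    rintro ⟨⟨_, _⟩, v⟩
    simp only [elim_inl, elim_inr, Option.elim, Prod.mk.injEq, true_and]
    ext i; cases i <;> rfl
  right_inv := by
    intro v; ext i; rcases i with (_ | _) | (_ | _) <;> rfl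

variable (a b : Option κ → A)

theorem lin_splitPi (p : (F₂ × F₂) × (κ ⊕ κ → F₂)) :
    lin (Sum.elim a b) (splitPi κ p) = p.1.1 • a none + p.1.2 • b none +
      lin (Sum.elim (fun i => a (some i)) (fun i => b (some i))) p.2 := by
  simp only [lin, sum_sum_type, sum_option, splitPi, Equiv.coe_fn_mk,
    elim_inl, elim_inr, Option.elim]
  ring

theorem arf_splitPi (p : (F₂ × F₂) × (κ ⊕ κ → F₂)) :
    arf (splitPi κ p) = p.1.1 * p.1.2 + arf p.2 := by
  simp only [arf, sum_option, splitPi, Equiv.coe_fn_mk,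
    elim_inl, elim_inr, Option.elim]

theorem gram_option (h : a none = 0) (k : ℕ) :
    gram a b k = gram (fun i => a (some i)) (fun i => b (some i)) k := by
  simp [gram, sum_option, h]

theorem qf_option (h : a none = 0) :
    qf a b = qf (fun i => a (some i)) (fun i => b (some i)) := by
  simp [qf, sum_option, h]

theorem evXi_option (h : a none = 0) (z : A) :
    evXi a b z = evXi (fun i => a (some i)) (fun i => b (some i)) z := by
  rw [evXi, evXi]
  congr 1
  ext i
  rw [gram_option a b h]

/-- The value at the coordinate `b none` of the Dickson polynomial of the remaining coordinates. -/
def wOf (a b : Option κ → A) : A :=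
  (dick (Sum.elim (fun i => a (some i)) (fun i => b (some i)))).eval (b none)

theorem dick_split (h : a none = 0) : dick (Sum.elim a b) =
    (dick (Sum.elim (fun i => a (some i)) (fun i => b (some i))) ^ 2 +
      C (wOf a b) * dick (Sum.elim (fun i => a (some i)) (fun i => b (some i)))) ^ 2 := by
  rw [← dick_reindex (splitEquiv κ), dick_option]
  have e1 : (fun i : Option (κ ⊕ κ) => Sum.elim a b (splitEquiv κ (some i))) =
      fun i => i.elim (b none) (Sum.elim (fun i => a (some i)) (fun i => b (some i))) := by
    ext i; rcases i with _ | _ | _ <;> rfl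
  have e2 : Sum.elim a b (splitEquiv κ none) = 0 := h
  rw [e1, e2, dick_option]
  simp only [Option.elim]
  have : eval 0 (dick (Sum.elim (fun i => a (some i)) (fun i => b (some i)))) = 0 := by
    have := eval_dick_lin (Sum.elim (fun i => a (some i)) (fun i => b (some i))) 0
    rwa [lin_zero] at this
  simp only [eval_add, eval_mul, eval_pow, eval_C, this]
  rw [wOf]
  simp

theorem coeff_two_pow_sum (c : ℕ → A) (N s j : ℕ) :
    (∑ i ∈ range (N + 1), C (c i) * X ^ 2 ^ (i + s)).coeff (2 ^ j) =
      if s ≤ j ∧ j - s < N + 1 then c (j - s) else 0 := by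
  simp only [finsetSum_coeff, coeff_C_mul, coeff_X_pow,
      (Nat.pow_right_injective (le_refl 2)).eq_iff, mul_ite, mul_one, mul_zero]
  split_ifs with h
  · rw [sum_eq_single (j - s)]
    · rw [if_pos (by omega)]
    · intro i _ hi; rw [if_neg (by omega)]
    · intro hi; simp at hi; omega
  · refine sum_eq_zero fun i hi => if_neg ?_
    simp at hi; omega

theorem cf_split (h : a none = 0) (j : ℕ) : cf a b (j + 1) =
    (if j = 0 then 0 else cf (fun i => a (some i)) (fun i => b (some i)) (j - 1) ^ 4) +
      wOf a b ^ 2 * cf (fun i => a (some i)) (fun i => b (some i)) j ^ 2 := by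
  set x := Sum.elim (fun i => a (some i)) (fun i => b (some i))
  have h1 : dick (Sum.elim a b) =
      ∑ i ∈ range (card (κ ⊕ κ) + 1), C (dk x i ^ 4) * X ^ 2 ^ (i + 2) +
        C (wOf a b ^ 2) *
      ∑ i ∈ range (card (κ ⊕ κ) + 1), C (dk x i ^ 2) * X ^ 2 ^ (i + 1) := by
    rw [dick_split a b h, CharTwo.add_sq, mul_pow, ← C_pow]
    congr 2
    · rw [dick_sq, sum_pow_char 2]
      refine sum_congr rfl fun i _ => ?_
      simp only [C_pow]; ring
    · rw [dick_sq]
  rw [cf, dk, h1, coeff_add, coeff_C_mul, coeff_two_pow_sum, coeff_two_pow_sum]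
  congr 1
  · rcases j with _ | j
    · simp
    · simp only [Nat.add_eq_zero_iff, one_ne_zero, and_false, if_false]
      split_ifs with h2
      · rfl
      · rw [cf, dk_of_lt _ (by omega)]; simp
  · congr 1
    split_ifs with h2
    · rfl
    · rw [cf, dk_of_lt _ (by omega)]; simp

theorem Qp_split (h : a none = 0) (ε : F₂) : Qp ε a b =
    Qp ε (fun i => a (some i)) (fun i => b (some i)) ^ 2 *
      (Qall (fun i => a (some i)) (fun i => b (some i)) + C (wOf a b ^ 2)) := by
  set a' := fun i => a (some i)
  set b' := fun i => b (some i)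
  rw [Qp, prod_filter, ← Equiv.prod_comp (splitPi κ), Fintype.prod_prod_type,
    Fintype.prod_prod_type]
  rw [show (univ : Finset F₂) = {0, 1} from rfl, prod_pair (by decide),
    prod_pair (by decide), prod_pair (by decide)]
  simp only [arf_splitPi, lin_splitPi, h, qf_option a b h, smul_zero, zero_smul, zero_add,
    one_smul, mul_zero, zero_mul, mul_one]
  have hQ : Qall a' b' + C (wOf a b ^ 2) =
      ∏ v : κ ⊕ κ → F₂, (X + C (qf a' b' + (b none + lin (Sum.elim a' b') v) ^ 2)) := by
    have := prod_sq_comp a' b' rfl (qf a' b' + b none ^ 2)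
    rw [Qall, prod_sq_comp a' b' rfl (qf a' b'), wOf, eval_dick, sum_pow_char 2]
    have h3 : ∀ v, qf a' b' + (b none + lin (Sum.elim a' b') v) ^ 2 =
        qf a' b' + b none ^ 2 + lin (Sum.elim a' b') v ^ 2 := by
      intro v; rw [CharTwo.add_sq]; ring
    simp only [h3]
    rw [this, add_assoc, ← C_add]
    congr 2
    rw [card_sum, ← two_mul, ← sum_add_distrib]
    refine sum_congr rfl fun j _ => ?_
    rw [add_pow_char_pow, cf]
    ring
  rw [hQ, mul_mul_mul_comm, ← prod_filter, sq]
  have hε : ∀ t : F₂, (1 + t = ε) ↔ ¬ (t = ε) := by revert ε; decide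
  have h4 : (∏ v : κ ⊕ κ → F₂, if arf v = ε then
        X + C (qf a' b' + (b none + lin (Sum.elim a' b') v) ^ 2) else 1) *
      (∏ v : κ ⊕ κ → F₂, if 1 + arf v = ε then
        X + C (qf a' b' + (b none + lin (Sum.elim a' b') v) ^ 2) else 1) =
      ∏ v : κ ⊕ κ → F₂, (X + C (qf a' b' + (b none + lin (Sum.elim a' b') v) ^ 2)) := by
    rw [← prod_mul_distrib]
    refine prod_congr rfl fun v _ => ?_
    simp only [hε]
    split_ifs <;> simp
  rw [h4]
  rfl

end Step

section Galois

theorem mem_range_of_isIntegral_of_mul_eq {P L : Type*} [CommRing P] [IsDomain P]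
    [IsIntegrallyClosed P] [Field L] [Algebra P L] [FaithfulSMul P L] {z : L}
    (hz : IsIntegral P z) {a b : P} (hb : b ≠ 0)
    (h : algebraMap P L b * z = algebraMap P L a) : ∃ c, algebraMap P L c = z := by
  letI := FractionRing.liftAlgebra P L
  have hw : algebraMap (FractionRing P) L (algebraMap P _ a / algebraMap P _ b) = z := by
    rw [map_div₀, ← IsScalarTower.algebraMap_apply, ← IsScalarTower.algebraMap_apply, ← h,
      mul_div_cancel_left₀]
    exact (map_ne_zero_iff _ (FaithfulSMul.algebraMap_injective P L)).mpr hb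
  rw [← hw, isIntegral_algebraMap_iff (algebraMap (FractionRing P) L).injective] at hz
  obtain ⟨c, hc⟩ := IsIntegrallyClosed.isIntegral_iff.mp hz
  exact ⟨c, by rw [← hw, ← hc, ← IsScalarTower.algebraMap_apply]⟩

variable {ι : Type*} [Fintype ι] [DecidableEq ι]

/-- Endomorphisms acting by linear substitutions. -/
def IsLinearSubst (φ : CoordRing ι →ₐ[F₂] CoordRing ι) : Prop :=
  ∀ i, ∃ v, φ (mX i) = lin mX v

theorem lin_X_injective :
    Injective (lin (mX : ι → CoordRing ι)) := by
  intro v w h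
  have key : ∀ v : ι → F₂, ∀ i, maeval (fun j => if j = i then (1 : F₂) else 0)
      (lin (mX : ι → CoordRing ι) v) = v i := by
    intro v i
    rw [map_lin]
    simp [lin]
  ext i
  rw [← key v i, h, key]

theorem lin_X_ne_zero {v : ι → F₂} (hv : v ≠ 0) :
    lin (mX : ι → CoordRing ι) v ≠ 0 := fun h =>
  hv (lin_X_injective (h.trans (lin_zero _).symm))

theorem dk_X_zero_ne_zero : dk (mX : ι → CoordRing ι) 0 ≠ 0 := by
  rw [dk_zero_eq_prod, Finset.prod_ne_zero_iff]
  intro v hv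
  exact lin_X_ne_zero (by simpa using hv)

variable {τ : Type*} [Fintype τ] (y : τ → CoordRing ι) (s : CoordRing ι)

theorem isIntegral_mul_of_dk {R : Subalgebra F₂ (CoordRing ι)} {t : CoordRing ι}
    (ht : t ∈ R) (h : ∀ j, t * dk mX j ∈ R) (i : ι) :
    IsIntegral R (t * mX i) := by
  have key := sum_dk_mul_pow (mX : ι → CoordRing ι) i
  rw [sum_range_succ, dk_card, one_mul, sum_range] at key
  generalize card ι = N at key
  have hlt : ∀ j : Fin N, 2 ^ (j : ℕ) < 2 ^ N := fun j => pow_lt_pow_right (by norm_num) j.2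
  have hmem : ∀ j : Fin N, t ^ (2 ^ N - 2 ^ (j : ℕ)) * dk mX (j : ℕ) ∈ R := by
    intro j
    have : 2 ^ N - 2 ^ (j : ℕ) = (2 ^ N - 2 ^ (j : ℕ) - 1) + 1 := by have := hlt j; omega
    rw [this, pow_succ, mul_assoc]
    exact mul_mem (pow_mem ht _) (h _)
  obtain ⟨c, hc⟩ : ∃ c : Fin N → R, ∀ j, algebraMap R (CoordRing ι) (c j) =
      t ^ (2 ^ N - 2 ^ (j : ℕ)) * dk mX (j : ℕ) := ⟨fun j => ⟨_, hmem j⟩, fun j => rfl⟩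
  refine ⟨X ^ 2 ^ N + ∑ j : Fin N, C (c j) * X ^ 2 ^ (j : ℕ), ?_, ?_⟩
  · apply monic_X_pow_add
    refine lt_of_le_of_lt (degree_sum_le _ _) ?_
    refine (Finset.sup_lt_iff (WithBot.bot_lt_coe _)).mpr fun j _ => ?_
    refine lt_of_le_of_lt (degree_C_mul_X_pow_le _ _) ?_
    exact_mod_cast hlt j
  · rw [eval₂_add, eval₂_finsetSum]
    simp only [eval₂_mul, eval₂_C, eval₂_pow, eval₂_X, hc]
    have h2 : ∀ j : Fin N, t ^ (2 ^ N - 2 ^ (j : ℕ)) * dk mX (j : ℕ) *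
        (t * mX i) ^ 2 ^ (j : ℕ) =
        t ^ 2 ^ N * (dk mX (j : ℕ) * mX i ^ 2 ^ (j : ℕ)) := by
      intro j
      have h3 : t ^ 2 ^ N = t ^ (2 ^ N - 2 ^ (j : ℕ)) * t ^ 2 ^ (j : ℕ) := by
        rw [← pow_add, Nat.sub_add_cancel (hlt j).le]
      rw [h3, mul_pow]
      ring
    rw [sum_congr rfl fun j _ => h2 j, ← mul_sum, mul_pow, ← mul_add, add_comm, key,
      mul_zero]

theorem exists_isIntegral_pow_mul {R : Subalgebra F₂ (CoordRing ι)} (hs : s ∈ R)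
    (h : ∀ j, ∃ k, s ^ k * dk mX j ∈ R) (f : CoordRing ι) :
    ∃ k, IsIntegral R (s ^ k * f) := by
  obtain ⟨K, hK⟩ : ∃ K, ∀ j, s ^ K * dk (mX : ι → CoordRing ι) j ∈ R := by
    choose k hk using h
    refine ⟨∑ j ∈ range (card ι + 1), k j, fun j => ?_⟩
    by_cases hj : j ∈ range (card ι + 1)
    · rw [← Finset.add_sum_erase _ _ hj, pow_add, mul_right_comm, mul_comm (s ^ k j * _) _]
      rw [mul_comm (s ^ k j)] at *
      exact mul_mem (pow_mem hs _) (by rw [mul_comm]; exact hk j)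
    · rw [dk_of_lt _ (by simpa using hj), mul_zero]; exact zero_mem _
  have hint : ∀ k, IsIntegral R (s ^ k) := fun k =>
    isIntegral_algebraMap (R := R) (x := ⟨s ^ k, pow_mem hs k⟩)
  induction f using minduction_on with
  | C a =>
    refine ⟨0, ?_⟩
    rw [pow_zero, one_mul]
    exact isIntegral_algebraMap (R := R) (x := ⟨mC a, R.algebraMap_mem a⟩)
  | add p q hp hq =>
    obtain ⟨k, hk⟩ := hp
    obtain ⟨l, hl⟩ := hq
    refine ⟨k + l, ?_⟩
    have : s ^ (k + l) * (p + q) = s ^ l * (s ^ k * p) + s ^ k * (s ^ l * q) := by ring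
    rw [this]
    exact ((hint l).mul hk).add ((hint k).mul hl)
  | mul_X p i hp =>
    obtain ⟨k, hk⟩ := hp
    refine ⟨k + K, ?_⟩
    have : s ^ (k + K) * (p * mX i) = (s ^ k * p) * (s ^ K * mX i) := by
      ring
    rw [this]
    exact hk.mul (isIntegral_mul_of_dk (pow_mem hs K) hK i)

/-- If, after inverting `s`, the Dickson coefficients lie in the subalgebra generated by as many
elements as there are coordinates, then these elements are algebraically independent. -/
theorem algebraicIndependent_of_dk (hcard : card τ = card ι) (hs0 : s ≠ 0)
    (hs : s ∈ (maeval (R := F₂) y).range)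
    (h : ∀ j, ∃ k, s ^ k * dk mX j ∈ (maeval (R := F₂) y).range) :
    AlgebraicIndependent F₂ y := by
  rw [← Algebra.adjoin_range_eq_range_aeval] at hs h
  have alg : Algebra.IsAlgebraic (adjoin F₂ (Set.range y)) (CoordRing ι) := by
    constructor
    intro f
    obtain ⟨k, hk⟩ := exists_isIntegral_pow_mul s hs h f
    have h1 := hk.isAlgebraic
    have h2 : s ^ k * f =
        (⟨s ^ k, pow_mem hs k⟩ : adjoin F₂ (Set.range y)) • f := rfl
    rw [h2] at h1
    refine h1.of_smul ?_
    rw [mem_nonZeroDivisors_iff_ne_zero]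
    intro h3
    exact pow_ne_zero k hs0 (congrArg Subtype.val h3)
  have := Algebra.IsAlgebraic.isTranscendenceBasis_of_lift_le_trdeg_of_finite F₂ y (by
    rw [MvPolynomial.trdeg_of_isDomain]
    simp [hcard])
  exact this.1

/-- The invariants of the group of linear substitutions fixing the `y`'s are, after inverting `s`,
polynomials in the `y`'s. -/
theorem exists_pow_mul_mem_range (hcard : card τ = card ι) (hs0 : s ≠ 0)
    (hs : s ∈ (maeval (R := F₂) y).range)
    (h : ∀ j, ∃ k, s ^ k * dk mX j ∈ (maeval (R := F₂) y).range)
    (f : CoordRing ι)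
    (hf : ∀ φ : CoordRing ι →ₐ[F₂] CoordRing ι, IsLinearSubst φ → Injective φ →
      (∀ i, φ (y i) = y i) → φ f = f) :
    ∃ k, s ^ k * f ∈ (maeval (R := F₂) y).range := by
  have hind := algebraicIndependent_of_dk y s hcard hs0 hs h
  let L := FractionRing (CoordRing ι)
  let inc : CoordRing ι →ₐ[F₂] L := IsScalarTower.toAlgHom _ _ _
  have hinc : Injective inc := IsFractionRing.injective (CoordRing ι) L
  let F : IntermediateField F₂ L := IntermediateField.adjoin F₂ (Set.range (inc ∘ y))
  have hyF : ∀ g ∈ (maeval (R := F₂) y).range, inc g ∈ F := by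
    rintro g ⟨p, rfl⟩
    have : inc (maeval y p) = maeval (inc ∘ y) p := by
      rw [← comp_apply, comp_aeval]; rfl
    change inc (maeval y p) ∈ F
    rw [this]
    have h2 : maeval (inc ∘ y) p ∈ adjoin F₂ (Set.range (inc ∘ y)) := by
      rw [Algebra.adjoin_range_eq_range_aeval]; exact ⟨p, rfl⟩
    exact IntermediateField.algebra_adjoin_le_adjoin _ _ h2
  have hsne : inc s ≠ 0 := (map_ne_zero_iff _ hinc).mpr hs0
  have hdkF : ∀ j, inc (dk mX j) ∈ F := by
    intro j
    obtain ⟨k, hk⟩ := h j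
    have h1 := hyF _ hk
    rw [map_mul, map_pow] at h1
    have h2 : (inc s ^ k)⁻¹ * (inc s ^ k * inc (dk mX j)) ∈ F :=
      mul_mem (inv_mem (pow_mem (hyF _ hs) k)) h1
    rwa [inv_mul_cancel_left₀ (pow_ne_zero k hsne)] at h2
  let N := card ι
  let P : F[X] := ∑ j ∈ range (N + 1), C (⟨_, hdkF j⟩ : F) * X ^ 2 ^ j
  let x : ι → L := fun i => inc (mX i)
  have hP : P.map (algebraMap F L) = dick x := by
    rw [dick_eq_sum, pmap_sum]
    refine sum_congr rfl fun j _ => ?_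
    rw [pmap_mul, map_C, pmap_pow, map_X, ← map_dk inc]
    rfl
  have hlinj : Injective (lin x) := by
    intro v w hvw
    rw [← map_lin inc, ← map_lin inc] at hvw
    exact lin_X_injective (hinc hvw)
  have hP' : P.map (algebraMap F L) = ∏ v : ι → F₂, (X - C (lin x v)) := by
    rw [hP, dick]
    refine prod_congr rfl fun v _ => ?_
    rw [sub_eq_add_neg, neg_eq]
  have hsep : P.Separable := by
    rw [← Polynomial.separable_map (algebraMap F L), hP']
    exact separable_prod_X_sub_C_iff.mpr hlinj
  have hroot : ∀ z : L, (P.map (algebraMap F L)).eval z = 0 → ∃ v, z = lin x v := by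
    intro z hz
    rw [hP', eval_prod, Finset.prod_eq_zero_iff] at hz
    obtain ⟨v, -, hv⟩ := hz
    exact ⟨v, by simpa [sub_eq_zero] using hv⟩
  have hsplit : P.IsSplittingField F L := by
    rw [isSplittingField_iff_intermediateField]
    refine ⟨?_, ?_⟩
    · rw [hP']
      exact Polynomial.Splits.prod fun v _ => Polynomial.Splits.X_sub_C _
    · rw [eq_top_iff]
      have hx : ∀ i, x i ∈ IntermediateField.adjoin F (P.rootSet L) := by
        intro i
        apply IntermediateField.subset_adjoin
        rw [Polynomial.mem_rootSet']
        refine ⟨?_, ?_⟩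
        rotate_left
        · rw [aeval_def, ← eval_map, hP', eval_prod]
          refine prod_eq_zero (mem_univ (Pi.single i 1)) ?_
          rw [lin_single]; simp
        · intro h0
          rw [h0] at hP
          exact (dick_monic x).ne_zero hP.symm
      have hp : ∀ p : CoordRing ι, inc p ∈ IntermediateField.adjoin F (P.rootSet L) := by
        intro p
        induction p using minduction_on with
        | C a =>
          have : inc (mC a) = algebraMap F₂ L a := inc.commutes a
          rw [this, IsScalarTower.algebraMap_apply F₂ F L]
          exact IntermediateField.algebraMap_mem _ _
        | add p q hp hq => rw [map_add]; exact add_mem hp hq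
        | mul_X p i hp => rw [map_mul]; exact mul_mem hp (hx i)
      intro z _
      obtain ⟨p, q, -, rfl⟩ := IsFractionRing.div_surjective (A := CoordRing ι) z
      exact div_mem (hp p) (hp q)
  haveI : IsGalois F L := IsGalois.of_separable_splitting_field hsep
  have hfF : inc f ∈ F := by
    have h1 : inc f ∈ Set.range (algebraMap F L) := by
      rw [InfiniteGalois.mem_range_algebraMap_iff_fixed]
      intro σ
      have hσ : ∀ i, ∃ v, σ (x i) = lin x v := by
        intro i
        apply hroot
        rw [eval_map, ← aeval_def]
        have := Polynomial.aeval_algHom_apply (σ : L →ₐ[F] L) (x i) P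
        change aeval (σ (x i)) P = _ at this
        rw [this, aeval_def, ← eval_map, hP', eval_prod]
        have h0 : ∏ v : ι → F₂, eval (x i) (X - C (lin x v)) = 0 :=
          prod_eq_zero (mem_univ (Pi.single i 1)) (by rw [lin_single]; simp)
        rw [h0, map_zero]
      choose v hv using hσ
      let φ : CoordRing ι →ₐ[F₂] CoordRing ι :=
        maeval fun i => lin mX (v i)
      have hcomm : ∀ p, inc (φ p) = σ (inc p) := by
        intro p
        have : inc.comp φ = ((σ : L →ₐ[F] L).restrictScalars F₂).comp inc := by
          apply malgHom_ext
          intro i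
          simp only [comp_apply, φ, maeval_X, map_lin]
          exact (hv i).symm
        exact dcongr_fun this p
      have := hf φ (fun i => ⟨v i, by simp [φ]⟩) ?_ ?_
      · rw [← hcomm, this]
      · intro p q hpq
        apply hinc
        apply σ.injective
        rw [← hcomm, ← hcomm, hpq]
      · intro i
        apply hinc
        rw [hcomm]
        have hyi : inc (y i) ∈ F := hyF _ ⟨mX i, by simp⟩
        exact σ.commutes (⟨_, hyi⟩ : F)
    obtain ⟨g, hg⟩ := h1
    rw [← hg]; exact g.2
  obtain ⟨r, hr, t, ht, hrt⟩ := IntermediateField.mem_adjoin_iff_div.mp hfF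
  rw [Algebra.adjoin_range_eq_range_aeval] at hr ht
  obtain ⟨a, ha⟩ := hr
  obtain ⟨b, hb'⟩ := ht
  replace ha : maeval (inc ∘ y) a = r := ha
  replace hb' : maeval (inc ∘ y) b = t := hb'
  subst ha hb'
  have hcomp : ∀ p : Poly τ,
      inc (maeval y p) = maeval (inc ∘ y) p := by
    intro p
    rw [← comp_apply, comp_aeval]; rfl
  obtain ⟨k, hk⟩ := exists_isIntegral_pow_mul s hs h f
  obtain ⟨σs, hσs⟩ := hs
  letI : Algebra (Poly τ) L :=
    ((maeval (R := F₂) (inc ∘ y)) : Poly τ →+* L).toAlgebra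
  have hamap : ∀ p, algebraMap (Poly τ) L p = inc (maeval y p) :=
    fun p => (hcomp p).symm
  haveI : FaithfulSMul (Poly τ) L := by
    rw [faithfulSMul_iff_algebraMap_injective]
    intro p q hpq
    rw [hamap, hamap] at hpq
    exact hind (hinc hpq)
  by_cases hb : b = 0
  · refine ⟨0, ?_⟩
    rw [hb] at hrt
    simp at hrt
    have : f = 0 := hinc (by rw [map_zero]; exact hrt)
    rw [this]; simp
  have hbne : inc (maeval y b) ≠ 0 := by
    rw [← hamap]
    exact (map_ne_zero_iff _ (FaithfulSMul.algebraMap_injective _ L)).mpr hb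
  have hz : IsIntegral (Poly τ) (inc (s ^ k * f)) := by
    obtain ⟨p, hp, hp0⟩ := hk
    let θ : (maeval (R := F₂) y).range →+* Poly τ :=
      ((AlgEquiv.ofInjective (maeval (R := F₂) y) hind).symm : _ →+* _)
    have hθ : ∀ r, algebraMap (Poly τ) L (θ r) = inc r := by
      intro r
      rw [hamap]
      congr 1
      exact congrArg Subtype.val
        ((AlgEquiv.ofInjective (maeval (R := F₂) y) hind).apply_symm_apply r)
    refine ⟨p.map θ, hp.map θ, ?_⟩
    rw [Polynomial.eval₂_map]
    have : (algebraMap (Poly τ) L).comp θ =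
        (inc : CoordRing ι →+* L).comp (algebraMap (maeval (R := F₂) y).range _) :=
      RingHom.ext hθ
    rw [this]
    have h3 := Polynomial.hom_eval₂ p (algebraMap (maeval (R := F₂) y).range _)
      (inc : CoordRing ι →+* L) (s ^ k * f)
    rw [hp0, map_zero] at h3
    exact h3.symm
  have hmul : algebraMap (Poly τ) L b * inc (s ^ k * f) =
      algebraMap (Poly τ) L (σs ^ k * a) := by
    rw [hamap, hamap, map_mul inc, hrt, map_mul, map_pow, map_mul, map_pow, hcomp b, hcomp a]
    rw [show maeval y σs = s from hσs]
    rw [hcomp] at hbne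
    generalize maeval (inc ∘ y) b = B at hbne ⊢
    generalize maeval (inc ∘ y) a = A
    rw [div_eq_mul_inv]
    calc B * (inc s ^ k * (A * B⁻¹)) = inc s ^ k * A * (B * B⁻¹) := by ring
      _ = inc (s ^ k) * A := by rw [mul_inv_cancel₀ hbne, mul_one, map_pow]
  obtain ⟨c, hc⟩ := mem_range_of_isIntegral_of_mul_eq hz hb hmul
  refine ⟨k, c, ?_⟩
  apply hinc
  rw [← hc, hamap]; rfl

end Galois

section SymBasics
variable {U : Type*} [AddCommGroup U] [Module F₂ U]

instance : CharP (Sym U) 2 :=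
  charP_of_injective_algebraMap (R := F₂)
    (fun x y h => (SymmetricAlgebra.algebraMap_inj (M := Dual F₂ U) x y).mp h) 2

theorem zmod_two_mul_self (x : F₂) : x * x = x := by revert x; decide

theorem zmod_two_cases (x : F₂) : x = 0 ∨ x = 1 := by revert x; decide

theorem zmod_two_add_self (x : F₂) : x + x = 0 := by revert x; decide

theorem sum_sum_eq_diag_add {A : Type*} [AddCommMonoid A] {N : ℕ} (f : Fin N → Fin N → A) :
    ∑ i, ∑ j, f i j = ∑ i, f i i +
      ∑ i, ∑ j ∈ Finset.univ.filter (fun j => i < j), (f i j + f j i) := by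
  have h1 : ∀ i, ∑ j, f i j = f i i + (∑ j, if i < j then f i j else 0) +
      ∑ j, if j < i then f i j else 0 := by
    intro i
    rw [← Finset.sum_add_sum_compl {i}, Finset.sum_singleton, add_assoc,
      ← sum_add_distrib]
    congr 1
    rw [← Finset.sum_add_sum_compl {i} (fun j => (if i < j then f i j else 0) +
      if j < i then f i j else 0)]
    simp only [Finset.sum_singleton, lt_irrefl, if_false, add_zero, zero_add]
    refine sum_congr rfl fun j hj => ?_
    have : j ≠ i := by simpa using hj
    rcases lt_or_gt_of_ne this with h | h
    · simp [h, h.not_gt]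
    · simp [h, h.not_gt]
  simp only [h1, sum_add_distrib, Finset.sum_filter]
  rw [sum_comm (f := fun i j => if j < i then f i j else 0)]
  rw [add_assoc]

variable [FiniteDimensional F₂ U]

theorem formElem_eq {κ : Type*} [Fintype κ] (q : QuadraticForm F₂ U)
    (y z : κ → Dual F₂ U) (h : ∀ u, q u = ∑ k, y k u * z k u) :
    formElem q = ∑ k, vec (y k) * vec (z k) := by
  set e := Module.finBasis F₂ U
  have hx : ∀ x : Dual F₂ U, vec x =
      ∑ i, algebraMap F₂ (Sym U) (x (e i)) * vec (e.coord i) := by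
    intro x
    conv_lhs => rw [← e.sum_dual_apply_smul_coord x]
    simp only [vec, map_sum, map_smul, smul_def]
  have hpol : ∀ i j, polar q (e i) (e j) =
      ∑ k, (y k (e i) * z k (e j) + y k (e j) * z k (e i)) := by
    intro i j
    simp only [polar, h, map_add, ← sum_sub_distrib]
    refine sum_congr rfl fun k _ => ?_
    ring
  have h2 : ∑ k, vec (y k) * vec (z k) = ∑ i, ∑ j,
      algebraMap F₂ (Sym U) (∑ k, y k (e i) * z k (e j)) *
        (vec (e.coord i) * vec (e.coord j)) := by
    simp only [hx (y _), hx (z _), Finset.sum_mul_sum, map_sum, sum_mul]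
    rw [sum_comm]
    refine sum_congr rfl fun i _ => ?_
    conv_lhs => enter [2, k]; rw [mul_sum]
    rw [sum_comm]
    refine sum_congr rfl fun j _ => sum_congr rfl fun k _ => ?_
    rw [map_mul]; ring
  rw [h2, sum_sum_eq_diag_add, formElem]
  congr 1
  · refine sum_congr rfl fun i _ => ?_
    rw [h, sq]
  · refine sum_congr rfl fun i _ => sum_congr rfl fun j _ => ?_
    rw [hpol, sum_add_distrib, map_add, mul_comm (vec (e.coord j))]
    simp only [mul_comm (y _ (e j))]
    ring


theorem steenrodTotal_vec (x : Dual F₂ U) :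
    steenrodTotal U (vec x) = C (vec x) + C (vec x ^ 2) * X := by
  rw [steenrodTotal, SymmetricAlgebra.lift_ι_apply]; rfl

theorem steenrodTotal_vec_pow (x : Dual F₂ U) (i : ℕ) :
    steenrodTotal U (vec x ^ 2 ^ i) = C (vec x ^ 2 ^ i) + C (vec x ^ 2 ^ (i + 1)) * X ^ 2 ^ i := by
  rw [map_pow, steenrodTotal_vec, add_pow_char_pow, mul_pow, ← C_pow, ← C_pow, ← pow_mul,
    pow_succ']

theorem Sq_sum {κ : Type*} [Fintype κ] (i : ℕ) (f : κ → Sym U) :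
    Sq i (∑ k, f k) = ∑ k, Sq i (f k) := by
  rw [Sq, map_sum, finsetSum_coeff]; rfl

theorem Sq_one_mul (x y : Dual F₂ U) :
    Sq 1 (vec x * vec y) = vec x * vec y ^ 2 + vec x ^ 2 * vec y := by
  rw [Sq, map_mul, steenrodTotal_vec, steenrodTotal_vec]
  have : (C (vec x) + C (vec x ^ 2) * X) * (C (vec y) + C (vec y ^ 2) * X) =
      C (vec x * vec y) + C (vec x * vec y ^ 2 + vec x ^ 2 * vec y) * X +
        C (vec x ^ 2 * vec y ^ 2) * X ^ 2 := by
    simp only [map_add, map_mul]; ring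
  rw [this]
  simp only [coeff_add, coeff_C_mul, coeff_X_one, coeff_X_pow, coeff_C]
  simp

theorem Sq_pow_mul (x y : Dual F₂ U) (i : ℕ) :
    Sq (2 ^ (i + 1)) (vec x * vec y ^ 2 ^ (i + 1)) = vec x * vec y ^ 2 ^ (i + 2) := by
  rw [Sq, map_mul, steenrodTotal_vec, steenrodTotal_vec_pow]
  set N := 2 ^ (i + 1) with hN
  have hN2 : 2 ≤ N := by rw [hN, pow_succ]; have := Nat.one_le_two_pow (n := i); omega
  set s := vec y ^ 2 ^ (i + 1 + 1)
  have : (C (vec x) + C (vec x ^ 2) * X) * (C (vec y ^ N) + C s * X ^ N) =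
      C (vec x * vec y ^ N) + C (vec x ^ 2 * vec y ^ N) * X ^ 1 +
        C (vec x * s) * X ^ N + C (vec x ^ 2 * s) * X ^ (N + 1) := by
    simp only [map_mul]; ring
  rw [this]
  simp only [coeff_add, coeff_C_mul, coeff_X_pow, coeff_C]
  rw [if_neg (by omega : ¬N = 0), if_neg (by omega : ¬N = 1), 
    if_neg (by omega : ¬N = N + 1)]
  simp only [if_true, mul_zero, mul_one, zero_add, add_zero]

theorem xi_succ_eq {κ : Type*} [Fintype κ] (q : QuadraticForm F₂ U)
    (y z : κ → Dual F₂ U) (h : ∀ u, q u = ∑ k, y k u * z k u) (i : ℕ) :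
    xi q (i + 1) = ∑ k, (vec (y k) * vec (z k) ^ 2 ^ (i + 1) +
      vec (y k) ^ 2 ^ (i + 1) * vec (z k)) := by
  induction i with
  | zero =>
    rw [xi, xi, formElem_eq q y z h, pow_zero, Sq_sum]
    simp only [Sq_one_mul, zero_add, pow_one]
  | succ i ih =>
    rw [xi, ih, Sq_sum]
    refine sum_congr rfl fun k _ => ?_
    have hadd : ∀ s t : Sym U, Sq (2 ^ (i + 1)) (s + t) = Sq (2 ^ (i + 1)) s +
      Sq (2 ^ (i + 1)) t := fun s t => by rw [Sq, map_add, coeff_add]; rfl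
    rw [hadd, Sq_pow_mul, mul_comm (vec (y k) ^ _), Sq_pow_mul, mul_comm (vec (z k))]

theorem dickson_eq_dk {ι : Type*} [Fintype ι] [DecidableEq ι]
    (bas : Basis ι F₂ (Dual F₂ U)) (j : ℕ) :
    dickson U j = dk (fun i => vec (bas i)) j := by
  rw [dickson, dk, dick]
  congr 1
  refine prod_equiv bas.equivFun.toEquiv _ _ fun x => ?_
  congr 2
  rw [lin]
  conv_lhs => rw [← bas.sum_equivFun x, vec, map_sum]
  exact sum_congr rfl fun i _ => map_smul _ _ _
end SymBasics

section Gauss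

/-- The additive character of the field with two elements. -/
def chi (x : F₂) : ℤ := if x = 0 then 1 else -1

theorem chi_add (x y : F₂) : chi (x + y) = chi x * chi y := by
  revert x y; decide

theorem chi_sum {κ : Type*} (s : Finset κ) (f : κ → F₂) :
    chi (∑ i ∈ s, f i) = ∏ i ∈ s, chi (f i) := by
  classical
  induction s using Finset.induction_on with
  | empty => simp [chi]
  | insert i s hi ih => rw [sum_insert hi, Finset.prod_insert hi, chi_add, ih]

variable {κ : Type*} [Fintype κ] [DecidableEq κ]

theorem sum_chi_arf : ∑ w : κ ⊕ κ → F₂, chi (arf w) = 2 ^ card κ := by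
  have h1 : ∑ w : κ ⊕ κ → F₂, chi (arf w) =
      ∑ p : κ → F₂ × F₂, ∏ i, chi ((p i).1 * (p i).2) := by
    let e : (κ ⊕ κ → F₂) ≃ (κ → F₂ × F₂) :=
      (Equiv.sumArrowEquivProdArrow κ κ F₂).trans (Equiv.arrowProdEquivProdArrow κ
        (fun _ => F₂) (fun _ => F₂)).symm
    refine sum_equiv e _ _ fun w => ?_
    rw [arf, chi_sum]
    rfl
  rw [h1, ← Fintype.piFinset_univ, ← Finset.prod_univ_sum (fun _ => univ)
    (fun _ (p : F₂ × F₂) => chi (p.1 * p.2))]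
  have h2 : ∑ j : F₂ × F₂, chi (j.1 * j.2) = 2 := by decide
  simp [h2]

theorem sum_chi_arf_add (v : κ ⊕ κ → F₂) :
    ∑ w : κ ⊕ κ → F₂, chi (arf w + ∑ i, v i * w i) = chi (arf v) * 2 ^ card κ := by
  rw [← sum_chi_arf, mul_sum]
  let v' : κ ⊕ κ → F₂ := fun i => v i.swap
  refine sum_equiv (Equiv.addRight v') _ _ fun w => ?_
  rw [← chi_add]
  congr 1
  simp only [arf, Equiv.coe_addRight, Pi.add_apply, sum_sum_type, v', Sum.swap_inl,
    Sum.swap_inr, ← sum_add_distrib]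
  refine sum_congr rfl fun i _ => ?_
  linear_combination (-1 : F₂) * zmod_two_add_self (v (inl i) * v (inr i))

theorem card_arf_eq_one : (Finset.univ.filter fun w : κ ⊕ κ → F₂ => arf w = 1).card +
    2 ^ (card κ - 1) = 2 ^ (2 * card κ - 1) ∨ card κ = 0 := by
  rcases Nat.eq_zero_or_pos (card κ) with h0 | h0
  · exact Or.inr h0
  left
  have h := sum_chi_arf (κ := κ)
  have h1 : ∀ x : F₂, chi x = 1 - 2 * (if x = 1 then 1 else 0) := by decide
  simp only [h1, sum_sub_distrib, ← mul_sum, Finset.sum_boole] at h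
  simp only [Finset.sum_const, Finset.card_univ, Fintype.card_fun, ZMod.card, card_sum,
    smul_eq_mul, nsmul_eq_mul, mul_one] at h
  obtain ⟨m, hm⟩ : ∃ m, card κ = m + 1 := ⟨_, (Nat.succ_pred_eq_of_pos h0).symm⟩
  rw [hm] at h ⊢
  simp only [Nat.add_sub_cancel]
  have e : 2 * (m + 1) - 1 = 2 * m + 1 := by omega
  rw [e]
  have e2 : m + 1 + (m + 1) = 2 * m + 1 + 1 := by ring
  rw [e2] at h
  push_cast at h
  have : (((Finset.univ.filter fun w : κ ⊕ κ → F₂ => arf w = 1).card : ℤ) + 2 ^ m) =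
      2 ^ (2 * m + 1) := by
    have p1 : (2 : ℤ) ^ (2 * m + 1 + 1) = 2 * 2 ^ (2 * m + 1) := by ring
    have p2 : (2 : ℤ) ^ (m + 1) = 2 * 2 ^ m := by ring
    rw [p1, p2] at h
    linarith
  exact_mod_cast this

end Gauss

section Coords
variable {U : Type*} [AddCommGroup U] [Module F₂ U] [FiniteDimensional F₂ U]
variable {κ : Type*} [Fintype κ] [DecidableEq κ]

/-- Symplectic coordinates for a quadratic form: it is the sum of the products of the conjugate
coordinates and of the linear form with coefficients `v`. -/
structure Coords (q : QuadraticForm F₂ U) (κ : Type*) [Fintype κ] where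
  bas : Basis (κ ⊕ κ) F₂ (Dual F₂ U)
  v : κ ⊕ κ → F₂
  eq : ∀ u, q u = ∑ i, bas (inl i) u * bas (inr i) u + ∑ i, v i * bas i u

namespace Coords
variable {q : QuadraticForm F₂ U} (c : Coords q κ)

/-- The first half of the coordinates. -/
def a (i : κ) : Sym U := vec (c.bas (inl i))

/-- The second half of the coordinates. -/
def b (i : κ) : Sym U := vec (c.bas (inr i))

/-- The identification of vectors with coordinate vectors. -/
def point : U ≃ₗ[F₂] (κ ⊕ κ → F₂) :=
  (Module.evalEquiv F₂ U).trans (c.bas.constr F₂).symm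

theorem point_apply (u : U) (i : κ ⊕ κ) : c.point u i = c.bas i u := rfl

theorem eq_point (u : U) : q u = arf (c.point u) + ∑ i, c.v i * c.point u i := c.eq u

theorem sumElim_ab : Sum.elim c.a c.b = fun i => vec (c.bas i) := by
  ext i; cases i <;> rfl

theorem vec_eq_lin (x : Dual F₂ U) :
    vec x = lin (Sum.elim c.a c.b) (c.bas.equivFun x) := by
  rw [sumElim_ab, lin]
  conv_lhs => rw [← c.bas.sum_equivFun x, vec, map_sum]
  exact sum_congr rfl fun i _ => map_smul _ _ _

theorem polar_eq (u w : U) : polar q u w = ∑ i, (c.bas (inl i) u *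
    c.bas (inr i) w + c.bas (inr i) u * c.bas (inl i) w) := by
  simp only [polar, c.eq, map_add, mul_add, add_mul, sum_add_distrib]
  simp only [mul_comm (c.bas (inl _) w)]
  ring

theorem radical_eq_bot (c : Coords q κ) : q.radical = ⊥ := by
  rw [eq_bot_iff]
  intro u hu
  have h : ∀ w, polar q u w = 0 := fun w => by
    have := (QuadraticMap.mem_radical_iff'.mp hu)
    rw [polar, this.2, this.1]; simp
  have h2 : c.point u = 0 := by
    ext i
    have h3 := h (c.point.symm (Pi.single i.swap 1))
    rw [c.polar_eq] at h3
    simp only [← c.point_apply, apply_symm_apply] at h3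
    rcases i with i | i
    · simpa [Pi.single_apply, sum_add_distrib] using h3
    · simpa [Pi.single_apply, sum_add_distrib] using h3
  simpa using h2

theorem isMinusType_iff : IsMinusType q ↔ arf c.v = 1 := by
  classical
  haveI : Fintype U := Fintype.ofEquiv _ c.point.symm.toEquiv
  have h1 : ∑ u : U, chi (q u) = chi (arf c.v) * 2 ^ card κ := by
    rw [← sum_chi_arf_add]
    exact sum_equiv c.point.toEquiv _ _ fun u => by rw [c.eq_point]; rfl
  have h2 : ∑ u : U, chi (q u) = (Nat.card {u : U // q u = 0} : ℤ) -
      Nat.card {u : U // q u = 1} := by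
    have h1 : ∀ x : F₂, chi x = (if x = 0 then 1 else 0) - (if x = 1 then 1 else 0) := by decide
    simp only [h1, sum_sub_distrib, Finset.sum_boole, Nat.card_eq_fintype_card,
      Fintype.card_subtype]
  rw [IsMinusType, and_iff_right c.radical_eq_bot]
  have hp : (0 : ℤ) < 2 ^ card κ := by positivity
  rcases zmod_two_cases (arf c.v) with h | h
  · rw [h] at h1 ⊢
    have : chi 0 = 1 := rfl
    rw [this, one_mul] at h1
    constructor
    · intro h3; exfalso; omega
    · intro h3; exact absurd h3 (by decide)
  · rw [h] at h1 ⊢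
    have : chi 1 = -1 := rfl
    rw [this] at h1
    refine ⟨fun _ => rfl, fun _ => by omega⟩

/-- Coordinates for `q + x²`. -/
def addSq (x : Dual F₂ U) : Coords (addSq q x) κ where
  bas := c.bas
  v := c.v + c.bas.equivFun x
  eq u := by
    have h : x u = ∑ i, c.bas.equivFun x i * c.bas i u := by
      conv_lhs => rw [← c.bas.sum_equivFun x]
      rw [LinearMap.sum_apply]
      rfl
    have h2 : OrthInv.addSq q x u = q u + x u := by
      simp [OrthInv.addSq, zmod_two_mul_self]
    rw [h2, c.eq, h]
    simp only [Pi.add_apply, add_mul, sum_add_distrib]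
    ring

theorem mem_minusVectors (x : Dual F₂ U) :
    x ∈ minusVectors q ↔ arf (c.v + c.bas.equivFun x) = 1 := by
  classical
  rw [minusVectors, mem_filter, and_iff_right (mem_univ _)]
  exact (c.addSq x).isMinusType_iff

theorem eq_sum_option (u : U) : q u = ∑ o : Option κ, (o.elim (∑ i, c.v i • c.bas i)
    fun i => c.bas (inl i)) u * (o.elim (∑ i, c.v i • c.bas i) fun i => c.bas (inr i)) u := by
  rw [sum_option, c.eq, add_comm]
  simp [zmod_two_mul_self]

theorem vec_sum : vec (∑ i, c.v i • c.bas i) = lin (Sum.elim c.a c.b) c.v := by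
  rw [sumElim_ab, lin, vec, map_sum]
  exact sum_congr rfl fun i _ => map_smul _ _ _

theorem formElem_eq : formElem q = qf c.a c.b + lin (Sum.elim c.a c.b) c.v ^ 2 := by
  rw [OrthInv.formElem_eq q _ _ c.eq_sum_option, sum_option, add_comm]
  simp only [Option.elim]
  rw [c.vec_sum, sq]
  rfl

theorem xi_succ (k : ℕ) : xi q (k + 1) = gram c.a c.b (k + 1) := by
  rw [xi_succ_eq q _ _ c.eq_sum_option, sum_option]
  simp only [Option.elim]
  rw [mul_comm (vec _), add_self_eq_zero_of_algebra, zero_add]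
  rfl

theorem dickson_eq (j : ℕ) : dickson U j = cf c.a c.b j := by
  rw [dickson_eq_dk c.bas, cf, sumElim_ab]

theorem prod_minusVectors {M : Type*} [CommMonoid M] (f : (κ ⊕ κ → F₂) → M) :
    ∏ x ∈ minusVectors q, f (c.v + c.bas.equivFun x) =
      ∏ w ∈ Finset.univ.filter (fun w : κ ⊕ κ → F₂ => arf w = 1), f w := by
  refine Finset.prod_bij (fun x _ => c.v + c.bas.equivFun x) ?_ ?_ ?_ ?_
  · intro x hx
    rw [mem_filter, and_iff_right (mem_univ _)]
    exact (c.mem_minusVectors x).mp hx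
  · intro x _ y _ h
    exact c.bas.equivFun.injective (add_left_cancel h)
  · intro w hw
    rw [mem_filter, and_iff_right (mem_univ _)] at hw
    have : c.v + c.bas.equivFun (c.bas.equivFun.symm (w - c.v)) = w := by
      rw [apply_symm_apply]; abel
    exact ⟨_, (c.mem_minusVectors _).mpr (by rw [this]; exact hw), this⟩
  · intro x _; rfl

theorem Qminus_eq : Qminus q = Qp 1 c.a c.b := by
  rw [Qminus, Qp, ← c.prod_minusVectors fun w => X + C (qf c.a c.b + lin (Sum.elim c.a c.b) w ^ 2)]
  refine prod_congr rfl fun x _ => ?_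
  rw [(c.addSq x).formElem_eq]
  rfl

/-- The symmetric algebra as the polynomial ring in the coordinates. -/
def equiv : PairRing κ ≃ₐ[F₂] Sym U := (SymmetricAlgebra.equivMvPolynomial c.bas).symm

theorem equiv_X (i : κ ⊕ κ) : c.equiv (mX i) = vec (c.bas i) :=
  SymmetricAlgebra.equivMvPolynomial_symm_X _ _

end Coords

/-- The coordinates of the standard form. -/
def stdCoords (m : ℕ) : Coords (stdForm m) (Fin m) where
  bas := (((Pi.basisFun F₂ (Fin m)).dualBasis.prod (Pi.basisFun F₂ (Fin m))).dualBasis)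
  v := 0
  eq u := by
    obtain ⟨f, w⟩ := u
    have h1 : ∀ i : Fin m, ((Pi.basisFun F₂ (Fin m)).dualBasis.prod
        (Pi.basisFun F₂ (Fin m))).dualBasis (inl i) (f, w) =
          f (Pi.basisFun F₂ (Fin m) i) := fun i => by
      rw [dualBasis_apply, Module.Basis.prod_repr_inl, Module.Basis.dualBasis_repr]
    have h2 : ∀ i : Fin m, ((Pi.basisFun F₂ (Fin m)).dualBasis.prod
        (Pi.basisFun F₂ (Fin m))).dualBasis (inr i) (f, w) = w i := fun i => by
      rw [dualBasis_apply, Module.Basis.prod_repr_inr, Pi.basisFun_repr]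
    simp only [h1, h2, Pi.zero_apply, zero_mul, sum_const_zero, add_zero,
      QuadraticForm.dualProd_apply]
    conv_lhs => rw [← (Pi.basisFun F₂ (Fin m)).sum_repr w, map_sum]
    refine sum_congr rfl fun i _ => ?_
    rw [map_smul, Pi.basisFun_repr, smul_eq_mul, mul_comm]

end Coords

section NormalForm
variable {U : Type*} [AddCommGroup U] [Module F₂ U] [FiniteDimensional F₂ U]

/-- The functionals `a, b` form a symplectic basis of an alternating form. -/
structure IsSymplectic {κ : Type*} [Fintype κ] (B : BilinForm F₂ U)
    (a b : κ → Dual F₂ U) : Prop where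
  eq : ∀ u w, B u w = ∑ i, (a i u * b i w + b i u * a i w)
  indep : ∀ x y : κ → F₂, ∑ i, (x i • a i + y i • b i) = 0 → x = 0 ∧ y = 0
  vanish : ∀ u, (∀ w, B u w = 0) → ∀ i, a i u = 0 ∧ b i u = 0

/-- Subtracting a hyperbolic plane. -/
def subPlane (B : BilinForm F₂ U) (e f : U) : BilinForm F₂ U :=
  B + LinearMap.BilinForm.linMulLin (B f) (B e) + LinearMap.BilinForm.linMulLin (B e) (B f)

variable {B : BilinForm F₂ U}

theorem subPlane_apply (e f u w : U) :
    subPlane B e f u w = B u w + B f u * B e w + B e u * B f w := by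
  simp [subPlane, LinearMap.BilinForm.linMulLin_apply]

theorem symm_of_alternating (hB : ∀ u, B u u = 0) (u w : U) : B u w = B w u := by
  have h := hB (u + w)
  simp only [map_add, LinearMap.add_apply, hB, zero_add, add_zero] at h
  have := zmod_two_add_self (B w u)
  linear_combination h - this

theorem subPlane_alternating (hB : ∀ u, B u u = 0) (e f u : U) : subPlane B e f u u = 0 := by
  rw [subPlane_apply, hB, mul_comm, zero_add, zmod_two_add_self]

theorem subPlane_left (hB : ∀ u, B u u = 0) {e f : U} (h : B e f = 1) (w : U) :
    subPlane B e f e w = 0 ∧ subPlane B e f f w = 0 := by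
  rw [subPlane_apply, subPlane_apply, hB, hB, h, symm_of_alternating hB f e, h]
  constructor
  · linear_combination zmod_two_add_self (B e w)
  · linear_combination zmod_two_add_self (B f w)

theorem IsSymplectic.option {κ : Type*} [Fintype κ] {a b : κ → Dual F₂ U}
    (hB : ∀ u, B u u = 0) {e f : U} (hef : B e f = 1) (h : IsSymplectic (subPlane B e f) a b) :
    IsSymplectic B (fun o : Option κ => o.elim (B f) a) (fun o : Option κ => o.elim (B e) b) where
  eq u w := by
    rw [sum_option]
    simp only [Option.elim]
    rw [← h.eq, subPlane_apply]
    linear_combination (-1 : F₂) * zmod_two_add_self (B f u * B e w) -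
      zmod_two_add_self (B e u * B f w)
  indep x y hxy := by
    rw [sum_option] at hxy
    simp only [Option.elim] at hxy
    have hve := h.vanish e fun w => (subPlane_left hB hef w).1
    have hvf := h.vanish f fun w => (subPlane_left hB hef w).2
    have he := dcongr_fun hxy e
    have hf := dcongr_fun hxy f
    simp only [LinearMap.add_apply, LinearMap.smul_apply, LinearMap.sum_apply, hve, hvf, hB,
      symm_of_alternating hB f e, hef, smul_eq_mul, mul_zero, mul_one, add_zero, zero_add,
      sum_const_zero, LinearMap.zero_apply] at he hf
    rw [he, hf, zero_smul, zero_smul, zero_add, zero_add] at hxy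
    obtain ⟨h1, h2⟩ := h.indep (fun i => x (some i)) (fun i => y (some i)) hxy
    constructor
    · ext (_ | i)
      · exact he
      · exact congrFun h1 i
    · ext (_ | i)
      · exact hf
      · exact congrFun h2 i
  vanish u hu i := by
    have hu' : ∀ w, B w u = 0 := fun w => by rw [symm_of_alternating hB, hu]
    rcases i with _ | i
    · exact ⟨hu' f, hu' e⟩
    · refine h.vanish u (fun w => ?_) i
      rw [subPlane_apply, hu, hu', hu']; ring

theorem exists_isSymplectic (hB : ∀ u, B u u = 0) :
    ∃ (κ : Type) (_ : Fintype κ) (_ : DecidableEq κ) (a b : κ → Dual F₂ U),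
      IsSymplectic B a b := by
  induction h : finrank F₂ U - finrank F₂ (LinearMap.ker B)
    using Nat.strong_induction_on generalizing B with
  | _ d ih =>
    by_cases h0 : ∀ u w, B u w = 0
    · refine ⟨PEmpty, inferInstance, inferInstance, PEmpty.elim, PEmpty.elim, ⟨?_, ?_, ?_⟩⟩
      · intro u w; simp [h0]
      · intro x y _; exact ⟨Subsingleton.elim _ _, Subsingleton.elim _ _⟩
      · intro u _ i; exact i.elim
    · push Not at h0
      obtain ⟨e, f, hef⟩ := h0
      have hef : B e f = 1 := (zmod_two_cases _).resolve_left hef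
      have hlt : LinearMap.ker B < LinearMap.ker (subPlane B e f) := by
        refine lt_of_le_of_ne ?_ ?_
        · intro u hu
          rw [mem_ker] at hu ⊢
          ext w
          rw [subPlane_apply, symm_of_alternating hB f u, symm_of_alternating hB e u, hu]
          simp
        · intro heq
          have : e ∈ LinearMap.ker B := by
            rw [heq, mem_ker]
            ext w
            exact (subPlane_left hB hef w).1
          rw [mem_ker] at this
          rw [this] at hef
          simp at hef
      have h1 := Submodule.finrank_lt_finrank_of_lt hlt
      have h2 := Submodule.finrank_le (LinearMap.ker (subPlane B e f))
      obtain ⟨κ, i1, i2, a, b, hab⟩ := ih _ (by omega) (subPlane_alternating hB e f) rfl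
      exact ⟨Option κ, inferInstance, inferInstance, _, _, hab.option hB hef⟩

theorem exists_linear_of_polar_eq {κ : Type*} [Fintype κ] {q : QuadraticForm F₂ U}
    {a b : κ → Dual F₂ U}
    (h : ∀ u w, polar q u w = ∑ i, (a i u * b i w + b i u * a i w)) :
    ∃ l : Dual F₂ U, ∀ u, q u = ∑ i, a i u * b i u + l u := by
  let l : U →+ F₂ := AddMonoidHom.mk' (fun u => q u + ∑ i, a i u * b i u) (by
    intro u w
    have h1 := h u w
    rw [polar] at h1
    simp only [map_add, add_mul, mul_add, sum_add_distrib] at h1 ⊢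
    have h2 : ∑ i, b i u * a i w = ∑ i, a i w * b i u :=
      sum_congr rfl fun i _ => mul_comm _ _
    rw [h2] at h1
    linear_combination h1 + zmod_two_add_self (∑ i, a i u * b i w) +
      zmod_two_add_self (∑ i, a i w * b i u))
  refine ⟨l.toZModLinearMap 2, fun u => ?_⟩
  change q u = _ + (q u + ∑ i, a i u * b i u)
  linear_combination (-1 : F₂) * zmod_two_add_self (∑ i, a i u * b i u)

/-- A symplectic basis of the polar form provides coordinates for a non-singular form on an
even-dimensional space. -/
theorem exists_coords_of_isSymplectic {κ : Type*} [Fintype κ] {q : QuadraticForm F₂ U}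
    {a b : κ → Dual F₂ U} (h : IsSymplectic q.polarBilin a b) (hrad : q.radical = ⊥)
    {n : ℕ} (hn : n ≠ 0) (hU : finrank F₂ U = 2 * n) :
    card κ = n ∧ ∃ c : Coords q κ, ⇑c.bas = Sum.elim a b := by
  have hind : LinearIndependent F₂ (Sum.elim a b) := by
    rw [Fintype.linearIndependent_iff]
    intro g hg
    rw [sum_sum_type, ← sum_add_distrib] at hg
    obtain ⟨h1, h2⟩ := h.indep (fun i => g (inl i)) (fun i => g (inr i)) hg
    rintro (i | i)
    · exact congrFun h1 i
    · exact congrFun h2 i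
  set Φ := Submodule.span F₂ (Set.range (Sum.elim a b))
  have hΦ : finrank F₂ Φ = 2 * card κ := by
    rw [finrank_span_eq_card hind, card_sum, two_mul]
  have hadd := Subspace.finrank_add_finrank_dualCoannihilator_eq Φ
  have hW : ∀ u ∈ Φ.dualCoannihilator, ∀ i, a i u = 0 ∧ b i u = 0 := fun u hu i =>
    ⟨(Submodule.mem_dualCoannihilator _).mp hu _ (Submodule.subset_span ⟨inl i, rfl⟩),
      (Submodule.mem_dualCoannihilator _).mp hu _ (Submodule.subset_span ⟨inr i, rfl⟩)⟩
  obtain ⟨l, hl⟩ := exists_linear_of_polar_eq h.eq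
  have hle : finrank F₂ Φ.dualCoannihilator ≤ 1 := by
    have hinj : Injective (l.comp Φ.dualCoannihilator.subtype) := by
      rw [← LinearMap.ker_eq_bot, eq_bot_iff]
      rintro ⟨u, hu⟩ hlu
      have hlu : l u = 0 := hlu
      have : u ∈ q.radical := by
        rw [QuadraticMap.mem_radical_iff']
        constructor
        · rw [hl, hlu]; simp [hW u hu]
        · intro w
          rw [hl, hl]
          simp [hW u hu, hlu]
      rw [hrad, Submodule.mem_bot] at this
      exact Subtype.ext this
    have := LinearMap.finrank_le_finrank_of_injective hinj
    rwa [Module.finrank_self] at this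
  have hκ : card κ = n := by omega
  refine ⟨hκ, ?_⟩
  have hcard : card (κ ⊕ κ) = finrank F₂ (Dual F₂ U) := by
    rw [Subspace.dual_finrank_eq, hU, card_sum, hκ, two_mul]
  haveI : Nonempty (κ ⊕ κ) := Fintype.card_pos_iff.mp (by rw [card_sum]; omega)
  let bas := basisOfLinearIndependentOfCardEqFinrank hind hcard
  have hbas : ⇑bas = Sum.elim a b := coe_basisOfLinearIndependentOfCardEqFinrank hind hcard
  refine ⟨⟨bas, bas.equivFun l, fun u => ?_⟩, hbas⟩
  rw [hl, hbas]
  congr 1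
  conv_lhs => rw [← bas.sum_equivFun l, LinearMap.sum_apply]
  rw [hbas]; rfl

/-- A basis of the dual that is symplectic for the polar form provides coordinates. -/
theorem exists_coords_of_polar_eq {κ : Type*} [Fintype κ] {q : QuadraticForm F₂ U}
    (bas : Basis (κ ⊕ κ) F₂ (Dual F₂ U))
    (h : ∀ u w, polar q u w = ∑ i, (bas (inl i) u * bas (inr i) w +
      bas (inr i) u * bas (inl i) w)) : ∃ c : Coords q κ, c.bas = bas := by
  obtain ⟨l, hl⟩ := exists_linear_of_polar_eq h
  refine ⟨⟨bas, bas.equivFun l, fun u => ?_⟩, rfl⟩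
  rw [hl]
  congr 1
  conv_lhs => rw [← bas.sum_equivFun l, LinearMap.sum_apply]
  rfl

theorem polarBilin_self (q : QuadraticForm F₂ U) (u : U) : q.polarBilin u u = 0 := by
  rw [QuadraticMap.polarBilin_apply_apply, polar, ← two_smul F₂ u,
    show (2 : F₂) = 0 from rfl, zero_smul, map_zero]
  linear_combination (-1 : F₂) * zmod_two_add_self (q u)

/-- A non-singular quadratic form on an even-dimensional space has symplectic coordinates. -/
theorem exists_coords {q : QuadraticForm F₂ U} (hrad : q.radical = ⊥)
    {n : ℕ} (hn : n ≠ 0) (hU : finrank F₂ U = 2 * n) :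
    ∃ (κ : Type) (_ : Fintype κ) (_ : DecidableEq κ), card κ = n ∧
      Nonempty (Coords q κ) := by
  obtain ⟨κ, i1, i2, a, b, h⟩ := exists_isSymplectic (polarBilin_self q)
  obtain ⟨h1, c, -⟩ := exists_coords_of_isSymplectic h hrad hn hU
  exact ⟨κ, i1, i2, h1, ⟨c⟩⟩

/-- Coordinates whose first pair is given by a hyperbolic pair of vectors. -/
theorem exists_coords_of_pair {q : QuadraticForm F₂ U} (hrad : q.radical = ⊥)
    {n : ℕ} (hn : n ≠ 0) (hU : finrank F₂ U = 2 * n) {e f : U}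
    (hef : polar q e f = 1) :
    ∃ (κ : Type) (_ : Fintype κ) (_ : DecidableEq κ), card κ + 1 = n ∧
      ∃ c : Coords q (Option κ), c.bas (inl none) = q.polarBilin f ∧
        c.bas (inr none) = q.polarBilin e ∧ c.v (inl none) = q e ∧
        c.v (inr none) = q f := by
  have hB := polarBilin_self q
  have hef' : q.polarBilin e f = 1 := hef
  obtain ⟨κ, i1, i2, a, b, h⟩ :=
    exists_isSymplectic (subPlane_alternating hB e f)
  obtain ⟨h1, c, hc⟩ := exists_coords_of_isSymplectic (h.option hB hef') hrad hn hU
  rw [card_option] at h1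
  refine ⟨κ, i1, i2, h1, c, by rw [hc]; rfl, by rw [hc]; rfl, ?_, ?_⟩
  · have hve := h.vanish e fun w => (subPlane_left hB hef' w).1
    rw [c.eq, hc]
    simp only [sum_sum_type, sum_option, elim_inl, elim_inr,
      Option.elim, hve]
    rw [hB, symm_of_alternating hB f e, hef']
    simp
  · have hve := h.vanish f fun w => (subPlane_left hB hef' w).2
    rw [c.eq, hc]
    simp only [sum_sum_type, sum_option, elim_inl, elim_inr,
      Option.elim, hve]
    rw [hB, hef']
    simp

end NormalForm

section Generic
variable {κ : Type*} [Fintype κ] [DecidableEq κ]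

/-- The generic first coordinates. -/
def gl (i : κ) : PairRing κ := mX (inl i)

/-- The generic second coordinates. -/
def gr (i : κ) : PairRing κ := mX (inr i)

theorem sumElim_gl_gr : Sum.elim gl gr = (mX : κ ⊕ κ → PairRing κ) := by
  ext1 i; cases i <;> rfl

/-- The quadratic form on coordinate vectors. -/
def genForm (κ : Type*) [Fintype κ] : QuadraticForm F₂ (κ ⊕ κ → F₂) :=
  ∑ i, QuadraticMap.linMulLin (LinearMap.proj (inl i)) (LinearMap.proj (inr i))

/-- The tautological coordinates. -/
def genCoords (κ : Type*) [Fintype κ] [DecidableEq κ] : Coords (genForm κ) κ where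
  bas := (Pi.basisFun F₂ (κ ⊕ κ)).dualBasis
  v := 0
  eq u := by
    have h : ∀ i, (Pi.basisFun F₂ (κ ⊕ κ)).dualBasis i u = u i := fun i => by
      rw [dualBasis_apply, Pi.basisFun_repr]
    simp [genForm, h, sum_apply]

namespace Coords
variable {U : Type*} [AddCommGroup U] [Module F₂ U] [FiniteDimensional F₂ U]
variable {q : QuadraticForm F₂ U} (c c' : Coords q κ)

theorem equiv_gl : (fun i => (c.equiv : PairRing κ →ₐ[F₂] Sym U) (gl i)) = c.a :=
  funext fun i => c.equiv_X (inl i)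

theorem equiv_gr : (fun i => (c.equiv : PairRing κ →ₐ[F₂] Sym U) (gr i)) = c.b :=
  funext fun i => c.equiv_X (inr i)

theorem equiv_gram (k : ℕ) : c.equiv (gram gl gr k) = gram c.a c.b k := by
  rw [← equiv_gl, ← equiv_gr]
  exact map_gram (c.equiv : PairRing κ →ₐ[F₂] Sym U) _ _ _

theorem equiv_cf (k : ℕ) : c.equiv (cf gl gr k) = cf c.a c.b k := by
  rw [← equiv_gl, ← equiv_gr]
  exact map_cf (c.equiv : PairRing κ →ₐ[F₂] Sym U) _ _ _

theorem equiv_Qp (ε : F₂) :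
    (Qp ε gl gr).map (c.equiv : PairRing κ →+* Sym U) = Qp ε c.a c.b := by
  rw [← equiv_gl, ← equiv_gr]
  exact map_Qp (c.equiv : PairRing κ →ₐ[F₂] Sym U) _ _ _

theorem equiv_lin (v : κ ⊕ κ → F₂) :
    c.equiv (lin mX v) = vec (∑ i, v i • c.bas i) := by
  have := map_lin (c.equiv : PairRing κ →ₐ[F₂] Sym U) mX v
  refine this.trans ?_
  rw [lin, vec, map_sum]
  refine sum_congr rfl fun i _ => ?_
  rw [map_smul]
  congr 1
  exact c.equiv_X i

/-- The change of coordinates. -/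
def change : PairRing κ ≃ₐ[F₂] PairRing κ := c'.equiv.trans c.equiv.symm

theorem change_gram (k : ℕ) : change c c' (gram gl gr (k + 1)) = gram gl gr (k + 1) := by
  rw [change, trans_apply, symm_apply_eq, equiv_gram, equiv_gram,
    ← xi_succ, ← xi_succ]

theorem change_Qp : (Qp 1 gl gr).map (change c c' : PairRing κ →+* PairRing κ) =
    Qp 1 gl gr := by
  apply map_injective (c.equiv : PairRing κ →+* Sym U) c.equiv.injective
  rw [map_map, equiv_Qp, ← Qminus_eq, c'.Qminus_eq, ← equiv_Qp]
  congr 1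
  refine RingHom.ext fun x => ?_
  exact c.equiv.apply_symm_apply _

theorem change_X (i : κ ⊕ κ) :
    change c c' (mX i) = lin mX (c.bas.equivFun (c'.bas i)) := by
  rw [change, trans_apply, symm_apply_eq, equiv_X, equiv_lin,
    c.bas.sum_equivFun]

/-- Relabelling coordinates. -/
def reindex {κ' : Type*} [Fintype κ'] [DecidableEq κ'] (e : κ ≃ κ') : Coords q κ' where
  bas := c.bas.reindex (sumCongr e e)
  v := fun i => c.v ((sumCongr e e).symm i)
  eq u := by
    rw [c.eq]
    simp only [reindex_apply]
    congr 1
    · exact sum_equiv e _ _ fun i => by simp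
    · exact sum_equiv (sumCongr e e) _ _ fun i => by simp

end Coords

theorem dick_subst {ι : Type*} [Fintype ι] [DecidableEq ι] {φ : CoordRing ι →ₐ[F₂] CoordRing ι}
    (hφ : IsLinearSubst φ) (hinj : Injective φ) :
    (dick mX).map (φ : CoordRing ι →+* CoordRing ι) = dick mX := by
  choose v hv using hφ
  have h1 : ∀ w, φ (lin mX w) = lin mX (∑ i, w i • v i) := by
    intro w
    rw [map_lin]
    simp only [hv, lin, Finset.smul_sum, Finset.sum_apply, Finset.sum_smul, Pi.smul_apply,
      smul_eq_mul, mul_smul]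
    rw [sum_comm]
  have hbij : Function.Bijective (fun w : ι → F₂ => ∑ i, w i • v i) := by
    rw [← Finite.injective_iff_bijective]
    intro w w' h
    apply lin_X_injective
    apply hinj
    rw [h1, h1]
    exact congrArg _ h
  rw [dick, pmap_prod]
  refine Fintype.prod_bijective _ hbij _ _ fun w => ?_
  rw [pmap_add, map_X, map_C]
  congr 2
  exact h1 w

theorem cf_subst {φ : PairRing κ →ₐ[F₂] PairRing κ}
    (hφ : IsLinearSubst φ) (hinj : Injective φ) (j : ℕ) :
    φ (cf gl gr j) = cf gl gr j := by
  rw [cf, sumElim_gl_gr, dk]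
  conv_rhs => rw [← dick_subst hφ hinj, coeff_map]
  rfl

theorem coeff_one_gram_aux (x x' y y' : F₂) :
    ((C x + C x' * X) * (C y + C y' * X) ^ 2 ^ 1 + (C x + C x' * X) ^ 2 ^ 1 *
      (C y + C y' * X)).coeff 1 = x * y' + y * x' := by
  have e : ((C x + C x' * X) * (C y + C y' * X) ^ 2 ^ 1 + (C x + C x' * X) ^ 2 ^ 1 *
      (C y + C y' * X) : F₂[X]) = C (x * y ^ 2 + x ^ 2 * y) +
        C (x' * y ^ 2 + x ^ 2 * y' + 2 * (x * y * y' + x * x' * y)) * X +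
        C (x' * y * y' * 2 + x * y' ^ 2 + x' ^ 2 * y + 2 * x * x' * y') * X ^ 2 +
        C (x' * y' ^ 2 + x' ^ 2 * y') * X ^ 3 := by
    simp only [map_add, map_mul, map_pow, map_ofNat]; ring
  rw [e]
  simp only [coeff_add, coeff_C_mul, coeff_X_one, coeff_X_pow, coeff_C]
  norm_num
  clear e
  revert x x' y y'; decide

/-- A linear substitution that fixes `ξ_1` is a change of symplectic coordinates. -/
theorem exists_coords_of_subst {φ : PairRing κ →ₐ[F₂] PairRing κ}
    (hφ : IsLinearSubst φ) (hinj : Injective φ) (h1 : φ (gram gl gr 1) = gram gl gr 1) :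
    ∃ c' : Coords (genForm κ) κ, ∀ f, φ f = (genCoords κ).change c' f := by
  choose v hv using hφ
  set c := genCoords κ
  let x : κ ⊕ κ → Dual F₂ (κ ⊕ κ → F₂) := fun i => c.bas.equivFun.symm (v i)
  have hx : ∀ i, c.equiv (φ (mX i)) = vec (x i) := by
    intro i
    rw [hv, c.equiv_lin]
    exact congrArg vec (c.bas.equivFun_symm_apply _).symm
  have hind : LinearIndependent F₂ x := by
    rw [Fintype.linearIndependent_iff]
    intro g hg
    have h2 : c.equiv (φ (lin mX g)) = 0 := by
      rw [map_lin, lin, map_sum]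
      simp only [map_smul, hx]
      have := congrArg vec hg
      rw [vec, map_sum] at this
      simp only [map_smul] at this
      rw [this, vec, map_zero]
    have h3 : lin mX g = (lin mX 0 : PairRing κ) := by
      apply hinj
      apply c.equiv.injective
      rw [h2, lin_zero, map_zero, map_zero]
    exact fun i => congrFun (lin_X_injective h3) i
  rcases isEmpty_or_nonempty (κ ⊕ κ) with hemp | hne
  · have hφid : φ = AlgHom.id _ _ := malgHom_ext fun i => hemp.elim i
    refine ⟨c, fun f => ?_⟩
    rw [hφid]
    exact (c.equiv.symm_apply_apply f).symm
  have hcard : card (κ ⊕ κ) =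
      finrank F₂ (Dual F₂ (κ ⊕ κ → F₂)) := by
    rw [Module.finrank_eq_card_basis c.bas]
  let bas := basisOfLinearIndependentOfCardEqFinrank hind hcard
  have hbas : ⇑bas = x := coe_basisOfLinearIndependentOfCardEqFinrank hind hcard
  have hpolar : ∀ u w, polar (genForm κ) u w = ∑ i, (bas (inl i) u *
      bas (inr i) w + bas (inr i) u * bas (inl i) w) := by
    intro u w
    rw [c.polar_eq, hbas]
    let ev : PairRing κ →ₐ[F₂] F₂[X] :=
      maeval fun i => C (c.bas i u) + C (c.bas i w) * X
    have hev : ∀ y : κ ⊕ κ → F₂, ev (lin mX y) =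
        C (c.bas.equivFun.symm y u) + C (c.bas.equivFun.symm y w) * X := by
      intro y
      rw [map_lin, c.bas.equivFun_symm_apply, LinearMap.sum_apply, LinearMap.sum_apply, lin]
      simp only [ev, maeval_X, map_sum, sum_mul, ← sum_add_distrib,
        LinearMap.smul_apply, smul_eq_mul, map_mul, smul_add, Polynomial.smul_eq_C_mul, mul_assoc]
    have h3 := congrArg (fun p => (ev p).coeff 1) h1
    have h4 := map_gram (ev.comp φ) (gl : κ → _) gr 1
    rw [comp_apply] at h4
    simp only [h4, map_gram] at h3
    simp only [gram, finsetSum_coeff, comp_apply] at h3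
    have e1 : ∀ i, ev (φ (gl i)) = C (x (inl i) u) + C (x (inl i) w) * X := fun i => by
      rw [gl, hv, hev]
    have e2 : ∀ i, ev (φ (gr i)) = C (x (inr i) u) + C (x (inr i) w) * X := fun i => by
      rw [gr, hv, hev]
    have e3 : ∀ i : κ, ev (gl i) = C (c.bas (inl i) u) + C (c.bas (inl i) w) * X :=
      fun i => maeval_X _ _
    have e4 : ∀ i : κ, ev (gr i) = C (c.bas (inr i) u) + C (c.bas (inr i) w) * X :=
      fun i => maeval_X _ _
    simp only [e1, e2, e3, e4, coeff_one_gram_aux] at h3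
    exact h3.symm
  obtain ⟨c', hc'⟩ := exists_coords_of_polar_eq bas hpolar
  refine ⟨c', fun f => ?_⟩
  have : ((c.equiv : PairRing κ →ₐ[F₂] _).comp φ) =
      (c'.equiv : PairRing κ →ₐ[F₂] Sym (κ ⊕ κ → F₂)) := by
    apply malgHom_ext
    intro i
    refine (hx i).trans ?_
    refine Eq.trans ?_ (c'.equiv_X i).symm
    rw [hc', hbas]
  rw [Coords.change, trans_apply, AlgEquiv.eq_symm_apply]
  exact dcongr_fun this f

/-- Every non-zero linear form is the first of a system of symplectic coordinates. -/
theorem exists_change {v : Option κ ⊕ Option κ → F₂} (hv : v ≠ 0) :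
    ∃ c : Coords (genForm (Option κ)) (Option κ),
      (genCoords (Option κ)).change c (gl none) = lin mX v := by
  set c := genCoords (Option κ)
  set x : Dual F₂ (Option κ ⊕ Option κ → F₂) := c.bas.equivFun.symm v with hx
  have hx0 : x ≠ 0 := by
    rw [hx]; exact (LinearEquiv.map_ne_zero_iff _).mpr hv
  let f : Option κ ⊕ Option κ → F₂ := c.point.symm fun i => v i.swap
  have hf : (genForm (Option κ)).polarBilin f = x := by
    refine LinearMap.ext fun w => ?_
    have hp : ∀ i, c.bas i f = v i.swap := fun i => by
      rw [← c.point_apply, apply_symm_apply]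
    refine (c.polar_eq f w).trans ?_
    rw [hx, c.bas.equivFun_symm_apply, LinearMap.sum_apply, sum_sum_type,
      ← sum_add_distrib]
    refine sum_congr rfl fun i _ => ?_
    rw [hp, hp, add_comm]
    rfl
  obtain ⟨e, he⟩ : ∃ e, x e = 1 := by
    by_contra! h
    exact hx0 (LinearMap.ext fun e => (zmod_two_cases _).resolve_right (h e))
  have hef : polar (genForm (Option κ)) e f = 1 := by
    rw [polar_comm, ← he, ← hf]; rfl
  obtain ⟨κ', i1, i2, hκ', c', h1, -⟩ := exists_coords_of_pair c.radical_eq_bot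
    (n := card κ + 1) (by omega) (by
      rw [Module.finrank_fintype_fun_eq_card, card_sum, card_option, two_mul]) hef
  have e0 : κ' ≃ κ := Fintype.equivOfCardEq (by omega)
  refine ⟨c'.reindex (Equiv.optionCongr e0), ?_⟩
  rw [gl, Coords.change_X]
  congr 1
  have : (c'.reindex (Equiv.optionCongr e0)).bas (inl none) = c'.bas (inl none) := by
    simp only [Coords.reindex, reindex_apply]
    rfl
  rw [this, h1, hf, hx, apply_symm_apply]

end Generic

section Descent
variable {ι τ : Type*} [Fintype ι] [DecidableEq ι] [Fintype τ]

theorem isUnit_of_isUnit_aeval {y : τ → CoordRing ι} (hy : AlgebraicIndependent F₂ y)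
    {p : Poly τ} (h : IsUnit (maeval y p)) : IsUnit p := by
  rw [MvPolynomial.isUnit_iff_eq_C_of_isReduced] at h ⊢
  obtain ⟨r, hr, h⟩ := h
  refine ⟨r, hr, hy ?_⟩
  rw [h, MvPolynomial.aeval_C]; rfl

/-- An element that becomes a polynomial in the `y`'s after multiplication by powers of two
relatively prime polynomials in the `y`'s is itself one. -/
theorem mem_range_of_isRelPrime {y : τ → CoordRing ι} (hy : AlgebraicIndependent F₂ y)
    {s t f : CoordRing ι} (hst : IsRelPrime s t)
    (hs : s ∈ (maeval (R := F₂) y).range)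
    (ht : t ∈ (maeval (R := F₂) y).range) (hs0 : s ≠ 0) {k l : ℕ}
    (h1 : s ^ k * f ∈ (maeval (R := F₂) y).range)
    (h2 : t ^ l * f ∈ (maeval (R := F₂) y).range) :
    f ∈ (maeval (R := F₂) y).range := by
  obtain ⟨s, rfl⟩ := hs
  obtain ⟨t, rfl⟩ := ht
  obtain ⟨a, ha⟩ := h1
  obtain ⟨b, hb⟩ := h2
  simp only [AlgHom.toRingHom_eq_coe, RingHom.coe_coe] at *
  have hrel : IsRelPrime s t := by
    intro d hd1 hd2
    exact isUnit_of_isUnit_aeval hy (hst (map_dvd _ hd1) (map_dvd _ hd2))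
  have hab : t ^ l * a = s ^ k * b := by
    apply hy
    rw [map_mul, map_mul, ha, hb, map_pow, map_pow]
    ring
  obtain ⟨e, he⟩ : s ^ k ∣ a := by
    refine IsRelPrime.dvd_of_dvd_mul_left (hrel.pow (m := k) (n := l)) (Dvd.intro _ hab.symm)
  refine ⟨e, ?_⟩
  rw [he, map_mul, map_pow] at ha
  exact mul_left_cancel₀ (pow_ne_zero k hs0) ha

theorem isHomogeneous_lin (v : ι → F₂) :
    (lin (mX : ι → CoordRing ι) v).IsHomogeneous 1 := by
  rw [lin]
  refine MvPolynomial.IsHomogeneous.sum _ _ _ fun i _ => ?_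
  rw [MvPolynomial.smul_eq_C_mul]
  have := (MvPolynomial.isHomogeneous_C ι (v i)).mul (isHomogeneous_X F₂ i)
  rwa [zero_add] at this

theorem lin_dvd_lin {v w : ι → F₂} (hw : w ≠ 0)
    (h : lin (mX : ι → CoordRing ι) v ∣ lin mX w) : v = w := by
  obtain ⟨g, hg⟩ := h
  have hw0 := lin_X_ne_zero hw
  have hv : lin (mX : ι → CoordRing ι) v ≠ 0 := fun h => hw0 (by rw [hg, h, zero_mul])
  have hg0 : g ≠ 0 := fun h => hw0 (by rw [hg, h, mul_zero])
  have hdeg := MvPolynomial.totalDegree_mul_of_isDomain hv hg0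
  rw [← hg, (isHomogeneous_lin w).totalDegree hw0, (isHomogeneous_lin v).totalDegree hv] at hdeg
  have hg1 := MvPolynomial.totalDegree_eq_zero_iff_eq_C.mp (by omega : g.totalDegree = 0)
  rcases zmod_two_cases (MvPolynomial.coeff 0 g) with h | h
  · rw [h, map_zero] at hg1; exact absurd hg1 hg0
  · rw [h, map_one] at hg1
    rw [hg1, mul_one] at hg
    exact (lin_X_injective hg).symm

end Descent

section Invariance
variable {κ : Type*} [Fintype κ] [DecidableEq κ]

/-- Invariance under the linear substitutions that fix `ξ_1`. -/
def IsSpInvariant (f : PairRing κ) : Prop :=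
  ∀ φ : PairRing κ →ₐ[F₂] PairRing κ, IsLinearSubst φ → Injective φ →
    φ (gram gl gr 1) = gram gl gr 1 → φ f = f

theorem IsSpInvariant.change {f : PairRing κ} (hf : IsSpInvariant f)
    (c c' : Coords (genForm κ) κ) : c.change c' f = f :=
  hf (c.change c' : PairRing κ →ₐ[F₂] PairRing κ)
    (fun i => ⟨_, c.change_X c' i⟩) (c.change c').injective (c.change_gram c' 0)

theorem isSpInvariant_cf (j : ℕ) : IsSpInvariant (cf gl gr j : PairRing κ) :=
  fun _ h1 h2 _ => cf_subst h1 h2 j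

/-- Setting the first coordinate of the first pair to zero. -/
def kill : PairRing (Option κ) →ₐ[F₂] PairRing (Option κ) :=
  maeval (Sum.elim (fun o => o.elim 0 fun i => gl (some i)) gr)

theorem gl_dvd_iff (f : PairRing (Option κ)) : gl none ∣ f ↔ kill f = 0 := by
  constructor
  · rintro ⟨g, rfl⟩
    rw [map_mul, kill, gl, maeval_X]
    simp
  · intro h
    have h2 : (Ideal.Quotient.mkₐ F₂ (span {gl (none : Option κ)})).comp kill =
        Ideal.Quotient.mkₐ F₂ (span {gl (none : Option κ)}) := by
      apply malgHom_ext
      rintro ((_ | i) | o)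
      · rw [comp_apply, kill, maeval_X]
        simp only [elim_inl, Option.elim, map_zero]
        exact (Ideal.Quotient.eq_zero_iff_mem.mpr (Ideal.mem_span_singleton_self _)).symm
      · rw [comp_apply, kill, maeval_X]; rfl
      · rw [comp_apply, kill, maeval_X]; rfl
    have h3 := dcongr_fun h2 f
    rw [comp_apply, h, map_zero] at h3
    exact Ideal.mem_span_singleton.mp (Ideal.Quotient.eq_zero_iff_mem.mp h3.symm)

theorem lin_dvd_iff_kill {f : PairRing (Option κ)} (hf : IsSpInvariant f)
    {v : Option κ ⊕ Option κ → F₂} (hv : v ≠ 0) : lin mX v ∣ f ↔ kill f = 0 := by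
  obtain ⟨c, hc⟩ := exists_change hv
  rw [← gl_dvd_iff, ← hc]
  conv_lhs => rw [← hf.change (genCoords _) c]
  exact map_dvd_iff _

theorem prime_lin {v : Option κ ⊕ Option κ → F₂} (hv : v ≠ 0) :
    Prime (lin mX v : PairRing (Option κ)) := by
  obtain ⟨c, hc⟩ := exists_change hv
  rw [← hc]
  exact (MulEquiv.prime_iff ((genCoords (Option κ)).change c)).mpr X_prime

theorem cf_zero_eq_prod : cf gl gr 0 = ∏ v ∈ Finset.univ.filter
    (fun v : κ ⊕ κ → F₂ => v ≠ 0), lin mX v := by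
  rw [cf, dk_zero_eq_prod, sumElim_gl_gr]

theorem cf_zero_ne_zero : (cf gl gr 0 : PairRing κ) ≠ 0 := by
  rw [cf, sumElim_gl_gr]; exact dk_X_zero_ne_zero

theorem isRelPrime_cf_zero {f : PairRing (Option κ)} (hf : IsSpInvariant f)
    (h : kill f ≠ 0) : IsRelPrime (cf gl gr 0) f := by
  rw [cf_zero_eq_prod]
  refine IsRelPrime.prod_left fun v hv => ?_
  have hv0 : v ≠ 0 := (Finset.mem_filter.mp hv).2
  rw [(prime_lin hv0).irreducible.isRelPrime_iff_not_dvd, lin_dvd_iff_kill hf hv0]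
  exact h

theorem cf_zero_dvd {f : PairRing (Option κ)} (hf : IsSpInvariant f)
    (h : kill f = 0) : cf gl gr 0 ∣ f := by
  rw [cf_zero_eq_prod]
  refine Finset.prod_dvd_of_isRelPrime ?_ ?_
  · intro v hv w hw hvw
    have hv0 : v ≠ 0 := (Finset.mem_filter.mp hv).2
    have hw0 : w ≠ 0 := (Finset.mem_filter.mp hw).2
    rw [Function.onFun, (prime_lin hv0).irreducible.isRelPrime_iff_not_dvd]
    exact fun h => hvw (lin_dvd_lin hw0 h)
  · intro v hv
    exact (lin_dvd_iff_kill hf (Finset.mem_filter.mp hv).2).mpr h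

end Invariance

section GramRange
variable {κ : Type*} [Fintype κ] [DecidableEq κ]

/-- The subalgebra generated by `ξ_1, …, ξ_N`. -/
def grange (κ : Type*) [Fintype κ] (N : ℕ) : Subalgebra F₂ (PairRing κ) :=
  (maeval (R := F₂) fun i : Fin N =>
    (gram gl gr ((i : ℕ) + 1) : PairRing κ)).range

theorem gram_mem_grange {N k : ℕ} (hk : k ≠ 0) (h : k ≤ N) : gram gl gr k ∈ grange κ N := by
  refine ⟨mX ⟨k - 1, by omega⟩, ?_⟩
  rw [AlgHom.toRingHom_eq_coe, RingHom.coe_coe, maeval_X]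
  congr 1
  exact Nat.sub_add_cancel (Nat.pos_of_ne_zero hk)

/-- The value of a polynomial in the `ξ`'s at the generic vector, with `ξ_0` sent to zero. -/
abbrev gv (κ : Type*) [Fintype κ] : XiRing →ₐ[F₂] PairRing κ := evXi gl gr 0

theorem gv_symEntry_mem {N i j : ℕ} (hi : i ≤ N) (hj : j ≤ N) :
    gv κ (symEntry i j) ∈ grange κ N := by
  rw [symEntry]
  split_ifs with h
  · rw [map_zero]; exact zero_mem _
  · rw [map_pow, evXi_X _ _ _ (by omega)]
    exact pow_mem (gram_mem_grange (by omega) (by omega)) _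

theorem gv_mem {N : ℕ} {p : XiRing} (hp : p ∈ supported F₂ (Iic N)) :
    gv κ p ∈ grange κ N := by
  rw [supported] at hp
  have : adjoin F₂ (mX '' Iic N) ≤ (grange κ N).comap (gv κ) := by
    rw [adjoin_le_iff]
    rintro _ ⟨k, hk, rfl⟩
    change gv κ (mX k) ∈ grange κ N
    by_cases h0 : k = 0
    · rw [h0, evXi_X_zero]; exact zero_mem _
    · rw [evXi_X _ _ _ h0]; exact gram_mem_grange h0 hk
  exact this hp

theorem isSpInvariant_gram (k : ℕ) : IsSpInvariant (gram gl gr k : PairRing κ) := by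
  intro φ h1 h2 h3
  obtain ⟨c, hc⟩ := exists_coords_of_subst h1 h2 h3
  rw [hc]
  rcases k with _ | k
  · have : (gram gl gr 0 : PairRing κ) = 0 :=
      sum_eq_zero fun i _ => by rw [pow_zero, pow_one, pow_one, add_self_eq_zero_of_algebra]
    rw [this, map_zero]
  · exact Coords.change_gram _ _ _

theorem isSpInvariant_coeff_Qp (i : ℕ) : IsSpInvariant ((Qp 1 gl gr).coeff i :
    PairRing κ) := by
  intro φ h1 h2 h3
  obtain ⟨c, hc⟩ := exists_coords_of_subst h1 h2 h3
  rw [hc]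
  conv_rhs => rw [← Coords.change_Qp (genCoords κ) c, coeff_map]
  rfl

theorem isSpInvariant_gv (p : XiRing) : IsSpInvariant (gv κ p) := by
  intro φ h1 h2 h3
  rw [map_evXi]
  have : ∀ k, gram (fun i => φ (gl i)) (fun i => φ (gr i)) k =
      (gram gl gr k : PairRing κ) := fun k => by
    rw [← map_gram, isSpInvariant_gram k φ h1 h2 h3]
  simp only [gv, evXi, this, map_zero]

section DetMem
variable {A : Type*} [CommRing A] [Algebra F₂ A] (S : Subalgebra F₂ A)
  {N : Type*} [Fintype N] [DecidableEq N] {M : Matrix N N A}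

theorem det_mem_of_forall (h : ∀ i j, M i j ∈ S) : M.det ∈ S := by
  rw [Matrix.det_apply]
  refine sum_mem fun σ _ => ?_
  rw [Units.smul_def]
  exact zsmul_mem (prod_mem fun i _ => h _ _) _

theorem det_mul_mem_of_mulVec (h : ∀ i j, M i j ∈ S) {x : N → A}
    (hx : ∀ i, (M.mulVec x) i ∈ S) (i : N) : M.det * x i ∈ S := by
  have h1 : M.adjugate.mulVec (M.mulVec x) = M.det • x := by
    rw [Matrix.mulVec_mulVec, Matrix.adjugate_mul, Matrix.smul_mulVec, Matrix.one_mulVec]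
  have h2 := congrFun h1 i
  rw [Pi.smul_apply, smul_eq_mul, ← Matrix.cramer_eq_adjugate_mulVec, Matrix.cramer_apply] at h2
  rw [← h2]
  refine det_mem_of_forall S fun j k => ?_
  rw [Matrix.updateCol_apply]
  split_ifs
  · exact hx j
  · exact h j k

end DetMem

variable {m : ℕ}

theorem cf_sq_mem (hm : card κ = m) : (cf gl gr 0 : PairRing κ) ^ 2 ∈ grange κ (2 * m) := by
  rw [← det_symEntry gl gr 0 hm]
  exact det_mem_of_forall _ fun i j => gv_symEntry_mem i.2.le j.2.le

theorem cf_sq_mul_mem (hm : card κ = m) (j : ℕ) :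
    (cf gl gr 0 : PairRing κ) ^ 2 * cf gl gr j ∈ grange κ (2 * m) := by
  rcases lt_trichotomy j (2 * m) with h | h | h
  · rw [← det_symEntry gl gr 0 hm]
    refine det_mul_mem_of_mulVec (grange κ (2 * m)) (fun i j => gv_symEntry_mem i.2.le j.2.le)
      (x := fun j : Fin (2 * m) => cf gl gr j) (fun i => ?_) ⟨j, h⟩
    have h2 := sum_cf_mul_symEntry (gl : κ → PairRing κ) gr 0 hm i
    rw [sum_range_succ, cf_top _ _ hm, one_mul, sum_range] at h2
    have h3 : ((Matrix.of fun i j : Fin (2 * m) => gv κ (symEntry i j)).mulVec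
        fun j : Fin (2 * m) => cf gl gr j) i = gv κ (symEntry i (2 * m)) := by
      refine CharTwo.add_eq_zero.mp (Eq.trans ?_ h2)
      refine congrArg (· + _) ?_
      change ∑ j : Fin (2 * m), gv κ (symEntry i j) * cf gl gr j = _
      exact sum_congr rfl fun j _ => mul_comm _ _
    refine (congrArg (· ∈ grange κ (2 * m)) h3).mpr ?_
    exact gv_symEntry_mem i.2.le le_rfl
  · rw [h, cf_top _ _ hm, mul_one]; exact cf_sq_mem hm
  · rw [cf_of_lt _ _ hm h, mul_zero]; exact zero_mem _

/-- The `ξ_1, …, ξ_{2m}` of the generic vector of a symplectic `2m`-space are algebraically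
independent. -/
theorem algebraicIndependent_gram (hm : card κ = m) : AlgebraicIndependent F₂
    fun i : Fin (2 * m) => (gram gl gr ((i : ℕ) + 1) : PairRing κ) := by
  refine algebraicIndependent_of_dk _ (cf gl gr 0 ^ 2) ?_ (pow_ne_zero 2 cf_zero_ne_zero)
    (cf_sq_mem hm) fun j => ⟨1, ?_⟩
  · rw [card_fin, card_sum, hm, two_mul]
  · have := cf_sq_mul_mem hm j
    rw [pow_one]
    conv => enter [2, 2]; rw [← sumElim_gl_gr]
    exact this

theorem exists_pow_mul_mem_grange (hm : card κ = m) {f : PairRing κ}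
    (hf : IsSpInvariant f) : ∃ k, cf gl gr 0 ^ k * f ∈ grange κ (2 * m) := by
  rcases Nat.eq_zero_or_pos m with rfl | h0
  · haveI : IsEmpty (κ ⊕ κ) := by
      have := Fintype.card_eq_zero_iff.mp hm
      infer_instance
    refine ⟨0, ?_⟩
    obtain ⟨r, hr⟩ := C_surjective (κ ⊕ κ) f
    rw [← hr, pow_zero, one_mul]
    exact (grange κ (2 * 0)).algebraMap_mem r
  obtain ⟨k, hk⟩ := exists_pow_mul_mem_range (fun i : Fin (2 * m) =>
    (gram gl gr ((i : ℕ) + 1) : PairRing κ)) (cf gl gr 0 ^ 2)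
    (by rw [card_fin, card_sum, hm, two_mul]) (pow_ne_zero 2 cf_zero_ne_zero)
    (cf_sq_mem hm) (fun j => ⟨1, by
      have := cf_sq_mul_mem hm j
      rw [pow_one]
      conv => enter [2, 2]; rw [← sumElim_gl_gr]
      exact this⟩) f
    (fun φ h1 h2 h3 => hf φ h1 h2 (h3 ⟨0, by omega⟩))
  exact ⟨2 * k, by rwa [pow_mul]⟩

end GramRange

section Reindex
variable {A : Type*} [CommRing A] [Algebra F₂ A]
variable {κ κ' : Type*} [Fintype κ] [DecidableEq κ] [Fintype κ'] [DecidableEq κ']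

theorem gram_reindex (e : κ' ≃ κ) (a b : κ → A) (k : ℕ) : gram (a ∘ e) (b ∘ e) k = gram a b k :=
  Equiv.sum_comp e fun i => a i * b i ^ 2 ^ k + a i ^ 2 ^ k * b i

theorem evXi_reindex (e : κ' ≃ κ) (a b : κ → A) (z : A) : evXi (a ∘ e) (b ∘ e) z = evXi a b z := by
  simp only [evXi, gram_reindex]

theorem sumElim_reindex (e : κ' ≃ κ) (a b : κ → A) :
    Sum.elim (a ∘ e) (b ∘ e) = fun i => Sum.elim a b (sumCongr e e i) := by
  ext i; cases i <;> rfl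

theorem cf_reindex (e : κ' ≃ κ) (a b : κ → A) (j : ℕ) : cf (a ∘ e) (b ∘ e) j = cf a b j := by
  rw [cf, sumElim_reindex, dk_reindex (sumCongr e e) (Sum.elim a b), cf]

theorem qf_reindex (e : κ' ≃ κ) (a b : κ → A) : qf (a ∘ e) (b ∘ e) = qf a b :=
  Equiv.sum_comp e fun i => a i * b i

theorem Qp_reindex (e : κ' ≃ κ) (ε : F₂) (a b : κ → A) :
    Qp ε (a ∘ e) (b ∘ e) = Qp ε a b := by
  rw [Qp, Qp, prod_filter, prod_filter]
  refine prod_equiv ((sumCongr e e).arrowCongr (Equiv.refl _)) _ _ fun v => ?_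
  have h1 : arf (((sumCongr e e).arrowCongr (Equiv.refl F₂)) v) = arf v := by
    rw [arf, arf]
    refine (Equiv.sum_comp e _).symm.trans ?_
    exact sum_congr rfl fun i _ => by simp
  have h2 : lin (Sum.elim a b) (((sumCongr e e).arrowCongr (Equiv.refl F₂)) v) =
      lin (Sum.elim (a ∘ e) (b ∘ e)) v := by
    rw [sumElim_reindex, lin, lin]
    refine (Equiv.sum_comp (sumCongr e e) _).symm.trans ?_
    exact sum_congr rfl fun i _ => by simp
  rw [h1, h2, qf_reindex]

/-- The specialization of the generic coordinates. -/
def specialize (a b : κ → A) : PairRing κ →ₐ[F₂] A := maeval (Sum.elim a b)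

theorem specialize_gl (a b : κ → A) : (fun i => specialize a b (gl i)) = a :=
  funext fun _ => maeval_X _ _

theorem specialize_gr (a b : κ → A) : (fun i => specialize a b (gr i)) = b :=
  funext fun _ => maeval_X _ _

theorem specialize_cf (a b : κ → A) (j : ℕ) : specialize a b (cf gl gr j) = cf a b j := by
  rw [map_cf, specialize_gl, specialize_gr]

theorem specialize_gv (a b : κ → A) (p : XiRing) : specialize a b (gv κ p) = evXi a b 0 p := by
  rw [map_evXi, specialize_gl, specialize_gr, map_zero]

end Reindex

section Support

/-- The polynomials in `ξ_1, …, ξ_N`. -/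
abbrev supp1 (N : ℕ) : Subalgebra F₂ XiRing := supported F₂ (Set.Icc 1 N)

theorem supp1_mono {N N' : ℕ} (h : N ≤ N') : supp1 N ≤ supp1 N' :=
  supported_mono (Set.Icc_subset_Icc_right h)

theorem supp1_le (N : ℕ) : supp1 N ≤ supported F₂ (Iic N) :=
  supported_mono fun _ h => h.2

theorem X_mem_supp1 {N k : ℕ} (h1 : 1 ≤ k) (h2 : k ≤ N) :
    (mX k : XiRing) ∈ supp1 N :=
  Algebra.subset_adjoin ⟨k, ⟨h1, h2⟩, rfl⟩

theorem symEntry_mem_supp1 {N i j : ℕ} (hi : i ≤ N) (hj : j ≤ N) : symEntry i j ∈ supp1 N := by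
  rw [symEntry]
  split_ifs with h
  · exact zero_mem _
  · exact pow_mem (X_mem_supp1 (by omega) (by omega)) _

theorem evXi_eq_zero_right {A : Type*} [CommRing A] [Algebra F₂ A] {κ : Type*} [Fintype κ]
    [DecidableEq κ]
    (a b : κ → A) (z : A) {N : ℕ} {p : XiRing} (hp : p ∈ supp1 N) :
    evXi a b z p = evXi a b 0 p := by
  have : supp1 N ≤ AlgHom.equalizer (evXi a b z) (evXi a b 0) := by
    rw [supp1, supported, adjoin_le_iff]
    rintro _ ⟨k, hk, rfl⟩
    have h0 : k ≠ 0 := by have := hk.1; omega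
    change evXi a b z _ = evXi a b 0 _
    rw [evXi_X _ _ _ h0, evXi_X _ _ _ h0]
  exact this hp

variable {κ : Type*} [Fintype κ] [DecidableEq κ]

/-- The polynomial ring in `ξ_1, …, ξ_N` inside that in all the `ξ`'s. -/
def shiftHom (N : ℕ) : Poly (Fin N) →ₐ[F₂] XiRing :=
  MvPolynomial.rename fun i => (i : ℕ) + 1

theorem shiftHom_mem {N : ℕ} (p : Poly (Fin N)) : shiftHom N p ∈ supp1 N := by
  induction p using minduction_on with
  | C a => rw [shiftHom, rename_C]; exact (supp1 N).algebraMap_mem a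
  | add p q hp hq => rw [map_add]; exact add_mem hp hq
  | mul_X p i hp =>
    rw [map_mul]
    refine mul_mem hp ?_
    rw [shiftHom, rename_X]
    exact X_mem_supp1 (by omega) (by omega)

theorem gv_shiftHom {N : ℕ} (p : Poly (Fin N)) : gv κ (shiftHom N p) =
    maeval (fun i : Fin N => (gram gl gr ((i : ℕ) + 1) : PairRing κ)) p := by
  rw [shiftHom, gv, evXi, aeval_rename]
  congr 1

theorem exists_shiftHom {N : ℕ} {p : XiRing} (hp : p ∈ supp1 N) : ∃ p', shiftHom N p' = p := by
  have : supp1 N ≤ (shiftHom N).range := by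
    rw [supp1, supported, adjoin_le_iff]
    rintro _ ⟨k, hk, rfl⟩
    refine ⟨mX ⟨k - 1, by have := hk.1; have := hk.2; omega⟩, ?_⟩
    rw [shiftHom, AlgHom.toRingHom_eq_coe, RingHom.coe_coe, rename_X]
    congr 1
    have := hk.1
    simp only
    omega
  exact this hp

theorem exists_gv_eq {N : ℕ} {f : PairRing κ} (hf : f ∈ grange κ N) :
    ∃ p ∈ supp1 N, gv κ p = f := by
  obtain ⟨p, rfl⟩ := hf
  exact ⟨shiftHom N p, shiftHom_mem p, gv_shiftHom p⟩

theorem gv_injective {m : ℕ} (hm : card κ = m) {p p' : XiRing} (hp : p ∈ supp1 (2 * m))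
    (hp' : p' ∈ supp1 (2 * m)) (h : gv κ p = gv κ p') : p = p' := by
  obtain ⟨p, rfl⟩ := exists_shiftHom hp
  obtain ⟨p', rfl⟩ := exists_shiftHom hp'
  rw [gv_shiftHom, gv_shiftHom] at h
  rw [algebraicIndependent_gram hm h]

/-- Polynomials in `ξ_0` with coefficients in the polynomials in `ξ_1, …, ξ_N`. -/
def shiftPoly (N : ℕ) : (Poly (Fin N))[X] →+* XiRing :=
  eval₂RingHom (shiftHom N).toRingHom (mX 0)

theorem shiftPoly_mem {N : ℕ} (P : (Poly (Fin N))[X]) :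
    shiftPoly N P ∈ supported F₂ (Iic N) := by
  rw [shiftPoly, coe_eval₂RingHom, Polynomial.eval₂_eq_sum, Polynomial.sum]
  refine sum_mem fun i _ => mul_mem (supp1_le N (shiftHom_mem _)) (pow_mem ?_ _)
  exact Algebra.subset_adjoin ⟨0, Nat.zero_le _, rfl⟩

theorem exists_shiftPoly {N : ℕ} {p : XiRing}
    (hp : p ∈ supported F₂ (Iic N)) : ∃ P, shiftPoly N P = p := by
  let R : Subalgebra F₂ XiRing :=
    { (shiftPoly N).range with
      algebraMap_mem' := fun r => ⟨C (mC r), by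
        rw [shiftPoly, coe_eval₂RingHom, eval₂_C]
        exact (shiftHom N).commutes r⟩ }
  have : supported F₂ (Iic N) ≤ R := by
    rw [supported, adjoin_le_iff]
    rintro _ ⟨k, hk, rfl⟩
    by_cases h0 : k = 0
    · exact ⟨X, by rw [shiftPoly, coe_eval₂RingHom, eval₂_X, h0]⟩
    · obtain ⟨p', hp'⟩ := exists_shiftHom (X_mem_supp1 (Nat.pos_of_ne_zero h0) hk)
      exact ⟨C p', by rw [shiftPoly, coe_eval₂RingHom, eval₂_C]; exact hp'⟩
  exact this hp

/-- The value of a polynomial in the `ξ`'s at the generic vector, with `ξ_0` sent to an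
indeterminate. -/
def spX (κ : Type*) [Fintype κ] : XiRing →ₐ[F₂] (PairRing κ)[X] :=
  evXi (fun i => C (gl i)) (fun i => C (gr i)) X

theorem spX_of_mem {N : ℕ} {p : XiRing} (hp : p ∈ supp1 N) : spX κ p = C (gv κ p) := by
  rw [spX, evXi_eq_zero_right _ _ _ hp]
  have := map_evXi (CAlgHom (R := F₂)) (gl : κ → PairRing κ) gr 0 p
  rw [map_zero] at this
  exact this.symm

theorem spX_shiftPoly {N : ℕ} (P : (Poly (Fin N))[X]) :
    spX κ (shiftPoly N P) = P.map (maeval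
      (fun i : Fin N => (gram gl gr ((i : ℕ) + 1) : PairRing κ))).toRingHom := by
  have : ((spX κ : XiRing →+* _).comp (shiftPoly N)) = Polynomial.mapRingHom (maeval
      (fun i : Fin N => (gram gl gr ((i : ℕ) + 1) : PairRing κ))).toRingHom := by
    refine Polynomial.ringHom_ext (fun p => ?_) ?_
    · rw [RingHom.comp_apply, shiftPoly, coe_eval₂RingHom, eval₂_C,
        coe_mapRingHom, map_C]
      refine (spX_of_mem (shiftHom_mem p)).trans ?_
      rw [gv_shiftHom]; rfl
    · rw [RingHom.comp_apply, shiftPoly, coe_eval₂RingHom, eval₂_X,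
        coe_mapRingHom, map_X]
      exact evXi_X_zero _ _ _
  exact dcongr_fun this P

theorem spX_injective {m : ℕ} (hm : card κ = m) {p p' : XiRing}
    (hp : p ∈ supported F₂ (Iic (2 * m)))
    (hp' : p' ∈ supported F₂ (Iic (2 * m))) (h : spX κ p = spX κ p') :
    p = p' := by
  obtain ⟨P, rfl⟩ := exists_shiftPoly hp
  obtain ⟨P', rfl⟩ := exists_shiftPoly hp'
  rw [spX_shiftPoly, spX_shiftPoly] at h
  rw [map_injective _ (algebraicIndependent_gram hm) h]

theorem exists_spX_eq {N : ℕ} {f : (PairRing κ)[X]} (hf : ∀ i, f.coeff i ∈ grange κ N) :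
    ∃ p ∈ supported F₂ (Iic N), spX κ p = f := by
  choose g hg using hf
  refine ⟨shiftPoly N (∑ i ∈ range (f.natDegree + 1), C (g i) * X ^ i), shiftPoly_mem _, ?_⟩
  rw [spX_shiftPoly, pmap_sum]
  conv_rhs => rw [f.as_sum_range_C_mul_X_pow]
  refine sum_congr rfl fun i _ => ?_
  rw [pmap_mul, map_C, pmap_pow, map_X, hg]

end Support

section Vectors

/-- The coefficients of the vector `e_{2m} + ∑ E_i e_i`. -/
def om (m : ℕ) (i : ℕ) : XiRing := if h : i < m then E m ⟨i, h⟩ else if i = 2 * m then 1 else 0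

/-- The Frobenius twist of a vector, shifted by one place. -/
def sh (x : ℕ → XiRing) : ℕ → XiRing
  | 0 => 0
  | i + 1 => x i ^ 2

/-- For `j < m` the `j`-th column of `K_m` on top of the unit matrix; for `j = m` the vector
`om m`. -/
def wv (m j : ℕ) : ℕ → XiRing := sh^[m - j] (om j)

theorem wv_self (m : ℕ) : wv m m = om m := by rw [wv, Nat.sub_self]; rfl

theorem wv_succ {m j : ℕ} (h : j ≤ m) : wv (m + 1) j = sh (wv m j) := by
  rw [wv, wv, Nat.succ_sub h, Function.iterate_succ_apply']

theorem om_of_lt {m : ℕ} (i : Fin m) : om m i = E m i := by rw [om, dif_pos i.2]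

theorem wv_of_le {m j i : ℕ} (hj : j ≤ m) (hi : m ≤ i) : wv m j i = if i = m + j then 1 else 0 := by
  induction m, hj using Nat.le_induction generalizing i with
  | base => rw [wv_self, om, dif_neg (by omega), two_mul]
  | succ m hj ih =>
    rw [wv_succ hj]
    obtain ⟨i, rfl⟩ : ∃ i', i = i' + 1 := ⟨i - 1, by omega⟩
    rw [sh, ih (by omega)]
    have : i + 1 = m + 1 + j ↔ i = m + j := by omega
    simp only [this, ite_pow, one_pow, ne_eq, OfNat.ofNat_ne_zero, not_false_eq_true, zero_pow]

theorem K_succ (m : ℕ) : K (m + 1) = stepK (K m) (E m) := rfl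

theorem K_eq_wv (m : ℕ) (i j : Fin m) : K m i j = wv m j i := by
  induction m with
  | zero => exact i.elim0
  | succ m ih =>
    rw [K_succ, stepK, of_apply, wv_succ (Nat.lt_succ_iff.mp j.2)]
    refine Fin.cases ?_ (fun i => ?_) i
    · rfl
    · refine Fin.lastCases ?_ (fun j => ?_) j
      · simp only [Fin.cases_succ, Fin.lastCases_last, val_succ, sh, val_last]
        rw [wv_self, om_of_lt]
      · simp only [Fin.cases_succ, Fin.lastCases_castSucc, val_succ, sh, Fin.val_castSucc]
        rw [ih]

/-- The pairing of two vectors with coefficients below `N`. -/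
def pair (N : ℕ) (x y : ℕ → XiRing) : XiRing :=
  ∑ i ∈ range N, ∑ k ∈ range N, x i * y k * symEntry i k

theorem pair_sh (N : ℕ) (x y : ℕ → XiRing) : pair (N + 1) (sh x) (sh y) = pair N x y ^ 2 := by
  rw [pair, sum_range_succ']
  simp only [sum_range_succ' _ N, sh, zero_mul, mul_zero, sum_const_zero, add_zero]
  rw [pair, sum_pow_char 2]
  refine sum_congr rfl fun i _ => ?_
  rw [sum_pow_char 2]
  refine sum_congr rfl fun k _ => ?_
  rw [symEntry_succ]; ring

theorem pair_succ {N : ℕ} {x y : ℕ → XiRing} (hx : x N = 0) (hy : y N = 0) :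
    pair (N + 1) x y = pair N x y := by
  rw [pair, sum_range_succ]
  simp only [sum_range_succ _ N, hx, hy, zero_mul, mul_zero, sum_const_zero, add_zero]
  rfl

theorem pair_comm (N : ℕ) (x y : ℕ → XiRing) : pair N x y = pair N y x := by
  rw [pair, sum_comm, pair]
  refine sum_congr rfl fun i _ => sum_congr rfl fun k _ => ?_
  rw [symEntry_comm]; ring

theorem pair_self (N : ℕ) (x : ℕ → XiRing) : pair N x x = 0 := by
  rw [pair, sum_range]
  simp only [sum_range]
  rw [sum_sum_eq_diag_add]
  simp only [symEntry_self, mul_zero, sum_const_zero, zero_add]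
  refine sum_eq_zero fun i _ => sum_eq_zero fun k _ => ?_
  rw [symEntry_comm, mul_comm (x k), add_self_eq_zero_of_algebra]

/-- The pairing of a unit vector with one of the vectors `wv`. -/
def nrow (m i k : ℕ) : XiRing := ∑ l ∈ range (2 * m + 1), symEntry i l * wv m k l

theorem nrow_succ {m k : ℕ} (i : ℕ) (hk : k ≤ m) : nrow (m + 1) (i + 1) k = nrow m i k ^ 2 := by
  rw [nrow, sum_range_succ', wv_succ hk]
  simp only [sh, mul_zero, add_zero]
  rw [show 2 * (m + 1) = 2 * m + 1 + 1 by ring, sum_range_succ, wv_of_le hk (by omega),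
    if_neg (by omega), nrow, sum_pow_char 2]
  simp only [ne_eq, OfNat.ofNat_ne_zero, not_false_eq_true, zero_pow, mul_zero, add_zero]
  refine sum_congr rfl fun l _ => ?_
  rw [symEntry_succ]; ring

theorem pair_eq_sum_nrow (m k : ℕ) (x : ℕ → XiRing) :
    pair (2 * m + 1) x (wv m k) = ∑ i ∈ range (2 * m + 1), x i * nrow m i k := by
  rw [pair]
  refine sum_congr rfl fun i _ => ?_
  rw [nrow, mul_sum]
  exact sum_congr rfl fun l _ => by ring

theorem sum_range_two_mul_succ {M : Type*} [AddCommMonoid M] (m : ℕ) (f : ℕ → M) :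
    ∑ i ∈ range (2 * m + 1), f i =
      ∑ i : Fin m, f i + ∑ i : Fin m, f (m + i) + f (2 * m) := by
  rw [sum_range_succ, two_mul, Finset.sum_range_add, sum_range, sum_range]

theorem pair_wv_eq {m j : ℕ} (k : ℕ) (hj : j < m) : pair (2 * m + 1) (wv m j) (wv m k) =
    ∑ i : Fin m, K m i ⟨j, hj⟩ * nrow m i k + nrow m (m + j) k := by
  rw [pair_eq_sum_nrow, sum_range_two_mul_succ]
  have h1 : ∀ i : Fin m, wv m j i = K m i ⟨j, hj⟩ := fun i => (K_eq_wv m i ⟨j, hj⟩).symm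
  have h2 : wv m j (2 * m) = 0 := by rw [wv_of_le hj.le (by omega), if_neg (by omega)]
  have h3 : ∀ i : Fin m, wv m j (m + i) = if i = ⟨j, hj⟩ then 1 else 0 := fun i => by
    rw [wv_of_le hj.le (by omega)]
    have : m + (i : ℕ) = m + j ↔ i = ⟨j, hj⟩ := by rw [Fin.ext_iff]; simp
    simp only [this]
  simp only [h1, h2, h3, ite_mul, one_mul, zero_mul, Finset.sum_ite_eq', mem_univ, if_true,
    add_zero]

theorem pair_om_eq (m k : ℕ) : pair (2 * m + 1) (om m) (wv m k) =
    ∑ i : Fin m, E m i * nrow m i k + nrow m (2 * m) k := by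
  rw [pair_eq_sum_nrow, sum_range_two_mul_succ]
  have h2 : om m (2 * m) = 1 ∨ m = 0 := by
    rcases Nat.eq_zero_or_pos m with h | h
    · exact Or.inr h
    · left; rw [om, dif_neg (by omega), if_pos rfl]
  have h2 : om m (2 * m) = 1 := by rw [om, dif_neg (by omega), if_pos rfl]
  have h3 : ∀ i : Fin m, om m (m + i) = 0 := fun i => by
    rw [om, dif_neg (by omega), if_neg (by omega)]
  simp only [om_of_lt, h2, h3, zero_mul, sum_const_zero, add_zero, one_mul]

/-- The orthogonality of the vectors `wv m j`, `j ≤ N`. -/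
def Orth (m N : ℕ) : Prop := ∀ j ≤ N, ∀ k ≤ N, pair (2 * m + 1) (wv m j) (wv m k) = 0

theorem Orth.succ {m : ℕ} (h : Orth m m) : Orth (m + 1) m := by
  intro j hj k hk
  rw [pair_succ, wv_succ hj, wv_succ hk]
  · rw [show 2 * (m + 1) = 2 * m + 1 + 1 by ring, pair_sh, h j hj k hk]
    simp
  · rw [wv_of_le (by omega) (by omega), if_neg (by omega)]
  · rw [wv_of_le (by omega) (by omega), if_neg (by omega)]

variable {A : Type*} [CommRing A] [Algebra F₂ A] [CharP A 2]
variable {κ : Type*} [Fintype κ] [DecidableEq κ]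

/-- The linear system satisfied by the remainders `c_i - ∑ K_{ij} c_{m+j}`. -/
theorem sum_remainder_mul_nrow (a b : κ → A) (z : A) {m : ℕ} (hm : card κ = m)
    {k : ℕ} (h : ∀ j < m, pair (2 * m + 1) (wv m j) (wv m k) = 0) :
    ∑ i : Fin m, (cf a b i + ∑ j : Fin m, evXi a b z (K m i j) * cf a b (m + j)) *
      evXi a b z (nrow m i k) = evXi a b z (nrow m (2 * m) k) := by
  have h1 : ∑ i ∈ range (2 * m + 1), cf a b i * evXi a b z (nrow m i k) = 0 := by
    simp only [nrow, map_sum, map_mul, mul_sum]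
    rw [sum_comm]
    refine sum_eq_zero fun l _ => ?_
    have := sum_cf_mul_symEntry a b z hm l
    calc _ = (∑ i ∈ range (2 * m + 1), cf a b i * evXi a b z (symEntry l i)) *
          evXi a b z (wv m k l) := by
          rw [sum_mul]
          exact sum_congr rfl fun i _ => by rw [symEntry_comm, mul_assoc]
      _ = 0 := by rw [this, zero_mul]
  rw [sum_range_two_mul_succ, cf_top _ _ hm, one_mul] at h1
  have h2 : ∀ j : Fin m, evXi a b z (nrow m (m + j) k) =
      ∑ i : Fin m, evXi a b z (K m i j) * evXi a b z (nrow m i k) := by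
    intro j
    have := congrArg (evXi a b z) (h j j.2)
    rw [pair_wv_eq k j.2, map_add, map_zero, map_sum] at this
    simp only [map_mul] at this
    exact (CharTwo.add_eq_zero.mp this).symm
  simp only [h2] at h1
  refine CharTwo.add_eq_zero.mp (Eq.trans ?_ h1)
  congr 1
  simp only [add_mul, sum_add_distrib, sum_mul, mul_sum]
  congr 1
  rw [sum_comm]
  exact sum_congr rfl fun i _ => sum_congr rfl fun j _ => by ring

theorem mul_det_eq_one {R : Type*} [CommRing R] [IsDomain R] [CharP R 2] {d : R} (h : d * d = 1) :
    d = 1 := by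
  have : (d + 1) ^ 2 = 0 := by
    rw [add_pow_char, one_pow, sq, h, CharTwo.add_self_eq_zero]
  exact CharTwo.add_eq_zero.mp (pow_eq_zero_iff (two_ne_zero)|>.mp this)

/-- The determinant of a symmetric block matrix with vanishing last block. -/
theorem det_fromBlocks_transpose_zero {R : Type*} [CommRing R] [IsDomain R] [CharP R 2]
    {m : ℕ} (P N : Matrix (Fin m) (Fin m) R) :
    (fromBlocks P N N.transpose 0).det = N.det ^ 2 := by
  set W : Matrix (Fin m ⊕ Fin m) (Fin m ⊕ Fin m) R := fromBlocks 0 1 1 0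
  have hW : W.det = 1 := by
    apply mul_det_eq_one
    rw [← det_mul, Matrix.fromBlocks_multiply]
    simp [Matrix.fromBlocks_one]
  rw [← mul_one (det _), ← hW, ← det_mul, Matrix.fromBlocks_multiply]
  simp only [Matrix.mul_zero, Matrix.mul_one, zero_add, add_zero]
  rw [Matrix.det_fromBlocks_zero₂₁, det_transpose, sq]

/-- The matrix `L_m K_m + R_m`. -/
def nmat (m : ℕ) : Matrix (Fin m) (Fin m) XiRing := Matrix.of fun i k => nrow m i k

theorem det_nmat_sq {m : ℕ} (h : ∀ j < m, ∀ k < m, pair (2 * m + 1) (wv m j) (wv m k) = 0) :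
    (nmat m).det ^ 2 = (Matrix.of fun i j : Fin (2 * m) => symEntry i j).det := by
  let e : Fin m ⊕ Fin m ≃ Fin (2 * m) := finSumFinEquiv.trans (finCongr (two_mul m).symm)
  have el : ∀ i : Fin m, ((e (inl i) : Fin (2 * m)) : ℕ) = i := fun i => rfl
  have er : ∀ i : Fin m, ((e (inr i) : Fin (2 * m)) : ℕ) = m + i := fun i => rfl
  let u : Fin m ⊕ Fin m → ℕ → XiRing :=
    Sum.elim (fun j i => if i = j then 1 else 0) (fun j => wv m j)
  let P : Matrix (Fin m ⊕ Fin m) (Fin m ⊕ Fin m) XiRing := Matrix.of fun i j => u j (e i)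
  have hP : P.det = 1 := by
    have : P = fromBlocks 1 (K m) 0 1 := by
      ext i j
      rcases i with i | i <;> rcases j with j | j
      · simp only [P, u, of_apply, elim_inl, el, Matrix.fromBlocks_apply₁₁,
          Matrix.one_apply, Fin.ext_iff]
      · simp only [P, u, of_apply, elim_inr, el, Matrix.fromBlocks_apply₁₂, K_eq_wv]
      · simp only [P, u, of_apply, elim_inl, er, Matrix.fromBlocks_apply₂₁]
        rw [if_neg (by omega)]; rfl
      · simp only [P, u, of_apply, elim_inr, er, Matrix.fromBlocks_apply₂₂,
          Matrix.one_apply, Fin.ext_iff]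
        rw [wv_of_le (by omega) (by omega)]
        simp
    rw [this, Matrix.det_fromBlocks_zero₂₁, Matrix.det_one, one_mul]
  let M : Matrix (Fin (2 * m)) (Fin (2 * m)) XiRing := Matrix.of fun i j => symEntry i j
  have hG : ∀ j k, (P.transpose * M.submatrix e e * P) j k = pair (2 * m) (u j) (u k) := by
    intro j k
    simp only [Matrix.mul_apply, Matrix.transpose_apply, sum_mul, Matrix.submatrix_apply]
    rw [sum_comm, pair, sum_range]
    rw [← Equiv.sum_comp e]
    refine sum_congr rfl fun i _ => ?_
    rw [sum_range, ← Equiv.sum_comp e]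
    refine sum_congr rfl fun l _ => ?_
    simp only [P, M, of_apply]; ring
  have htop : ∀ j k : Fin m, pair (2 * m) (u (inl j)) (u (inr k)) = nrow m j k := by
    intro j k
    simp only [u, elim_inl, elim_inr]
    rw [pair, sum_eq_single (j : ℕ)]
    · have h0 : wv m k (2 * m) = 0 := by
        rw [wv_of_le (by omega) (by omega), if_neg (by omega)]
      rw [nrow, sum_range_succ, h0, mul_zero, add_zero]
      exact sum_congr rfl fun l _ => by rw [if_pos rfl]; ring
    · intro i _ hi
      exact sum_eq_zero fun l _ => by rw [if_neg hi]; ring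
    · intro h; exact absurd (Finset.mem_range.mpr (by omega)) h
  have hblock : P.transpose * M.submatrix e e * P = fromBlocks
      (Matrix.of fun j k => pair (2 * m) (u (inl j)) (u (inl k))) (nmat m)
      (nmat m).transpose 0 := by
    refine Matrix.ext fun j k => ?_
    rw [hG]
    rcases j with j | j <;> rcases k with k | k
    · rfl
    · exact htop j k
    · rw [pair_comm]; exact htop k j
    · rw [← pair_succ]
      · exact h j j.2 k k.2
      · simp only [u, elim_inr]; rw [wv_of_le (by omega) (by omega), if_neg (by omega)]
      · simp only [u, elim_inr]; rw [wv_of_le (by omega) (by omega), if_neg (by omega)]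
  have := congrArg det hblock
  rw [det_fromBlocks_transpose_zero, det_mul, det_mul, det_transpose, hP,
    one_mul, mul_one, Matrix.det_submatrix_equiv_self] at this
  exact this.symm

theorem evXi_det_nmat_generic {m : ℕ} (hm : card κ = m)
    (h : ∀ j < m, ∀ k < m, pair (2 * m + 1) (wv m j) (wv m k) = 0) :
    spX κ (nmat m).det = C (cf gl gr 0) := by
  have h1 := congrArg (spX κ) (det_nmat_sq h)
  rw [map_det] at h1
  have h2 := det_symEntry (fun i => C (gl i) : κ → (PairRing κ)[X]) (fun i => C (gr i)) X hm
  have h3 : cf (fun i => C (gl i) : κ → (PairRing κ)[X]) (fun i => C (gr i)) 0 =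
      C (cf gl gr 0) := (map_cf (CAlgHom (R := F₂)) gl gr 0).symm
  rw [h3] at h2
  rw [map_pow] at h1
  have h4 := h1.trans h2
  have h5 : (spX κ (nmat m).det + C (cf gl gr 0)) ^ 2 = 0 := by
    rw [add_pow_char, h4, CharTwo.add_self_eq_zero]
  exact CharTwo.add_eq_zero.mp (pow_eq_zero_iff (two_ne_zero)|>.mp h5)

theorem evXi_det_nmat (a b : κ → A) (z : A) {m : ℕ} (hm : card κ = m)
    (h : ∀ j < m, ∀ k < m, pair (2 * m + 1) (wv m j) (wv m k) = 0) :
    evXi a b z (nmat m).det = cf a b 0 := by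
  let pt : (PairRing κ)[X] →ₐ[F₂] A :=
    { eval₂RingHom (specialize a b).toRingHom z with
      commutes' := fun r => (eval₂_C _ _).trans ((specialize a b).commutes r) }
  have hC : ∀ f, pt (C f) = specialize a b f := fun f => eval₂_C _ _
  have hX : pt X = z := eval₂_X _ _
  have h1 := congrArg pt (evXi_det_nmat_generic hm h)
  rw [spX, map_evXi, hX, hC, specialize_cf] at h1
  simp only [hC, specialize_gl, specialize_gr] at h1
  exact h1

end Vectors

section Existence
universe u1 u2

theorem wv_mem {m : ℕ} (hE : ∀ p < m, ∀ i, E p i ∈ supp1 (2 * p)) {j : ℕ} (hj : j < m) (i : ℕ) :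
    wv m j i ∈ supp1 (2 * m) := by
  have hsh : ∀ (k : ℕ) (x : ℕ → XiRing), (∀ i, x i ∈ supp1 (2 * m)) → ∀ i, sh^[k] x i ∈
      supp1 (2 * m) := by
    intro k
    induction k with
    | zero => exact fun x h => h
    | succ k ih =>
      intro x hx i
      rw [Function.iterate_succ_apply']
      rcases i with _ | i
      · exact zero_mem _
      · exact pow_mem (ih x hx i) 2
  refine hsh _ _ (fun i => ?_) i
  rw [om]
  split_ifs
  · exact supp1_mono (by omega) (hE j hj _)
  · exact one_mem _
  · exact zero_mem _

theorem nrow_mem {m : ℕ} (hE : ∀ p < m, ∀ i, E p i ∈ supp1 (2 * p)) {i k : ℕ} (hi : i ≤ 2 * m)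
    (hk : k < m) : nrow m i k ∈ supp1 (2 * m) :=
  sum_mem fun l hl => mul_mem (symEntry_mem_supp1 hi (by
    have := Finset.mem_range.mp hl; omega)) (wv_mem hE hk l)

theorem gv_mem_of_supp1 {κ : Type*} [Fintype κ] [DecidableEq κ] {N : ℕ} {p : XiRing}
    (hp : p ∈ supp1 N) : gv κ p ∈ grange κ N := gv_mem (supp1_le N hp)

theorem kill_gv {κ : Type*} [Fintype κ] [DecidableEq κ] (p : XiRing) :
    kill (gv (Option κ) p) = MvPolynomial.rename (Sum.map some some) (gv κ p) := by
  rw [map_evXi, map_evXi, map_zero, map_zero]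
  have h0 : kill (gl (none : Option κ)) = 0 := maeval_X _ _
  rw [evXi_option _ _ h0]
  have h1 : ∀ i : κ, kill (gl (some i)) = MvPolynomial.rename (Sum.map some some) (gl i) :=
    fun i => by rw [kill, gl, gl, maeval_X, rename_X]; rfl
  have h2 : ∀ i : κ, kill (gr (some i)) = MvPolynomial.rename (Sum.map some some) (gr i) :=
    fun i => by rw [kill, gr, gr, maeval_X, rename_X]; rfl
  simp only [h1, h2]

/-- The remainder `c_i - ∑ K_{ij} c_{m+j}` at the generic vector. -/
def remainder (κ : Type*) [Fintype κ] [DecidableEq κ] (m : ℕ) (i : Fin m) : PairRing κ :=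
  cf gl gr i + ∑ j : Fin m, gv κ (K m i j) * cf gl gr (m + j)

theorem of_mulVec_apply {R ι ι' : Type*} [CommRing R] [Fintype ι'] (f : ι → ι' → R) (x : ι' → R)
    (i : ι) : ((Matrix.of f).mulVec x) i = ∑ j, x j * f i j := by
  simp only [mulVec, dotProduct, of_apply, mul_comm]

theorem remainder_mem {p : ℕ} (hE : ∀ q < p + 1, ∀ i, E q i ∈ supp1 (2 * q))
    (h : Orth (p + 1) p) (hp : Orth p p) (i : Fin (p + 1)) :
    remainder (Option (Fin p)) (p + 1) i ∈ grange (Option (Fin p)) (2 * (p + 1)) := by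
  set κ := Option (Fin p)
  have hm : card κ = p + 1 := by rw [card_option, card_fin]
  have hsys : ∀ k : Fin (p + 1), ∑ i : Fin (p + 1), remainder κ (p + 1) i *
      gv κ (nrow (p + 1) i k) = gv κ (nrow (p + 1) (2 * (p + 1)) k) := fun k =>
    sum_remainder_mul_nrow gl gr 0 hm fun j hj => h j (by omega) k (by omega)
  have hdet : gv κ (nmat (p + 1)).det = cf gl gr 0 :=
    evXi_det_nmat gl gr 0 hm fun j hj k hk => h j (by omega) k (by omega)
  have hnmem : ∀ i k, i ≤ 2 * (p + 1) → k < p + 1 →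
      gv κ (nrow (p + 1) i k) ∈ grange κ (2 * (p + 1)) := fun i k hi hk =>
    gv_mem_of_supp1 (nrow_mem hE hi hk)
  have h1 : ∀ i, cf gl gr 0 * remainder κ (p + 1) i ∈ grange κ (2 * (p + 1)) := by
    intro i
    have := det_mul_mem_of_mulVec (grange κ (2 * (p + 1)))
      (M := (Matrix.of fun i k : Fin (p + 1) => gv κ (nrow (p + 1) i k)).transpose)
      (fun k i => hnmem i k (by omega) (by omega)) (x := remainder κ (p + 1)) (fun k => by
        have e : ((Matrix.of fun i k : Fin (p + 1) => gv κ (nrow (p + 1) i k)).transpose.mulVec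
            (remainder κ (p + 1))) k = gv κ (nrow (p + 1) (2 * (p + 1)) k) := by
          rw [← hsys k]
          exact of_mulVec_apply (fun k i : Fin (p + 1) => gv κ (nrow (p + 1) i k)) _ k
        rw [e]
        exact hnmem _ _ le_rfl k.2) i
    rw [det_transpose] at this
    rw [← hdet, map_det]
    exact this
  have hK0 : ∀ j, K (p + 1) 0 j = 0 := fun j => rfl
  have hrem0 : remainder κ (p + 1) 0 = cf gl gr 0 := by
    simp only [remainder, hK0, map_zero, zero_mul, sum_const_zero, add_zero]; rfl
  have hcmem : cf gl gr 0 ∈ grange κ (2 * (p + 1)) := by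
    rw [← hdet, map_det]
    exact det_mem_of_forall _ fun i k => hnmem i k (by omega) (by omega)
  refine Fin.cases (by rw [hrem0]; exact hcmem) (fun i => ?_) i
  set w := gv κ (nmat p).det with hw
  have hwmem : w ∈ grange κ (2 * (p + 1)) := by
    rw [hw, map_det]
    exact det_mem_of_forall _ fun i k => gv_mem_of_supp1 (supp1_mono (by omega)
      (nrow_mem (fun q hq => hE q (by omega)) (by omega : (i : ℕ) ≤ 2 * p) k.2))
  have hrel : IsRelPrime (cf gl gr 0) w := by
    refine isRelPrime_cf_zero (isSpInvariant_gv _) ?_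
    rw [kill_gv, gv, evXi_det_nmat gl gr 0 (card_fin p)
      (fun j hj k hk => hp j (by omega) k (by omega))]
    exact (map_ne_zero_iff _ (rename_injective _
      (Sum.map_injective.mpr ⟨some_injective _, some_injective _⟩))).mpr
      cf_zero_ne_zero
  have h2 : w ^ 2 * remainder κ (p + 1) i.succ ∈ grange κ (2 * (p + 1)) := by
    have hM : (Matrix.of fun k i : Fin p => gv κ (nrow (p + 1) (i + 1) k)).det = w ^ 2 := by
      have e : (Matrix.of fun k i : Fin p => gv κ (nrow (p + 1) (i + 1) k)) =
          (frobenius (PairRing κ) 2).mapMatrix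
            ((gv κ : XiRing →+* PairRing κ).mapMatrix (nmat p)).transpose := by
        refine Matrix.ext fun k i => ?_
        change gv κ (nrow (p + 1) (i + 1) k) = gv κ (nrow p i k) ^ 2
        rw [nrow_succ _ (by omega), map_pow]
      rw [e, ← RingHom.map_det, det_transpose, ← RingHom.map_det, frobenius_def]
      rfl
    rw [← hM]
    refine det_mul_mem_of_mulVec (grange κ (2 * (p + 1)))
      (M := Matrix.of fun k i : Fin p => gv κ (nrow (p + 1) (i + 1) k))
      (fun k i => hnmem _ _ (by omega) (by omega))
      (x := fun i => remainder κ (p + 1) i.succ) (fun k => ?_) i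
    have := hsys k.castSucc
    rw [Fin.sum_univ_succ, hrem0] at this
    have e : ((Matrix.of fun k i : Fin p => gv κ (nrow (p + 1) (i + 1) k)).mulVec
        fun i => remainder κ (p + 1) i.succ) k = cf gl gr 0 * gv κ (nrow (p + 1) 0 k) +
          gv κ (nrow (p + 1) (2 * (p + 1)) k) := by
      have h3 : ∀ x y z : PairRing κ, x + y = z → y = x + z := by
        intro x y z h
        rw [← h, ← add_assoc, CharTwo.add_self_eq_zero, zero_add]
      refine Eq.trans ?_ (h3 _ _ _ this)
      exact of_mulVec_apply (fun k i : Fin p => gv κ (nrow (p + 1) (i + 1) k)) _ k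
    rw [e]
    exact add_mem (mul_mem hcmem (hnmem _ _ (by omega) (by omega))) (hnmem _ _ le_rfl (by omega))
  refine mem_range_of_isRelPrime (algebraicIndependent_gram hm) hrel hcmem hwmem cf_zero_ne_zero
    (k := 1) (l := 2) ?_ h2
  rw [pow_one]; exact h1 _


theorem spec_eq_map (m : ℕ) (p : XiRing) : spec m p = (spX (Fin m) p).map
    ((stdCoords m).equiv : CoordRing (Fin m ⊕ Fin m) →+* Sym (Std m)) := by
  set c := stdCoords m
  let F : (CoordRing (Fin m ⊕ Fin m))[X] →ₐ[F₂] (Sym (Std m))[X] :=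
    mapAlgHom (c.equiv : CoordRing (Fin m ⊕ Fin m) →ₐ[F₂] Sym (Std m))
  change _ = F (spX (Fin m) p)
  rw [spX, map_evXi]
  have hC : ∀ f, F (C f) = C (c.equiv f) := fun f => map_C _
  have hX : F X = X := map_X _
  simp only [hC, hX]
  rw [spec, evXi]
  congr 2
  ext1 i
  rcases i with _ | i
  · rfl
  · rw [if_neg (Nat.succ_ne_zero i), if_neg (Nat.succ_ne_zero i), c.xi_succ, ← c.equiv_gram]
    have h1 := map_gram (A := Sym (Std m)) (CAlgHom (R := F₂) (A := Sym (Std m)))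
      (fun j : Fin m => c.equiv (gl j)) (fun j : Fin m => c.equiv (gr j)) (i + 1)
    have h2 := map_gram (c.equiv : CoordRing (Fin m ⊕ Fin m) →ₐ[F₂] Sym (Std m)) gl gr (i + 1)
    exact (congrArg C h2).trans h1

theorem isXiExpression_map_iff (m : ℕ) (f : (CoordRing (Fin m ⊕ Fin m))[X]) (p : XiRing) :
    IsXiExpression m (f.map ((stdCoords m).equiv : CoordRing (Fin m ⊕ Fin m) →+* Sym (Std m))) p ↔
      p ∈ supported F₂ (Iic (2 * m)) ∧ spX (Fin m) p = f := by
  rw [IsXiExpression, spec_eq_map]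
  refine and_congr_right fun _ => (map_injective _ ?_).eq_iff
  exact (stdCoords m).equiv.injective

theorem dicksonRemainder_eq {m : ℕ} (hK : ∀ i j, K m i j ∈ supp1 (2 * m)) (i : Fin m) :
    dicksonRemainder m (K m) i = (C (remainder (Fin m) m i)).map
      ((stdCoords m).equiv : CoordRing (Fin m ⊕ Fin m) →+* Sym (Std m)) := by
  have hd : ∀ j, dickson (Std m) j =
      ((stdCoords m).equiv : CoordRing (Fin m ⊕ Fin m) →+* Sym (Std m)) (cf gl gr j) := fun j =>
    ((stdCoords m).dickson_eq j).trans ((stdCoords m).equiv_cf j).symm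
  rw [dicksonRemainder, remainder, CharTwo.sub_eq_add, map_add, map_sum, pmap_add,
    pmap_sum, map_C, hd]
  congr 1
  refine sum_congr rfl fun j _ => ?_
  rw [spec_eq_map, spX_of_mem (hK i j), map_mul, pmap_mul, map_C,
    map_C, hd]

theorem gv_specialize {κ κ' : Type*} [Fintype κ] [DecidableEq κ] [Fintype κ'] [DecidableEq κ']
    (e : κ ≃ κ') (p : XiRing) : specialize (gl ∘ e) (gr ∘ e) (gv κ p) = gv κ' p := by
  rw [specialize_gv, evXi_reindex]

theorem remainder_specialize {κ κ' : Type*} [Fintype κ] [DecidableEq κ] [Fintype κ']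
    [DecidableEq κ'] (e : κ ≃ κ') (m : ℕ) (i : Fin m) :
    specialize (gl ∘ e) (gr ∘ e) (remainder κ m i) = remainder κ' m i := by
  rw [remainder, map_add, map_sum, specialize_cf, cf_reindex, remainder]
  congr 1
  refine sum_congr rfl fun j _ => ?_
  rw [map_mul, gv_specialize, specialize_cf, cf_reindex]

theorem K_mem {m : ℕ} (hE : ∀ p < m, ∀ i, E p i ∈ supp1 (2 * p)) (i j : Fin m) :
    K m i j ∈ supp1 (2 * m) := by
  rw [K_eq_wv]; exact wv_mem hE j.2 i

theorem orth_self {m : ℕ} (hE : ∀ p ≤ m, ∀ i, E p i ∈ supp1 (2 * p))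
    (h : ∀ j < m, ∀ k < m, pair (2 * m + 1) (wv m j) (wv m k) = 0)
    (hm : ∀ i, gv (Fin m) (E m i) = remainder (Fin m) m i) : Orth m m := by
  have key : ∀ k < m, pair (2 * m + 1) (om m) (wv m k) = 0 := by
    intro k hk
    have hE' : ∀ p < m, ∀ i, E p i ∈ supp1 (2 * p) := fun p hp => hE p hp.le
    refine gv_injective (card_fin m) ?_ (zero_mem (supp1 (2 * m))) ?_
    · rw [pair_om_eq]
      exact add_mem (sum_mem fun i _ => mul_mem (hE m le_rfl i) (nrow_mem hE' (by omega) hk))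
        (nrow_mem hE' le_rfl hk)
    · rw [pair_om_eq, map_zero, map_add, map_sum,
        ← sum_remainder_mul_nrow gl gr 0 (card_fin m) fun j hj => h j hj k hk]
      simp only [map_mul, hm]
      exact CharTwo.add_self_eq_zero _
  intro j hj k hk
  rcases hj.lt_or_eq with hj | rfl <;> rcases hk.lt_or_eq with hk | rfl
  · exact h j hj k hk
  · rw [pair_comm, wv_self]; exact key j hj
  · rw [wv_self]; exact key k hk
  · exact pair_self _ _

/-- The polynomials `E_m` have their defining property, and the vectors `wv` are orthogonal. -/
theorem E_spec (m : ℕ) : (∀ i, E m i ∈ supp1 (2 * m)) ∧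
    (∀ i, gv (Fin m) (E m i) = remainder (Fin m) m i) ∧ Orth m m := by
  induction m using Nat.strong_induction_on with
  | _ m ih =>
    have hE : ∀ p < m, ∀ i, E p i ∈ supp1 (2 * p) := fun p hp => (ih p hp).1
    have horth : ∀ j < m, ∀ k < m, pair (2 * m + 1) (wv m j) (wv m k) = 0 := by
      rcases m with _ | p
      · intro j hj; omega
      · intro j hj k hk
        exact (ih p (by omega)).2.2.succ j (by omega) k (by omega)
    suffices h : ∀ i, E m i ∈ supp1 (2 * m) ∧ gv (Fin m) (E m i) = remainder (Fin m) m i by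
      refine ⟨fun i => (h i).1, fun i => (h i).2, orth_self (fun p hp => ?_) horth fun i => (h i).2⟩
      rcases hp.lt_or_eq with hp | rfl
      · exact hE p hp
      · exact fun i => (h i).1
    rcases m with _ | p
    · exact fun i => i.elim0
    · intro i
      have hex : ∃ e ∈ supp1 (2 * (p + 1)), gv (Fin (p + 1)) e = remainder (Fin (p + 1)) (p + 1) i := by
        obtain ⟨e, he, h1⟩ := exists_gv_eq (remainder_mem hE (ih p (by omega)).2.2.succ
          (ih p (by omega)).2.2 i)
        refine ⟨e, he, ?_⟩
        let eqv : Option (Fin p) ≃ Fin (p + 1) := (finSuccEquiv p).symm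
        rw [← gv_specialize eqv, h1, remainder_specialize]
      obtain ⟨e, he, h1⟩ := hex
      have hexp : IsXiExpression (p + 1) (dicksonRemainder (p + 1) (K (p + 1)) i) e := by
        rw [dicksonRemainder_eq (K_mem hE), isXiExpression_map_iff]
        exact ⟨supp1_le _ he, by rw [spX_of_mem he, h1]⟩
      have hchoice : IsXiExpression (p + 1) (dicksonRemainder (p + 1) (K (p + 1)) i)
          (E (p + 1) i) := by
        have e0 : E (p + 1) i = xiExpression (p + 1) (dicksonRemainder (p + 1) (K (p + 1)) i) := rfl
        rw [e0, xiExpression, dif_pos ⟨e, hexp⟩]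
        exact Exists.choose_spec (⟨e, hexp⟩ : ∃ e, IsXiExpression _ _ e)
      have heq : E (p + 1) i = e := by
        rw [dicksonRemainder_eq (K_mem hE), isXiExpression_map_iff] at hexp hchoice
        exact spX_injective (card_fin _) hchoice.1 hexp.1 (hchoice.2.trans hexp.2.symm)
      rw [heq]
      exact ⟨he, h1⟩

theorem isXiExpression_E (m : ℕ) (i : Fin m) :
    IsXiExpression m (dicksonRemainder m (K m) i) (E m i) := by
  rw [dicksonRemainder_eq (K_mem fun p _ => (E_spec p).1), isXiExpression_map_iff]
  exact ⟨supp1_le _ ((E_spec m).1 i), by rw [spX_of_mem ((E_spec m).1 i), (E_spec m).2.1]⟩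

theorem K_mem_supp1 (m : ℕ) (i j : Fin m) : K m i j ∈ supp1 (2 * m) :=
  K_mem (fun p _ => (E_spec p).1) i j

theorem nrow_mem_supp1 {m i k : ℕ} (hi : i ≤ 2 * m) (hk : k < m) : nrow m i k ∈ supp1 (2 * m) :=
  nrow_mem (fun p _ => (E_spec p).1) hi hk

theorem pair_wv (m : ℕ) {j k : ℕ} (hj : j ≤ m) (hk : k ≤ m) :
    pair (2 * m + 1) (wv m j) (wv m k) = 0 := (E_spec m).2.2 j hj k hk

end Existence

section Families
variable {A : Type*} [CommRing A] [Algebra F₂ A] [CharP A 2]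
variable {κ : Type*} [Fintype κ] [DecidableEq κ] (a b : κ → A) (z : A) {m : ℕ}

theorem evXi_E (hm : card κ = m) (i : Fin m) : evXi a b z (E m i) =
    cf a b i + ∑ j : Fin m, evXi a b z (K m i j) * cf a b (m + j) := by
  have e : Fin m ≃ κ := Fintype.equivOfCardEq (by rw [card_fin, hm])
  have h := congrArg (specialize (a ∘ e) (b ∘ e)) ((E_spec m).2.1 i)
  rw [specialize_gv, evXi_reindex, remainder, map_add, map_sum, specialize_cf, cf_reindex] at h
  simp only [map_mul, specialize_gv, specialize_cf, cf_reindex, evXi_reindex] at h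
  rw [evXi_eq_zero_right a b z ((E_spec m).1 i), h]
  simp only [evXi_eq_zero_right a b z (K_mem_supp1 m i _)]

theorem evXi_det_nmat_eq (hm : card κ = m) : evXi a b z (nmat m).det = cf a b 0 :=
  evXi_det_nmat a b z hm fun _ hj _ hk => pair_wv m hj.le hk.le

end Families

section Bidegree
variable {R : Type*} [CommRing R]

theorem coeff_coeff_swap (f : R[X][X]) (i j : ℕ) :
    ((Bivariate.swap f).coeff i).coeff j = (f.coeff j).coeff i := by
  induction f using Polynomial.induction_on' with
  | add f g hf hg => simp only [map_add, coeff_add, hf, hg]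
  | monomial n g =>
    induction g using Polynomial.induction_on' with
    | add f g hf hg => simp only [map_add, coeff_add, hf, hg]
    | monomial k r =>
      rw [Bivariate.swap_monomial_monomial, coeff_monomial, coeff_monomial]
      split_ifs with h1 h2 h2 <;> simp [coeff_monomial, h1, h2]

theorem natDegree_swap_le_iff (f : R[X][X]) (d : ℕ) :
    (Bivariate.swap f).natDegree ≤ d ↔ ∀ i, (f.coeff i).natDegree ≤ d := by
  simp only [natDegree_le_iff_coeff_eq_zero]
  constructor
  · intro h i j hj
    rw [← coeff_coeff_swap, h j hj, coeff_zero]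
  · intro h j hj
    ext i
    rw [coeff_coeff_swap, h i j hj, coeff_zero]

theorem natDegree_coeff_le_of_mul [IsDomain R] {f g : R[X][X]} {d e : ℕ} (hg : g ≠ 0)
    (h : ∀ i, ((f * g).coeff i).natDegree ≤ d + e) (he : ¬ ∀ i, (g.coeff i).natDegree < e)
    (i : ℕ) : (f.coeff i).natDegree ≤ d := by
  rcases eq_or_ne f 0 with rfl | hf
  · simp
  revert i
  rw [← natDegree_swap_le_iff] at h ⊢
  rw [map_mul, natDegree_mul (by simpa using hf) (by simpa using hg)] at h
  have h2 : e ≤ (Bivariate.swap g).natDegree := by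
    by_contra hlt
    refine he fun i => ?_
    have := (natDegree_swap_le_iff g (e - 1)).mp (by omega) i
    omega
  omega

end Bidegree

section TopDickson
variable {κ : Type*} [Fintype κ] [DecidableEq κ]

theorem coeff_spX_mem {N : ℕ} {p : XiRing}
    (hp : p ∈ supported F₂ (Iic N)) (i : ℕ) :
    (spX κ p).coeff i ∈ grange κ N := by
  obtain ⟨P, rfl⟩ := exists_shiftPoly hp
  rw [spX_shiftPoly, coeff_map]
  exact ⟨_, rfl⟩

theorem grange_mono {N N' : ℕ} (h : N ≤ N') : grange κ N ≤ grange κ N' := by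
  rintro _ ⟨p, rfl⟩
  have : (maeval fun i : Fin N => (gram gl gr ((i : ℕ) + 1) : PairRing κ)) p =
      maeval (fun i : Fin N' => (gram gl gr ((i : ℕ) + 1) : PairRing κ))
        (MvPolynomial.rename (castLE h) p) := by
    rw [aeval_rename]; rfl
  exact ⟨_, this.symm⟩

/-- The elements `ξ_1, …, ξ_{2p+1}` and the Dickson invariant `c_{2p+1}`, of a space of dimension
`2p + 2`. -/
def topSys (κ : Type*) [Fintype κ] [DecidableEq κ] (p : ℕ) :
    Option (Fin (2 * p + 1)) → PairRing (Option κ) :=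
  fun o => o.elim (cf gl gr (2 * p + 1)) fun i => gram gl gr ((i : ℕ) + 1)

/-- Evaluation of polynomials in the top Dickson invariant, with coefficients in `𝔽₂[ξ]`. -/
def topEval (κ : Type*) [Fintype κ] [DecidableEq κ] (p : ℕ) :
    (Poly (Fin (2 * p + 1)))[X] →ₐ[F₂] PairRing (Option κ) :=
  (maeval (topSys κ p)).comp
    (optionEquivLeft F₂ (Fin (2 * p + 1))).symm.toAlgHom

variable (p : ℕ)

theorem topEval_C (r : Poly (Fin (2 * p + 1))) : topEval κ p (C r) =
    maeval (fun i : Fin (2 * p + 1) =>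
      (gram gl gr ((i : ℕ) + 1) : PairRing (Option κ))) r := by
  have : (topEval κ p).comp (CAlgHom (R := F₂)) =
      maeval (fun i : Fin (2 * p + 1) =>
      (gram gl gr ((i : ℕ) + 1) : PairRing (Option κ))) := by
    ext i
    simp [topEval, topSys]
  exact dcongr_fun this r

theorem topEval_X : topEval κ p X = cf gl gr (2 * p + 1) := by
  simp [topEval, topSys]

theorem mem_range_topSys_iff (f : PairRing (Option κ)) :
    f ∈ (maeval (R := F₂) (topSys κ p)).range ↔ ∃ g, topEval κ p g = f := by
  constructor
  · rintro ⟨g, rfl⟩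
    refine ⟨optionEquivLeft _ _ g, ?_⟩
    change maeval _ ((optionEquivLeft _ _).symm _) = _
    rw [AlgEquiv.symm_apply_apply]
    rfl
  · rintro ⟨g, rfl⟩
    exact ⟨_, rfl⟩

/-- The element `f` is a polynomial of degree at most `d` in the top Dickson invariant, with
coefficients in `𝔽₂[ξ_1, …, ξ_{2p+1}]`. -/
def TopLe (κ : Type*) [Fintype κ] [DecidableEq κ] (p d : ℕ)
    (f : PairRing (Option κ)) : Prop :=
  ∃ g, g.natDegree ≤ d ∧ topEval κ p g = f

variable {p} {d e : ℕ} {f g : PairRing (Option κ)}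

theorem TopLe.mono (hf : TopLe κ p d f) (h : d ≤ e) : TopLe κ p e f := by
  obtain ⟨u, h1, h2⟩ := hf
  exact ⟨u, h1.trans h, h2⟩

theorem TopLe.add (hf : TopLe κ p d f) (hg : TopLe κ p d g) : TopLe κ p d (f + g) := by
  obtain ⟨u, h1, h2⟩ := hf
  obtain ⟨v, h3, h4⟩ := hg
  exact ⟨u + v, natDegree_add_le_of_degree_le h1 h3, by rw [map_add, h2, h4]⟩

theorem TopLe.mul (hf : TopLe κ p d f) (hg : TopLe κ p e g) : TopLe κ p (d + e) (f * g) := by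
  obtain ⟨u, h1, h2⟩ := hf
  obtain ⟨v, h3, h4⟩ := hg
  exact ⟨u * v, natDegree_mul_le_of_le h1 h3, by rw [map_mul, h2, h4]⟩

theorem topLe_zero_iff : TopLe κ p 0 f ↔ f ∈ grange (Option κ) (2 * p + 1) := by
  constructor
  · rintro ⟨u, h1, rfl⟩
    rw [eq_C_of_natDegree_le_zero h1, topEval_C]
    exact ⟨_, rfl⟩
  · rintro ⟨r, rfl⟩
    exact ⟨C r, by simp, topEval_C p r⟩

theorem TopLe.sum {ι : Type*} {s : Finset ι} {F : ι → PairRing (Option κ)}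
    (h : ∀ i ∈ s, TopLe κ p d (F i)) : TopLe κ p d (∑ i ∈ s, F i) := by
  classical
  induction s using Finset.induction_on with
  | empty => exact ⟨0, by simp, by simp⟩
  | insert i s hi ih =>
    rw [sum_insert hi]
    exact (h i (Finset.mem_insert_self _ _)).add
      (ih fun j hj => h j (Finset.mem_insert_of_mem hj))

theorem TopLe.mul_left (hf : TopLe κ p d f) (hg : g ∈ grange (Option κ) (2 * p + 1)) :
    TopLe κ p d (g * f) := by
  have := (topLe_zero_iff.mpr hg).mul hf
  rwa [zero_add] at this

theorem wv_mem_supp1_pred {k : ℕ} (hk : k < p + 1) (l : ℕ) : wv (p + 1) k l ∈ supp1 (2 * p + 1) := by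
  rw [wv_succ (by omega : k ≤ p)]
  rcases l with _ | l
  · exact zero_mem _
  · refine pow_mem (supp1_mono (by omega : 2 * p ≤ 2 * p + 1) ?_) 2
    rcases (Nat.lt_succ_iff.mp hk).lt_or_eq with hk | rfl
    · exact wv_mem (fun q _ => (E_spec q).1) hk l
    · rw [wv_self, om]
      split_ifs with h1 h2
      · exact (E_spec k).1 _
      · exact one_mem _
      · exact zero_mem _

theorem symEntry_mem_supp1_sub {N i j : ℕ} (h1 : i ≤ j + N) (h2 : j ≤ i + N) :
    symEntry i j ∈ supp1 N := by
  rw [symEntry]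
  split_ifs with h
  · exact zero_mem _
  · refine pow_mem (X_mem_supp1 ?_ ?_) _ <;> omega

theorem det_nmat_mem_supp1_pred : (nmat (p + 1)).det ∈ supp1 (2 * p + 1) := by
  refine det_mem_of_forall (supp1 (2 * p + 1)) fun i k => ?_
  change ∑ l ∈ range (2 * (p + 1) + 1), _ ∈ _
  refine Subalgebra.sum_mem _ fun l hl => ?_
  rcases Nat.lt_or_ge (l : ℕ) (2 * (p + 1)) with h | h
  · exact mul_mem (symEntry_mem_supp1_sub (by omega) (by omega)) (wv_mem_supp1_pred k.2 l)
  · rw [wv_of_le (by omega) (by omega), if_neg (by have := k.2; omega), mul_zero]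
    exact zero_mem _

variable (hp : card κ = p)

theorem card_option_eq (hp : card κ = p) : card (Option κ) = p + 1 := by
  rw [card_option, hp]

theorem cf_zero_mem (hp : card κ = p) :
    cf gl gr 0 ∈ grange (Option κ) (2 * p + 1) := by
  rw [← evXi_det_nmat_eq gl gr 0 (card_option_eq hp)]
  exact gv_mem_of_supp1 det_nmat_mem_supp1_pred

/-- The element `Ω_{p}(ξ)` of a space of dimension `2p + 2`. -/
def lowOmega (κ : Type*) [Fintype κ] [DecidableEq κ] (p : ℕ) :
    PairRing (Option κ) := gv (Option κ) (nmat p).det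

theorem lowOmega_mem : lowOmega κ p ∈ grange (Option κ) (2 * p) :=
  gv_mem_of_supp1 (det_mem_of_forall _ fun i k => nrow_mem_supp1 (by omega) k.2)

theorem kill_lowOmega_ne_zero (hp : card κ = p) : kill (lowOmega κ p) ≠ 0 := by
  rw [lowOmega, kill_gv, evXi_det_nmat_eq gl gr 0 hp]
  intro h
  refine cf_zero_ne_zero (κ := κ) (rename_injective _ ?_ (h.trans (map_zero _).symm))
  exact Sum.map_injective.mpr ⟨some_injective _, some_injective _⟩

theorem lowOmega_ne_zero (hp : card κ = p) : lowOmega κ p ≠ 0 := fun h =>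
  kill_lowOmega_ne_zero hp (by rw [h, map_zero])

theorem topLe_cf (hp : card κ = p) (j : ℕ) : TopLe κ p 1 (lowOmega κ p ^ 4 * cf gl gr j) := by
  have hs : lowOmega κ p ^ 4 ∈ grange (Option κ) (2 * p + 1) :=
    pow_mem (grange_mono (by omega) lowOmega_mem) 4
  have hm := card_option_eq hp
  have hy : TopLe κ p 1 (cf gl gr (2 * p + 1)) := ⟨X, by simp, topEval_X p⟩
  have hsym : ∀ i j : ℕ, i ≤ j + (2 * p + 1) → j ≤ i + (2 * p + 1) →
      gv (Option κ) (symEntry i j) ∈ grange (Option κ) (2 * p + 1) := fun i j h1 h2 =>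
    gv_mem_of_supp1 (symEntry_mem_supp1_sub h1 h2)
  rcases Nat.eq_zero_or_pos j with rfl | h0
  · exact (topLe_zero_iff.mpr (mul_mem hs (cf_zero_mem hp))).mono (by omega)
  rcases Nat.lt_or_ge j (2 * p + 1) with h1 | h1
  swap
  · refine TopLe.mul_left ?_ hs
    rcases h1.eq_or_lt with rfl | h1
    · exact hy
    rcases (show 2 * (p + 1) ≤ j by omega).eq_or_lt with rfl | h1
    · rw [cf_top _ _ hm]
      exact (topLe_zero_iff.mpr (one_mem _)).mono (by omega)
    · rw [cf_of_lt _ _ hm h1]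
      exact (topLe_zero_iff.mpr (zero_mem _)).mono (by omega)
  let M0 : Matrix (Fin (2 * p)) (Fin (2 * p)) XiRing := Matrix.of fun i j => symEntry i j
  let M : Matrix (Fin (2 * p)) (Fin (2 * p)) (PairRing (Option κ)) :=
    Matrix.of fun i j => gv (Option κ) (symEntry ((i : ℕ) + 1) ((j : ℕ) + 1))
  let x : Fin (2 * p) → PairRing (Option κ) := fun j => cf gl gr ((j : ℕ) + 1)
  have hdet : M.det = lowOmega κ p ^ 4 := by
    have e1 : M = M0.map ((gv (Option κ) : XiRing →+* _).comp (frobenius XiRing 2)) := by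
      ext i j
      simp only [M, M0, of_apply, map_apply, RingHom.comp_apply, symEntry_succ,
        frobenius_def]
      rfl
    rw [e1, ← RingHom.mapMatrix_apply, ← RingHom.map_det, RingHom.comp_apply, frobenius_def,
      ← det_nmat_sq (fun j hj k hk => pair_wv p hj.le hk.le), lowOmega, ← pow_mul, map_pow]
    rfl
  have hrow : ∀ i, TopLe κ p 1 (M.mulVec x i) := by
    intro i
    have h2 := sum_cf_mul_symEntry (gl : Option κ → _) gr 0 hm ((i : ℕ) + 1)
    rw [show 2 * (p + 1) + 1 = 2 * p + 1 + 1 + 1 by ring, sum_range_succ,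
      sum_range_succ, sum_range_succ', show 2 * p + 1 + 1 = 2 * (p + 1) by ring,
      cf_top _ _ hm, one_mul, ← Fin.sum_univ_eq_sum_range (fun j => cf gl gr (j + 1) *
        gv (Option κ) (symEntry ((i : ℕ) + 1) (j + 1)))] at h2
    have h3 : M.mulVec x i = cf gl gr 0 * gv (Option κ) (symEntry ((i : ℕ) + 1) 0) +
        gv (Option κ) (symEntry ((i : ℕ) + 1) (2 * p + 1)) * cf gl gr (2 * p + 1) +
        gv (Option κ) (symEntry ((i : ℕ) + 1) (2 * (p + 1))) := by
      have h4 : M.mulVec x i = ∑ j : Fin (2 * p), cf gl gr ((j : ℕ) + 1) *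
          gv (Option κ) (symEntry ((i : ℕ) + 1) ((j : ℕ) + 1)) := by
        rw [mulVec, dotProduct]
        exact sum_congr rfl fun j _ => mul_comm _ _
      rw [h4]
      refine CharTwo.add_eq_zero.mp ?_
      rw [← h2]
      ring
    have hi := i.2
    rw [h3]
    refine (TopLe.add ((topLe_zero_iff.mpr ?_).mono (by omega)) (hy.mul_left ?_)).add
      ((topLe_zero_iff.mpr ?_).mono (by omega))
    · exact mul_mem (cf_zero_mem hp) (hsym _ _ (by omega) (by omega))
    · exact hsym _ _ (by omega) (by omega)
    · exact hsym _ _ (by omega) (by omega)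
  have hadj : M.det * cf gl gr j = ∑ i, M.adjugate ⟨j - 1, by omega⟩ i * M.mulVec x i := by
    have h5 : M.adjugate.mulVec (M.mulVec x) = M.det • x := by
      rw [Matrix.mulVec_mulVec, Matrix.adjugate_mul, Matrix.smul_mulVec, Matrix.one_mulVec]
    have h6 := congrFun h5 ⟨j - 1, by omega⟩
    rw [Pi.smul_apply, smul_eq_mul] at h6
    simp only [x] at h6
    rw [show j - 1 + 1 = j by omega] at h6
    rw [← h6]
    rfl
  rw [← hdet, hadj]
  refine TopLe.sum fun i _ => (hrow i).mul_left ?_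
  rw [Matrix.adjugate_apply]
  refine det_mem_of_forall _ fun a b => ?_
  rw [Matrix.updateRow_apply]
  split_ifs
  · rw [Pi.single_apply]
    split_ifs
    · exact one_mem _
    · exact zero_mem _
  · have ha := a.2
    have hb := b.2
    exact hsym _ _ (by omega) (by omega)

theorem lowOmega_mem_range : lowOmega κ p ∈
    (maeval (R := F₂) (topSys κ p)).range := by
  rw [mem_range_topSys_iff]
  obtain ⟨g, _, hg⟩ := topLe_zero_iff.mpr (grange_mono (by omega : 2 * p ≤ 2 * p + 1) (lowOmega_mem (κ := κ) (p := p)))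
  exact ⟨g, hg⟩

theorem pow_mul_dk_mem_range (hp : card κ = p) (j : ℕ) :
    lowOmega κ p ^ 4 * dk mX j ∈
      (maeval (R := F₂) (topSys κ p)).range := by
  rw [mem_range_topSys_iff, ← sumElim_gl_gr]
  obtain ⟨g, _, hg⟩ := topLe_cf hp j
  exact ⟨g, hg⟩

theorem card_topSys (hp : card κ = p) :
    card (Option (Fin (2 * p + 1))) = card (Option κ ⊕ Option κ) := by
  rw [card_option, card_fin, card_sum, card_option_eq hp]
  ring

theorem topEval_injective (hp : card κ = p) : Injective (topEval κ p) := by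
  have h := algebraicIndependent_of_dk (topSys κ p) (lowOmega κ p) (card_topSys hp)
    (lowOmega_ne_zero hp) lowOmega_mem_range fun j => ⟨4, pow_mul_dk_mem_range hp j⟩
  have h' : Injective (maeval (R := F₂) (topSys κ p)) := h
  exact h'.comp (optionEquivLeft F₂ (Fin (2 * p + 1))).symm.injective

theorem exists_topEval_eq (hp : card κ = p) (hf : IsSpInvariant f) :
    ∃ k g, topEval κ p g = lowOmega κ p ^ k * f := by
  obtain ⟨k, hk⟩ := exists_pow_mul_mem_range (topSys κ p) (lowOmega κ p) (card_topSys hp)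
    (lowOmega_ne_zero hp) lowOmega_mem_range (fun j => ⟨4, pow_mul_dk_mem_range hp j⟩) f
    fun φ h1 h2 h3 => hf φ h1 h2 (h3 (some ⟨0, by omega⟩))
  exact ⟨k, (mem_range_topSys_iff p _).mp hk⟩

theorem exists_map_topEval_eq (hp : card κ = p) {P : (PairRing (Option κ))[X]}
    (hP : ∀ i, IsSpInvariant (P.coeff i)) :
    ∃ (k : ℕ) (G : (Poly (Fin (2 * p + 1)))[X][X]), G.map (topEval κ p : _ →+* PairRing (Option κ)) =
      C (lowOmega κ p ^ k) * P := by
  obtain ⟨w, -, hw⟩ := topLe_zero_iff.mpr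
    (grange_mono (by omega : 2 * p ≤ 2 * p + 1) (lowOmega_mem (κ := κ) (p := p)))
  choose k g hg using fun i => exists_topEval_eq hp (hP i)
  set K := ∑ i ∈ P.support, k i with hK
  have hle : ∀ i ∈ P.support, k i ≤ K := fun i hi =>
    Finset.single_le_sum (f := k) (fun _ _ => Nat.zero_le _) hi
  clear_value K
  refine ⟨K, ∑ i ∈ P.support, monomial i (w ^ (K - k i) * g i), ?_⟩
  rw [pmap_sum]
  conv_rhs => rw [P.as_sum_support, mul_sum]
  refine sum_congr rfl fun i hi => ?_
  rw [Polynomial.map_monomial, C_mul_monomial, RingHom.coe_coe, map_mul, map_pow, hw, hg,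
    ← mul_assoc, ← pow_add, Nat.sub_add_cancel (hle i hi)]

end TopDickson

section AlphaStep
variable {κ : Type*} [Fintype κ] [DecidableEq κ] {p d : ℕ} {f : PairRing (Option κ)}
  {A : Type*} [CommRing A] [Algebra F₂ A] [CharP A 2]

theorem TopLe.natDegree_le (hp : card κ = p) {g} (h : TopLe κ p d (topEval κ p g)) :
    g.natDegree ≤ d := by
  obtain ⟨g', h1, h2⟩ := h
  rwa [← topEval_injective hp h2]

theorem topLe_gram_top (hp : card κ = p) :
    TopLe κ p 1 (lowOmega κ p ^ 4 * gv (Option κ) (symEntry 0 (2 * (p + 1)))) := by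
  have h := sum_cf_mul_symEntry (gl : Option κ → _) gr 0 (card_option_eq hp) 0
  rw [sum_range_succ, cf_top _ _ (card_option_eq hp), one_mul] at h
  rw [← CharTwo.add_eq_zero.mp h, mul_sum]
  refine TopLe.sum fun j hj => ?_
  have hj := Finset.mem_range.mp hj
  rw [← mul_assoc, mul_comm]
  exact (topLe_cf hp j).mul_left
    (gv_mem_of_supp1 (symEntry_mem_supp1_sub (by omega) (by omega)))

theorem topLe_coeff_Qall (hp : card κ = p) (i : ℕ) :
    TopLe κ p 2 (lowOmega κ p ^ 8 * (Qall gl gr).coeff i) := by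
  have h0 : TopLe κ p 2 0 := ⟨0, by simp, map_zero _⟩
  rw [Qall_eq gl gr 0 (card_option_eq hp), coeff_add, mul_add, finsetSum_coeff, mul_sum]
  refine (TopLe.sum fun j _ => ?_).add ?_
  · rw [coeff_C_mul, coeff_X_pow]
    split_ifs
    · have := (topLe_cf hp j).mul (topLe_cf hp j)
      convert this using 1
      ring
    · rwa [mul_zero, mul_zero]
  · rw [coeff_C]
    split_ifs
    swap
    · rwa [mul_zero]
    rw [mul_sum]
    refine TopLe.sum fun j hj => ?_
    rw [mul_sum]
    refine TopLe.sum fun k hk => ?_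
    have hj := Finset.mem_range.mp hj
    have hk := Finset.mem_range.mp hk
    by_cases h : k = 0 ∧ j = 2 * (p + 1)
    · obtain ⟨rfl, rfl⟩ := h
      have := (topLe_gram_top hp).mul_left (mul_mem (pow_mem (grange_mono (by omega :
        2 * p ≤ 2 * p + 1) (lowOmega_mem (κ := κ) (p := p))) 4) (cf_zero_mem hp))
      rw [cf_top _ _ (card_option_eq hp)]
      refine TopLe.mono (d := 1) ?_ (by omega)
      convert this using 1
      ring
    · have := ((topLe_cf hp k).mul (topLe_cf hp j)).mul_left (gv_mem_of_supp1
        (symEntry_mem_supp1_sub (N := 2 * p + 1) (i := k) (j := j) (by omega) (by omega)))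
      convert this using 1
      ring

/-- Restriction to the hyperplane where the first coordinate vanishes; the coordinate paired with
it becomes the variable of the polynomial ring. -/
def botEval (κ : Type*) [Fintype κ] [DecidableEq κ] :
    PairRing (Option κ) →ₐ[F₂] (PairRing κ)[X] :=
  specialize (fun o => o.elim 0 fun i => C (gl i)) (fun o => o.elim X fun i => C (gr i))

theorem map_C_eval_X {R : Type*} [CommRing R] (P : R[X]) : (P.map C).eval X = P := by
  rw [eval_map, eval₂_C_X]

/-- The restriction of `wOf`. -/
def botW (κ : Type*) [Fintype κ] [DecidableEq κ] : (PairRing κ)[X] :=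
  dick (Sum.elim gl gr)

theorem botW_natDegree_pos : 0 < (botW κ).natDegree := by
  rw [botW, dick, natDegree_prod_of_monic _ _ fun _ _ => monic_X_add_C _]
  simp

theorem wOf_bot : wOf (fun o : Option κ => o.elim (0 : (PairRing κ)[X]) fun i => C (gl i))
    (fun o => o.elim X fun i => C (gr i)) = botW κ := by
  rw [wOf, botW]
  have h := dick_map (CAlgHom (R := F₂) (A := PairRing κ)) (Sum.elim gl gr)
  rw [comp_sumElim] at h
  conv_rhs => rw [← map_C_eval_X (dick (Sum.elim gl gr))]
  exact (congrArg (eval X) h).symm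

theorem map_cf_C (j : ℕ) : cf (fun i : κ => C (gl i)) (fun i => C (gr i)) j =
    C (cf gl gr j : PairRing κ) :=
  (map_cf (CAlgHom (R := F₂) (A := PairRing κ)) gl gr j).symm

theorem botEval_cf (j : ℕ) : botEval κ (cf gl gr (j + 1)) =
    C (if j = 0 then 0 else cf gl gr (j - 1) ^ 4) + botW κ ^ 2 * C (cf gl gr j ^ 2) := by
  rw [botEval, specialize_cf, cf_split _ _ rfl, wOf_bot]
  simp only [Option.elim_some, map_cf_C]
  split_ifs <;> simp

theorem botEval_gv (r : XiRing) : botEval κ (gv (Option κ) r) = C (gv κ r) := by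
  rw [botEval, specialize_gv, evXi_option _ _ rfl]
  have h := map_evXi (CAlgHom (R := F₂) (A := PairRing κ)) gl gr 0 r
  rw [map_zero] at h
  exact h.symm

theorem map_botEval_spX (r : XiRing) :
    (spX (Option κ) r).map (botEval κ : _ →+* (PairRing κ)[X]) = (spX κ r).map C := by
  let F : (PairRing (Option κ))[X] →ₐ[F₂] (PairRing κ)[X][X] :=
    mapAlgHom (botEval κ)
  let G : (PairRing κ)[X] →ₐ[F₂] (PairRing κ)[X][X] :=
    mapAlgHom (CAlgHom (R := F₂))
  have h1 := map_evXi (A := (PairRing (Option κ))[X])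
    (B := (PairRing κ)[X][X]) F (fun i : Option κ => C (gl i)) (fun i => C (gr i)) X r
  have h2 := map_evXi (A := (PairRing κ)[X])
    (B := (PairRing κ)[X][X]) G (fun i : κ => C (gl i)) (fun i => C (gr i)) X r
  have hb : ∀ f, F (C f) = C (botEval κ f) := fun f => map_C _
  have hc : ∀ f, G (C f) = C (C f) := fun f => map_C _
  have hx : F X = X := map_X _
  have hx' : G X = X := map_X _
  have hgl : ∀ o, botEval κ (gl o) = o.elim 0 fun i => C (gl i) := congrFun (specialize_gl _ _)
  have hgr : ∀ o, botEval κ (gr o) = o.elim X fun i => C (gr i) := congrFun (specialize_gr _ _)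
  simp only [hb, hc, hx, hx', hgl, hgr] at h1 h2
  have h3 := dcongr_fun (evXi_option
    (fun i : Option κ => (C (i.elim 0 fun i => C (gl i)) : (PairRing κ)[X][X]))
    (fun i => C (i.elim X fun i => C (gr i))) C_0 X) r
  exact h1.trans (h3.trans h2.symm)

theorem map_botEval_Qp (ε : F₂) :
    (Qp ε gl gr).map (botEval κ : PairRing (Option κ) →+* (PairRing κ)[X]) =
      (Qp ε gl gr).map C ^ 2 * ((Qall gl gr).map C + C (botW κ ^ 2)) := by
  have hQ : ∀ ε, Qp ε (fun i : κ => C (gl i)) (fun i => C (gr i)) =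
      (Qp ε gl gr : (PairRing κ)[X]).map C := fun ε =>
    (map_Qp (CAlgHom (R := F₂) (A := PairRing κ)) ε gl gr).symm
  rw [map_Qp, botEval]
  have h1 : (fun o : Option κ => specialize (fun o => o.elim 0 fun i => C (gl i))
    (fun o => o.elim X fun i => C (gr i)) (gl o)) = _ := specialize_gl (A := (PairRing κ)[X]) _ _
  have h2 : (fun o : Option κ => specialize (fun o => o.elim 0 fun i => C (gl i))
    (fun o => o.elim X fun i => C (gr i)) (gr o)) = _ := specialize_gr (A := (PairRing κ)[X]) _ _
  rw [h1, h2, Qp_split _ _ rfl, wOf_bot, ← Qp_mul_Qp, ← Qp_mul_Qp, pmap_mul]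
  simp only [Option.elim_some, hQ]

theorem kill_eq_zero_of_botEval (h : botEval κ f = 0) : kill f = 0 := by
  have : kill = (aevalTower (MvPolynomial.rename (Sum.map some some))
      (gr none) : (PairRing κ)[X] →ₐ[F₂] PairRing (Option κ)).comp
      (botEval κ) := by
    ext i
    rcases i with (_ | i) | (_ | i) <;> simp [kill, botEval, specialize, gl, gr]
  rw [this, comp_apply, h, map_zero]

theorem botEval_topEval (g) : botEval κ (topEval κ p g) =
    (g.map (maeval fun i : Fin (2 * p + 1) =>
      (gram gl gr ((i : ℕ) + 1) : PairRing κ)).toRingHom).comp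
      (botEval κ (cf gl gr (2 * p + 1))) := by
  induction g using Polynomial.induction_on' with
  | add f g hf hg => simp only [map_add, hf, hg, pmap_add, add_comp]
  | monomial k r =>
    rw [← C_mul_X_pow_eq_monomial, map_mul, map_mul, topEval_C, map_pow, map_pow, topEval_X,
      pmap_mul, pmap_pow, map_C, map_X, mul_comp, C_comp, pow_comp, X_comp,
      ← gv_shiftHom, botEval_gv, gv_shiftHom]
    rfl

theorem natDegree_botEval_top_pos (hp : card κ = p) :
    0 < (botEval κ (cf gl gr (2 * p + 1))).natDegree := by
  rw [botEval_cf, cf_top _ _ hp, one_pow, map_one, mul_one, natDegree_C_add, natDegree_pow]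
  have := botW_natDegree_pos (κ := κ)
  omega

theorem isSpInvariant_topEval_C (r) : IsSpInvariant (topEval κ p (C r)) := by
  rw [topEval_C, ← gv_shiftHom]
  exact isSpInvariant_gv _

theorem isSpInvariant_lowOmega : IsSpInvariant (lowOmega κ p) := isSpInvariant_gv _

theorem sum_elim_low {R : Type*} [CommRing R] [CharP R 2] {p : ℕ} {k : Fin p → Fin p → R}
    {c e s x t : Fin p → R} {u : R} (hc : ∀ l, e l = c l + ∑ j, k l j * x j)
    (h : ∑ l, c l * s l + ∑ j, x j * t j + u = 0) :
    ∑ j, (∑ l, s l * k l j + t j) * x j = ∑ l, e l * s l + u := by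
  have h1 : ∑ l, e l * s l = ∑ l, c l * s l + ∑ j, (∑ l, s l * k l j) * x j := by
    simp only [hc, add_mul, sum_add_distrib, sum_mul]
    rw [sum_comm (s := univ (α := Fin p))]
    congr 1
    exact sum_congr rfl fun l _ => sum_congr rfl fun j _ => by ring
  have h2 : ∑ j, (∑ l, s l * k l j + t j) * x j =
      ∑ j, (∑ l, s l * k l j) * x j + ∑ j, x j * t j := by
    rw [← sum_add_distrib]
    exact sum_congr rfl fun j _ => by ring
  rw [h1, h2]
  refine CharTwo.add_eq_zero.mp ?_
  have h3 : ∀ a b c d : R, c + b + d = 0 → a + b + (c + a + d) = 0 := fun a b c d h => by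
    linear_combination h + CharTwo.add_self_eq_zero a
  exact h3 _ _ _ _ h

theorem nrow_eq {i : ℕ} (j : Fin p) : nrow p i j =
    ∑ l : Fin p, symEntry i l * K p l j + symEntry i (p + j) := by
  rw [nrow, sum_range_two_mul_succ,
    wv_of_le j.2.le (by omega : p ≤ 2 * p), if_neg (by omega), mul_zero, add_zero]
  congr 1
  · exact sum_congr rfl fun l _ => by rw [K_eq_wv]
  · rw [sum_eq_single j]
    · rw [wv_of_le j.2.le (by omega), if_pos rfl, mul_one]
    · intro l _ hl
      rw [wv_of_le j.2.le (by omega), if_neg (by omega), mul_zero]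
    · exact fun h => absurd (mem_univ _) h

theorem evXi_nrow (a b : κ → A) (z : A) {i : ℕ} (j : Fin p) : evXi a b z (nrow p i j) =
    ∑ l : Fin p, evXi a b z (symEntry i l) * evXi a b z (K p l j) +
      evXi a b z (symEntry i (p + j)) := by
  rw [nrow_eq, map_add, map_sum]
  simp only [map_mul]

theorem sum_nrow_mul_cf (a b : κ → A) (z : A) (hp : card κ = p) (i : ℕ) :
    ∑ j : Fin p, evXi a b z (nrow p i j) * cf a b (p + j) =
      ∑ l : Fin p, evXi a b z (E p l) * evXi a b z (symEntry i l) +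
        evXi a b z (symEntry i (2 * p)) := by
  have h := sum_cf_mul_symEntry a b z hp i
  rw [sum_range_two_mul_succ, cf_top _ _ hp, one_mul] at h
  simp only [evXi_nrow]
  exact sum_elim_low (evXi_E a b z hp) h

theorem cf_zero_mul_cf_mem (hp : card κ = p) (j : Fin p) :
    cf gl gr 0 * cf gl gr (p + j) ∈ grange κ (2 * p) := by
  let M : Matrix (Fin p) (Fin p) (PairRing κ) := (nmat p).map (gv κ)
  have hdet : M.det = cf gl gr 0 := by
    rw [← evXi_det_nmat_eq gl gr 0 hp]
    exact (map_det (gv κ) (nmat p)).symm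
  rw [← hdet]
  refine det_mul_mem_of_mulVec (grange κ (2 * p)) (M := M) (x := fun j => cf gl gr (p + j))
    (fun i j => gv_mem_of_supp1 (nrow_mem_supp1 (by omega) j.2)) (fun i => ?_) j
  have h1 := sum_nrow_mul_cf gl gr 0 hp (i : ℕ)
  change ∑ j : Fin p, gv κ (nrow p i j) * _ ∈ _
  rw [h1]
  refine add_mem (sum_mem fun l _ => mul_mem (gv_mem_of_supp1 ((E_spec p).1 l)) ?_) ?_
  · exact gv_symEntry_mem (by omega) (by omega)
  · exact gv_symEntry_mem (by omega) (by omega)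

end AlphaStep

section AlphaExistence
variable {κ : Type*} [Fintype κ] [DecidableEq κ] {p : ℕ}

theorem coeff_inv_of_map {P : (PairRing κ)[X]}
    (h : ∀ φ : PairRing κ →ₐ[F₂] PairRing κ, IsLinearSubst φ →
      Injective φ → φ (gram gl gr 1) = gram gl gr 1 →
      P.map (φ : PairRing κ →+* PairRing κ) = P) (i : ℕ) :
    IsSpInvariant (P.coeff i) := by
  intro φ h1 h2 h3
  conv_rhs => rw [← h φ h1 h2 h3, coeff_map]
  rfl

theorem map_of_coeff_inv {P : (PairRing κ)[X]} (h : ∀ i, IsSpInvariant (P.coeff i))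
    {φ : PairRing κ →ₐ[F₂] PairRing κ} (h1 : IsLinearSubst φ)
    (h2 : Injective φ) (h3 : φ (gram gl gr 1) = gram gl gr 1) :
    P.map (φ : PairRing κ →+* PairRing κ) = P := by
  ext i
  rw [coeff_map]
  exact congrArg _ (h i φ h1 h2 h3)

theorem map_Qall_subst {φ : PairRing κ →ₐ[F₂] PairRing κ}
    (h1 : IsLinearSubst φ) (h2 : Injective φ) (h3 : φ (gram gl gr 1) = gram gl gr 1) :
    (Qall gl gr).map (φ : PairRing κ →+* PairRing κ) = Qall gl gr := by
  have hc : ∀ j, (φ : PairRing κ →+* PairRing κ) (cf gl gr j) = cf gl gr j :=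
    fun j => isSpInvariant_cf j φ h1 h2 h3
  have hg : ∀ r, (φ : PairRing κ →+* PairRing κ) (gv κ r) = gv κ r :=
    fun r => isSpInvariant_gv r φ h1 h2 h3
  rw [Qall_eq gl gr 0 rfl]
  simp only [pmap_add, pmap_sum, pmap_mul, pmap_pow,
    map_C, map_X, map_pow, map_mul, map_sum, hc, hg]

theorem isSpInvariant_coeff_Qp_zero (i : ℕ) :
    IsSpInvariant ((Qp 0 gl gr : (PairRing κ)[X]).coeff i) := by
  refine coeff_inv_of_map (fun φ h1 h2 h3 => ?_) i
  have h4 := map_Qall_subst h1 h2 h3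
  have h5 := map_of_coeff_inv isSpInvariant_coeff_Qp h1 h2 h3
  rw [← Qp_mul_Qp, pmap_mul, h5] at h4
  exact mul_left_cancel₀ (Qp_monic 1 _ _).ne_zero h4

theorem exists_topLe_coeff_Qp (hp : card κ = p) :
    ∃ k, ∀ i, TopLe κ p 1 (lowOmega κ p ^ k * (Qp 1 gl gr).coeff i) := by
  obtain ⟨k1, G1, h1⟩ := exists_map_topEval_eq hp (P := Qp 1 gl gr) isSpInvariant_coeff_Qp
  obtain ⟨k2, G2, h2⟩ := exists_map_topEval_eq hp (P := Qp 0 gl gr) isSpInvariant_coeff_Qp_zero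
  have hs := lowOmega_ne_zero (κ := κ) hp
  have hs0 : TopLe κ p 0 (lowOmega κ p) := topLe_zero_iff.mpr (grange_mono (by omega) lowOmega_mem)
  obtain ⟨w, hw0, hw⟩ := hs0
  have hcoeff1 : ∀ i, topEval κ p (G1.coeff i) = lowOmega κ p ^ k1 * (Qp 1 gl gr).coeff i :=
    fun i => by
      rw [← coeff_C_mul, ← h1, coeff_map]
      rfl
  have hcoeff2 : ∀ i, topEval κ p (G2.coeff i) = lowOmega κ p ^ k2 * (Qp 0 gl gr).coeff i :=
    fun i => by
      rw [← coeff_C_mul, ← h2, coeff_map]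
      rfl
  have hG2 : G2 ≠ 0 := by
    rintro rfl
    rw [Polynomial.map_zero] at h2
    have := mul_ne_zero (C_ne_zero.mpr (pow_ne_zero k2 hs)) (Qp_monic 0 gl gr).ne_zero
    exact this h2.symm
  refine ⟨8 + k1, fun i => ⟨w ^ 8 * G1.coeff i, ?_, ?_⟩⟩
  swap
  · rw [map_mul, map_pow, hw, hcoeff1, pow_add]
    ring
  rw [← coeff_C_mul]
  refine natDegree_coeff_le_of_mul (e := 1) hG2 (fun i => ?_) ?_ i
  · refine TopLe.natDegree_le hp ?_
    have h3 : topEval κ p ((C (w ^ 8) * G1 * G2).coeff i) =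
        (lowOmega κ p ^ k1 * lowOmega κ p ^ k2) * (lowOmega κ p ^ 8 * (Qall gl gr).coeff i) := by
      have h4 : (C (w ^ 8) * G1 * G2).map (topEval κ p : _ →+* PairRing (Option κ)) =
          C (lowOmega κ p ^ k1 * lowOmega κ p ^ k2 * lowOmega κ p ^ 8) * Qall gl gr := by
        rw [pmap_mul, pmap_mul, h1, h2, map_C, ← Qp_mul_Qp, RingHom.coe_coe,
          map_pow, hw]
        simp only [C_mul]
        ring
      rw [← mul_assoc, ← coeff_C_mul, ← h4, coeff_map]
      rfl
    rw [h3]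
    exact (topLe_coeff_Qall hp i).mul_left (mul_mem (pow_mem (grange_mono (by omega) lowOmega_mem) _)
      (pow_mem (grange_mono (by omega) lowOmega_mem) _))
  · intro hlt
    -- all coefficients of the `+`-polynomial would restrict to constants
    obtain ⟨r0, hr0⟩ : ∃ r, botEval κ (lowOmega κ p) = C r := ⟨_, botEval_gv _⟩
    have hr : r0 ≠ 0 := by
      rintro rfl
      exact kill_lowOmega_ne_zero hp (kill_eq_zero_of_botEval (hr0.trans C_0))
    have hconst : ∀ i, (botEval κ ((Qp 0 gl gr).coeff i)).natDegree = 0 := by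
      intro i
      have h5 : botEval κ (topEval κ p (G2.coeff i)) = C (r0 ^ k2) *
          botEval κ ((Qp 0 gl gr).coeff i) := by
        rw [hcoeff2, map_mul, map_pow, hr0, C_pow]
      have h6 := congrArg natDegree h5
      rw [natDegree_C_mul (pow_ne_zero _ hr), eq_C_of_natDegree_eq_zero (Nat.lt_one_iff.mp (hlt i)),
        topEval_C, ← gv_shiftHom, botEval_gv, natDegree_C] at h6
      exact h6.symm
    set P : (PairRing κ)[X] := Qp 0 gl gr ^ 2 with hP
    have hPm : P.Monic := (Qp_monic 0 gl gr).pow 2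
    set N := P.natDegree
    have h7 := congrArg (fun F => Polynomial.coeff F N) (map_botEval_Qp (κ := κ) 0)
    simp only [coeff_map, mul_add, coeff_add, coeff_mul_C] at h7
    rw [← pmap_pow, ← hP, ← pmap_mul, coeff_map, coeff_map,
      hPm.coeff_natDegree, map_one, one_mul] at h7
    have h8 := hconst N
    have h9 := congrArg natDegree h7
    rw [natDegree_C_add, natDegree_pow] at h9
    have h10 := botW_natDegree_pos (κ := κ)
    change (botEval κ ((Qp 0 gl gr).coeff N)).natDegree = _ at h9
    omega

theorem mem_grange_of_botEval (hp : card κ = p) {f : PairRing (Option κ)}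
    (hf : IsSpInvariant f) {k : ℕ} (h1 : TopLe κ p 1 (lowOmega κ p ^ k * f))
    {r : PairRing κ} (h2 : botEval κ f = C r) :
    f ∈ grange (Option κ) (2 * (p + 1)) := by
  have hs := lowOmega_ne_zero (κ := κ) hp
  obtain ⟨g, hg, hgf⟩ := h1
  obtain ⟨r0, hr0⟩ : ∃ r, botEval κ (lowOmega κ p) = C r := ⟨_, botEval_gv _⟩
  have h3 := botEval_topEval (κ := κ) (p := p) g
  rw [hgf, map_mul, map_pow, h2, hr0, ← C_pow, ← C_mul] at h3
  have h4 := congrArg natDegree h3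
  rw [natDegree_C, natDegree_comp] at h4
  have h5 := natDegree_botEval_top_pos (κ := κ) hp
  have h6 : (g.map (maeval fun i : Fin (2 * p + 1) =>
      (gram gl gr ((i : ℕ) + 1) : PairRing κ)).toRingHom).natDegree = 0 := by
    rcases mul_eq_zero.mp h4.symm with h | h
    · exact h
    · omega
  have h7 : botEval κ (topEval κ p (C (g.coeff 1))) = 0 := by
    rw [topEval_C, ← gv_shiftHom, botEval_gv, gv_shiftHom]
    have h8 := coeff_eq_zero_of_natDegree_lt (n := 1) (h6.trans_lt one_pos)
    rw [coeff_map] at h8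
    exact (congrArg C h8).trans C_0
  obtain ⟨u, hu⟩ := cf_zero_dvd (isSpInvariant_topEval_C (κ := κ) (g.coeff 1))
    (kill_eq_zero_of_botEval h7)
  have hu' : IsSpInvariant u := by
    intro φ a1 a2 a3
    have e1 := isSpInvariant_topEval_C (κ := κ) (g.coeff 1) φ a1 a2 a3
    rw [hu, map_mul, isSpInvariant_cf 0 φ a1 a2 a3] at e1
    exact mul_left_cancel₀ cf_zero_ne_zero e1
  obtain ⟨l, g2, hg2⟩ := exists_topEval_eq hp hu'
  obtain ⟨w, hw0, hw⟩ := topLe_zero_iff.mpr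
    (grange_mono (by omega : 2 * p ≤ 2 * p + 1) (lowOmega_mem (κ := κ) (p := p)))
  obtain ⟨z, hz0, hz⟩ := topLe_zero_iff.mpr (cf_zero_mem (κ := κ) hp)
  have hz1 : z ≠ 0 := by
    rintro rfl
    exact cf_zero_ne_zero (hz.symm.trans (map_zero _))
  have hdeg : g2.natDegree ≤ 0 := by
    have e1 : w ^ l * C (g.coeff 1) = z * g2 := by
      apply topEval_injective (κ := κ) hp
      rw [map_mul, map_mul, map_pow, hw, hz, hg2, hu]
      ring
    have e2 := congrArg natDegree e1
    rcases eq_or_ne g2 0 with rfl | h0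
    · simp
    rw [natDegree_mul hz1 h0] at e2
    have e3 : (w ^ l * C (g.coeff 1)).natDegree ≤ 0 := by
      refine natDegree_mul_le.trans ?_
      rw [natDegree_C, add_zero]
      refine natDegree_pow_le.trans ?_
      rw [Nat.le_zero.mp hw0, mul_zero]
    omega
  have hup : lowOmega κ p ^ l * u ∈ grange (Option κ) (2 * p + 1) :=
    topLe_zero_iff.mp ⟨g2, hdeg, hg2⟩
  have hcy : cf gl gr 0 * cf gl gr (2 * p + 1) ∈ grange (Option κ) (2 * (p + 1)) := by
    have := cf_zero_mul_cf_mem (card_option_eq hp) (Fin.last p)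
    rwa [val_last, show p + 1 + p = 2 * p + 1 by ring] at this
  have hsm : lowOmega κ p ∈ grange (Option κ) (2 * (p + 1)) := grange_mono (by omega) lowOmega_mem
  have hfin : lowOmega κ p ^ (l + k) * f ∈ grange (Option κ) (2 * (p + 1)) := by
    have e1 : lowOmega κ p ^ (l + k) * f = lowOmega κ p ^ l * topEval κ p (C (g.coeff 0)) +
        lowOmega κ p ^ l * u * (cf gl gr 0 * cf gl gr (2 * p + 1)) := by
      rw [pow_add, mul_assoc, ← hgf]
      conv_lhs => rw [eq_X_add_C_of_natDegree_le_one hg, map_add, map_mul, topEval_X, hu]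
      ring
    rw [e1]
    refine add_mem (mul_mem (pow_mem hsm _) ?_) (mul_mem (grange_mono (by omega) hup) hcy)
    exact grange_mono (by omega) (topLe_zero_iff.mp ⟨_, by simp, rfl⟩)
  obtain ⟨k', hk'⟩ := exists_pow_mul_mem_grange (card_option_eq hp) hf
  have hc0 : cf gl gr 0 ∈ grange (Option κ) (2 * (p + 1)) := grange_mono (by omega) (cf_zero_mem hp)
  exact mem_range_of_isRelPrime (algebraicIndependent_gram (card_option_eq hp))
    (isRelPrime_cf_zero isSpInvariant_lowOmega (kill_lowOmega_ne_zero hp)) hc0 hsm cf_zero_ne_zero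
    hk' hfin

/-- The difference between `Q^-` and the contribution of the `α_l` with `l < m`. -/
def alphaRem (κ : Type*) [Fintype κ] [DecidableEq κ] (m : ℕ) : (PairRing κ)[X] :=
  Qp 1 gl gr + ∑ l : Fin m, C (cf gl gr (m + l)) * spX κ (alpha l) ^ 2 ^ (m - l)

theorem coeff_alphaRem_mem (hp : card κ = p)
    (hs : ∀ l ≤ p, alpha l ∈ supported F₂ (Iic (2 * l)))
    (hQ : (Qp 1 gl gr : (PairRing κ)[X]) = ∑ l ∈ range (p + 1),
      C (cf gl gr (p + l)) * spX κ (alpha l) ^ 2 ^ (p - l)) (i : ℕ) :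
    (alphaRem (Option κ) (p + 1)).coeff i ∈ grange (Option κ) (2 * (p + 1)) := by
  have hsp : ∀ (l : Fin (p + 1)) i,
      (spX (Option κ) (alpha l) ^ 2 ^ (p + 1 - (l : ℕ))).coeff i ∈
        grange (Option κ) (2 * p + 1) := fun l i => by
    rw [← map_pow]
    exact grange_mono (by omega) (coeff_spX_mem (pow_mem (hs l (by omega)) _) i)
  obtain ⟨k, hk⟩ := exists_topLe_coeff_Qp (κ := κ) hp
  have hsm : ∀ k, lowOmega κ p ^ k ∈ grange (Option κ) (2 * p + 1) := fun k =>
    pow_mem (grange_mono (by omega) lowOmega_mem) k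
  have hcoeff : (alphaRem (Option κ) (p + 1)).coeff i = (Qp 1 gl gr).coeff i +
      ∑ l : Fin (p + 1), cf gl gr (p + 1 + l) *
        (spX (Option κ) (alpha l) ^ 2 ^ (p + 1 - (l : ℕ))).coeff i := by
    rw [alphaRem, coeff_add, finsetSum_coeff]
    simp only [coeff_C_mul]
  have htop : TopLe κ p 1 (lowOmega κ p ^ (4 + k) * (alphaRem (Option κ) (p + 1)).coeff i) := by
    rw [hcoeff, mul_add, mul_sum, pow_add]
    refine TopLe.add ?_ (TopLe.sum fun l _ => ?_)
    · rw [mul_assoc]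
      exact (hk i).mul_left (hsm 4)
    · have := (topLe_cf hp (p + 1 + l)).mul_left (mul_mem (hsm k) (hsp l i))
      convert this using 1
      ring
  have hinv : IsSpInvariant ((alphaRem (Option κ) (p + 1)).coeff i) := by
    refine coeff_inv_of_map (fun φ h1 h2 h3 => ?_) i
    rw [alphaRem, pmap_add, map_of_coeff_inv isSpInvariant_coeff_Qp h1 h2 h3,
      pmap_sum]
    congr 1
    refine sum_congr rfl fun l _ => ?_
    rw [pmap_mul, map_C]
    congr 1
    · exact congrArg C (isSpInvariant_cf _ φ h1 h2 h3)
    · refine map_of_coeff_inv (fun j => ?_) h1 h2 h3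
      obtain ⟨q, -, hq⟩ := exists_gv_eq (hsp l j)
      rw [← hq]
      exact isSpInvariant_gv q
  have hbot : ∃ B : (PairRing κ)[X], (alphaRem (Option κ) (p + 1)).map
      (botEval κ : PairRing (Option κ) →+* (PairRing κ)[X]) = B.map C := by
    have hsq : (Qp 1 gl gr : (PairRing κ)[X]) ^ 2 = ∑ l : Fin (p + 1),
        C (cf gl gr (p + l) ^ 2) * spX κ (alpha l) ^ 2 ^ (p + 1 - (l : ℕ)) := by
      rw [hQ, ← Fin.sum_univ_eq_sum_range (fun l => C (cf gl gr (p + l)) *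
        spX κ (alpha l) ^ 2 ^ (p - l)), CharTwo.sum_sq]
      refine sum_congr rfl fun l _ => ?_
      rw [mul_pow, ← C_pow, ← pow_mul, ← pow_succ,
        show p - (l : ℕ) + 1 = p + 1 - l by omega]
    refine ⟨Qp 1 gl gr ^ 2 * Qall gl gr + ∑ l : Fin (p + 1),
      C (if p + (l : ℕ) = 0 then 0 else cf gl gr (p + l - 1) ^ 4) *
        spX κ (alpha l) ^ 2 ^ (p + 1 - (l : ℕ)), ?_⟩
    rw [alphaRem, pmap_add, map_botEval_Qp, pmap_sum, pmap_add,
      pmap_mul, pmap_pow, mul_add, add_assoc, pmap_sum]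
    congr 1
    have hterm : ∀ l : Fin (p + 1), (C (cf gl gr (p + 1 + l)) *
        spX (Option κ) (alpha l) ^ 2 ^ (p + 1 - (l : ℕ))).map
          (botEval κ : PairRing (Option κ) →+* (PairRing κ)[X]) =
        (C (if p + (l : ℕ) = 0 then 0 else cf gl gr (p + l - 1) ^ 4) *
          spX κ (alpha l) ^ 2 ^ (p + 1 - (l : ℕ))).map C + C (botW κ ^ 2) *
          (C (cf gl gr (p + l) ^ 2) * spX κ (alpha l) ^ 2 ^ (p + 1 - (l : ℕ))).map C := by
      intro l
      rw [pmap_mul, pmap_pow, map_botEval_spX, map_C, RingHom.coe_coe,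
        show p + 1 + (l : ℕ) = p + l + 1 by ring, botEval_cf]
      simp only [pmap_mul, pmap_pow, map_C, C_add, C_mul]
      ring
    have hsum : ∑ l : Fin (p + 1), (C (cf gl gr (p + l) ^ 2) *
        spX κ (alpha l) ^ 2 ^ (p + 1 - (l : ℕ))).map C = (Qp 1 gl gr).map C ^ 2 := by
      rw [← pmap_sum, ← hsq, pmap_pow]
    rw [sum_congr rfl fun l _ => hterm l, sum_add_distrib, ← mul_sum,
      hsum, add_comm, add_assoc, mul_comm (C (botW κ ^ 2)), CharTwo.add_self_eq_zero, add_zero]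
  obtain ⟨B, hB⟩ := hbot
  refine mem_grange_of_botEval hp hinv htop (r := B.coeff i) ?_
  have := congrArg (fun F => Polynomial.coeff F i) hB
  simp only [coeff_map] at this
  exact this

end AlphaExistence

section AlphaSpec

theorem alphaRem_reindex {κ κ' : Type*} [Fintype κ] [DecidableEq κ] [Fintype κ'] [DecidableEq κ']
    (e : κ ≃ κ') (m : ℕ) : (alphaRem κ m).map
      (specialize (gl ∘ e) (gr ∘ e) : PairRing κ →+* PairRing κ') =
        alphaRem κ' m := by
  have hc : ∀ j, (specialize (gl ∘ e) (gr ∘ e) : PairRing κ →+* PairRing κ')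
      (cf gl gr j) = cf gl gr j := fun j => by
    rw [RingHom.coe_coe, specialize_cf, cf_reindex]
  have hs : ∀ r, (spX κ r).map (specialize (gl ∘ e) (gr ∘ e) :
      PairRing κ →+* PairRing κ') = spX κ' r := fun r => by
    let F : (PairRing κ)[X] →ₐ[F₂] (PairRing κ')[X] :=
      mapAlgHom (specialize (gl ∘ e) (gr ∘ e))
    have h1 := map_evXi (A := (PairRing κ)[X]) (B := (PairRing κ')[X]) F
      (fun i : κ => C (gl i)) (fun i => C (gr i)) X r
    have hb : ∀ f, F (C f) = C (specialize (gl ∘ e) (gr ∘ e) f) := fun f => map_C _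
    have hx : F X = X := map_X _
    have hgl : ∀ o, specialize (gl ∘ e) (gr ∘ e) (gl o) = (gl ∘ e) o :=
      congrFun (specialize_gl (A := PairRing κ') _ _)
    have hgr : ∀ o, specialize (gl ∘ e) (gr ∘ e) (gr o) = (gr ∘ e) o :=
      congrFun (specialize_gr (A := PairRing κ') _ _)
    simp only [hb, hx, hgl, hgr] at h1
    refine Eq.trans h1 ?_
    exact dcongr_fun (evXi_reindex e (fun i => (C (gl i) : (PairRing κ')[X]))
      (fun i => C (gr i)) X) r
  have hq : (Qp 1 gl gr).map (specialize (gl ∘ e) (gr ∘ e) :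
      PairRing κ →+* PairRing κ') = Qp 1 gl gr := by
    rw [map_Qp, specialize_gl, specialize_gr, Qp_reindex]
  rw [alphaRem, pmap_add, pmap_sum, hq, alphaRem]
  simp only [pmap_mul, pmap_pow, map_C, hc, hs]

theorem alphaRem_map_equiv (m : ℕ) : (alphaRem (Fin m) m).map
    ((stdCoords m).equiv : CoordRing (Fin m ⊕ Fin m) →+* Sym (Std m)) = Qminus (stdForm m) -
    ∑ l : Fin m, C (dickson (Std m) (m + l)) * spec m (alpha l) ^ 2 ^ (m - (l : ℕ)) := by
  have hd : ∀ j, dickson (Std m) j =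
      ((stdCoords m).equiv : CoordRing (Fin m ⊕ Fin m) →+* Sym (Std m)) (cf gl gr j) := fun j =>
    ((stdCoords m).dickson_eq j).trans ((stdCoords m).equiv_cf j).symm
  rw [alphaRem, CharTwo.sub_eq_add, (stdCoords m).Qminus_eq, ← (stdCoords m).equiv_Qp,
    pmap_add, pmap_sum]
  simp only [pmap_mul, pmap_pow, map_C, spec_eq_map, hd]

theorem xiExpression_eq {m : ℕ} {f : (CoordRing (Fin m ⊕ Fin m))[X]}
    (hf : ∀ i, f.coeff i ∈ grange (Fin m) (2 * m)) :
    xiExpression m (f.map ((stdCoords m).equiv : CoordRing (Fin m ⊕ Fin m) →+* Sym (Std m))) ∈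
      supported F₂ (Iic (2 * m)) ∧
    spX (Fin m) (xiExpression m (f.map
      ((stdCoords m).equiv : CoordRing (Fin m ⊕ Fin m) →+* Sym (Std m)))) = f := by
  obtain ⟨e, he, h1⟩ := exists_spX_eq hf
  rw [← isXiExpression_map_iff]
  have hex : ∃ e, IsXiExpression m (f.map
      ((stdCoords m).equiv : CoordRing (Fin m ⊕ Fin m) →+* Sym (Std m))) e :=
    ⟨e, (isXiExpression_map_iff m f e).mpr ⟨he, h1⟩⟩
  rw [xiExpression, dif_pos hex]
  exact hex.choose_spec

theorem mem_grange_of_isEmpty {κ : Type*} [Fintype κ] [IsEmpty κ] {N : ℕ}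
    (f : PairRing κ) : f ∈ grange κ N := by
  obtain ⟨r, hr⟩ := C_surjective (κ ⊕ κ) f
  rw [← hr]
  exact (grange κ N).algebraMap_mem r

theorem eq_sum_of_spX_eq {κ : Type*} [Fintype κ] [DecidableEq κ] {m : ℕ}
    (hm : card κ = m) (h : spX κ (alpha m) = alphaRem κ m) :
    (Qp 1 gl gr : (PairRing κ)[X]) = ∑ l ∈ range (m + 1),
      C (cf gl gr (m + l)) * spX κ (alpha l) ^ 2 ^ (m - l) := by
  rw [sum_range_succ, Nat.sub_self, pow_zero, pow_one, ← two_mul, cf_top _ _ hm, C_1,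
    one_mul, h, alphaRem, ← Fin.sum_univ_eq_sum_range
      (fun l => C (cf gl gr (m + l)) * spX κ (alpha l) ^ 2 ^ (m - l)), add_left_comm,
    CharTwo.add_self_eq_zero, add_zero]

theorem alpha_spec (m : ℕ) : alpha m ∈ supported F₂ (Iic (2 * m)) ∧
    spX (Fin m) (alpha m) = alphaRem (Fin m) m := by
  induction m using Nat.strong_induction_on with
  | _ m ih =>
    have h : alpha m = xiExpression m ((alphaRem (Fin m) m).map
        ((stdCoords m).equiv : CoordRing (Fin m ⊕ Fin m) →+* Sym (Std m))) := by
      rw [alphaRem_map_equiv, alpha]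
    rw [h]
    refine xiExpression_eq fun i => ?_
    rcases m with _ | p
    · exact mem_grange_of_isEmpty _
    · let e : Option (Fin p) ≃ Fin (p + 1) := (finSuccEquiv p).symm
      have h1 := coeff_alphaRem_mem (card_fin p) (fun l hl => (ih l (by omega)).1)
        (eq_sum_of_spX_eq (card_fin p) (ih p (by omega)).2) i
      obtain ⟨r, -, hr⟩ := exists_gv_eq h1
      rw [← alphaRem_reindex e, coeff_map, ← hr, RingHom.coe_coe, gv_specialize, ]
      obtain ⟨r', hr', h2⟩ := exists_gv_eq h1
      have : gv (Fin (p + 1)) r = gv (Fin (p + 1)) r' := by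
        rw [← gv_specialize e, ← gv_specialize e, hr, h2]
      rw [this]
      exact gv_mem_of_supp1 hr'

theorem alpha_mem (m : ℕ) : alpha m ∈ supported F₂ (Iic (2 * m)) :=
  (alpha_spec m).1

variable {A : Type*} [CommRing A] [Algebra F₂ A] [CharP A 2]
variable {κ : Type*} [Fintype κ] [DecidableEq κ]

/-- The expansion of `Q^-` in terms of the `α_l`, in any symplectic family. -/
theorem eval_Qp (a b : κ → A) (z : A) {m : ℕ} (hm : card κ = m) :
    (Qp 1 a b).eval z = ∑ l ∈ range (m + 1),
      cf a b (m + l) * evXi a b z (alpha l) ^ 2 ^ (m - l) := by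
  obtain ⟨e⟩ : Nonempty (Fin m ≃ κ) := ⟨(Fintype.equivFinOfCardEq hm).symm⟩
  let pt : (CoordRing (Fin m ⊕ Fin m))[X] →ₐ[F₂] A :=
    aevalTower (specialize (a ∘ e) (b ∘ e)) z
  have hC : ∀ f, pt (C f) = specialize (a ∘ e) (b ∘ e) f := fun f => Polynomial.aevalTower_C _ _ _
  have hX : pt X = z := Polynomial.aevalTower_X _ _
  have h1 := congrArg pt (eq_sum_of_spX_eq (card_fin m) (alpha_spec m).2)
  have hs : ∀ r, pt (spX (Fin m) r) = evXi a b z r := fun r => by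
    rw [spX, map_evXi, hX]
    simp only [hC, congrFun (specialize_gl (a ∘ e) (b ∘ e)), congrFun (specialize_gr (a ∘ e) (b ∘ e))]
    exact dcongr_fun (evXi_reindex e a b z) r
  have hq : pt (Qp 1 gl gr) = (Qp 1 a b).eval z := by
    have h2 : ∀ P, pt P = (P.map (specialize (a ∘ e) (b ∘ e) :
        CoordRing (Fin m ⊕ Fin m) →+* A)).eval z := fun P => (eval_map _ _).symm
    rw [h2, map_Qp, specialize_gl, specialize_gr, Qp_reindex]
  rw [hq] at h1
  rw [h1, map_sum]
  refine sum_congr rfl fun l _ => ?_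
  rw [map_mul, map_pow, hC, hs, specialize_cf, cf_reindex]

theorem Qminus_stdForm_eq (m : ℕ) : Qminus (stdForm m) = ∑ l ∈ range (m + 1),
    C (dickson (Std m) (m + l)) * spec m (alpha l) ^ 2 ^ (m - l) := by
  have hd : ∀ j, dickson (Std m) j =
      ((stdCoords m).equiv : CoordRing (Fin m ⊕ Fin m) →+* Sym (Std m)) (cf gl gr j) := fun j =>
    ((stdCoords m).dickson_eq j).trans ((stdCoords m).equiv_cf j).symm
  rw [(stdCoords m).Qminus_eq, ← (stdCoords m).equiv_Qp,
    eq_sum_of_spX_eq (card_fin m) (alpha_spec m).2, pmap_sum]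
  refine sum_congr rfl fun l _ => ?_
  rw [pmap_mul, pmap_pow, map_C, hd, spec_eq_map]

end AlphaSpec

section Weights

/-- The weights of the variables of `XiRing`. -/
abbrev wX (k : ℕ) : ℕ := 2 ^ k + 1

/-- The polynomial `p` in the `ξ`'s is homogeneous of degree `d`. -/
abbrev WH (p : XiRing) (d : ℕ) : Prop := IsWH wX p d

/-- The homogeneous component of degree `d`. -/
abbrev whc (d : ℕ) (p : XiRing) : XiRing := MvPolynomial.weightedHomogeneousComponent wX d p

section Scaling

variable {σ : Type*} (w : σ → ℕ)

/-- The homomorphism that multiplies a homogeneous element of degree `d` by `T^d`. -/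
def scaleHom : Poly σ →ₐ[F₂] (Poly σ)[X] :=
  maeval fun k => C (mX k) * X ^ w k

theorem scaleHom_monomial (s : σ →₀ ℕ) (c : F₂) : scaleHom w (mmonomial s c) =
    C (mmonomial s c) * X ^ weight w s := by
  rw [scaleHom, MvPolynomial.aeval_monomial, MvPolynomial.monomial_eq, C_mul, mul_assoc]
  congr 1
  rw [Finsupp.prod, Finsupp.prod, map_prod, weight_apply, Finsupp.sum,
    ← Finset.prod_pow_eq_pow_sum, ← prod_mul_distrib]
  refine prod_congr rfl fun k _ => ?_
  rw [mul_pow, C_pow, ← pow_mul, smul_eq_mul, mul_comm (s k)]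

theorem coeff_scaleHom (p : Poly σ) (d : ℕ) :
    (scaleHom w p).coeff d = MvPolynomial.weightedHomogeneousComponent w d p := by
  classical
  induction p using MvPolynomial.induction_on' with
  | add p q hp hq =>
    rw [map_add, coeff_add, hp, hq]
    exact (map_add (MvPolynomial.weightedHomogeneousComponent w d) p q).symm
  | monomial s c =>
    rw [scaleHom_monomial, coeff_C_mul_X_pow]
    ext t
    rw [MvPolynomial.coeff_weightedHomogeneousComponent]
    by_cases h : t = s
    · subst h
      split_ifs with h1 h2 h2
      · rfl
      · exact absurd h1.symm h2
      · exact absurd h2.symm h1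
      · exact MvPolynomial.coeff_zero _
    · rw [mcoeff_monomial, if_neg (Ne.symm h), ite_self]
      split_ifs
      · rw [mcoeff_monomial, if_neg (Ne.symm h)]
      · exact MvPolynomial.coeff_zero _

theorem scaleHom_eq_iff {p : Poly σ} {d : ℕ} :
    scaleHom w p = C p * X ^ d ↔ IsWH w p d := by
  constructor
  · intro h
    have h1 := congrArg (fun F => Polynomial.coeff F d) h
    simp only [coeff_scaleHom, coeff_C_mul_X_pow, if_true] at h1
    rw [← h1]
    exact MvPolynomial.weightedHomogeneousComponent_mem w p d
  · intro h
    ext1 e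
    rw [coeff_scaleHom, coeff_C_mul_X_pow]
    split_ifs with h1
    · rw [h1]; exact h.weightedHomogeneousComponent_same
    · exact h.weightedHomogeneousComponent_ne _ h1

end Scaling

/-- The homomorphism that multiplies a homogeneous element of degree `d` by `T^d`. -/
abbrev scXi : XiRing →ₐ[F₂] XiRing[X] := scaleHom wX

theorem coeff_scXi (p : XiRing) (d : ℕ) : (scXi p).coeff d = whc d p := coeff_scaleHom wX p d

theorem scXi_eq_iff {p : XiRing} {d : ℕ} : scXi p = C p * X ^ d ↔ WH p d := scaleHom_eq_iff wX

theorem whc_mem_supported {p : XiRing} {s : Set ℕ} (hp : p ∈ supported F₂ s)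
    (d : ℕ) : whc d p ∈ supported F₂ s := by
  rw [MvPolynomial.mem_supported] at hp ⊢
  refine subset_trans ?_ hp
  intro k hk
  obtain ⟨t, ht, hkt⟩ := (mem_vars_iff_mem_support _).mp hk
  refine (mem_vars_iff_mem_support _).mpr ⟨t, ?_, hkt⟩
  rw [mmem_support, MvPolynomial.coeff_weightedHomogeneousComponent] at ht
  rw [mmem_support]
  split_ifs at ht with h
  · exact ht
  · exact absurd rfl ht

theorem WH.mem_supported {p : XiRing} {d N : ℕ} (hp : WH p d) (h : d < 2 ^ (N + 1) + 1) :
    p ∈ supported F₂ (Iic N) := by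
  rw [MvPolynomial.mem_supported]
  intro k hk
  obtain ⟨t, ht, hkt⟩ := (mem_vars_iff_mem_support _).mp hk
  have h1 := hp (MvPolynomial.mem_support_iff.mp ht)
  have h2 : wX k ≤ weight wX t :=
    (Nat.le_mul_of_pos_left _ (Nat.pos_of_ne_zero (Finsupp.mem_support_iff.mp hkt))).trans
      (Finset.single_le_sum (f := fun i => t i • wX i) (fun _ _ => Nat.zero_le _) hkt)
  by_contra hlt
  have h3 : 2 ^ (N + 1) ≤ 2 ^ k := pow_le_pow_right (by omega) (by
    simp only [Set.mem_Iic] at hlt; omega)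
  simp only [wX] at h2
  omega

theorem WH.eq_C {p : XiRing} (hp : WH p 0) : ∃ r, p = mC r := by
  have h := hp.weightedHomogeneousComponent_same
  rw [MvPolynomial.weightedHomogeneousComponent_zero] at h
  · exact ⟨_, h.symm⟩
  · intro k; simp

variable {A : Type*} [CommRing A] [Algebra F₂ A] [CharP A 2]
variable {κ : Type*} [Fintype κ] [DecidableEq κ] (a b : κ → A) (z : A) {m : ℕ}

theorem scale_gram (k : ℕ) : gram (fun i => C (a i) * X) (fun i => C (b i) * X) k =
    C (gram a b k) * X ^ wX k := by
  rw [gram, gram, map_sum, sum_mul]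
  refine sum_congr rfl fun i _ => ?_
  simp only [mul_pow, C_add, C_mul, C_pow, wX, pow_succ]
  ring

theorem scale_lin {ι : Type*} [Fintype ι] (x : ι → A) (v : ι → F₂) :
    lin (fun i => C (x i) * X) v = C (lin x v) * X := by
  rw [lin, lin, map_sum, sum_mul]
  refine sum_congr rfl fun i _ => ?_
  rw [← smul_C, smul_mul_assoc]

theorem scale_sumElim : Sum.elim (fun i => C (a i) * X) (fun i => C (b i) * X) =
    fun i => C (Sum.elim a b i) * X := by
  ext1 i; cases i <;> rfl

theorem scale_evXi (p : XiRing) : evXi (fun i => C (a i) * X) (fun i => C (b i) * X)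
    (C z * X ^ 2) p = (scXi p).map (evXi a b z : XiRing →+* A) := by
  have h : evXi (fun i => C (a i) * X) (fun i => C (b i) * X) (C z * X ^ 2) =
      (mapAlgHom (evXi a b z)).comp scXi := by
    ext1 k
    have h1 : (mapAlgHom (evXi a b z)).comp scXi (mX k) =
        C (evXi a b z (mX k)) * X ^ wX k := by
      rw [comp_apply, scXi, scaleHom, maeval_X, map_mul, map_pow]
      exact congrArg₂ (· * ·) (map_C _) (congrArg (· ^ _) (map_X _))
    rw [h1]
    rcases k with _ | k
    · rw [evXi_X_zero, evXi_X_zero]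
      rfl
    · rw [evXi_X _ _ _ k.succ_ne_zero, evXi_X _ _ _ k.succ_ne_zero, scale_gram]
  exact dcongr_fun h p

theorem WH.scale {p : XiRing} {d : ℕ} (hp : WH p d) : evXi (fun i => C (a i) * X)
    (fun i => C (b i) * X) (C z * X ^ 2) p = C (evXi a b z p) * X ^ d := by
  rw [scale_evXi, scXi_eq_iff.mpr hp, pmap_mul, map_C, pmap_pow, map_X]
  rfl

theorem scale_cf (hm : card κ = m) {j : ℕ} (hj : j ≤ 2 * m) :
    cf (fun i => C (a i) * X) (fun i => C (b i) * X) j =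
      C (cf a b j) * X ^ (2 ^ (2 * m) - 2 ^ j) := by
  have h1 : (dick fun i => C (Sum.elim a b i) * (X : A[X])).comp (C X * X) =
      C (X ^ 2 ^ (2 * m)) * (dick (Sum.elim a b)).map C := by
    rw [dick, dick, prod_comp, pmap_prod]
    have hc : (univ : Finset (κ ⊕ κ → F₂)).card = 2 ^ (2 * m) := by
      rw [Finset.card_univ, Fintype.card_fun, ZMod.card, card_sum, hm, two_mul]
    rw [C_pow, ← hc, ← prod_const, ← prod_mul_distrib]
    refine prod_congr rfl fun v _ => ?_
    rw [scale_lin, add_comp, X_comp, C_comp, pmap_add, map_X, map_C, C_mul]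
    ring
  have h2 := congrArg (fun F => Polynomial.coeff F (2 ^ j)) h1
  simp only [comp_C_mul_X_coeff, coeff_C_mul, coeff_map] at h2
  have hle : 2 ^ j ≤ 2 ^ (2 * m) := pow_le_pow_right (by omega) hj
  have h3 : cf (fun i => C (a i) * X) (fun i => C (b i) * X) j * X ^ 2 ^ j =
      C (cf a b j) * X ^ (2 ^ (2 * m) - 2 ^ j) * X ^ 2 ^ j := by
    rw [mul_assoc, ← pow_add, Nat.sub_add_cancel hle, cf, scale_sumElim, mul_comm (C _)]
    exact h2
  exact (monic_X_pow (2 ^ j)).isRegular.right h3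

theorem card_arf_eq (hm : card κ = m) :
    2 * (Finset.univ.filter fun w : κ ⊕ κ → F₂ => arf w = 1).card = 2 ^ (2 * m) - 2 ^ m := by
  subst hm
  rcases card_arf_eq_one (κ := κ) with h | h
  · rcases Nat.eq_zero_or_pos (card κ) with h0 | h0
    · rw [h0] at h ⊢
      simp only [mul_zero, Nat.zero_sub, pow_zero] at h ⊢
      omega
    · have h1 : 2 ^ (2 * card κ) = 2 * 2 ^ (2 * card κ - 1) := by
        rw [← pow_succ']; congr 1; omega
      have h2 : 2 ^ card κ = 2 * 2 ^ (card κ - 1) := by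
        rw [← pow_succ']; congr 1; omega
      omega
  · have : IsEmpty κ := Fintype.card_eq_zero_iff.mp h
    rw [h, Finset.filter_eq_empty_iff.mpr]
    · simp
    · intro w _
      simp [arf]

theorem scale_eval_Qp (hm : card κ = m) :
    (Qp 1 (fun i => C (a i) * X) (fun i => C (b i) * X)).eval (C z * X ^ 2) =
      C ((Qp 1 a b).eval z) * X ^ (2 ^ (2 * m) - 2 ^ m) := by
  rw [← card_arf_eq hm, pow_mul, ← prod_const, Qp, Qp, eval_prod, eval_prod, map_prod,
    ← prod_mul_distrib]
  refine prod_congr rfl fun v _ => ?_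
  have hq : qf (fun i => C (a i) * (X : A[X])) (fun i => C (b i) * X) = C (qf a b) * X ^ 2 := by
    rw [qf, qf, map_sum, sum_mul]
    exact sum_congr rfl fun i _ => by rw [C_mul]; ring
  rw [eval_add, eval_X, eval_C, eval_add, eval_X, eval_C, scale_sumElim, scale_lin, hq]
  simp only [C_add, C_pow]
  ring

theorem WH.of_scale (hm : card κ = m) {p : XiRing}
    (hp : p ∈ supported F₂ (Iic (2 * m))) {d : ℕ}
    (h : evXi (fun i : κ => C (C (gl i)) * X) (fun i => C (C (gr i)) * X) (C X * X ^ 2) p =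
      C (spX κ p) * X ^ d) : WH p d := by
  rw [scale_evXi] at h
  have h1 := congrArg (fun F => Polynomial.coeff F d) h
  simp only [coeff_map, coeff_C_mul_X_pow, if_true, coeff_scXi] at h1
  have h2 := spX_injective hm (whc_mem_supported hp d) hp h1
  rw [← h2]
  exact MvPolynomial.weightedHomogeneousComponent_mem wX p d

theorem scale_evXi_E (hm : card κ = m)
    (hK : ∀ i j, WH (K m i j) (2 ^ (m + (j : ℕ)) - 2 ^ (i : ℕ))) (i : Fin m) :
    evXi (fun i => C (a i) * X) (fun i => C (b i) * X) (C z * X ^ 2) (E m i) =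
      C (evXi a b z (E m i)) * X ^ (2 ^ (2 * m) - 2 ^ (i : ℕ)) := by
  rw [evXi_E _ _ _ hm, evXi_E _ _ _ hm, scale_cf _ _ hm (by omega), C_add, map_sum, add_mul,
    sum_mul]
  congr 1
  refine sum_congr rfl fun j _ => ?_
  rw [(hK i j).scale, scale_cf _ _ hm (by omega), C_mul]
  have h1 : 2 ^ (i : ℕ) ≤ 2 ^ (m + (j : ℕ)) := pow_le_pow_right (by omega) (by omega)
  have h2 : 2 ^ (m + (j : ℕ)) ≤ 2 ^ (2 * m) :=
    pow_le_pow_right (by omega) (by omega)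
  rw [show 2 ^ (2 * m) - 2 ^ (i : ℕ) = (2 ^ (m + (j : ℕ)) - 2 ^ (i : ℕ)) +
    (2 ^ (2 * m) - 2 ^ (m + (j : ℕ))) by omega, pow_add]
  ring

theorem scale_evXi_alpha (hm : card κ = m)
    (ih : ∀ l < m, WH (alpha l) (2 ^ (2 * l) - 2 ^ l)) :
    evXi (fun i => C (a i) * X) (fun i => C (b i) * X) (C z * X ^ 2) (alpha m) =
      C (evXi a b z (alpha m)) * X ^ (2 ^ (2 * m) - 2 ^ m) := by
  have h1 := scale_eval_Qp a b z hm
  rw [eval_Qp _ _ _ hm, eval_Qp _ _ _ hm, sum_range_succ, sum_range_succ,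
    Nat.sub_self, pow_zero, pow_one, pow_one, ← two_mul, cf_top _ _ hm, cf_top _ _ hm, one_mul,
    one_mul, C_add, add_mul, map_sum, sum_mul] at h1
  have h2 : ∀ {x y u v : A[X]}, x + y = u + v → x = u → y = v := fun h e => by
    rw [e] at h; exact add_left_cancel h
  refine h2 h1 (sum_congr rfl fun l hl => ?_)
  have hl := Finset.mem_range.mp hl
  rw [(ih l hl).scale, scale_cf _ _ hm (by omega), mul_pow, C_mul, C_pow, ← pow_mul,
    Nat.sub_mul, ← pow_add, ← pow_add]
  have e1 : 2 * l + (m - l) = m + l := by omega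
  have e2 : l + (m - l) = m := by omega
  have h1 : 2 ^ m ≤ 2 ^ (m + l) := pow_le_pow_right (by omega) (by omega)
  have h2 : 2 ^ (m + l) ≤ 2 ^ (2 * m) := pow_le_pow_right (by omega) (by omega)
  rw [e1, e2, show 2 ^ (2 * m) - 2 ^ m = (2 ^ (2 * m) - 2 ^ (m + l)) + (2 ^ (m + l) - 2 ^ m) by
    omega, pow_add]
  ring

theorem wh_K_E (m : ℕ) : (∀ i j, WH (K m i j) (2 ^ (m + (j : ℕ)) - 2 ^ (i : ℕ))) ∧
    ∀ i, WH (E m i) (2 ^ (2 * m) - 2 ^ (i : ℕ)) := by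
  induction m with
  | zero => exact ⟨fun i => i.elim0, fun i => i.elim0⟩
  | succ m ih =>
    have hK : ∀ i j, WH (K (m + 1) i j) (2 ^ (m + 1 + (j : ℕ)) - 2 ^ (i : ℕ)) := by
      intro i j
      rw [K_succ, stepK, of_apply]
      refine Fin.cases ?_ (fun i => ?_) i
      · exact isWH_zero _ _ _
      refine Fin.lastCases ?_ (fun j => ?_) j
      · rw [Fin.cases_succ, Fin.lastCases_last]
        convert (ih.2 i).pow 2 using 1
        rw [val_last, val_succ, smul_eq_mul, Nat.mul_sub, ← pow_succ', ← pow_succ']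
        congr 2
        ring
      · rw [Fin.cases_succ, Fin.lastCases_castSucc]
        convert (ih.1 i j).pow 2 using 1
        rw [Fin.val_castSucc, val_succ, smul_eq_mul, Nat.mul_sub, ← pow_succ', ← pow_succ']
        congr 2
        ring
    refine ⟨hK, fun i => WH.of_scale (κ := Fin (m + 1)) (card_fin _)
      (supp1_le _ ((E_spec (m + 1)).1 i)) ?_⟩
    exact scale_evXi_E _ _ _ (card_fin _) hK i

theorem wh_alpha (m : ℕ) : WH (alpha m) (2 ^ (2 * m) - 2 ^ m) := by
  induction m using Nat.strong_induction_on with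
  | _ m ih =>
    refine WH.of_scale (κ := Fin m) (card_fin _) (alpha_mem m) ?_
    exact scale_evXi_alpha _ _ _ (card_fin _) ih

end Weights

section Grading

theorem aeval_mem_graded {σ B : Type*} [CommRing B] [Algebra F₂ B]
    (G : ℕ → Submodule F₂ B) [SetLike.GradedMonoid G] {w : σ → ℕ} {f : σ → B}
    (hf : ∀ i, f i ∈ G (w i)) {p : Poly σ} {d : ℕ}
    (hp : IsWH w p d) : maeval f p ∈ G d := by
  induction hp using MvPolynomial.IsWeightedHomogeneous.induction_on with
  | zero => rw [map_zero]; exact zero_mem _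
  | add p q hp hq h1 h2 => rw [map_add]; exact add_mem h1 h2
  | monomial s r hr =>
    rw [MvPolynomial.aeval_monomial, ← smul_def]
    refine smul_mem _ _ ?_
    rw [← hr, weight_apply]
    exact SetLike.prod_pow_mem_graded G w f s fun k _ => hf k

/-- The polynomials in `t` over the `ξ`'s, homogeneous of degree `d` when `t` has degree one. -/
def tGrade (d : ℕ) : Submodule F₂ XiRing[X] where
  carrier := {f | ∀ e, (e ≤ d → WH (f.coeff e) (d - e)) ∧ (d < e → f.coeff e = 0)}
  zero_mem' := fun e => ⟨fun _ => by
    rw [coeff_zero]; exact isWH_zero _ _ _, fun _ => coeff_zero _⟩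
  add_mem' := fun hf hg e => ⟨fun h => by rw [coeff_add]; exact ((hf e).1 h).add ((hg e).1 h),
    fun h => by rw [coeff_add, (hf e).2 h, (hg e).2 h, add_zero]⟩
  smul_mem' := fun c f hf e => ⟨fun h => by
    rw [coeff_smul]
    exact (weightedHomogeneousSubmodule F₂ wX (d - e)).smul_mem c ((hf e).1 h),
    fun h => by rw [coeff_smul, (hf e).2 h, smul_zero]⟩

instance : SetLike.GradedMonoid tGrade where
  one_mem := fun e => ⟨fun h => by
    obtain rfl := Nat.le_zero.mp h
    rw [coeff_one_zero]
    exact isWH_one _ _, fun h => by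
    rw [coeff_one, if_neg (by omega)]⟩
  mul_mem := fun {d d'} f g hf hg e => by
    refine ⟨fun h => ?_, fun h => ?_⟩
    · rw [coeff_mul]
      refine MvPolynomial.IsWeightedHomogeneous.sum _ _ _ fun x hx => ?_
      have hx := Finset.HasAntidiagonal.mem_antidiagonal.mp hx
      rcases Nat.lt_or_ge d x.1 with h1 | h1
      · rw [(hf x.1).2 h1, zero_mul]
        exact isWH_zero _ _ _
      rcases Nat.lt_or_ge d' x.2 with h2 | h2
      · rw [(hg x.2).2 h2, mul_zero]
        exact isWH_zero _ _ _
      convert ((hf x.1).1 h1).mul ((hg x.2).1 h2) using 1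
      omega
    · rw [coeff_mul]
      refine sum_eq_zero fun x hx => ?_
      have hx := Finset.HasAntidiagonal.mem_antidiagonal.mp hx
      rcases Nat.lt_or_ge d x.1 with h1 | h1
      · rw [(hf x.1).2 h1, zero_mul]
      · rw [(hg x.2).2 (by omega), mul_zero]

theorem alphaT_mem (m : ℕ) : alphaT m ∈ tGrade (2 ^ (2 * m) - 2 ^ m) := by
  refine aeval_mem_graded tGrade (fun k => ?_) (wh_alpha m)
  have hC : ∀ k, C (mX k : XiRing) ∈ tGrade (wX k) := fun k e => by
    rw [coeff_C]
    refine ⟨fun h => ?_, fun h => by rw [if_neg (by omega)]⟩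
    split_ifs with h0
    · rw [h0, Nat.sub_zero]
      exact isWH_X _ _ _
    · exact isWH_zero _ _ _
  split_ifs with h
  · subst h
    refine add_mem (fun e => ⟨fun h => ?_, fun h => ?_⟩) (hC 0)
    · rw [coeff_X_pow]
      split_ifs with h0
      · rw [h0]
        exact isWH_one _ _
      · exact isWH_zero _ _ _
    · rw [coeff_X_pow, if_neg]
      intro h0
      rw [h0] at h
      simp [wX] at h
  · exact hC k

variable {A : Type*} [CommRing A] [Algebra F₂ A] [CharP A 2]
variable {κ : Type*} [Fintype κ] [DecidableEq κ] (a b : κ → A) (z : A) {m : ℕ}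

theorem map_alphaT (l : ℕ) : (alphaT l).map (evXi a b z : XiRing →+* A) =
    evXi (fun i => C (a i)) (fun i => C (b i)) (X ^ 2 + C z) (alpha l) := by
  have h : (mapAlgHom (evXi a b z)).comp (maeval (fun i : ℕ =>
      if i = 0 then Polynomial.X ^ 2 + Polynomial.C (mX 0 : XiRing)
      else Polynomial.C (mX i))) =
      evXi (fun i => C (a i)) (fun i => C (b i)) (X ^ 2 + C z) := by
    ext1 k
    rw [comp_apply, maeval_X]
    rcases k with _ | k
    · rw [if_pos rfl, evXi_X_zero]
      change Polynomial.map _ _ = _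
      rw [pmap_add, pmap_pow, map_X, map_C]
      exact congrArg (fun y => X ^ 2 + C y) (evXi_X_zero a b z)
    · rw [if_neg k.succ_ne_zero, evXi_X _ _ _ k.succ_ne_zero]
      change Polynomial.map _ _ = _
      rw [map_C]
      refine (congrArg C (evXi_X a b z k.succ_ne_zero)).trans ?_
      exact map_gram (CAlgHom (R := F₂)) a b _
  exact dcongr_fun h (alpha l)

theorem coeff_pow_two_pow (f : A[X]) (n e : ℕ) :
    (f ^ 2 ^ n).coeff (e * 2 ^ n) = f.coeff e ^ 2 ^ n := by
  rw [← map_iterateFrobenius_expand (p := 2), coeff_map, coeff_expand_mul (by positivity),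
    iterateFrobenius_def]

theorem Qp_comp_eq (hm : card κ = m) : (Qp 1 a b).comp (X ^ 2 + C z) =
    ∑ l ∈ range (m + 1), C (cf a b (m + l)) *
      (alphaT l).map (evXi a b z : XiRing →+* A) ^ 2 ^ (m - l) := by
  have h := eval_Qp (fun i => C (a i)) (fun i => C (b i)) (X ^ 2 + C z) hm
  have h1 : Qp 1 (fun i => C (a i)) (fun i => C (b i)) = (Qp 1 a b).map C :=
    (map_Qp (CAlgHom (R := F₂)) 1 a b).symm
  have h2 : ∀ j, cf (fun i => C (a i)) (fun i => C (b i)) j = C (cf a b j) := fun j =>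
    (map_cf (CAlgHom (R := F₂)) a b j).symm
  rw [h1, eval_map] at h
  simp only [h2, ← map_alphaT] at h
  exact h

theorem two_pow_sub_mul {m k l : ℕ} (h : l ≤ m) :
    2 ^ (m + k) - 2 ^ m = (2 ^ (k + l) - 2 ^ l) * 2 ^ (m - l) := by
  rw [Nat.sub_mul, ← pow_add, ← pow_add]
  congr 2 <;> omega

theorem coeff_Qp_comp (hm : card κ = m) (k : ℕ) :
    ((Qp 1 a b).comp (X ^ 2 + C z)).coeff (2 ^ (m + k) - 2 ^ m) =
    ∑ l ∈ range (m + 1), cf a b (m + l) *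
      evXi a b z ((alphaT l).coeff (2 ^ (k + l) - 2 ^ l)) ^ 2 ^ (m - l) := by
  rw [Qp_comp_eq a b z hm, finsetSum_coeff]
  refine sum_congr rfl fun l hl => ?_
  have hl := Finset.mem_range.mp hl
  rw [coeff_C_mul, two_pow_sub_mul (show l ≤ m by omega), coeff_pow_two_pow, coeff_map]
  rfl

theorem Qp_comp_monic [Nontrivial A] (hm : card κ = m) :
    ((Qp 1 a b).comp (X ^ 2 + C z)).Monic ∧
      ((Qp 1 a b).comp (X ^ 2 + C z)).natDegree = 2 ^ (2 * m) - 2 ^ m := by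
  have h : ((Qp 1 a b).comp (X ^ 2 + C z)) = ∏ v ∈ Finset.univ.filter
      (fun v : κ ⊕ κ → F₂ => arf v = 1),
      (X ^ 2 + C (z + (qf a b + lin (Sum.elim a b) v ^ 2))) := by
    rw [Qp, prod_comp]
    refine prod_congr rfl fun v _ => ?_
    rw [add_comp, X_comp, C_comp, add_assoc, ← C_add]
  rw [h]
  refine ⟨monic_prod_of_monic _ _ fun _ _ => monic_X_pow_add_C _ two_ne_zero, ?_⟩
  rw [natDegree_prod_of_monic _ _ fun _ _ => monic_X_pow_add_C _ two_ne_zero, ← card_arf_eq hm]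
  rw [sum_congr rfl fun _ _ => natDegree_X_pow_add_C, Finset.sum_const, smul_eq_mul, mul_comm]

theorem coeff_alphaT_of_lt {l k : ℕ} (h : l < k) :
    (alphaT l).coeff (2 ^ (k + l) - 2 ^ l) = 0 := by
  refine (alphaT_mem l _).2 ?_
  have h1 : 2 ^ (2 * l) < 2 ^ (k + l) := pow_lt_pow_right (by omega) (by omega)
  have h2 : 2 ^ l ≤ 2 ^ (2 * l) := pow_le_pow_right (by omega) (by omega)
  omega

theorem wh_coeff_alphaT {l k : ℕ} (h : k ≤ l) :
    WH ((alphaT l).coeff (2 ^ (k + l) - 2 ^ l)) (2 ^ (2 * l) - 2 ^ (k + l)) := by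
  have h1 : 2 ^ (k + l) ≤ 2 ^ (2 * l) := pow_le_pow_right (by omega) (by omega)
  have h2 : 2 ^ l ≤ 2 ^ (k + l) := pow_le_pow_right (by omega) (by omega)
  convert (alphaT_mem l (2 ^ (k + l) - 2 ^ l)).1 (by omega) using 1
  omega

theorem coeff_alphaT_top (m : ℕ) : (alphaT m).coeff (2 ^ (m + m) - 2 ^ m) = 1 := by
  have hm : card (Fin m) = m := card_fin m
  have h := coeff_Qp_comp (gl : Fin m → CoordRing (Fin m ⊕ Fin m)) gr 0 hm m
  obtain ⟨h1, h2⟩ := Qp_comp_monic (gl : Fin m → CoordRing (Fin m ⊕ Fin m)) gr 0 hm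
  rw [← two_mul, ← h2, h1.coeff_natDegree, sum_range_succ, sum_eq_zero, zero_add,
    Nat.sub_self, pow_zero, pow_one, ← two_mul, cf_top _ _ hm, one_mul] at h
  · have h3 := wh_coeff_alphaT (le_refl m)
    rw [← two_mul, Nat.sub_self] at h3
    obtain ⟨r, hr⟩ := h3.eq_C
    rw [← two_mul, hr]
    rw [hr, ← MvPolynomial.algebraMap_eq, AlgHom.commutes] at h
    have : r = 1 := (algebraMap F₂ (CoordRing (Fin m ⊕ Fin m))).injective (by
      rw [← h, map_one])
    rw [this, MvPolynomial.C_1]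
  · intro l hl
    rw [coeff_alphaT_of_lt (Finset.mem_range.mp hl), map_zero, zero_pow (by positivity), mul_zero]

theorem Umat_of_lt {n : ℕ} {k l : Fin n} (h : l < k) : Umat n k l = 0 := by
  rw [Umat, of_apply, coeff_alphaT_of_lt h, zero_pow (by positivity)]

theorem Umat_diag {n : ℕ} (k : Fin n) : Umat n k k = 1 := by
  rw [Umat, of_apply, coeff_alphaT_top, one_pow]

theorem wh_Umat {n : ℕ} (k l : Fin n) :
    WH (Umat n k l) (2 ^ (n - 1 + (l : ℕ)) - 2 ^ (n - 1 + (k : ℕ))) := by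
  rcases lt_or_ge l k with h | h
  · rw [Umat_of_lt h]
    exact isWH_zero _ _ _
  · have h1 := (wh_coeff_alphaT (Fin.le_def.mp h)).pow (2 ^ (n - 1 - (l : ℕ)))
    have hl := l.2
    rwa [smul_eq_mul, mul_comm, Nat.sub_mul, ← pow_add, ← pow_add,
      show 2 * (l : ℕ) + (n - 1 - l) = n - 1 + l by omega,
      show (k : ℕ) + l + (n - 1 - l) = n - 1 + k by omega] at h1

theorem det_Umat (n : ℕ) : (Umat n).det = 1 := by
  have hU : (Umat n).IsUpperTriangular := fun k l h => Umat_of_lt h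
  rw [Matrix.det_of_isUpperTriangular hU]
  exact Finset.prod_eq_one fun k _ => Umat_diag k

theorem Umat_mul_J (n : ℕ) : Umat n * J n = 1 :=
  Matrix.mul_nonsing_inv _ (by rw [det_Umat]; exact isUnit_one)

theorem J_mul_Umat (n : ℕ) : J n * Umat n = 1 :=
  Matrix.nonsing_inv_mul _ (by rw [det_Umat]; exact isUnit_one)

theorem J_scale {n : ℕ} (k l : Fin n) : C (J n k l) * X ^ 2 ^ (n - 1 + (l : ℕ)) =
    X ^ 2 ^ (n - 1 + (k : ℕ)) * scXi (J n k l) := by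
  let D : Matrix (Fin n) (Fin n) XiRing[X] := Matrix.diagonal fun k => X ^ 2 ^ (n - 1 + (k : ℕ))
  let sU := (Umat n).map scXi
  let sJ := (J n).map scXi
  let cU := (Umat n).map (C : XiRing →+* XiRing[X])
  let cJ := (J n).map (C : XiRing →+* XiRing[X])
  have h1 : D * sU = cU * D := by
    ext1 k l
    rw [Matrix.diagonal_mul, Matrix.mul_diagonal]
    change X ^ _ * scXi (Umat n k l) = C (Umat n k l) * X ^ _
    rw [scXi_eq_iff.mpr (wh_Umat k l)]
    rcases lt_or_ge l k with h | h
    · rw [Umat_of_lt h, C_0, zero_mul, zero_mul, mul_zero]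
    · have : 2 ^ (n - 1 + (k : ℕ)) ≤ 2 ^ (n - 1 + (l : ℕ)) :=
        pow_le_pow_right (by omega) (by have := Fin.le_def.mp h; omega)
      rw [mul_left_comm, ← pow_add, Nat.add_sub_cancel' this]
  have h2 : sU * sJ = 1 := by
    rw [← Matrix.map_mul, Umat_mul_J, Matrix.map_one _ (map_zero _) (map_one _)]
  have h3 : cJ * cU = 1 := by
    rw [← Matrix.map_mul, J_mul_Umat, Matrix.map_one _ (map_zero _) (map_one _)]
  have h4 : cJ * D = D * sJ := by
    calc cJ * D = cJ * D * (sU * sJ) := by rw [h2, mul_one]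
      _ = cJ * (D * sU) * sJ := by simp only [mul_assoc]
      _ = (cJ * cU) * D * sJ := by rw [h1]; simp only [mul_assoc]
      _ = D * sJ := by rw [h3, one_mul]
  have h5 := congrFun (congrFun h4 k) l
  rwa [Matrix.mul_diagonal, Matrix.diagonal_mul] at h5

theorem J_of_lt {n : ℕ} {k l : Fin n} (h : l < k) : J n k l = 0 := by
  have h1 := congrArg (fun F => Polynomial.coeff F (2 ^ (n - 1 + (l : ℕ)))) (J_scale k l)
  have h2 : 2 ^ (n - 1 + (l : ℕ)) < 2 ^ (n - 1 + (k : ℕ)) :=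
    pow_lt_pow_right (by omega) (by have := Fin.lt_def.mp h; omega)
  simpa only [mul_comm (X ^ _) _, coeff_mul_X_pow', le_refl, if_true, Nat.sub_self, coeff_C_zero,
    not_le.mpr h2, if_false] using h1

theorem wh_J {n : ℕ} (k l : Fin n) :
    WH (J n k l) (2 ^ (n - 1 + (l : ℕ)) - 2 ^ (n - 1 + (k : ℕ))) := by
  rcases lt_or_ge l k with h | h
  · rw [J_of_lt h]
    exact isWH_zero _ _ _
  · have h1 : 2 ^ (n - 1 + (k : ℕ)) ≤ 2 ^ (n - 1 + (l : ℕ)) :=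
      pow_le_pow_right (by omega) (by have := Fin.le_def.mp h; omega)
    rw [← scXi_eq_iff]
    refine (monic_X_pow (2 ^ (n - 1 + (k : ℕ)))).isRegular.left ?_
    change X ^ _ * _ = X ^ _ * _
    rw [← J_scale, mul_left_comm, ← pow_add, Nat.add_sub_cancel' h1]

theorem wh_symEntry (i j : ℕ) : WH (symEntry i j) (2 ^ i + 2 ^ j) := by
  have key : ∀ i j, i < j → WH (symEntry i j) (2 ^ i + 2 ^ j) := fun i j h => by
    rw [symEntry_of_lt h]
    convert (isWH_X F₂ wX (j - i)).pow (2 ^ i) using 1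
    rw [smul_eq_mul, wX, mul_add, ← pow_add, Nat.add_sub_cancel' h.le, mul_one, add_comm]
  rcases lt_trichotomy i j with h | rfl | h
  · exact key i j h
  · rw [symEntry_self]
    exact isWH_zero _ _ _
  · rw [symEntry_comm, add_comm]
    exact key j i h

theorem wv_of_gt {m k l : ℕ} (hk : k ≤ m) (h : m + k < l) : wv m k l = 0 := by
  rw [wv_of_le hk (by omega), if_neg (by omega)]

theorem wh_wv {m k : ℕ} (hk : k ≤ m) (l : ℕ) : WH (wv m k l) (2 ^ (m + k) - 2 ^ l) := by
  rcases Nat.lt_or_ge l m with h | h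
  · rcases hk.lt_or_eq with hk | rfl
    · exact K_eq_wv m ⟨l, h⟩ ⟨k, hk⟩ ▸ (wh_K_E m).1 ⟨l, h⟩ ⟨k, hk⟩
    · rw [wv_self, ← two_mul]
      exact (om_of_lt ⟨l, h⟩ : om k l = _) ▸ (wh_K_E k).2 ⟨l, h⟩
  · rw [wv_of_le hk h]
    split_ifs with h1
    · rw [h1, Nat.sub_self]
      exact isWH_one _ _
    · exact isWH_zero _ _ _

theorem wh_nrow {m i k : ℕ} (hk : k ≤ m) : WH (nrow m i k) (2 ^ i + 2 ^ (m + k)) := by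
  refine MvPolynomial.IsWeightedHomogeneous.sum _ _ _ fun l _ => ?_
  rcases Nat.lt_or_ge (m + k) l with h | h
  · rw [wv_of_gt hk h, mul_zero]
    exact isWH_zero _ _ _
  · convert (wh_symEntry i l).mul (wh_wv hk l) using 1
    have : 2 ^ l ≤ 2 ^ (m + k) := pow_le_pow_right (by omega) h
    omega

theorem wh_relMatrix_aux {m i k l d : ℕ} (h : k ≤ l) (hd : d = 2 ^ i + 2 ^ (m + l)) :
    2 ^ i + 2 ^ (m + k) + (2 ^ (m + l) - 2 ^ (m + k)) = d := by
  have : 2 ^ (m + k) ≤ 2 ^ (m + l) := pow_le_pow_right (by omega) (by omega)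
  omega

theorem sqrtXi_sq (a : XiRing) : sqrtXi (a ^ 2) = a := by
  have h : ∃ r : XiRing, r ^ 2 = a ^ 2 := ⟨a, rfl⟩
  rw [sqrtXi, dif_pos h]
  exact sq_injective h.choose_spec

theorem nrow_self (m i : ℕ) : nrow m i m =
    ∑ l : Fin m, symEntry i l * E m l + symEntry i (2 * m) := by
  have h0 : ∑ j : Fin m, symEntry i (m + j) * wv m m (m + j) = 0 := by
    refine sum_eq_zero fun j _ => ?_
    rw [wv_of_le le_rfl (by omega), if_neg (by omega), mul_zero]
  rw [nrow, sum_range_two_mul_succ, wv_of_le le_rfl (by omega : m ≤ 2 * m), if_pos (by omega),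
    mul_one, h0, add_zero]
  congr 1
  exact sum_congr rfl fun l _ => by rw [wv_self, om_of_lt]

theorem relMatrix_eq (m : ℕ) (i : Fin m) (l : Fin (m + 1)) :
    relMatrix (m + 1) i l = ∑ k : Fin (m + 1), nrow m i k * J (m + 1) k l := by
  rw [relMatrix, Matrix.mul_apply]
  refine sum_congr rfl fun k _ => ?_
  congr 1
  have hR : sqrtXi (R' (m + 1) i k) = symEntry i (m + k) := by
    rw [R', of_apply, show m + 1 + (k : ℕ) = m + k + 1 by ring, symEntry_succ, sqrtXi_sq]
  rw [Matrix.add_apply, map_apply, hR, LKE, of_apply]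
  split_ifs with h
  · exact (nrow_eq (p := m) (i := i) ⟨k, h⟩).symm
  · have hk : (k : ℕ) = m := by have := k.2; simp at h; omega
    rw [hk, nrow_self, ← two_mul]
    rfl

theorem wh_relMatrix (m : ℕ) (i : Fin m) (l : Fin (m + 1)) :
    WH (relMatrix (m + 1) i l) (2 ^ (i : ℕ) + 2 ^ (m + (l : ℕ))) := by
  rw [relMatrix_eq]
  refine MvPolynomial.IsWeightedHomogeneous.sum _ _ _ fun k _ => ?_
  rcases lt_or_ge l k with h | h
  · rw [J_of_lt h, mul_zero]
    exact isWH_zero _ _ _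
  · exact wh_relMatrix_aux (Fin.le_def.mp h) rfl ▸
      (wh_nrow (i := i) (Nat.lt_succ_iff.mp k.2)).mul (wh_J k l)

theorem wh_T (n : ℕ) (i j : Fin (n - 1)) : WH (T n i j) (2 ^ (i : ℕ) + 2 ^ (n + (j : ℕ))) := by
  rcases n with _ | m
  · exact i.elim0
  · have h := wh_relMatrix m i ⟨j + 1, by have := j.2; omega⟩
    rwa [show m + ((⟨j + 1, by have := j.2; omega⟩ : Fin (m + 1)) : ℕ) = m + 1 + j by
      simp only; ring] at h

theorem T_mem (n : ℕ) (i j : Fin (n - 1)) :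
    T n i j ∈ supported F₂ (Iic (2 * n - 2)) := by
  refine (wh_T n i j).mem_supported ?_
  have hi := i.2
  have hj := j.2
  have h1 : 2 ^ (i : ℕ) ≤ 2 ^ (2 * n - 2) := pow_le_pow_right (by omega) (by omega)
  have h2 : 2 ^ (n + (j : ℕ)) ≤ 2 ^ (2 * n - 2) := pow_le_pow_right (by omega) (by omega)
  rw [pow_succ]
  omega

theorem det_T_eq (m : ℕ) : (T (m + 1)).det = (Matrix.of fun i k : Fin (m + 1) =>
    Fin.cases (Umat (m + 1) 0 k) (fun i => nrow m i k) i).det := by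
  set Bd : Matrix (Fin (m + 1)) (Fin (m + 1)) XiRing := Matrix.of fun i k : Fin (m + 1) =>
    Fin.cases (Umat (m + 1) 0 k) (fun i => nrow m i k) i with hBd
  have hJ : (J (m + 1)).det = 1 := by
    have := congrArg det (Umat_mul_J (m + 1))
    rwa [det_mul, det_Umat, one_mul, Matrix.det_one] at this
  have h1 : Bd.det = (Bd * J (m + 1)).det := by rw [det_mul, hJ, mul_one]
  have h0 : ∀ j, (Bd * J (m + 1)) 0 j = if 0 = j then 1 else 0 := fun j =>
    congrFun (congrFun (Umat_mul_J (m + 1)) 0) j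
  rw [h1, Matrix.det_succ_row_zero, sum_eq_single 0]
  · rw [h0, if_pos rfl, Fin.val_zero, pow_zero, one_mul, one_mul]
    congr 1
    ext1 i j
    exact relMatrix_eq m i j.succ
  · intro j _ hj
    rw [h0, if_neg hj.symm, mul_zero, zero_mul]
  · exact fun h => absurd (mem_univ _) h

/-- The determinant of `T` becomes `c_0 Q^-` in a symplectic family of the right size. -/
theorem evXi_det_T (hm : card κ = m) :
    evXi a b z (T (m + 1)).det = cf a b 0 * (Qp 1 a b).eval z := by
  rw [det_T_eq, map_det]
  set M := (evXi a b z).mapMatrix (Matrix.of fun i k : Fin (m + 1) =>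
    Fin.cases (Umat (m + 1) 0 k) (fun i => nrow m i k) i) with hM
  let c : Fin (m + 1) → A := fun j => cf a b (m + j)
  have hrow0 : M.mulVec c 0 = (Qp 1 a b).eval z := by
    have h := coeff_Qp_comp a b z hm 0
    rw [add_zero, Nat.sub_self, coeff_zero_eq_eval_zero, eval_comp, eval_add, eval_pow, eval_X,
      eval_C, zero_pow two_ne_zero, zero_add] at h
    rw [h, ← Fin.sum_univ_eq_sum_range (fun l => cf a b (m + l) *
      evXi a b z ((alphaT l).coeff (2 ^ (0 + l) - 2 ^ l)) ^ 2 ^ (m - l))]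
    change ∑ l : Fin (m + 1), M 0 l * c l = _
    refine sum_congr rfl fun l _ => ?_
    change evXi a b z (Umat (m + 1) 0 l) * cf a b (m + l) = _
    rw [Umat, of_apply, map_pow, mul_comm]
    rfl
  have hrow : ∀ i : Fin m, M.mulVec c i.succ = 0 := by
    intro i
    change ∑ k : Fin (m + 1), evXi a b z (nrow m i k) * cf a b (m + k) = 0
    rw [Fin.sum_univ_castSucc, val_last, ← two_mul, cf_top _ _ hm, mul_one]
    simp only [Fin.val_castSucc]
    rw [sum_nrow_mul_cf a b z hm]
    refine CharTwo.add_eq_zero.mpr ?_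
    rw [nrow_self, map_add, map_sum]
    refine congrArg (· + _) (sum_congr rfl fun l _ => ?_)
    rw [map_mul, mul_comm]
  have h5 : M.adjugate.mulVec (M.mulVec c) = M.det • c := by
    rw [Matrix.mulVec_mulVec, Matrix.adjugate_mul, Matrix.smul_mulVec, Matrix.one_mulVec]
  have h6 := congrFun h5 (Fin.last m)
  have hc : c (Fin.last m) = 1 := by
    simp only [c, val_last]
    rw [← two_mul, cf_top _ _ hm]
  have hz : ∑ i : Fin m, M.adjugate (Fin.last m) i.succ * M.mulVec c i.succ = 0 :=
    sum_eq_zero fun i _ => by rw [hrow, mul_zero]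
  rw [Pi.smul_apply, hc, smul_eq_mul, mul_one, mulVec, dotProduct, Fin.sum_univ_succ,
    hz, add_zero, hrow0,
    Matrix.adjugate_fin_succ_eq_det_submatrix] at h6
  rw [← h6, neg_eq, one_pow, one_mul, ← evXi_det_nmat_eq a b z hm, map_det]
  congr 2
  ext1 i k
  simp only [Matrix.submatrix_apply, Fin.zero_succAbove, Fin.succAbove_last]
  rfl

theorem det_T_isOmegaMinus (m : ℕ) : IsOmegaMinus m (T (m + 1)).det := by
  have hd : C (dickson (Std m) 0) * Qminus (stdForm m) = (C (cf gl gr 0) * Qp 1 gl gr).map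
      ((stdCoords m).equiv : CoordRing (Fin m ⊕ Fin m) →+* Sym (Std m)) := by
    rw [pmap_mul, map_C, (stdCoords m).equiv_Qp, (stdCoords m).Qminus_eq,
      (stdCoords m).dickson_eq, ← (stdCoords m).equiv_cf]
    rfl
  rw [IsOmegaMinus, hd, isXiExpression_map_iff]
  refine ⟨det_mem_of_forall _ fun i j => T_mem (m + 1) i j, ?_⟩
  rw [spX, evXi_det_T _ _ _ (card_fin m)]
  have h1 : Qp 1 (fun i : Fin m => C (gl i)) (fun i => C (gr i)) = (Qp 1 gl gr).map C :=
    (map_Qp (CAlgHom (R := F₂)) 1 gl gr).symm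
  rw [h1, map_C_eval_X, map_cf_C]

end Grading

section SquareColumn

theorem squareColumn_eq (m : ℕ) (i : Fin m) : squareColumn (m + 1) i =
    ∑ l : Fin (m + 1), symEntry (i + 1) l * E (m + 1) l +
      ∑ k : Fin (m + 1), nrow m i k ^ 2 * F (m + 1) k := by
  have h : ∀ k : Fin (m + 1), (L' (m + 1) * K (m + 1) + R' (m + 1)) i k = nrow m i k ^ 2 :=
    fun k => by
      rw [← nrow_succ _ (Nat.lt_succ_iff.mp k.2)]
      exact (nrow_eq (p := m + 1) (i := i + 1) k).symm
  rw [squareColumn, Pi.add_apply, mulVec, mulVec, dotProduct, dotProduct]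
  simp only [h]
  rfl

theorem wh_V (n : ℕ) (k : Fin n) : WH (Vvec n k) (2 ^ (2 * n) - 2 ^ (n + (k : ℕ))) := by
  have h := wh_coeff_alphaT (l := n) (k := k) k.2.le
  rwa [add_comm (k : ℕ)] at h

theorem wh_F (n : ℕ) (k : Fin n) : WH (F n k) (2 ^ (2 * n) - 2 ^ (n + (k : ℕ))) := by
  refine MvPolynomial.IsWeightedHomogeneous.sum _ _ _ fun l _ => ?_
  change WH (J n k l ^ 2 * Vvec n l) _
  rcases lt_or_ge l k with h | h
  · rw [J_of_lt h, zero_pow two_ne_zero, zero_mul]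
    exact isWH_zero _ _ _
  convert ((wh_J k l).pow 2).mul (wh_V n l) using 1
  have hl := l.2
  have h1 : 2 ^ (n + (k : ℕ)) ≤ 2 ^ (n + (l : ℕ)) :=
    pow_le_pow_right (by omega) (by have := Fin.le_def.mp h; omega)
  have h2 : 2 ^ (n + (l : ℕ)) ≤ 2 ^ (2 * n) := pow_le_pow_right (by omega) (by omega)
  have h3 : ∀ j, 2 ^ (n + j) = 2 * 2 ^ (n - 1 + j) := fun j => by
    rw [← pow_succ']; congr 1; omega
  rw [smul_eq_mul, Nat.mul_sub, ← h3, ← h3]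
  omega

theorem wh_squareColumn (n : ℕ) (i : Fin (n - 1)) :
    WH (squareColumn n i) (2 * (2 ^ (2 * n - 1) + 2 ^ (i : ℕ))) := by
  rcases n with _ | m
  · exact i.elim0
  have hd : 2 * (2 ^ (2 * (m + 1) - 1) + 2 ^ (i : ℕ)) = 2 ^ (2 * (m + 1)) + 2 ^ ((i : ℕ) + 1) := by
    rw [mul_add, ← pow_succ', ← pow_succ', show 2 * (m + 1) - 1 + 1 = 2 * (m + 1) by omega]
  rw [squareColumn_eq, hd]
  refine .add (.sum _ _ _ fun l _ => ?_) (.sum _ _ _ fun k _ => ?_)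
  · convert (wh_symEntry ((i : ℕ) + 1) l).mul ((wh_K_E (m + 1)).2 l) using 1
    have : 2 ^ (l : ℕ) ≤ 2 ^ (2 * (m + 1)) := pow_le_pow_right (by omega) (by omega)
    omega
  · rw [← nrow_succ _ (Nat.lt_succ_iff.mp k.2)]
    convert (wh_nrow (i := (i : ℕ) + 1) k.2.le).mul (wh_F (m + 1) k) using 1
    have : 2 ^ (m + 1 + (k : ℕ)) ≤ 2 ^ (2 * (m + 1)) := pow_le_pow_right (by omega) (by omega)
    omega

theorem mul_le_weight {σ : Type*} (w : σ → ℕ) (s : σ →₀ ℕ) (k : σ) :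
    s k * w k ≤ weight w s := by
  rw [weight_apply]
  by_cases hk : s k = 0
  · rw [hk, zero_mul]; exact Nat.zero_le _
  · exact Finset.single_le_sum (f := fun k => s k • w k) (fun _ _ => Nat.zero_le _)
      (Finsupp.mem_support_iff.mpr hk)

theorem WH.degreeOf_le {p : XiRing} {d k j : ℕ} (hp : WH p d) (h : d < (j + 1) * wX k) :
    p.degreeOf k ≤ j := by
  rw [MvPolynomial.degreeOf_le_iff]
  intro s hs
  have h1 := hp (MvPolynomial.mem_support_iff.mp hs)
  have h2 := mul_le_weight wX s k
  rw [h1] at h2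
  by_contra! hc
  exact absurd (h.trans_le (Nat.mul_le_mul_right _ hc)) h2.not_gt

theorem degreeOf_squareColumn_le (n : ℕ) (i : Fin (n - 1)) :
    (squareColumn n i).degreeOf (2 * n - 1) ≤ 1 := by
  rcases n with _ | m
  · exact i.elim0
  have hi : (i : ℕ) < m := i.2
  have hN : 2 * (m + 1) - 1 = 2 * m + 1 := by omega
  have h0 : 2 ^ (i : ℕ) < 2 ^ m := pow_lt_pow_right (by omega) hi
  have h3 : 2 ^ m ≤ 2 ^ (2 * m) := pow_le_pow_right (by omega) (by omega)
  have hN2 : 2 ^ (2 * m + 1) = 2 * 2 ^ (2 * m) := pow_succ' _ _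
  have hN3 : 2 ^ (2 * (m + 1)) = 4 * 2 ^ (2 * m) := by ring
  have hmul : ∀ p p' : XiRing, p.degreeOf (2 * m + 1) ≤ 0 → p'.degreeOf (2 * m + 1) ≤ 1 →
      (p * p').degreeOf (2 * m + 1) ≤ 1 := fun p p' h h' =>
    (MvPolynomial.degreeOf_mul_le _ _ _).trans (by omega)
  rw [squareColumn_eq, hN]
  refine (MvPolynomial.degreeOf_add_le _ _ _).trans (max_le ?_ ?_)
  · refine (MvPolynomial.degreeOf_sum_le _ _ _).trans (Finset.sup_le fun l _ => hmul _ _ ?_ ?_)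
    · refine (wh_symEntry _ _).degreeOf_le ?_
      have h2 : 2 ^ (l : ℕ) ≤ 2 ^ m := pow_le_pow_right (by omega) (by omega)
      have h4 : 2 ^ ((i : ℕ) + 1) ≤ 2 ^ m := pow_le_pow_right (by omega) (by omega)
      rw [wX, hN2, zero_add, one_mul]
      omega
    · refine ((wh_K_E (m + 1)).2 l).degreeOf_le ?_
      have := Nat.two_pow_pos (l : ℕ)
      rw [wX, hN2, hN3]
      omega
  · refine (MvPolynomial.degreeOf_sum_le _ _ _).trans (Finset.sup_le fun k _ => hmul _ _ ?_ ?_)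
    · refine (MvPolynomial.degreeOf_pow_le _ _ _).trans ?_
      have : (nrow m i k).degreeOf (2 * m + 1) ≤ 0 := by
        refine (wh_nrow (Nat.lt_succ_iff.mp k.2)).degreeOf_le ?_
        have h2 : 2 ^ (m + (k : ℕ)) ≤ 2 ^ (2 * m) := pow_le_pow_right (by omega) (by omega)
        rw [wX, hN2]
        omega
      omega
    · refine (wh_F (m + 1) k).degreeOf_le ?_
      have := Nat.two_pow_pos (m + 1 + (k : ℕ))
      rw [wX, hN2, hN3]
      omega

theorem sqrtXi_pow_two {p : XiRing} (h : IsSquare p) : sqrtXi p ^ 2 = p := by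
  obtain ⟨r, rfl⟩ := h
  rw [← sq, sqrtXi_sq]

theorem WH.of_sq {p : XiRing} {d : ℕ} (h : WH (p ^ 2) (2 * d)) : WH p d := by
  rw [← scXi_eq_iff] at h ⊢
  refine sq_injective ?_
  change scXi p ^ 2 = (C p * X ^ d) ^ 2
  rw [← map_pow, h, C_pow, mul_pow, ← pow_mul, mul_comm d]

variable {n : ℕ} {i : Fin (n - 1)}

theorem wh_rootColumn (h : IsSquare (squareColumn n i)) :
    WH (rootColumn n i) (2 ^ (2 * n - 1) + 2 ^ (i : ℕ)) :=
  WH.of_sq (by rw [rootColumn, sqrtXi_pow_two h]; exact wh_squareColumn n i)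

/-- The column of square roots does not involve `ξ_{2n-1}`. -/
theorem rootColumn_mem (h : IsSquare (squareColumn n i)) :
    rootColumn n i ∈ supported F₂ (Iic (2 * n - 2)) := by
  have hi := i.2
  have h1 : rootColumn n i ∈ supported F₂ (Iic (2 * n - 1)) := by
    refine (wh_rootColumn h).mem_supported ?_
    have : 2 ^ (i : ℕ) ≤ 2 ^ (2 * n - 1) := pow_le_pow_right (by omega) (by omega)
    rw [pow_succ]
    omega
  have h2 := degreeOf_squareColumn_le n i
  rcases eq_or_ne (rootColumn n i) 0 with h0 | h0
  · rw [h0]; exact zero_mem _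
  rw [← sqrtXi_pow_two h, ← rootColumn.eq_def, MvPolynomial.degreeOf_pow_eq _ _ _ h0] at h2
  rw [MvPolynomial.mem_supported] at h1 ⊢
  intro k hk
  have h3 := h1 hk
  have h4 : k ≠ 2 * n - 1 := by
    rintro rfl
    have := MvPolynomial.mem_vars_iff_degreeOf_ne_zero.mp hk
    omega
  simp only [Set.mem_Iic] at h3 ⊢
  omega

/-- The homomorphism that kills all the variables but one. -/
def keep {σ : Type*} [DecidableEq σ] (k : σ) : Poly σ →ₐ[F₂] F₂[X] :=
  maeval fun j => if j = k then X else 0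

theorem coeff_keep {σ : Type*} [DecidableEq σ] (k : σ) (p : Poly σ) (e : ℕ) :
    (keep k p).coeff e = p.coeff (single k e) := by
  induction p using MvPolynomial.induction_on' with
  | add p q hp hq => rw [map_add, coeff_add, hp, hq, MvPolynomial.coeff_add]
  | monomial s c =>
    rw [keep, MvPolynomial.aeval_monomial, mcoeff_monomial, algebraMap_eq, coeff_C_mul]
    by_cases hs : s = single k (s k)
    · rw [hs]
      generalize s k = r
      rw [Finsupp.prod_single_index (by exact pow_zero _), if_pos rfl, coeff_X_pow]
      by_cases he : e = r
      · rw [if_pos he, he, if_pos rfl, mul_one]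
      · rw [if_neg he, if_neg, mul_zero]
        exact fun h => he (Finsupp.single_injective k h).symm
    · obtain ⟨j, hj⟩ : ∃ j, j ≠ k ∧ s j ≠ 0 := by
        by_contra! hc
        refine hs (Finsupp.ext fun j => ?_)
        by_cases hj : j = k
        · rw [hj, single_eq_same]
        · rw [hc j hj, single_eq_of_ne hj]
      rw [Finsupp.prod, prod_eq_zero (Finsupp.mem_support_iff.mpr hj.2)
        (by rw [if_neg hj.1, zero_pow hj.2]), coeff_zero, mul_zero, if_neg]
      rintro rfl
      exact hs (by rw [single_eq_same])

theorem keep_symEntry {k i j : ℕ} (hi : i < k + j) (hj : j < k + i) : keep k (symEntry i j) = 0 := by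
  rw [symEntry]
  split_ifs with h
  · exact map_zero _
  · rw [map_pow, keep, maeval_X, if_neg (by omega), zero_pow (by positivity)]

theorem keep_rootColumn (h : IsSquare (squareColumn n i)) :
    keep (2 * n - 1 - (i : ℕ)) (rootColumn n i) = 0 := by
  rcases n with _ | m
  · exact i.elim0
  have hi : (i : ℕ) < m := i.2
  refine pow_eq_zero_iff two_ne_zero |>.mp ?_
  rw [← map_pow, rootColumn, sqrtXi_pow_two h, squareColumn_eq, map_add, map_sum, map_sum,
    sum_eq_zero, sum_eq_zero, add_zero]
  · intro k _
    have hn : keep (2 * (m + 1) - 1 - (i : ℕ)) (nrow m i k) = 0 := by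
      have hs : ∀ l : Fin m, keep (2 * (m + 1) - 1 - (i : ℕ)) (symEntry i l) = 0 := fun l =>
        keep_symEntry (by omega) (by omega)
      rcases (Nat.lt_succ_iff.mp k.2).lt_or_eq with hk | hk
      · rw [nrow_eq ⟨k, hk⟩, map_add, map_sum, sum_eq_zero, zero_add]
        · exact keep_symEntry (by omega) (by simp only; omega)
        · intro l _
          rw [map_mul, hs, zero_mul]
      · rw [hk, nrow_self, map_add, map_sum, sum_eq_zero, zero_add]
        · exact keep_symEntry (by omega) (by omega)
        · intro l _
          rw [map_mul, hs, zero_mul]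
    rw [map_mul, map_pow, hn, zero_pow two_ne_zero, zero_mul]
  · intro l _
    rw [map_mul, keep_symEntry (by omega) (by omega), zero_mul]

end SquareColumn

section Relations

variable {U : Type*} [AddCommGroup U] [Module F₂ U] [FiniteDimensional F₂ U]
variable {κ : Type*} [Fintype κ] [DecidableEq κ] {q : QuadraticForm F₂ U}

/-- Evaluation of polynomials in the `ξ`'s at the elements `ξ_i` of `S(U^*)`. -/
def xiS (q : QuadraticForm F₂ U) : XiRing →ₐ[F₂] Sym U := maeval (xi q)

theorem Coords.xiS_eq (c : Coords q κ) : xiS q = evXi c.a c.b (formElem q) := by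
  refine malgHom_ext fun i => ?_
  rw [xiS, maeval_X, evXi, maeval_X]
  rcases i with _ | i
  · rfl
  · rw [if_neg (Nat.succ_ne_zero i), c.xi_succ]

theorem formElem_addSq (c : Coords q κ) (x : Dual F₂ U) :
    formElem (addSq q x) = formElem q + vec x ^ 2 := by
  rw [(c.addSq x).formElem_eq, c.formElem_eq, c.vec_eq_lin, add_assoc, ← add_pow_char, ← lin_add]
  rfl

/-- The product of the `t + x` over all `x` such that `q + x²` is of `-`type. -/
def Pminus (q : QuadraticForm F₂ U) : (Sym U)[X] :=
  ∏ x ∈ minusVectors q, (X + C (vec x))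

theorem Pminus_sq (c : Coords q κ) :
    Pminus q ^ 2 = (Qp 1 c.a c.b).comp (X ^ 2 + C (formElem q)) := by
  rw [← c.Qminus_eq, Qminus, Pminus, prod_comp, ← Finset.prod_pow]
  refine prod_congr rfl fun x _ => ?_
  rw [formElem_addSq c, add_comp, X_comp, C_comp, add_pow_char, C_add, C_pow]
  rw [add_assoc, ← add_assoc (C (formElem q)), CharTwo.add_self_eq_zero, zero_add]

variable {n : ℕ}

theorem card_minusVectors (c : Coords q κ) (hn : card κ = n) :
    2 * (minusVectors q).card = 2 ^ (2 * n) - 2 ^ n := by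
  rw [← card_arf_eq hn]
  have h := c.prod_minusVectors (M := Multiplicative ℕ) fun _ => Multiplicative.ofAdd 1
  rw [prod_const, prod_const, ← ofAdd_nsmul, ← ofAdd_nsmul, smul_eq_mul, smul_eq_mul,
    mul_one, mul_one] at h
  rw [Multiplicative.ofAdd.injective h]

theorem dInv_eq_coeff (c : Coords q κ) (hn : card κ = n) (h0 : n ≠ 0) {k : ℕ}
    (hk : k ≤ n) : dInv q n (n + k) = (Pminus q).coeff (2 ^ (n + k - 1) - 2 ^ (n - 1)) := by
  have hc := card_minusVectors c hn
  have h1 : 2 ^ (n + k - 1) ≤ 2 ^ (2 * n - 1) := pow_le_pow_right (by omega) (by omega)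
  have h2 : 2 ^ (n - 1) ≤ 2 ^ (n + k - 1) := pow_le_pow_right (by omega) (by omega)
  have h3 : 2 ^ (2 * n) = 2 * 2 ^ (2 * n - 1) := by rw [← pow_succ']; congr 1; omega
  have h4 : 2 ^ n = 2 * 2 ^ (n - 1) := by rw [← pow_succ']; congr 1; omega
  have h5 : Pminus q = (((minusVectors q).val.map vec).map fun r => X + C r).prod := by
    rw [Multiset.map_map]; rfl
  rw [h5, Multiset.prod_X_add_C_coeff _ (by rw [Multiset.card_map]; change _ ≤ Finset.card _; omega),
    Multiset.card_map, dInv]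
  congr 1
  change _ = Finset.card _ - _
  omega

theorem dInv_self (c : Coords q κ) (hn : card κ = n) (h0 : n ≠ 0)
    (hq : IsMinusType q) : dInv q n n = 0 := by
  have h := dInv_eq_coeff c hn h0 (Nat.zero_le n)
  rw [add_zero, Nat.sub_self, coeff_zero_eq_eval_zero, Pminus, eval_prod] at h
  rw [h]
  refine prod_eq_zero (i := 0) ?_ ?_
  · rw [c.mem_minusVectors, map_zero, add_zero]
    exact c.isMinusType_iff.mp hq
  · rw [eval_add, eval_X, eval_C, zero_add]
    exact map_zero _

/-- The squares of the `d_j` in terms of the Dickson invariants. -/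
theorem dInv_sq (c : Coords q κ) (hn : card κ = n) (h0 : n ≠ 0) (k : Fin n) :
    dInv q n (n + k) ^ 2 = ∑ l : Fin n, xiS q (Umat n k l) ^ 2 * cf c.a c.b (n + l) +
      xiS q (Vvec n k) := by
  have h1 : 2 ^ (n + (k : ℕ)) - 2 ^ n = (2 ^ (n + (k : ℕ) - 1) - 2 ^ (n - 1)) * 2 ^ 1 := by
    rw [Nat.sub_mul, ← pow_add, ← pow_add]
    congr 2 <;> omega
  have h2 := coeff_pow_two_pow (Pminus q) 1 (2 ^ (n + (k : ℕ) - 1) - 2 ^ (n - 1))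
  rw [← h1, ← dInv_eq_coeff c hn h0 k.2.le, pow_one, Pminus_sq c, coeff_Qp_comp _ _ _ hn,
    sum_range_succ, Nat.sub_self, pow_zero, pow_one, ← two_mul, cf_top _ _ hn, one_mul] at h2
  rw [← h2, sum_range, c.xiS_eq]
  refine congrArg₂ (· + ·) (sum_congr rfl fun l _ => ?_) ?_
  · rw [Umat, of_apply, map_pow, ← pow_mul, ← pow_succ, mul_comm]
    congr 3
    omega
  · rw [Vvec, add_comm (k : ℕ)]

/-- The upper half of the Dickson invariants in terms of the squares of the `d_j`. -/
theorem cf_high_eq (c : Coords q κ) (hn : card κ = n) (h0 : n ≠ 0) (k : Fin n) :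
    cf c.a c.b (n + k) = ∑ l : Fin n, xiS q (J n k l) ^ 2 * dInv q n (n + l) ^ 2 +
      xiS q (F n k) := by
  have hF : xiS q (F n k) = ∑ l, xiS q (J n k l) ^ 2 * xiS q (Vvec n l) := by
    rw [F, mulVec, dotProduct, map_sum]
    refine sum_congr rfl fun l _ => ?_
    rw [map_mul, map_apply, map_pow]
  have hJ : ∀ j, ∑ l, xiS q (J n k l) * xiS q (Umat n l j) = if k = j then 1 else 0 := fun j => by
    have h := congrArg (xiS q) (congrFun (congrFun (J_mul_Umat n) k) j)
    rw [Matrix.mul_apply, map_sum, Matrix.one_apply] at h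
    simp only [map_mul] at h
    rw [h]
    split_ifs
    · exact map_one _
    · exact map_zero _
  rw [hF, ← sum_add_distrib]
  simp only [dInv_sq c hn h0, ← mul_add, CharTwo.add_cancel_right, mul_sum]
  rw [sum_comm, sum_eq_single k]
  · have h := congrArg (· ^ 2) (hJ k)
    simp only [sum_pow_char, if_true, mul_pow, one_pow] at h
    simp only [← mul_assoc, ← sum_mul]
    rw [h, one_mul]
  · intro j _ hj
    have h := congrArg (· ^ 2) (hJ j)
    simp only [sum_pow_char, if_neg hj.symm, mul_pow, ne_eq, OfNat.ofNat_ne_zero, not_false_eq_true,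
      zero_pow] at h
    simp only [← mul_assoc, ← sum_mul]
    rw [h, zero_mul]
  · exact fun h => absurd (mem_univ _) h

theorem cf_low_eq (c : Coords q κ) (hn : card κ = n) (k : Fin n) :
    cf c.a c.b k = ∑ l : Fin n, xiS q (K n k l) * cf c.a c.b (n + l) + xiS q (E n k) := by
  rw [c.xiS_eq, evXi_E _ _ _ hn, add_comm (cf _ _ _), ← add_assoc, CharTwo.add_self_eq_zero,
    zero_add]

/-- The combination of `d`'s and powers of `ξ`'s whose square is a polynomial in the `ξ`'s. -/
def rootElem (q : QuadraticForm F₂ U) (n : ℕ) (i : Fin (n - 1)) : Sym U :=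
  ∑ j : Fin (n - 1), xiS q (T n i j) * dInv q n (n + 1 + j) + xi q (2 * n - 1 - i) ^ 2 ^ (i : ℕ)

theorem rootElem_sq (c : Coords q κ) (hn : card κ = n) (hq : IsMinusType q)
    (i : Fin (n - 1)) : rootElem q n i ^ 2 = xiS q (squareColumn n i) := by
  rcases n with _ | m
  · exact i.elim0
  have hi : (i : ℕ) < m := i.2
  have h1 : ∑ j : Fin m, xiS q (T (m + 1) i j) * dInv q (m + 1) (m + 1 + 1 + j) =
      ∑ l : Fin (m + 1), xiS q (relMatrix (m + 1) i l) * dInv q (m + 1) (m + 1 + l) := by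
    rw [Fin.sum_univ_succ, Fin.val_zero, add_zero, dInv_self c hn (by omega) hq, mul_zero, zero_add]
    refine sum_congr rfl fun j _ => ?_
    rw [val_succ, add_assoc (m + 1), add_comm 1]
    rfl
  have h2 := sum_nrow_mul_cf c.a c.b (formElem q) hn (i + 1)
  rw [← c.xiS_eq] at h2
  have h3 : ∑ j : Fin (m + 1), xiS q (nrow (m + 1) (i + 1) j) * cf c.a c.b (m + 1 + j) =
      (∑ l : Fin (m + 1), xiS q (relMatrix (m + 1) i l) * dInv q (m + 1) (m + 1 + l)) ^ 2 +
        ∑ k : Fin (m + 1), xiS q (nrow m i k) ^ 2 * xiS q (F (m + 1) k) := by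
    simp only [cf_high_eq c hn (by omega), mul_add, sum_add_distrib,
      nrow_succ _ (Nat.lt_succ_iff.mp (Fin.is_lt _)), map_pow]
    congr 1
    rw [sum_pow_char]
    simp only [mul_sum, mul_pow]
    rw [sum_comm]
    refine sum_congr rfl fun l _ => ?_
    rw [relMatrix_eq, map_sum, sum_pow_char, sum_mul]
    refine sum_congr rfl fun k _ => ?_
    rw [map_mul, mul_pow, mul_assoc]
  have h4 : xiS q (symEntry (i + 1) (2 * (m + 1))) =
      (xi q (2 * (m + 1) - 1 - i) ^ 2 ^ (i : ℕ)) ^ 2 := by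
    rw [symEntry_of_lt (by omega), map_pow, xiS, maeval_X, ← pow_mul, ← pow_succ]
    congr 2
    omega
  rw [h3, h4] at h2
  have h5 : ∑ j : Fin (m + 1 - 1), xiS q (T (m + 1) i j) * dInv q (m + 1) (m + 1 + 1 + j) =
      ∑ l : Fin (m + 1), xiS q (relMatrix (m + 1) i l) * dInv q (m + 1) (m + 1 + l) := h1
  rw [rootElem, h5, add_pow_char, squareColumn_eq, map_add, map_sum, map_sum]
  simp only [map_mul, map_pow]
  rw [sum_congr rfl fun l _ => mul_comm (xiS q (symEntry _ _)) _]
  linear_combination h2 + add_self_eq_zero_of_algebra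
    (∑ k : Fin (m + 1), xiS q (nrow m i k) ^ 2 * xiS q (F (m + 1) k)) * (-1) +
    add_self_eq_zero_of_algebra ((xi q (2 * (m + 1) - 1 - i) ^ 2 ^ (i : ℕ)) ^ 2)

end Relations

section Omega

variable {κ : Type*} [Fintype κ] [DecidableEq κ]

theorem map_evXi_form {A B : Type*} [CommRing A] [Algebra F₂ A] [CommRing B]
    [Algebra F₂ B] (f : A →ₐ[F₂] B) (a b : κ → A) (v : κ ⊕ κ → F₂) (p : XiRing) :
    f (evXi a b (qf a b + lin (Sum.elim a b) v ^ 2) p) = evXi (fun i => f (a i)) (fun i => f (b i))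
      (qf (fun i => f (a i)) (fun i => f (b i)) +
        lin (Sum.elim (fun i => f (a i)) fun i => f (b i)) v ^ 2) p := by
  rw [map_evXi, map_add, map_pow, map_qf, map_lin, comp_sumElim]

theorem kill_omega {A : Type*} [CommRing A] [Algebra F₂ A] [CharP A 2] {m : ℕ}
    (hm : card κ = m) {a b : Option κ → A} (h : a none = 0)
    (v : Option κ ⊕ Option κ → F₂) :
    evXi a b (qf a b + lin (Sum.elim a b) v ^ 2) (T (m + 1)).det =
      cf (fun i => a (some i)) (fun i => b (some i)) 0 *
        ∏ w ∈ Finset.univ.filter (fun w : κ ⊕ κ → F₂ => arf w = 1),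
          (v (inr none) • b none + lin (Sum.elim (fun i => a (some i)) (fun i => b (some i)))
            (fun i => v (Sum.map some some i) + w i)) ^ 2 := by
  have hl : lin (Sum.elim a b) v = v (inr none) • b none +
      lin (Sum.elim (fun i => a (some i)) (fun i => b (some i))) (fun i => v (Sum.map some some i)) := by
    simp only [lin, sum_sum_type, sum_option, elim_inl, elim_inr, h, smul_zero,
      zero_add, Sum.map_inl, Sum.map_inr]
    ring
  rw [evXi_option _ _ h, evXi_det_T _ _ _ hm, Qp, eval_prod]
  congr 1
  refine prod_congr rfl fun w _ => ?_
  have hw : lin (Sum.elim (fun i => a (some i)) (fun i => b (some i)))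
      (fun i => v (Sum.map some some i) + w i) = _ := lin_add _ _ w
  rw [hw, eval_add, eval_X, eval_C, qf_option _ _ h, hl]
  simp only [CharTwo.add_sq]
  linear_combination add_self_eq_zero_of_algebra (qf (fun i => a (some i)) fun i => b (some i))

theorem arf_option (v : Option κ ⊕ Option κ → F₂) : arf v =
    v (inl none) * v (inr none) + arf fun i : κ ⊕ κ => v (Sum.map some some i) := by
  rw [arf, sum_option]
  rfl

theorem exists_of_arf {v : κ ⊕ κ → F₂} (h : arf v = 1) :
    ∃ i, v (inr i) = 1 := by
  by_contra! hc
  have : arf v = 0 := sum_eq_zero fun i _ => by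
    rw [(zmod_two_cases (v (inr i))).resolve_right (hc i), mul_zero]
  rw [this] at h
  exact absurd h (by decide)

/-- The generic vector of the form with coefficients `v`. -/
abbrev genOmega {n : ℕ} (v : κ ⊕ κ → F₂) (p : Matrix (Fin n) (Fin n) XiRing) :
    PairRing κ :=
  evXi gl gr (qf gl gr + lin mX v ^ 2) p.det

theorem genOmega_ne_zero {n : ℕ} (hn : card κ = n) {v : κ ⊕ κ → F₂} (h : arf v = 1) :
    genOmega v (T n) ≠ 0 := by
  obtain ⟨i, hi⟩ := exists_of_arf h
  let κ' := {j : κ // j ≠ i}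
  let e : Option κ' ≃ κ := Equiv.optionSubtypeNe i
  have he : e none = i := rfl
  have hn' : n = card κ' + 1 := by rw [← card_option, Fintype.card_congr e, hn]
  let a : Option κ' → (PairRing κ')[X] := fun o => o.elim 0 fun j => C (gl j)
  let b : Option κ' → (PairRing κ')[X] := fun o => o.elim X fun j => C (gr j)
  let v' : Option κ' ⊕ Option κ' → F₂ := fun j => v (sumCongr e e j)
  intro h0
  have h1 := congrArg (specialize (a ∘ e.symm) (b ∘ e.symm)) h0
  have hl : specialize (a ∘ e.symm) (b ∘ e.symm) (lin mX v) =
      lin (Sum.elim a b) v' := by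
    rw [map_lin, ← sumElim_gl_gr, comp_sumElim, specialize_gl, specialize_gr, sumElim_reindex, lin,
      lin, ← Equiv.sum_comp (sumCongr e e)]
    refine sum_congr rfl fun j _ => ?_
    congr 2
    exact (sumCongr e e).symm_apply_apply j
  rw [map_zero, map_evXi, map_add, map_pow, hl, map_qf, specialize_gl, specialize_gr,
    evXi_reindex, qf_reindex, hn', kill_omega rfl rfl] at h1
  have hcf : cf (fun j => a (some j)) (fun j => b (some j)) 0 = C (cf gl gr 0) := map_cf_C 0
  rw [hcf] at h1
  rcases mul_eq_zero.mp h1 with h2 | h2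
  · exact cf_zero_ne_zero (C_eq_zero.mp h2)
  · obtain ⟨w, -, hw⟩ := Finset.prod_eq_zero_iff.mp h2
    have hw := pow_eq_zero_iff two_ne_zero |>.mp hw
    have hv' : v' (inr none) = 1 := hi
    have hlin : lin (Sum.elim (fun j => a (some j)) (fun j => b (some j)))
        (fun j => v' (Sum.map some some j) + w j) = C (lin mX
          fun j => v' (Sum.map some some j) + w j) := by
      have := map_lin (CAlgHom (R := F₂) (A := PairRing κ')) mX
        fun j => v' (Sum.map some some j) + w j
      rw [← sumElim_gl_gr, comp_sumElim] at this
      rw [← sumElim_gl_gr]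
      exact this.symm
    rw [hv', one_smul, hlin] at hw
    exact (monic_X_add_C _).ne_zero hw

variable {U : Type*} [AddCommGroup U] [Module F₂ U] [FiniteDimensional F₂ U]
variable {q : QuadraticForm F₂ U}

theorem Coords.xiS_eq_equiv (c : Coords q κ) (p : XiRing) : xiS q p =
    c.equiv (evXi gl gr (qf gl gr + lin mX c.v ^ 2) p) := by
  have h := map_evXi_form (c.equiv : PairRing κ →ₐ[F₂] Sym U) gl gr c.v p
  rw [equiv_gl, equiv_gr, ← c.formElem_eq, ← c.xiS_eq, sumElim_gl_gr] at h
  exact h.symm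

theorem xiS_det_ne_zero {n : ℕ} (c : Coords q κ) (hn : card κ = n) (hq : IsMinusType q) :
    xiS q (T n).det ≠ 0 := by
  rw [c.xiS_eq_equiv]
  exact fun h => genOmega_ne_zero hn (c.isMinusType_iff.mp hq)
    (c.equiv.injective (h.trans (map_zero c.equiv).symm))

theorem Coords.vec_dvd_iff (c : Coords q (Option κ)) (f : PairRing (Option κ)) :
    vec (c.bas (inl none)) ∣ c.equiv f ↔ kill f = 0 := by
  rw [← c.equiv_X, map_dvd_iff]
  exact gl_dvd_iff f

theorem kill_evXi_of_arf (v : Option κ ⊕ Option κ → F₂) (p : XiRing)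
    (hv : v (inr none) = 0) :
    kill (evXi gl gr (qf gl gr + lin mX v ^ 2) p) =
      MvPolynomial.rename (Sum.map some some) (evXi gl gr (qf gl gr +
        lin mX (fun i : κ ⊕ κ => v (Sum.map some some i)) ^ 2) p) := by
  have h0 : kill (gl (none : Option κ)) = 0 := maeval_X _ _
  rw [map_evXi, map_evXi, evXi_option (fun i => kill (gl i)) _ h0]
  have h1 : ∀ i : κ, kill (gl (some i)) = MvPolynomial.rename (Sum.map some some) (gl i) :=
    fun i => by rw [kill, gl, maeval_X, gl, rename_X]; rfl
  have h2 : ∀ i : κ, kill (gr (some i)) = MvPolynomial.rename (Sum.map some some) (gr i) :=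
    fun i => by rw [kill, gr, maeval_X, gr, rename_X]; rfl
  have h3 : kill (qf gl gr + lin mX v ^ 2) =
      MvPolynomial.rename (Sum.map some some) (qf gl gr +
        lin mX (fun i : κ ⊕ κ => v (Sum.map some some i)) ^ 2) := by
    rw [map_add, map_add, map_pow, map_pow, map_qf, map_qf, qf_option (fun i => kill (gl i)) _ h0,
      map_lin, map_lin]
    simp only [h1, h2, lin, sum_sum_type, sum_option, hv, zero_smul, zero_add]
    have h4 : kill (mX (inl (none : Option κ))) = 0 := h0
    have h5 : ∀ i : κ, kill (mX (inl (some i))) = _ := h1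
    have h6 : ∀ i : κ, kill (mX (inr (some i))) = _ := h2
    simp only [h4, h5, h6, smul_zero, zero_add]
    rfl
  simp only [h1, h2, h3]

/-- The linear form belonging to a singular vector divides `Ω`, but not the next smaller `Ω`. -/
theorem Coords.vec_dvd_det {m : ℕ} (hm : card κ = m) (c : Coords q (Option κ))
    (hq : IsMinusType q) (hv : c.v (inr none) = 0) :
    vec (c.bas (inl none)) ∣ xiS q (T (m + 1)).det ∧
      ¬ vec (c.bas (inl none)) ∣ xiS q (T m).det := by
  have ha : arf (fun i : κ ⊕ κ => c.v (Sum.map some some i)) = 1 := by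
    have := c.isMinusType_iff.mp hq
    rwa [arf_option, hv, mul_zero, zero_add] at this
  have hinj : Injective (MvPolynomial.rename (R := F₂)
      (Sum.map some some : κ ⊕ κ → Option κ ⊕ Option κ)) :=
    rename_injective _ (Sum.map_injective.mpr
      ⟨some_injective _, some_injective _⟩)
  rw [c.xiS_eq_equiv, c.xiS_eq_equiv, c.vec_dvd_iff, c.vec_dvd_iff, kill_evXi_of_arf _ _ hv,
    kill_evXi_of_arf _ _ hv, map_eq_zero_iff _ hinj, map_eq_zero_iff _ hinj]
  refine ⟨?_, genOmega_ne_zero hm ha⟩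
  rw [evXi_det_T _ _ _ hm, Qp, eval_prod, prod_eq_zero (i := fun i : κ ⊕ κ =>
    c.v (Sum.map some some i)) (Finset.mem_filter.mpr ⟨mem_univ _, ha⟩), mul_zero]
  rw [eval_add, eval_X, eval_C, sumElim_gl_gr, CharTwo.add_self_eq_zero]

theorem Coords.exists_coords_of_mem (c : Coords q κ) {n : ℕ} (hn : card κ = n)
    (hq : IsMinusType q) {x : Dual F₂ U} (hx : x ∈ minusVectors q) (hx0 : x ≠ 0) :
    ∃ (κ' : Type) (_ : Fintype κ') (_ : DecidableEq κ'), card κ' + 1 = n ∧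
      ∃ c' : Coords q (Option κ'), c'.bas (inl none) = x ∧ c'.v (inr none) = 0 := by
  set w := c.bas.equivFun x with hw
  set f : U := c.point.symm fun i => w i.swap with hf
  have hp : ∀ i, c.bas i f = w i.swap := fun i => by
    rw [← c.point_apply, hf, apply_symm_apply]
  have hfx : q.polarBilin f = x := by
    refine LinearMap.ext fun u => ?_
    rw [QuadraticMap.polarBilin_apply_apply, c.polar_eq]
    conv_rhs => rw [← c.bas.sum_equivFun x, LinearMap.sum_apply, sum_sum_type,
      ← sum_add_distrib]
    refine sum_congr rfl fun i _ => ?_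
    rw [hp, hp, add_comm]
    rfl
  have hqf : q f = 0 := by
    have h1 := (c.mem_minusVectors x).mp hx
    have h2 := c.isMinusType_iff.mp hq
    rw [c.eq, sum_sum_type]
    simp only [hp, Sum.swap_inl, Sum.swap_inr]
    rw [arf] at h1 h2
    simp only [Pi.add_apply, add_mul, mul_add, sum_add_distrib, ← hw] at h1
    rw [h2] at h1
    have h3 : ∑ i, w (inr i) * w (inl i) = ∑ i, w (inl i) * w (inr i) :=
      sum_congr rfl fun i _ => mul_comm _ _
    have h4 : ∑ i, c.v (inr i) * w (inl i) = ∑ i, w (inl i) * c.v (inr i) :=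
      sum_congr rfl fun i _ => mul_comm _ _
    rw [h3, h4]
    linear_combination h1
  obtain ⟨e, he⟩ : ∃ e, x e ≠ 0 := by
    by_contra! hc
    exact hx0 (LinearMap.ext hc)
  have hef : polar q e f = 1 := by
    rw [polar_comm]
    have h1 : polar q f e = x e := dcongr_fun hfx e
    rw [h1]
    exact (zmod_two_cases _).resolve_left he
  have hn0 : n ≠ 0 := by
    rintro rfl
    haveI := Fintype.card_eq_zero_iff.mp hn
    exact hx0 (c.bas.equivFun.injective (Subsingleton.elim _ _))
  have hU : finrank F₂ U = 2 * n := by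
    rw [← Subspace.dual_finrank_eq, Module.finrank_eq_card_basis c.bas, card_sum, hn,
      two_mul]
  obtain ⟨κ', i1, i2, h1, c', h2, -, -, h3⟩ := exists_coords_of_pair hq.1 hn0 hU hef
  exact ⟨κ', i1, i2, h1, c', h2.trans hfx, h3.trans hqf⟩

end Omega

section Minor

theorem J_castSucc (m : ℕ) (k l : Fin m) : J (m + 1) k.castSucc l.castSucc = J m k l ^ 2 := by
  let A : Matrix (Fin m) (Fin m) XiRing := Matrix.of fun k l => J (m + 1) k.castSucc l.castSucc
  have hU : ∀ k j : Fin m, Umat (m + 1) k.castSucc j.castSucc = Umat m k j ^ 2 := fun k j => by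
    rw [Umat, Umat, of_apply, of_apply, ← pow_mul, ← pow_succ]
    congr 2
    rw [Fin.val_castSucc]
    omega
  have h1 : (Umat m).map (frobenius XiRing 2) * A = 1 := by
    ext1 k l
    have h := congrFun (congrFun (Umat_mul_J (m + 1)) k.castSucc) l.castSucc
    rw [Matrix.mul_apply, Fin.sum_univ_castSucc, J_of_lt (k := Fin.last m) (Fin.castSucc_lt_last l),
      mul_zero, add_zero] at h
    rw [Matrix.mul_apply]
    refine Eq.trans (sum_congr rfl fun j _ => ?_) (h.trans ?_)
    · rw [map_apply, frobenius_def, ← hU]; rfl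
    · simp only [Matrix.one_apply, Fin.castSucc_inj]
  have h2 : (J m).map (frobenius XiRing 2) * (Umat m).map (frobenius XiRing 2) = 1 := by
    rw [← Matrix.map_mul, J_mul_Umat, Matrix.map_one _ (map_zero _) (map_one _)]
  have h3 : A = (J m).map (frobenius XiRing 2) := by
    rw [← one_mul A, ← h2, mul_assoc, h1, mul_one]
  exact congrFun (congrFun h3 k) l

/-- Away from the first row and the last column, `T` is the entrywise square of its predecessor. -/
theorem T_succ (m : ℕ) (i j : Fin m) :
    T (m + 2) i.succ j.castSucc = T (m + 1) i j ^ 2 := by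
  change relMatrix (m + 2) i.succ _ = relMatrix (m + 1) i _ ^ 2
  rw [relMatrix_eq (m + 1) i.succ, relMatrix_eq m i, Fin.sum_univ_castSucc]
  have hl : (⟨(j.castSucc : ℕ) + 1, by omega⟩ : Fin (m + 1 + 1)) = (j.succ).castSucc := rfl
  have hl' : (⟨(j : ℕ) + 1, by omega⟩ : Fin (m + 1)) = j.succ := rfl
  rw [sum_pow_char]
  have h0 : J (m + 1 + 1) (Fin.last (m + 1)) ⟨(j.castSucc : ℕ) + 1, by omega⟩ = 0 :=
    J_of_lt (l := (j.succ).castSucc) (Fin.castSucc_lt_last _)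
  rw [h0, mul_zero, add_zero]
  refine sum_congr rfl fun k _ => ?_
  rw [mul_pow, ← J_castSucc]
  refine congrArg₂ (· * ·) ?_ rfl
  exact nrow_succ _ (Nat.lt_succ_iff.mp k.2)

end Minor

section Coprime

variable {κ : Type*} [Fintype κ] [DecidableEq κ]

theorem wh_det {n : ℕ} {M : Matrix (Fin n) (Fin n) XiRing} {u v : Fin n → ℕ}
    (h : ∀ i j, WH (M i j) (u i + v j)) : WH M.det (∑ i, u i + ∑ i, v i) := by
  rw [Matrix.det_apply]
  refine MvPolynomial.IsWeightedHomogeneous.sum _ _ _ fun σ _ => ?_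
  rw [Units.smul_def]
  refine zsmul_mem (S := Submodule F₂ XiRing)
    (K := weightedHomogeneousSubmodule F₂ wX _) ?_ _
  have h1 := MvPolynomial.IsWeightedHomogeneous.prod univ (fun i => M (σ i) i)
    (fun i => u (σ i) + v i) (w := wX) fun i _ => h (σ i) i
  rwa [sum_add_distrib, Equiv.sum_comp σ u] at h1

theorem sum_two_pow (k s : ℕ) : ∑ i : Fin k, 2 ^ (s + (i : ℕ)) + 2 ^ s = 2 ^ (s + k) := by
  induction k with
  | zero => simp
  | succ k ih =>
    rw [Fin.sum_univ_castSucc, val_last, ← add_assoc s, pow_succ]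
    simp only [Fin.val_castSucc]
    omega

theorem wh_det_T (m : ℕ) : WH (T (m + 1)).det (2 ^ (2 * m + 1) - 2 ^ m - 1) := by
  have h := wh_det (M := T (m + 1)) fun i j => wh_T (m + 1) i j
  have h1 : ∑ i : Fin (m + 1 - 1), 2 ^ (i : ℕ) + 1 = 2 ^ m := by
    simpa using sum_two_pow m 0
  have h2 : ∑ i : Fin (m + 1 - 1), 2 ^ (m + 1 + (i : ℕ)) + 2 ^ (m + 1) = 2 ^ (2 * m + 1) :=
    (sum_two_pow m (m + 1)).trans (congrArg _ (by ring))
  convert h using 1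
  rw [pow_succ] at h2
  omega

theorem isHomogeneous_genOmega {m : ℕ} (v : κ ⊕ κ → F₂) :
    (genOmega v (T (m + 1))).IsHomogeneous (2 ^ (2 * m + 1) - 2 ^ m - 1) := by
  have hX : ∀ i : κ ⊕ κ, ∀ k, ((mX i : PairRing κ) ^ k).IsHomogeneous k :=
    fun i k => MvPolynomial.isHomogeneous_X_pow i k
  refine aeval_mem_graded (MvPolynomial.homogeneousSubmodule (κ ⊕ κ) F₂) (w := wX)
    (fun i => ?_) (wh_det_T m)
  rw [MvPolynomial.mem_homogeneousSubmodule]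
  split_ifs with hi
  · rw [hi]
    refine .add (.sum _ _ _ fun j _ => ?_) ((isHomogeneous_lin v).pow 2)
    exact (isHomogeneous_X _ _).mul (isHomogeneous_X _ _)
  · refine .sum _ _ _ fun j _ => .add ?_ ((hX _ _).mul (isHomogeneous_X _ _))
    rw [wX, add_comm]
    exact (isHomogeneous_X _ _).mul (hX _ _)

variable {U : Type*} [AddCommGroup U] [Module F₂ U] [FiniteDimensional F₂ U]
variable {q : QuadraticForm F₂ U}

theorem Coords.prime_vec (c : Coords q κ) (i : κ ⊕ κ) : Prime (vec (c.bas i)) := by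
  rw [← c.equiv_X]
  exact (MulEquiv.prime_iff c.equiv.toMulEquiv).mpr X_prime

theorem Coords.vec_eq_equiv (c : Coords q κ) (x : Dual F₂ U) :
    vec x = c.equiv (lin mX (c.bas.equivFun x)) := by
  rw [c.equiv_lin, c.bas.sum_equivFun]

theorem Coords.uniqueFactorizationMonoid (c : Coords q κ) :
    UniqueFactorizationMonoid (Sym U) :=
  c.equiv.toMulEquiv.uniqueFactorizationMonoid inferInstance

/-- The invariants `Ω` of two consecutive sizes are relatively prime. -/
theorem Coords.isRelPrime_det (c : Coords q κ) {m : ℕ} (hm : card κ = m + 1)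
    (hq : IsMinusType q) :
    IsRelPrime (xiS q (T (m + 1)).det) (xiS q (T m).det) := by
  classical
  haveI := c.uniqueFactorizationMonoid
  set s := (minusVectors q).erase 0
  have hs : ∀ x ∈ s, Prime (vec x) ∧ vec x ∣ xiS q (T (m + 1)).det ∧
      ¬ vec x ∣ xiS q (T m).det := by
    intro x hx
    obtain ⟨hx0, hx⟩ := Finset.mem_erase.mp hx
    obtain ⟨κ', i1, i2, h1, c', rfl, h3⟩ := c.exists_coords_of_mem hm hq hx hx0
    exact ⟨c'.prime_vec _, c'.vec_dvd_det (by omega) hq h3⟩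
  have hdvd : ∏ x ∈ s, vec x ∣ xiS q (T (m + 1)).det := by
    refine Finset.prod_dvd_of_isRelPrime (fun x hx y hy hxy => ?_) fun x hx => (hs x hx).2.1
    refine (Irreducible.isRelPrime_iff_not_dvd (hs x hx).1.irreducible).mpr fun h => hxy ?_
    rw [c.vec_eq_equiv, c.vec_eq_equiv, map_dvd_iff] at h
    refine c.bas.equivFun.injective (lin_dvd_lin (fun h0 => ?_) h)
    exact (Finset.mem_erase.mp hy).1 (c.bas.equivFun.injective (h0.trans (map_zero _).symm))
  obtain ⟨g, hg⟩ := hdvd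
  have hunit : IsUnit g := by
    set P : PairRing κ := ∏ x ∈ s, lin mX (c.bas.equivFun x)
    have h1 : genOmega c.v (T (m + 1)) = P * c.equiv.symm g := by
      apply c.equiv.injective
      rw [← c.xiS_eq_equiv, hg, map_mul, AlgEquiv.apply_symm_apply, map_prod]
      simp only [← c.vec_eq_equiv]
    have h0 : genOmega c.v (T (m + 1)) ≠ 0 := genOmega_ne_zero hm (c.isMinusType_iff.mp hq)
    have hP0 : P ≠ 0 := fun h => h0 (by rw [h1, h, zero_mul])
    have hg0 : c.equiv.symm g ≠ 0 := fun h => h0 (by rw [h1, h, mul_zero])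
    have hP : P.IsHomogeneous s.card := by
      have := MvPolynomial.IsHomogeneous.prod s (fun x => lin (mX : κ ⊕ κ → _)
        (c.bas.equivFun x)) (fun _ => 1) fun x _ => isHomogeneous_lin _
      rwa [Finset.sum_const, smul_eq_mul, mul_one] at this
    have h2 := MvPolynomial.totalDegree_mul_of_isDomain hP0 hg0
    have hcard : s.card = 2 ^ (2 * m + 1) - 2 ^ m - 1 := by
      have h3 := card_minusVectors c hm
      have h4 : (0 : Dual F₂ U) ∈ minusVectors q := by
        rw [c.mem_minusVectors, map_zero, add_zero]
        exact c.isMinusType_iff.mp hq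
      rw [Finset.card_erase_of_mem h4]
      have h5 : 2 ^ (2 * (m + 1)) = 2 * 2 ^ (2 * m + 1) := by ring
      have h6 : 2 ^ (m + 1) = 2 * 2 ^ m := by ring
      omega
    rw [← h1, (isHomogeneous_genOmega c.v).totalDegree h0, hP.totalDegree hP0, hcard] at h2
    have h3 : (c.equiv.symm g).totalDegree = 0 := by omega
    obtain ⟨r, hr⟩ : ∃ r, c.equiv.symm g = mC r :=
      ⟨_, MvPolynomial.totalDegree_eq_zero_iff_eq_C.mp h3⟩
    rw [← MulEquiv.isUnit_map c.equiv.symm, hr]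
    refine IsUnit.map _ (isUnit_iff_ne_zero.mpr fun h => hg0 ?_)
    rw [hr, h, MvPolynomial.C_0]
  rw [hg]
  refine IsRelPrime.mul_left (IsRelPrime.prod_left fun x hx => ?_) hunit.isRelPrime_left
  exact (Irreducible.isRelPrime_iff_not_dvd (hs x hx).1.irreducible).mpr (hs x hx).2.2

end Coprime

section Action

variable {U : Type*} [AddCommGroup U] [Module F₂ U] [FiniteDimensional F₂ U]
variable {κ : Type*} [Fintype κ] [DecidableEq κ] {q : QuadraticForm F₂ U}

theorem aeval_algEquiv {A B τ : Type*} [CommRing A] [CommRing B] [Algebra F₂ A]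
    [Algebra F₂ B] (e : A ≃ₐ[F₂] B) (y : τ → A) (p : Poly τ) :
    maeval (fun i => e (y i)) p = e (maeval y p) :=
  (MvPolynomial.comp_aeval_apply y (e : A →ₐ[F₂] B) p).symm

theorem symAction_vec (g : U ≃ₗ[F₂] U) (x : Dual F₂ U) :
    symAction g (vec x) = vec (x ∘ₗ (g⁻¹ : U ≃ₗ[F₂] U).toLinearMap) :=
  SymmetricAlgebra.lift_ι_apply _ _

/-- The transport of coordinates by an isometry. -/
def Coords.act (c : Coords q κ) {g : U ≃ₗ[F₂] U} (hg : g ∈ orthogonalGroup q) :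
    Coords q κ where
  bas := c.bas.map (g⁻¹ : U ≃ₗ[F₂] U).dualMap
  v := c.v
  eq u := by
    have h : q (g⁻¹ u) = q u := (orthogonalGroup q).inv_mem hg u
    rw [← h, c.eq]
    rfl

theorem Coords.act_a (c : Coords q κ) {g : U ≃ₗ[F₂] U} (hg : g ∈ orthogonalGroup q) :
    (c.act hg).a = fun i => symAction g (c.a i) := by
  funext i
  rw [Coords.a, Coords.a, symAction_vec, act, Module.Basis.map_apply]
  rfl

theorem Coords.act_b (c : Coords q κ) {g : U ≃ₗ[F₂] U} (hg : g ∈ orthogonalGroup q) :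
    (c.act hg).b = fun i => symAction g (c.b i) := by
  funext i
  rw [Coords.b, Coords.b, symAction_vec, act, Module.Basis.map_apply]
  rfl

theorem symAction_xi (c : Coords q κ) {g : U ≃ₗ[F₂] U} (hg : g ∈ orthogonalGroup q) (k : ℕ) :
    symAction g (xi q k) = xi q k := by
  rcases k with _ | k
  · change symAction g (formElem q) = formElem q
    conv_rhs => rw [(c.act hg).formElem_eq, c.act_a, c.act_b]
    rw [c.formElem_eq, map_add, map_pow, map_qf, map_lin, comp_sumElim]
    rfl
  · conv_rhs => rw [(c.act hg).xi_succ, c.act_a, c.act_b]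
    rw [c.xi_succ, map_gram]

theorem Coords.Pminus_eq (c : Coords q κ) : Pminus q = ∏ w ∈ Finset.univ.filter
    (fun w : κ ⊕ κ → F₂ => arf w = 1), (X + C (lin (Sum.elim c.a c.b) (w - c.v))) := by
  rw [← c.prod_minusVectors fun w => X + C (lin (Sum.elim c.a c.b) (w - c.v)), Pminus]
  refine prod_congr rfl fun x _ => ?_
  rw [add_sub_cancel_left, ← c.vec_eq_lin]

theorem map_Pminus (c : Coords q κ) {g : U ≃ₗ[F₂] U} (hg : g ∈ orthogonalGroup q) :
    (Pminus q).map (symAction g : Sym U →+* Sym U) = Pminus q := by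
  conv_rhs => rw [(c.act hg).Pminus_eq, c.act_a, c.act_b]
  rw [c.Pminus_eq, pmap_prod]
  refine prod_congr rfl fun w _ => ?_
  rw [pmap_add, map_X, map_C, ← comp_sumElim, ← map_lin]
  rfl

theorem symAction_dInv (c : Coords q κ) {g : U ≃ₗ[F₂] U} (hg : g ∈ orthogonalGroup q)
    {n k : ℕ} (hn : card κ = n) (h0 : n ≠ 0) (hk : k ≤ n) :
    symAction g (dInv q n (n + k)) = dInv q n (n + k) := by
  rw [dInv_eq_coeff c hn h0 hk]
  conv_rhs => rw [← map_Pminus c hg, coeff_map]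
  rfl

theorem Coords.eval_formElem (c : Coords q κ) (u : U) :
    SymmetricAlgebra.lift (LinearMap.applyₗ u) (formElem q) = q u := by
  have h : ∀ x, SymmetricAlgebra.lift (LinearMap.applyₗ u) (vec x) = x u :=
    fun x => SymmetricAlgebra.lift_ι_apply _ _
  rw [OrthInv.formElem_eq q _ _ c.eq_sum_option, map_sum, c.eq_sum_option]
  simp only [map_mul, h]

/-- An automorphism that fixes `ξ_0` is an isometry. -/
theorem mem_orthogonalGroup_of_fix (c : Coords q κ) {g : U ≃ₗ[F₂] U}
    (h : symAction g (formElem q) = formElem q) : g ∈ orthogonalGroup q := by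
  have h1 : ∀ u, q (g⁻¹ u) = q u := fun u => by
    have h2 : (SymmetricAlgebra.lift (LinearMap.applyₗ u)).comp (symAction g) =
        SymmetricAlgebra.lift (LinearMap.applyₗ ((g⁻¹ : U ≃ₗ[F₂] U) u)) := by
      refine SymmetricAlgebra.algHom_ext (LinearMap.ext fun x => ?_)
      change SymmetricAlgebra.lift (LinearMap.applyₗ u) (symAction g (vec x)) =
        SymmetricAlgebra.lift _ (vec x)
      rw [symAction_vec, SymmetricAlgebra.lift_ι_apply, SymmetricAlgebra.lift_ι_apply]
      rfl
    rw [← c.eval_formElem, ← h2, comp_apply, h, c.eval_formElem]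
  have h2 : (g⁻¹ : U ≃ₗ[F₂] U) ∈ orthogonalGroup q := h1
  exact inv_inv g ▸ (orthogonalGroup q).inv_mem h2

theorem Coords.exists_symAction (c : Coords q κ) {φ : PairRing κ →ₐ[F₂] PairRing κ}
    (hφ : IsLinearSubst φ) (hinj : Injective φ) :
    ∃ g : U ≃ₗ[F₂] U, ∀ f, symAction g (c.equiv f) = c.equiv (φ f) := by
  choose v hv using hφ
  let x : κ ⊕ κ → Dual F₂ U := fun i => c.bas.equivFun.symm (v i)
  have hx : ∀ i, c.equiv (φ (mX i)) = vec (x i) := fun i => by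
    rw [hv, c.equiv_lin]
    exact congrArg vec (c.bas.equivFun_symm_apply _).symm
  let L : Dual F₂ U →ₗ[F₂] Dual F₂ U := c.bas.constr F₂ x
  have hL : ∀ y, vec (L y) = c.equiv (φ (c.equiv.symm (vec y))) := fun y => by
    conv_lhs => rw [← c.bas.sum_equivFun y, map_sum]
    conv_rhs => rw [c.vec_eq_equiv, AlgEquiv.symm_apply_apply, map_lin, lin, map_sum]
    rw [vec, map_sum]
    refine sum_congr rfl fun i _ => ?_
    rw [map_smul, map_smul, map_smul, hx]
    congr 2
    exact c.bas.constr_basis _ _ _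
  have hvec : Injective (vec : Dual F₂ U → Sym U) := fun y y' h => by
    rw [c.vec_eq_equiv, c.vec_eq_equiv] at h
    exact c.bas.equivFun.injective (lin_X_injective (c.equiv.injective h))
  have hLinj : Injective L := fun y y' h => by
    have h1 := congrArg vec h
    rw [hL, hL] at h1
    exact hvec (c.equiv.symm.injective (hinj (c.equiv.injective h1)))
  have hLsurj : Surjective L := LinearMap.injective_iff_surjective.mp hLinj
  let G : U →ₗ[F₂] U := (Module.evalEquiv F₂ U).symm.toLinearMap ∘ₗ L.dualMap ∘ₗ
    (Module.evalEquiv F₂ U).toLinearMap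
  have hG : ∀ y u, y (G u) = L y u := fun y u =>
    Module.apply_evalEquiv_symm_apply F₂ U y _
  have hGinj : Injective G := by
    rw [← LinearMap.ker_eq_bot, LinearMap.ker_eq_bot']
    intro u hu
    rw [← Module.forall_dual_apply_eq_zero_iff F₂]
    intro y
    obtain ⟨y, rfl⟩ := hLsurj y
    rw [← hG, hu, map_zero]
  let g : U ≃ₗ[F₂] U := (LinearEquiv.ofInjectiveEndo G hGinj)⁻¹
  refine ⟨g, fun f => ?_⟩
  have h2 : (symAction g).comp (c.equiv : PairRing κ →ₐ[F₂] Sym U) =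
      (c.equiv : PairRing κ →ₐ[F₂] Sym U).comp φ := by
    refine malgHom_ext fun i => ?_
    change symAction g (c.equiv (mX i)) = c.equiv (φ (mX i))
    rw [c.equiv_X, symAction_vec, ← c.equiv.symm_apply_apply (mX i), c.equiv_X, ← hL]
    congr 1
    refine LinearMap.ext fun u => ?_
    rw [← hG]
    rfl
  exact dcongr_fun h2 f

variable {τ : Type*} [Fintype τ] (y : τ → Sym U) (s : Sym U)

theorem Coords.aeval_symm (c : Coords q κ) (p : Poly τ) :
    maeval (fun i => c.equiv.symm (y i)) p = c.equiv.symm (maeval y p) :=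
  aeval_algEquiv c.equiv.symm y p

theorem Coords.mem_range_symm (c : Coords q κ) {f : Sym U} :
    c.equiv.symm f ∈ (maeval (R := F₂) fun i => c.equiv.symm (y i)).range ↔
      f ∈ (maeval (R := F₂) y).range := by
  constructor
  · rintro ⟨p, hp⟩
    exact ⟨p, c.equiv.symm.injective ((c.aeval_symm y p).symm.trans hp)⟩
  · rintro ⟨p, hp⟩
    exact ⟨p, (c.aeval_symm y p).trans (congrArg _ hp)⟩

theorem Coords.symm_dk (c : Coords q κ) (j : ℕ) :
    dk mX j = c.equiv.symm (cf c.a c.b j) := by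
  rw [← c.equiv_cf, AlgEquiv.symm_apply_apply, cf, sumElim_gl_gr]

variable {y s} (c : Coords q κ)

theorem Coords.dk_mem (h : ∀ j, ∃ k, s ^ k * cf c.a c.b j ∈
    (maeval (R := F₂) y).range) (j : ℕ) : ∃ k, c.equiv.symm s ^ k *
      dk mX j ∈ (maeval (R := F₂) fun i => c.equiv.symm (y i)).range := by
  obtain ⟨k, hk⟩ := h j
  refine ⟨k, ?_⟩
  rwa [c.symm_dk, ← map_pow, ← map_mul, c.mem_range_symm]

theorem Coords.algebraicIndependent (hcard : card τ = 2 * card κ) (hs0 : s ≠ 0)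
    (hs : s ∈ (maeval (R := F₂) y).range)
    (h : ∀ j, ∃ k, s ^ k * cf c.a c.b j ∈ (maeval (R := F₂) y).range) :
    AlgebraicIndependent F₂ y := by
  have h1 := algebraicIndependent_of_dk (fun i => c.equiv.symm (y i)) (c.equiv.symm s)
    (by rw [hcard, card_sum, two_mul])
    (fun h => hs0 (c.equiv.symm.injective (h.trans (map_zero c.equiv.symm).symm)))
    ((c.mem_range_symm y).mpr hs) (c.dk_mem h)
  intro p p' hp
  exact h1 ((c.aeval_symm y p).trans ((congrArg _ hp).trans (c.aeval_symm y p').symm))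

theorem Coords.exists_pow_mul_mem (hcard : card τ = 2 * card κ) (hs0 : s ≠ 0)
    (hs : s ∈ (maeval (R := F₂) y).range)
    (h : ∀ j, ∃ k, s ^ k * cf c.a c.b j ∈ (maeval (R := F₂) y).range) {f : Sym U}
    (hf : ∀ g : U ≃ₗ[F₂] U, (∀ i, symAction g (y i) = y i) → symAction g f = f) :
    ∃ k, s ^ k * f ∈ (maeval (R := F₂) y).range := by
  obtain ⟨k, hk⟩ := exists_pow_mul_mem_range (fun i => c.equiv.symm (y i)) (c.equiv.symm s)
    (by rw [hcard, card_sum, two_mul])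
    (fun h => hs0 (c.equiv.symm.injective (h.trans (map_zero c.equiv.symm).symm)))
    ((c.mem_range_symm y).mpr hs) (c.dk_mem h) (c.equiv.symm f) fun φ h1 h2 h3 => by
      obtain ⟨g, hg⟩ := c.exists_symAction h1 h2
      have key : ∀ f, φ (c.equiv.symm f) = c.equiv.symm (symAction g f) := fun f => by
        rw [AlgEquiv.eq_symm_apply, ← hg, AlgEquiv.apply_symm_apply]
      rw [key, hf g fun i => c.equiv.symm.injective (by rw [← key, h3])]
  refine ⟨k, ?_⟩
  rwa [← map_pow, ← map_mul, c.mem_range_symm] at hk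

end Action

section Descent

variable {B : Type*} [CommRing B] [Algebra F₂ B]

/-- The elements that a power of `s` multiplies into `A`. -/
def satur (A : Subalgebra F₂ B) (s : B) (hs : s ∈ A) : Subalgebra F₂ B where
  carrier := {f | ∃ k, s ^ k * f ∈ A}
  mul_mem' := by
    rintro f g ⟨k, hk⟩ ⟨l, hl⟩
    exact ⟨k + l, by rw [pow_add, mul_mul_mul_comm]; exact mul_mem hk hl⟩
  add_mem' := by
    rintro f g ⟨k, hk⟩ ⟨l, hl⟩
    refine ⟨k + l, ?_⟩
    rw [mul_add, pow_add]
    refine add_mem ?_ ?_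
    · rw [mul_comm (s ^ k), mul_assoc]; exact mul_mem (pow_mem hs l) hk
    · rw [mul_assoc]; exact mul_mem (pow_mem hs k) hl
  algebraMap_mem' r := ⟨0, by rw [pow_zero, one_mul]; exact A.algebraMap_mem r⟩

theorem mem_satur {A : Subalgebra F₂ B} {s : B} {hs : s ∈ A} {f : B} :
    f ∈ satur A s hs ↔ ∃ k, s ^ k * f ∈ A := Iff.rfl

theorem le_satur {A : Subalgebra F₂ B} {s : B} {hs : s ∈ A} : A ≤ satur A s hs :=
  fun f hf => ⟨0, by rwa [pow_zero, one_mul]⟩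

theorem squareColumn_mem (n : ℕ) (i : Fin (n - 1)) :
    squareColumn n i ∈ supported F₂ (Iic (2 * n - 1)) := by
  rcases n with _ | m
  · exact i.elim0
  have hi : (i : ℕ) < m := i.2
  have h1 : ∀ {p d}, WH p d → d ≤ 2 ^ (2 * (m + 1)) →
      p ∈ supported F₂ (Iic (2 * (m + 1) - 1)) := fun h hd =>
    h.mem_supported (by
      rw [show 2 * (m + 1) - 1 + 1 = 2 * (m + 1) by omega]
      omega)
  have h2 : ∀ a b c : ℕ, a < c → b < c → 2 ^ a + 2 ^ b ≤ 2 ^ c := fun a b c ha hb => by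
    have h1 : 2 ^ a ≤ 2 ^ (c - 1) := pow_le_pow_right (by omega) (by omega)
    have h2 : 2 ^ b ≤ 2 ^ (c - 1) := pow_le_pow_right (by omega) (by omega)
    have h3 : 2 ^ c = 2 * 2 ^ (c - 1) := by rw [← pow_succ']; congr 1; omega
    omega
  rw [squareColumn_eq]
  refine add_mem (sum_mem fun l _ => mul_mem ?_ ?_) (sum_mem fun k _ => mul_mem (pow_mem ?_ 2) ?_)
  · exact h1 (wh_symEntry _ _) (h2 _ _ _ (by omega) (by omega))
  · exact h1 ((wh_K_E (m + 1)).2 l) (sub_le _ _)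
  · exact h1 (wh_nrow (Nat.lt_succ_iff.mp k.2)) (h2 _ _ _ (by omega) (by omega))
  · exact h1 (wh_F (m + 1) k) (sub_le _ _)

variable {U : Type*} [AddCommGroup U] [Module F₂ U] [FiniteDimensional F₂ U]
variable {κ : Type*} [Fintype κ] [DecidableEq κ] {q : QuadraticForm F₂ U} {n : ℕ}

/-- The subalgebra of `S(U^*)` generated by `ξ_0, …, ξ_{N-1}`. -/
abbrev xiRange (q : QuadraticForm F₂ U) (N : ℕ) : Subalgebra F₂ (Sym U) :=
  (maeval (R := F₂) fun i : Fin N => xi q i).range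

theorem xiS_mem {N : ℕ} {p : XiRing} (hp : p ∈ supported F₂ (Iio N)) :
    xiS q p ∈ xiRange q N := by
  rw [supported] at hp
  have : adjoin F₂ (mX '' Iio N) ≤ (xiRange q N).comap (xiS q) := by
    rw [adjoin_le_iff]
    rintro _ ⟨k, hk, rfl⟩
    refine ⟨mX ⟨k, hk⟩, ?_⟩
    rw [xiS]
    simp
  exact this hp

theorem supported_Iic_lt {N M : ℕ} {p : XiRing} (h : N < M)
    (hp : p ∈ supported F₂ (Iic N)) :
    p ∈ supported F₂ (Iio M) :=
  supported_mono (fun _ hk => lt_of_le_of_lt hk h) hp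

theorem exists_xiS_eq {N : ℕ} {f : Sym U} (h : f ∈ xiRange q N) :
    ∃ p ∈ supported F₂ (Iio N), xiS q p = f := by
  obtain ⟨p, rfl⟩ := h
  refine ⟨MvPolynomial.rename (fun i : Fin N => (i : ℕ)) p, ?_, ?_⟩
  · have := MvPolynomial.supported_eq_range_rename (R := F₂) (Iio N)
    have hle := MvPolynomial.vars_rename (fun i : Fin N => (i : ℕ)) p
    rw [MvPolynomial.mem_supported]
    intro k hk
    obtain ⟨i, -, rfl⟩ := Finset.mem_image.mp (hle hk)
    exact i.2
  · rw [xiS, aeval_rename]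
    rfl

/-- The Dickson invariants lie in any subalgebra that contains `ξ_0, …, ξ_{2n-1}` and the squares
of the `d_j`. -/
theorem cf_mem (c : Coords q κ) (hn : card κ = n) (h0 : n ≠ 0)
    {R : Subalgebra F₂ (Sym U)} (hxi : xiRange q (2 * n) ≤ R)
    (hd : ∀ l : Fin n, dInv q n (n + l) ^ 2 ∈ R) (j : ℕ) : cf c.a c.b j ∈ R := by
  have hR : ∀ {p d}, WH p d → d ≤ 2 ^ (2 * n) → xiS q p ∈ R := fun h hd =>
    hxi (xiS_mem (supported_Iic_lt (by omega) (h.mem_supported (N := 2 * n - 1) (by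
      rw [show 2 * n - 1 + 1 = 2 * n by omega]; omega))))
  have h1 : ∀ k : Fin n, cf c.a c.b (n + k) ∈ R := fun k => by
    rw [cf_high_eq c hn h0]
    refine add_mem (sum_mem fun l _ => mul_mem (pow_mem (hR (wh_J k l) ?_) 2) (hd l))
      (hR (wh_F n k) (sub_le _ _))
    exact (sub_le _ _).trans (pow_le_pow_right (by omega) (by omega))
  rcases lt_trichotomy j (2 * n) with h | rfl | h
  · rcases Nat.lt_or_ge j n with h2 | h2
    · rw [show j = ((⟨j, h2⟩ : Fin n) : ℕ) from rfl, cf_low_eq c hn]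
      refine add_mem (sum_mem fun l _ => mul_mem (hR ((wh_K_E n).1 _ l) ?_) (h1 l))
        (hR ((wh_K_E n).2 _) (sub_le _ _))
      exact (sub_le _ _).trans (pow_le_pow_right (by omega) (by omega))
    · have := h1 ⟨j - n, by omega⟩
      rwa [show n + ((⟨j - n, by omega⟩ : Fin n) : ℕ) = j by simp only; omega] at this
  · rw [cf_top _ _ hn]; exact one_mem R
  · rw [cf_of_lt _ _ hn h]; exact zero_mem R

theorem T_xiS_mem {N : ℕ} (hN : 2 * n - 2 < N) (i j : Fin (n - 1)) :
    xiS q (T n i j) ∈ xiRange q N :=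
  xiS_mem (supported_Iic_lt hN (T_mem n i j))

theorem det_xiS_eq {n' : ℕ} (M : Matrix (Fin n') (Fin n') XiRing) :
    xiS q M.det = (M.map (xiS q)).det := map_det _ _

theorem dInv_sq_mem (c : Coords q κ) (hn : card κ = n) (h0 : n ≠ 0)
    (hq : IsMinusType q) (l : Fin n) : ∃ k, xiS q (T n).det ^ k * dInv q n (n + l) ^ 2 ∈
      xiRange q (2 * n) := by
  rcases l with ⟨_ | l, hl⟩
  · exact ⟨0, by
      change _ * dInv q n (n + 0) ^ 2 ∈ _
      rw [add_zero, dInv_self c hn h0 hq, zero_pow two_ne_zero, mul_zero]; exact zero_mem _⟩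
  have hA : ∀ k < 2 * n, xi q k ∈ xiRange q (2 * n) := fun k hk =>
    ⟨mX ⟨k, hk⟩, by simp⟩
  let M : Matrix (Fin (n - 1)) (Fin (n - 1)) (Sym U) := Matrix.of fun i j => xiS q (T n i j) ^ 2
  have hM : ∀ i, (M.mulVec fun j => dInv q n (n + 1 + j) ^ 2) i ∈ xiRange q (2 * n) := fun i => by
    have h := rootElem_sq c hn hq i
    rw [rootElem, CharTwo.add_sq, CharTwo.sum_sq] at h
    have h1 : (M.mulVec fun j => dInv q n (n + 1 + j) ^ 2) i = xiS q (squareColumn n i) +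
        (xi q (2 * n - 1 - i) ^ 2 ^ (i : ℕ)) ^ 2 := by
      rw [← h, add_assoc, CharTwo.add_self_eq_zero, add_zero]
      change ∑ j, xiS q (T n i j) ^ 2 * dInv q n (n + 1 + j) ^ 2 = _
      exact sum_congr rfl fun j _ => (mul_pow (xiS q (T n i j)) _ 2).symm
    rw [h1]
    exact add_mem (xiS_mem (supported_Iic_lt (by omega) (squareColumn_mem n i)))
      (pow_mem (pow_mem (hA _ (by omega)) _) _)
  have h2 := det_mul_mem_of_mulVec (M := M) (S := xiRange q (2 * n))
    (fun i j => pow_mem (T_xiS_mem (by omega) i j) 2) hM ⟨l, by omega⟩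
  have h3 : M.det = xiS q (T n).det ^ 2 := by
    rw [det_xiS_eq]
    exact ((frobenius (Sym U) 2).map_det ((T n).map (xiS q))).symm
  rw [h3] at h2
  refine ⟨2, ?_⟩
  rwa [show n + ((⟨l + 1, hl⟩ : Fin n) : ℕ) = n + 1 + l by simp only; ring]

theorem xiS_det_mem {N : ℕ} (hN : 2 * n - 2 < N) : xiS q (T n).det ∈ xiRange q N :=
  xiS_mem (supported_Iic_lt hN (det_mem_of_forall _ fun i j => T_mem n i j))

theorem pow_mul_cf_mem (c : Coords q κ) (hn : card κ = n) (h0 : n ≠ 0)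
    (hq : IsMinusType q) (j : ℕ) : ∃ k, xiS q (T n).det ^ k * cf c.a c.b j ∈ xiRange q (2 * n) :=
  mem_satur.mp (cf_mem c hn h0 (R := satur _ _ (xiS_det_mem (by omega))) le_satur
    (fun l => dInv_sq_mem c hn h0 hq l) j)

/-- The elements `ξ_0, …, ξ_{2n-1}` of `S(U^*)` are algebraically independent. -/
theorem algebraicIndependent_xi (c : Coords q κ) (hn : card κ = n) (h0 : n ≠ 0)
    (hq : IsMinusType q) : AlgebraicIndependent F₂ fun i : Fin (2 * n) => xi q i :=
  c.algebraicIndependent (by rw [card_fin, hn]) (xiS_det_ne_zero c hn hq)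
    (xiS_det_mem (by omega)) (pow_mul_cf_mem c hn h0 hq)

theorem xiS_injective (c : Coords q κ) (hn : card κ = n) (h0 : n ≠ 0)
    (hq : IsMinusType q) {p p' : XiRing}
    (hp : p ∈ supported F₂ (Iio (2 * n)))
    (hp' : p' ∈ supported F₂ (Iio (2 * n))) (h : xiS q p = xiS q p') :
    p = p' := by
  rw [MvPolynomial.supported_eq_range_rename] at hp hp'
  obtain ⟨r, rfl⟩ := hp
  obtain ⟨r', rfl⟩ := hp'
  have h1 : ∀ r : MvPolynomial (Iio (2 * n)) F₂, xiS q (MvPolynomial.rename (↑) r) =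
      maeval (fun i : Fin (2 * n) => xi q i)
        (MvPolynomial.rename (fun i : Iio (2 * n) => (⟨i, i.2⟩ : Fin (2 * n))) r) := fun r => by
    rw [xiS, aeval_rename, aeval_rename]
    rfl
  have h2 : MvPolynomial.rename (fun i : Iio (2 * n) => (⟨i, i.2⟩ : Fin (2 * n))) r = _ :=
    algebraicIndependent_xi c hn h0 hq ((h1 r).symm.trans (h.trans (h1 r')))
  rw [rename_injective _ (fun i j hij => Subtype.ext (congrArg Fin.val hij)) h2]

/-- The entries of the column under the square root are squares. -/
theorem isSquare_squareColumn (c : Coords q κ) (hn : card κ = n) (h0 : n ≠ 0)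
    (hq : IsMinusType q) (i : Fin (n - 1)) : IsSquare (squareColumn n i) := by
  have hr := rootElem_sq c hn hq i
  obtain ⟨k, hk⟩ := c.exists_pow_mul_mem (f := rootElem q n i) (by rw [card_fin, hn])
    (xiS_det_ne_zero c hn hq) (xiS_det_mem (by omega)) (pow_mul_cf_mem c hn h0 hq) fun g hg => by
      refine sq_injective ?_
      change symAction g _ ^ 2 = _ ^ 2
      have h1 : (symAction g).comp (xiS q) = maeval fun i => symAction g (xi q i) :=
        malgHom_ext fun i => by simp [xiS]
      have h2 := symAction_xi c (mem_orthogonalGroup_of_fix c (hg ⟨0, by omega⟩))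
      rw [← map_pow, hr, ← comp_apply, h1]
      simp only [h2]
      rfl
  obtain ⟨g, hg, hgk⟩ := exists_xiS_eq hk
  have hdet : (T n).det ∈ supported F₂ (Iio (2 * n)) :=
    supported_Iic_lt (by omega) (det_mem_of_forall _ fun i j => T_mem n i j)
  have h1 : g ^ 2 = ((T n).det ^ k) ^ 2 * squareColumn n i := by
    refine xiS_injective c hn h0 hq (pow_mem hg 2)
      (mul_mem (pow_mem (pow_mem hdet k) 2) (supported_Iic_lt (by omega) (squareColumn_mem n i))) ?_
    rw [map_pow, hgk, mul_pow, map_mul, map_pow, map_pow, hr]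
  have h2 : (T n).det ≠ 0 := fun h => xiS_det_ne_zero c hn hq (by rw [h, map_zero])
  obtain ⟨r, rfl⟩ : (T n).det ^ k ∣ g :=
    (IsIntegrallyClosed.pow_dvd_pow_iff two_ne_zero).mp (Dvd.intro _ h1.symm)
  refine ⟨r, ?_⟩
  rw [mul_pow] at h1
  rw [← sq, mul_left_cancel₀ (pow_ne_zero 2 (pow_ne_zero k h2)) h1]

end Descent

section LeadingMonomials

variable {σ : Type*} [Fintype σ] [DecidableEq σ] {ω : σ → ℕ}

/-- The polynomials all of whose monomials have weight less than `d`. -/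
def lowPart (ω : σ → ℕ) (d : ℕ) : Submodule F₂ (Poly σ) :=
  MvPolynomial.restrictSupport F₂ {s | weight ω s < d}

theorem mul_mem_lowPart {a b : ℕ} {f g : Poly σ} (hf : f ∈ lowPart ω (a + 1))
    (hg : g ∈ lowPart ω b) : f * g ∈ lowPart ω (a + b) := fun s hs => by
  obtain ⟨t, ht, u, hu, rfl⟩ := Finset.mem_add.mp (MvPolynomial.support_mul f g hs)
  change weight ω (t + u) < _
  have h1 := hf ht
  have h2 := hg hu
  simp only [Set.mem_ofPred_eq] at h1 h2
  rw [map_add]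
  omega

theorem lowPart_mono {a b : ℕ} (h : a ≤ b) : lowPart ω a ≤ lowPart ω b :=
  fun _ hf _ hs => lt_of_lt_of_le (hf hs) h

/-- `f` has the leading monomial `s` for the weight `ω`. -/
def Lead (ω : σ → ℕ) (f : Poly σ) (s : σ →₀ ℕ) : Prop :=
  f - mmonomial s 1 ∈ lowPart ω (weight ω s)

theorem Lead.self (s : σ →₀ ℕ) : Lead ω (mmonomial s 1) s := by
  rw [Lead, sub_self]; exact zero_mem _

theorem monomial_mem_lowPart (s : σ →₀ ℕ) :
    mmonomial s (1 : F₂) ∈ lowPart ω (weight ω s + 1) :=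
  fun t ht => by
    rw [Finset.mem_singleton.mp (MvPolynomial.support_monomial_subset ht)]
    exact Nat.lt_succ_self _

theorem Lead.mul {f g : Poly σ} {s t : σ →₀ ℕ} (hf : Lead ω f s)
    (hg : Lead ω g t) : Lead ω (f * g) (s + t) := by
  have h1 : f ∈ lowPart ω (weight ω s + 1) := by
    have := add_mem (lowPart_mono (Nat.le_succ _) hf) (monomial_mem_lowPart s)
    rwa [sub_add_cancel] at this
  have h2 : f * g - mmonomial (s + t) 1 = f * (g - mmonomial t 1) +
      mmonomial t 1 * (f - mmonomial s 1) := by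
    rw [← mul_one (1 : F₂), ← monomial_mul, mul_one]
    ring
  rw [Lead, h2, map_add]
  refine add_mem (mul_mem_lowPart h1 hg) ?_
  rw [add_comm]
  exact mul_mem_lowPart (monomial_mem_lowPart t) hf

theorem Lead.pow {f : Poly σ} {s : σ →₀ ℕ} (hf : Lead ω f s) (k : ℕ) :
    Lead ω (f ^ k) (k • s) := by
  induction k with
  | zero => rw [pow_zero, zero_smul]; exact Lead.self 0
  | succ k ih => rw [pow_succ, succ_nsmul]; exact ih.mul hf

theorem Lead.prod {ι : Type*} (t : Finset ι) {f : ι → Poly σ} {s : ι → σ →₀ ℕ}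
    (h : ∀ i, Lead ω (f i) (s i)) : Lead ω (∏ i ∈ t, f i) (∑ i ∈ t, s i) := by
  classical
  induction t using Finset.induction with
  | empty => exact Lead.self 0
  | insert i t hi ih => rw [Finset.prod_insert hi, sum_insert hi]; exact (h i).mul ih

variable {r : σ → Poly σ} {e : σ → ℕ}

/-- The linear endomorphism that replaces in every monomial `X_x ^ {e_x}` by `r_x` as often as
possible. -/
def replaceMap (r : σ → Poly σ) (e : σ → ℕ) :
    Poly σ →ₗ[F₂] Poly σ :=
  (MvPolynomial.basisMonomials σ F₂).constr F₂
    fun s => ∏ x, (r x ^ (s x / e x) * mX x ^ (s x % e x))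

theorem replaceMap_monomial (s : σ →₀ ℕ) : replaceMap r e (mmonomial s 1) =
    ∏ x, (r x ^ (s x / e x) * mX x ^ (s x % e x)) := by
  have h := (MvPolynomial.basisMonomials σ F₂).constr_basis F₂
    (fun s => ∏ x, (r x ^ (s x / e x) * mX x ^ (s x % e x))) s
  rwa [MvPolynomial.coe_basisMonomials] at h

theorem replaceMap_mul (he : ∀ x, 0 < e x) (x : σ) (f : Poly σ) :
    replaceMap r e (mX x ^ e x * f) = r x * replaceMap r e f := by
  have : (replaceMap r e).comp (mulLeft F₂ (mX x ^ e x)) =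
      (mulLeft F₂ (r x)).comp (replaceMap r e) := by
    refine (MvPolynomial.basisMonomials σ F₂).ext fun s => ?_
    rw [MvPolynomial.coe_basisMonomials]
    simp only [LinearMap.comp_apply, LinearMap.mulLeft_apply]
    rw [mX_pow_eq, monomial_mul, mul_one, replaceMap_monomial,
      replaceMap_monomial]
    have h1 : r x = ∏ y, if y = x then r x else 1 := by
      rw [Finset.prod_ite_eq' univ x fun _ => r x, if_pos (mem_univ x)]
    conv_rhs => rw [h1]
    rw [← prod_mul_distrib]
    refine prod_congr rfl fun y _ => ?_
    rw [Finsupp.add_apply]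
    split_ifs with h
    · subst h
      rw [single_eq_same, Nat.add_div_left _ (he y), Nat.add_mod_left, pow_succ', mul_assoc]
    · rw [single_eq_of_ne h, zero_add, one_mul]
  exact LinearMap.congr_fun this f

theorem lead_replaceMap (hr : ∀ x, Lead ω (r x) (single x (e x)))
    (s : σ →₀ ℕ) : Lead ω (replaceMap r e (mmonomial s 1)) s := by
  have h := Lead.prod univ fun x => ((hr x).pow (s x / e x)).mul
    (Lead.self (ω := ω) (single x (s x % e x)))
  rw [replaceMap_monomial]
  simp only [mX_pow_eq]
  convert h
  conv_lhs => rw [← Finsupp.univ_sum_single s]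
  refine sum_congr rfl fun x _ => ?_
  rw [Finsupp.smul_single, ← Finsupp.single_add, smul_eq_mul, mul_comm, Nat.div_add_mod]

theorem replaceMap_sub_mem (hr : ∀ x, Lead ω (r x) (single x (e x)))
    {d : ℕ} {f : Poly σ} (hf : f ∈ lowPart ω (d + 1)) :
    replaceMap r e f - f ∈ lowPart ω d := by
  rw [f.as_sum, map_sum, ← sum_sub_distrib]
  refine sum_mem fun s hs => ?_
  have h1 : mmonomial s (f.coeff s) = f.coeff s • mmonomial s (1 : F₂) := by
    rw [MvPolynomial.smul_monomial, smul_eq_mul, mul_one]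
  rw [h1, map_smul, ← smul_sub]
  exact smul_mem _ _ (lowPart_mono (Nat.le_of_lt_succ (hf hs)) (lead_replaceMap hr s))

theorem replaceMap_bijective (hr : ∀ x, Lead ω (r x) (single x (e x)))
    : Function.Bijective (replaceMap r e) := by
  have h0 : ∀ f : Poly σ, ∃ d, f ∈ lowPart ω d := fun f =>
    ⟨f.support.sup (weight ω) + 1, fun s hs => Nat.lt_succ_of_le (Finset.le_sup hs)⟩
  have h00 : ∀ f ∈ lowPart ω 0, f = 0 := fun f hf => by
    rw [← MvPolynomial.support_eq_empty, Finset.eq_empty_iff_forall_notMem]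
    exact fun s hs => Nat.not_lt_zero _ (hf hs)
  constructor
  · rw [injective_iff_map_eq_zero]
    intro f hf
    have : ∀ d, f ∈ lowPart ω d → f = 0 := fun d => by
      induction d with
      | zero => exact h00 f
      | succ d ih =>
        intro h
        have := replaceMap_sub_mem hr h
        rw [hf, zero_sub, neg_mem_iff] at this
        exact ih this
    exact (h0 f).elim this
  · have : ∀ d, ∀ f ∈ lowPart ω d, f ∈ LinearMap.range (replaceMap r e) := fun d => by
      induction d with
      | zero => intro f hf; rw [h00 f hf]; exact zero_mem _
      | succ d ih =>
        intro f hf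
        have := sub_mem (LinearMap.mem_range_self (replaceMap r e) f)
          (ih _ (replaceMap_sub_mem hr hf))
        rwa [sub_sub_cancel] at this
    exact fun f => (h0 f).elim fun d hd => this d f hd

/-- The bijection `replaceMap`. -/
def replaceEquiv (hr : ∀ x, Lead ω (r x) (single x (e x))) :
    Poly σ ≃ₗ[F₂] Poly σ :=
  LinearEquiv.ofBijective (replaceMap r e) (replaceMap_bijective hr)

theorem isRegular_X_pow (he : ∀ x, 0 < e x) (l : List σ) (hl : l.Nodup) :
    IsRegSeq (Poly σ)
      (l.map fun x => (mX x ^ e x : Poly σ)) := by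
  have key : ∀ l : List σ, ∀ f : Poly σ,
      f ∈ (ofList (l.map fun x => (mX x ^ e x : Poly σ)) • ⊤ :
        Submodule (Poly σ) (Poly σ)) ↔
      ∀ s ∈ f.support, ∃ x ∈ l, e x ≤ s x := fun l f => by
    rw [smul_eq_mul, Ideal.mul_top, ofList]
    have h1 : {a | a ∈ l.map fun x => (mX x ^ e x : Poly σ)} =
        (fun s => mmonomial s (1 : F₂)) '' ((fun x => single x (e x)) '' {x | x ∈ l}) := by
      ext a
      simp [mX_pow_eq]
    rw [h1, MvPolynomial.mem_ideal_span_monomial_image]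
    simp [Finsupp.single_le_iff]
  refine ⟨⟨fun i hi => ?_⟩, fun h => ?_⟩
  · rw [List.length_map] at hi
    rw [← List.map_take, List.getElem_map]
    intro a b h
    obtain ⟨a, rfl⟩ := Submodule.mkQ_surjective _ a
    obtain ⟨b, rfl⟩ := Submodule.mkQ_surjective _ b
    replace h : Submodule.Quotient.mk ((mX l[i] ^ e l[i] : Poly σ) • a) =
      Submodule.Quotient.mk ((mX l[i] ^ e l[i] : Poly σ) • b) := h
    rw [Submodule.Quotient.eq, ← smul_sub, key, smul_eq_mul, mX_pow_eq,
      mul_comm] at h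
    refine (Submodule.Quotient.eq _).mpr ((key _ _).mpr fun s hs => ?_)
    obtain ⟨x, hx, hle⟩ := h (s + single l[i] (e l[i])) (by
      rw [mmem_support, MvPolynomial.coeff_mul_monomial, mul_one]
      exact MvPolynomial.mem_support_iff.mp hs)
    refine ⟨x, hx, ?_⟩
    have hne : l[i] ≠ x := fun h => by
      rw [← List.take_append_drop i l, List.nodup_append, List.drop_eq_getElem_cons hi] at hl
      exact hl.2.2 _ hx _ (List.mem_cons_self) h.symm
    rwa [Finsupp.add_apply, single_eq_of_ne hne.symm, add_zero] at hle
  · have := (key l 1).mp (by rw [← h]; trivial) 0 (by simp)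
    obtain ⟨x, -, hx⟩ := this
    exact absurd (he x) (by simpa using hx)

theorem isRegular_of_lead (hr : ∀ x, Lead ω (r x) (single x (e x)))
    (he : ∀ x, 0 < e x) (l : List σ) (hl : l.Nodup) :
    IsRegSeq (Poly σ) (l.map r) := by
  refine (AddEquiv.isRegular_congr (e := (replaceEquiv hr).toAddEquiv) ?_).mp
    (isRegular_X_pow he l hl)
  rw [List.forall₂_map_left_iff, List.forall₂_map_right_iff, List.forall₂_same]
  exact fun x _ f => replaceMap_mul he x f

end LeadingMonomials

section Coefficients

theorem mem_span_X_pow {ζ P : Type*} [CommRing P] (e : ζ → ℕ) (f : MvPolynomial ζ P) :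
    f ∈ span (Set.range fun z => (mX z ^ e z : MvPolynomial ζ P)) ↔
      ∀ s ∈ f.support, ∃ z, e z ≤ s z := by
  have h1 : (Set.range fun z => (mX z ^ e z : MvPolynomial ζ P)) =
      (fun s => mmonomial s (1 : P)) '' (Set.range fun x => single x (e x)) := by
    rw [← Set.range_comp]
    exact congrArg _ (funext fun z => mX_pow_eq)
  rw [h1, MvPolynomial.mem_ideal_span_monomial_image]
  simp [Finsupp.single_le_iff]

/-- Coefficients with respect to a basis of the quotient by `r`. -/
theorem exists_coeffs_of_addEquiv {ζ P A : Type*} [Fintype ζ] [DecidableEq ζ] [CommRing P]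
    [CommRing A] {i : P →+* A} {r : ζ → A} {e : ζ → ℕ} (Θ : A ≃+ MvPolynomial ζ P)
    (h1 : ∀ z f, Θ (r z * f) = mX z ^ e z * Θ f)
    (h2 : ∀ p f, Θ (i p * f) = mC p * Θ f) :
    ∃ c : A →+ ((∀ z, Fin (e z)) → P), Surjective c ∧ (∀ p f, c (i p * f) = p • c f) ∧
      ∀ f, c f = 0 ↔ f ∈ span (Set.range r) := by
  let m (s : ∀ z, Fin (e z)) : ζ →₀ ℕ := Finsupp.equivFunOnFinite.symm fun z => (s z : ℕ)
  have hm : Injective m := fun s t h => funext fun z => Fin.ext (dcongr_fun h z)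
  let c : A →+ ((∀ z, Fin (e z)) → P) :=
    { toFun := fun f s => (Θ f).coeff (m s)
      map_zero' := funext fun s => by rw [map_zero, MvPolynomial.coeff_zero]; rfl
      map_add' := fun f g => funext fun s => by rw [map_add, MvPolynomial.coeff_add]; rfl }
  refine ⟨c, fun g => ⟨Θ.symm (∑ s, mmonomial (m s) (g s)), funext fun t => ?_⟩,
    fun p f => funext fun s => ?_, fun f => ?_⟩
  · change (Θ (Θ.symm _)).coeff (m t) = _
    rw [AddEquiv.apply_symm_apply, MvPolynomial.coeff_sum, sum_eq_single t]
    · rw [mcoeff_monomial, if_pos rfl]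
    · exact fun s _ hs => by rw [mcoeff_monomial, if_neg fun h => hs (hm h)]
    · exact fun h => absurd (mem_univ t) h
  · change (Θ _).coeff (m s) = p • (Θ f).coeff (m s)
    rw [h2, MvPolynomial.coeff_C_mul, smul_eq_mul]
  · have h3 : f ∈ span (Set.range r) ↔ Θ f ∈ span (Set.range fun z =>
        (mX z ^ e z : MvPolynomial ζ P)) := by
      rw [Ideal.mem_span_range_iff_exists_fun, Ideal.mem_span_range_iff_exists_fun]
      constructor
      · rintro ⟨a, rfl⟩
        refine ⟨fun z => Θ (a z), ?_⟩
        rw [map_sum]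
        exact sum_congr rfl fun z _ => by rw [mul_comm (a z), h1, mul_comm]
      · rintro ⟨a, ha⟩
        refine ⟨fun z => Θ.symm (a z), Θ.injective ?_⟩
        rw [map_sum, ← ha]
        exact sum_congr rfl fun z _ => by
          rw [mul_comm _ (r z), h1, mul_comm, AddEquiv.apply_symm_apply]
    rw [h3, mem_span_X_pow]
    constructor
    · intro h s hs
      by_contra! hlt
      have hsz : m (fun z => ⟨s z, hlt z⟩) = s := Finsupp.ext fun _ => rfl
      rw [mmem_support, ← hsz] at hs
      exact hs (congrFun h _)
    · intro h
      refine funext fun s => ?_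
      change (Θ f).coeff (m s) = 0
      by_contra hs
      obtain ⟨z, hz⟩ := h _ (MvPolynomial.mem_support_iff.mpr hs)
      exact absurd (s z).2 (Nat.not_lt.mpr hz)

variable {σ : Type*} [Fintype σ] [DecidableEq σ] {ω : σ → ℕ}
variable {r : σ → Poly σ} {e : σ → ℕ} (Z : σ → Prop) [DecidablePred Z]

/-- The polynomials in the variables outside `Z`. -/
abbrev Params : Type _ := MvPolynomial {x // ¬ Z x} F₂

/-- The polynomials in the variables outside `Z` among all polynomials. -/
abbrev ofParams : Params Z →ₐ[F₂] Poly σ :=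
  MvPolynomial.rename Subtype.val

/-- Polynomials as polynomials in the variables in `Z`. -/
def splitVars : Poly σ ≃ₐ[F₂] MvPolynomial {x // Z x} (Params Z) :=
  (MvPolynomial.renameEquiv F₂ (Equiv.sumCompl Z).symm).trans
    (MvPolynomial.sumAlgEquiv F₂ {x // Z x} {x // ¬ Z x})

theorem splitVars_X (z : {x // Z x}) : splitVars Z (mX z) = mX z := by
  rw [splitVars, trans_apply, MvPolynomial.renameEquiv_apply, rename_X,
    Equiv.sumCompl_symm_apply_of_pos z.2]
  exact MvPolynomial.sumRingEquiv_X_inl F₂ {x // Z x} {x // ¬ Z x} z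

theorem splitVars_ofParams (p : Params Z) : splitVars Z (ofParams Z p) = mC p := by
  have : (splitVars Z : _ →ₐ[F₂] _).comp (ofParams Z) =
      (Algebra.algHom F₂ _ _ : Params Z →ₐ[F₂] MvPolynomial {x // Z x} (Params Z)) := by
    refine malgHom_ext fun x => ?_
    change splitVars Z (ofParams Z (mX x)) = mC (mX x)
    rw [ofParams, rename_X, splitVars, trans_apply,
      MvPolynomial.renameEquiv_apply, rename_X, Equiv.sumCompl_symm_apply_of_neg x.2]
    exact MvPolynomial.sumRingEquiv_X_inr F₂ {x // Z x} {x // ¬ Z x} x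
  exact dcongr_fun this p

theorem replaceMap_ofParams (h : ∀ x, ¬ Z x → r x = mX x ∧ e x = 1)
    (he : ∀ x, 0 < e x) (p : Params Z) (f : Poly σ) :
    replaceMap r e (ofParams Z p * f) = ofParams Z p * replaceMap r e f := by
  induction p using minduction_on generalizing f with
  | C a =>
    rw [ofParams, rename_C, ← MvPolynomial.smul_eq_C_mul, map_smul,
      MvPolynomial.smul_eq_C_mul]
  | add p q hp hq => rw [map_add, add_mul, map_add, hp, hq, add_mul]
  | mul_X p x hp =>
    have h1 := replaceMap_mul (r := r) he x f
    rw [(h x x.2).1, (h x x.2).2, pow_one] at h1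
    rw [map_mul (ofParams Z), mul_assoc, hp, ofParams, rename_X, h1, mul_assoc]

/-- The quotient by the `r_x` with `x ∈ Z` is free over the polynomials in the other variables. -/
theorem exists_coeffs (hr : ∀ x, Lead ω (r x) (single x (e x))) (he : ∀ x, 0 < e x)
    (h : ∀ x, ¬ Z x → r x = mX x ∧ e x = 1) :
    ∃ c : Poly σ →+ ((∀ z : {x // Z x}, Fin (e z)) → Params Z),
      Surjective c ∧ (∀ p f, c (ofParams Z p * f) = p • c f) ∧
        ∀ f, c f = 0 ↔ f ∈ span (Set.range fun z : {x // Z x} => r z) := by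
  refine exists_coeffs_of_addEquiv (i := (ofParams Z : Params Z →+* Poly σ))
    ((replaceEquiv hr).symm.toAddEquiv.trans (splitVars Z).toAddEquiv) (fun z f => ?_) fun p f => ?_
  · change splitVars Z ((replaceEquiv hr).symm _) = _ * splitVars Z ((replaceEquiv hr).symm f)
    rw [← splitVars_X, ← map_pow, ← map_mul]
    congr 1
    rw [LinearEquiv.symm_apply_eq]
    change _ = replaceMap r e _
    rw [replaceMap_mul he]
    exact congrArg _ ((replaceEquiv hr).apply_symm_apply f).symm
  · change splitVars Z ((replaceEquiv hr).symm _) = _ * splitVars Z ((replaceEquiv hr).symm f)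
    rw [← splitVars_ofParams, ← map_mul]
    congr 1
    rw [LinearEquiv.symm_apply_eq]
    change _ = replaceMap r e _
    rw [replaceMap_ofParams Z h he]
    exact congrArg _ ((replaceEquiv hr).apply_symm_apply f).symm

end Coefficients

section Relations

theorem weight_eq_sum {σ : Type*} [Fintype σ] (w : σ → ℕ) (s : σ →₀ ℕ) :
    weight w s = ∑ x, s x * w x := Finsupp.sum_fintype _ _ fun _ => zero_mul _

variable {k n : ℕ}

/-- A monomial of the degree of a relation in the last few `ξ`'s is a power of a variable. -/
theorem eq_single_of_weight {i : ℕ} (hi : i < n - 1) {A : Fin k} (hA : (A : ℕ) = 2 * n - 1 - i)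
    {s : Fin k ⊕ Fin (n - 1) →₀ ℕ} (hs : weight (wt k n) s = 2 ^ (2 * n - 1) + 2 ^ i)
    (h : ∀ x, s x ≠ 0 → ∃ a : Fin k, x = inl a ∧ n < (a : ℕ) ∧ a ≤ A) :
    s = single (inl A) (2 ^ i) := by
  let g : Fin k ⊕ Fin (n - 1) → ℕ := Sum.elim (fun a => 2 ^ (a : ℕ)) fun _ => 0
  have h1 : ∑ x, s x * g x + ∑ x, s x = 2 ^ (2 * n - 1) + 2 ^ i := by
    rw [← hs, weight_eq_sum, ← sum_add_distrib]
    refine sum_congr rfl fun x _ => ?_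
    by_cases hx : s x = 0
    · simp [hx]
    · obtain ⟨a, rfl, -⟩ := h x hx
      exact (mul_add_one _ _).symm
  have hle : ∀ x ∈ univ, s x * g x ≤ s x * 2 ^ (A : ℕ) := fun x _ => by
    by_cases hx : s x = 0
    · simp [hx]
    · obtain ⟨a, rfl, -, ha⟩ := h x hx
      exact Nat.mul_le_mul_left _ (pow_le_pow_right two_pos ha)
  have h2 : ∑ x, s x * g x ≤ (∑ x, s x) * 2 ^ (A : ℕ) := by
    rw [sum_mul]; exact Finset.sum_le_sum hle
  have h3 : (∑ x, s x) * 2 ^ (n + 1) ≤ ∑ x, s x * g x := by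
    rw [sum_mul]
    refine Finset.sum_le_sum fun x _ => ?_
    by_cases hx : s x = 0
    · simp [hx]
    · obtain ⟨a, rfl, ha, -⟩ := h x hx
      exact Nat.mul_le_mul_left _ (pow_le_pow_right two_pos ha)
  have h4 : 2 ^ (n + 1) ∣ ∑ x, s x * g x := Finset.dvd_sum fun x _ => by
    by_cases hx : s x = 0
    · rw [hx, zero_mul]; exact dvd_zero _
    · obtain ⟨a, rfl, ha, -⟩ := h x hx
      exact Dvd.dvd.mul_left (pow_dvd_pow 2 ha) _
  have h5 : 2 ^ (2 * n - 1) = 2 ^ i * 2 ^ (A : ℕ) := by rw [← pow_add]; congr 1; omega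
  have h6 : 2 ^ i ≤ ∑ x, s x := by
    by_contra! hlt
    have := Nat.mul_le_mul_right (2 ^ (A : ℕ)) hlt.le
    omega
  have h7 : ∑ x, s x = 2 ^ i := by
    by_contra hne
    have h8 : 2 ^ (n + 1) ∣ (∑ x, s x) - 2 ^ i := by
      have h9 : (∑ x, s x) - 2 ^ i = 2 ^ (2 * n - 1) - ∑ x, s x * g x := by omega
      rw [h9]
      exact Nat.dvd_sub (pow_dvd_pow 2 (by omega)) h4
    have h9 := Nat.le_of_dvd (by omega) h8
    have h10 : 2 ^ (n + 1) * 2 ^ (n + 1) ≤ (∑ x, s x) * 2 ^ (n + 1) :=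
      Nat.mul_le_mul_right _ (h9.trans (sub_le _ _))
    have h11 : 2 ^ (2 * n - 1) ≤ 2 ^ (n + 1) * 2 ^ (n + 1) := by
      rw [← pow_add]; exact pow_le_pow_right two_pos (by omega)
    omega
  have h8 : ∀ x, x ≠ inl A → s x = 0 := fun x hx => by
    by_contra hsx
    obtain ⟨a, rfl, -⟩ := h x hsx
    have h9 := (Finset.sum_eq_sum_iff_of_le hle).mp (by rw [← sum_mul, h7]; omega)
      (inl a) (mem_univ _)
    exact hx (congrArg inl (Fin.ext
      (Nat.pow_right_injective le_rfl (Nat.eq_of_mul_eq_mul_left (Nat.pos_of_ne_zero hsx) h9))))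
  rw [sum_eq_single (inl A) (fun x _ hx => h8 x hx)
    fun h => absurd (mem_univ _) h] at h7
  ext x
  by_cases hx : x = inl A
  · rw [hx, h7, single_eq_same]
  · rw [h8 x hx, single_eq_of_ne hx]

/-- The relation `r_{i+1}`, in any of the rings of generators. -/
def relGen (k n : ℕ) (i : Fin (n - 1)) : GenRing k n :=
  ∑ j : Fin (n - 1), ofXi k n (T n i j) * genD k n j +
    ofXi k n (mX (2 * n - 1 - i)) ^ 2 ^ (i : ℕ) + ofXi k n (rootColumn n i)

theorem ofXi_X {a : ℕ} (h : a < k) : ofXi k n (mX a) = genXi k n ⟨a, h⟩ := by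
  rw [ofXi, maeval_X, dif_pos h]

theorem relator_eq (i : Fin (n - 1)) : relator n i = relGen (2 * n) n i := by
  rw [relGen, ofXi_X (by have := i.2; omega)]
  rfl

theorem wh_ofXi {p : XiRing} {d : ℕ} (hp : WH p d) :
    IsWH (wt k n) (ofXi k n p) d := by
  haveI := MvPolynomial.WeightedHomogeneousSubmodule.gradedMonoid (R := F₂) (w := wt k n)
  have hf : ∀ a, IsWH (wt k n)
      (if h : a < k then genXi k n ⟨a, h⟩ else 0) (wX a) := fun a => by
    by_cases h : a < k
    · rw [dif_pos h]
      exact isWH_X F₂ (wt k n) (inl ⟨a, h⟩)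
    · rw [dif_neg h]
      exact isWH_zero _ _ _
  exact aeval_mem_graded (weightedHomogeneousSubmodule F₂ (wt k n)) (w := wX)
    hf hp

theorem keep_X_self {σ : Type*} [DecidableEq σ] (x : σ) : keep x (mX x) = X := by
  rw [keep, maeval_X, if_pos rfl]

theorem keep_ofXi (a : Fin k) (p : XiRing) :
    keep (inl a) (ofXi k n p) = keep (a : ℕ) p := by
  have : (keep (inl a)).comp (ofXi k n) = keep (a : ℕ) := by
    refine malgHom_ext fun b => ?_
    rw [comp_apply, ofXi, maeval_X, keep, keep, maeval_X]
    split_ifs with h1 h2 h2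
    · subst h2; rw [genXi, maeval_X, if_pos rfl]
    · rw [genXi, maeval_X, if_neg fun h => h2 (congrArg Fin.val (Sum.inl.inj h))]
    · exact absurd (h2 ▸ a.2) h1
    · exact map_zero _
  exact dcongr_fun this p

theorem keep_genD (a : Fin k) (j : Fin (n - 1)) : keep (inl a) (genD k n j) = 0 := by
  rw [genD, keep, maeval_X, if_neg Sum.inr_ne_inl]

theorem algHom_eq_of_supported {B : Type*} [CommRing B] [Algebra F₂ B] {s : Set ℕ}
    {f g : XiRing →ₐ[F₂] B} (h : ∀ a ∈ s, f (mX a) = g (mX a))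
    {p : XiRing} (hp : p ∈ supported F₂ s) : f p = g p :=
  AlgHom.adjoin_le_equalizer f g (by rintro _ ⟨a, ha, rfl⟩; exact h a ha) hp

theorem wh_relGen (hsq : HasRoots n) (i : Fin (n - 1)) : IsWH (wt k n)
    (relGen k n i) (2 ^ (2 * n - 1) + 2 ^ (i : ℕ)) := by
  have hi := i.2
  refine ((MvPolynomial.IsWeightedHomogeneous.sum _ _ _ fun j _ => ?_).add ?_).add
    (wh_ofXi (wh_rootColumn (hsq i)))
  · have h1 := (wh_ofXi (k := k) (n := n) (wh_T n i j)).mul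
      (isWH_X F₂ (wt k n) (inr j))
    have h2 : 2 ^ (n + (j : ℕ)) ≤ 2 ^ (2 * n - 1) := pow_le_pow_right two_pos (by omega)
    have h3 : 2 ^ (i : ℕ) + 2 ^ (n + (j : ℕ)) + wt k n (inr j) =
        2 ^ (2 * n - 1) + 2 ^ (i : ℕ) := by
      change _ + (2 ^ (2 * n - 1) - 2 ^ (n + (j : ℕ))) = _
      omega
    rw [h3] at h1
    exact h1
  · have h1 := (wh_ofXi (k := k) (n := n) (isWH_X F₂ wX
      (2 * n - 1 - i))).pow (2 ^ (i : ℕ))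
    convert h1 using 1
    rw [smul_eq_mul, wX, mul_add_one, ← pow_add]
    congr 2
    omega

theorem keep_relGen (hsq : HasRoots n) {i : Fin (n - 1)} {A : Fin k} (hA : (A : ℕ) = 2 * n - 1 - i) :
    keep (inl A) (relGen k n i) = X ^ 2 ^ (i : ℕ) := by
  rw [relGen, map_add, map_add, map_sum, map_pow, keep_ofXi, keep_ofXi, hA,
    keep_rootColumn (hsq i), add_zero, keep_X_self, sum_eq_zero, zero_add]
  intro j _
  rw [map_mul, keep_genD, mul_zero]

theorem coeff_relGen_sub (hsq : HasRoots n) {i : Fin (n - 1)} {A : Fin k} (hA : (A : ℕ) = 2 * n - 1 - i) :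
    (relGen k n i - genXi k n A ^ 2 ^ (i : ℕ)).coeff (single (inl A) (2 ^ (i : ℕ))) =
      0 := by
  rw [← coeff_keep, map_sub, keep_relGen hsq hA, map_pow, genXi, keep_X_self, sub_self, coeff_zero]

theorem weight_of_mem_support (hsq : HasRoots n) {i : Fin (n - 1)} {A : Fin k} (hA : (A : ℕ) = 2 * n - 1 - i)
    {s : Fin k ⊕ Fin (n - 1) →₀ ℕ}
    (hs : s ∈ (relGen k n i - genXi k n A ^ 2 ^ (i : ℕ)).support) :
    weight (wt k n) s = 2 ^ (2 * n - 1) + 2 ^ (i : ℕ) := by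
  have hi := i.2
  have h1 : 2 ^ (i : ℕ) * (2 ^ (A : ℕ) + 1) = 2 ^ (2 * n - 1) + 2 ^ (i : ℕ) := by
    rw [mul_add_one, ← pow_add]; congr 2; omega
  have h2 := (isWH_X F₂ (wt k n) (inl A)).pow (2 ^ (i : ℕ))
  rw [smul_eq_mul, wt, elim_inl, h1] at h2
  exact (weightedHomogeneousSubmodule F₂ (wt k n) _).sub_mem
    (wh_relGen hsq i) h2 (MvPolynomial.mem_support_iff.mp hs)

theorem degreeOf_relGen_sub (hsq : HasRoots n) {i : Fin (n - 1)} {A : Fin k} (hA : (A : ℕ) = 2 * n - 1 - i) :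
    (relGen k n i - genXi k n A ^ 2 ^ (i : ℕ)).degreeOf (inl A) < 2 ^ (i : ℕ) := by
  have hi := i.2
  rw [MvPolynomial.degreeOf_lt_iff (by positivity)]
  intro s hs
  by_contra! hle
  have h1 := weight_of_mem_support hsq hA hs
  have h2 : s = single (inl A) (2 ^ (i : ℕ)) := by
    refine eq_single_of_weight hi hA h1 fun x hx => ⟨A, ?_, by omega, le_rfl⟩
    by_contra hne
    obtain ⟨t, ht⟩ := le_iff_exists_add.mp (Finsupp.single_le_iff.mpr hle)
    have hx2 : t x ≠ 0 := by
      rwa [ht, Finsupp.add_apply, single_eq_of_ne hne, zero_add] at hx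
    have h3 : 2 ^ (i : ℕ) * (2 ^ (A : ℕ) + 1) = 2 ^ (2 * n - 1) + 2 ^ (i : ℕ) := by
      rw [mul_add_one, ← pow_add]; congr 2; omega
    have h4 := mul_le_weight (wt k n) t x
    have h5 : 0 < wt k n x := by
      rcases x with a | j
      · exact Nat.succ_pos _
      · exact Nat.sub_pos_of_lt (pow_lt_pow_right one_lt_two (by have := j.2; omega))
    have h6 : 0 < t x * wt k n x := Nat.mul_pos (Nat.pos_of_ne_zero hx2) h5
    rw [ht, map_add, weight_single, smul_eq_mul, wt, elim_inl, h3, ← wt] at h1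
    omega
  exact MvPolynomial.mem_support_iff.mp hs (h2 ▸ coeff_relGen_sub hsq hA)

theorem keep_relGen_ne (hsq : HasRoots n) {i j : Fin (n - 1)} (hij : j ≠ i) {A : Fin k}
    (hA : (A : ℕ) = 2 * n - 1 - i) : keep (inl A) (relGen k n j) = 0 := by
  have hi := i.2
  have hj := j.2
  ext e
  rw [coeff_keep, coeff_zero]
  by_contra hne
  have h1 := wh_relGen hsq j hne
  rw [weight_single, smul_eq_mul, wt, elim_inl] at h1
  have h2 : 2 ^ (2 * n - 1) = 2 ^ (i : ℕ) * 2 ^ (A : ℕ) := by rw [← pow_add]; congr 1; omega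
  have h3 : ∀ l < n - 1, 2 ^ l < 2 ^ (A : ℕ) := fun l hl =>
    pow_lt_pow_right one_lt_two (by omega)
  have h4 : e ≤ 2 ^ (i : ℕ) := by
    by_contra! hlt
    have := Nat.mul_le_mul_right (2 ^ (A : ℕ)) (Nat.succ_le_of_lt hlt)
    have := h3 j hj
    rw [Nat.succ_mul] at *
    rw [mul_add_one] at h1
    omega
  have h5 := congrArg (· % 2 ^ (A : ℕ)) h1
  simp only [h2, mul_add_one, Nat.mul_add_mod_self_right] at h5
  rw [Nat.mod_eq_of_lt (h4.trans_lt (h3 i hi)), Nat.mod_eq_of_lt (h3 j hj)] at h5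
  have h6 : e * 2 ^ (A : ℕ) = 2 ^ (i : ℕ) * 2 ^ (A : ℕ) := by rw [mul_add_one] at h1; omega
  have h7 := Nat.eq_of_mul_eq_mul_right (by positivity) h6
  exact hij (Fin.ext (Nat.pow_right_injective le_rfl (h5.symm.trans h7)))

end Relations

section RegularSequences

variable {k n : ℕ}

/-- The amount by which `leadWt` falls short of a multiple of the degree. -/
def defect (k n : ℕ) : Fin k ⊕ Fin (n - 1) → ℕ :=
  Sum.elim (fun a : Fin k => if n < (a : ℕ) then 2 ^ (n * (a + 1 - n)) else 2 ^ (n * (n + 1)))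
    (fun _ => 2 ^ (n * (n + 1)))

/-- A weight for which the relations have pure powers of variables as leading monomials. -/
def leadWt (k n : ℕ) (x : Fin k ⊕ Fin (n - 1)) : ℕ :=
  2 ^ (n * (n + 1)) * wt k n x - defect k n x

theorem wt_pos (x : Fin k ⊕ Fin (n - 1)) : 0 < wt k n x := by
  rcases x with a | j
  · exact Nat.succ_pos _
  · exact Nat.sub_pos_of_lt (pow_lt_pow_right one_lt_two (by have := j.2; omega))

theorem weight_leadWt (hk : k ≤ 2 * n) (s : Fin k ⊕ Fin (n - 1) →₀ ℕ) :
    weight (leadWt k n) s + weight (defect k n) s =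
      2 ^ (n * (n + 1)) * weight (wt k n) s := by
  rw [weight_eq_sum, weight_eq_sum, weight_eq_sum, ← sum_add_distrib, mul_sum]
  refine sum_congr rfl fun x _ => ?_
  rw [← mul_add, mul_left_comm]
  congr 1
  refine Nat.sub_add_cancel (le_trans ?_ (Nat.le_mul_of_pos_right _ (wt_pos x)))
  rcases x with a | j
  · change (if n < (a : ℕ) then 2 ^ (n * (a + 1 - n)) else 2 ^ (n * (n + 1))) ≤ _
    split_ifs
    · exact pow_le_pow_right two_pos (Nat.mul_le_mul_left _ (by have := a.2; omega))
    · exact le_rfl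
  · exact le_rfl

/-- The relations with leading monomials the powers of some of the variables, and the remaining
variables. -/
def rels (k n : ℕ) (hk : k ≤ 2 * n) : Fin k ⊕ Fin (n - 1) → GenRing k n :=
  Sum.elim (fun a => if h : n < (a : ℕ) then relGen k n ⟨2 * n - 1 - a, by omega⟩ else genXi k n a)
    (genD k n)

/-- The exponents of the leading monomials. -/
def expo (k n : ℕ) : Fin k ⊕ Fin (n - 1) → ℕ :=
  Sum.elim (fun a => if n < (a : ℕ) then 2 ^ (2 * n - 1 - a) else 1) fun _ => 1

theorem expo_pos (x : Fin k ⊕ Fin (n - 1)) : 0 < expo k n x := by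
  rcases x with a | j
  · change 0 < if n < (a : ℕ) then 2 ^ (2 * n - 1 - a) else 1
    split_ifs
    · exact Nat.two_pow_pos _
    · exact one_pos
  · exact one_pos

theorem lead_relGen (hk : k ≤ 2 * n) (hsq : HasRoots n) {i : Fin (n - 1)} {A : Fin k}
    (hA : (A : ℕ) = 2 * n - 1 - i) :
    Lead (leadWt k n) (relGen k n i) (single (inl A) (2 ^ (i : ℕ))) := by
  have hi := i.2
  intro s hs
  rw [← mX_pow_eq] at hs
  change weight (leadWt k n) s < weight (leadWt k n) _
  have h1 := weight_of_mem_support hsq hA hs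
  have h2 : s ≠ single (inl A) (2 ^ (i : ℕ)) := fun h =>
    MvPolynomial.mem_support_iff.mp hs (h ▸ coeff_relGen_sub hsq hA)
  have h3 := weight_leadWt hk s
  have h4 := weight_leadWt hk (single (inl A : Fin k ⊕ Fin (n - 1)) (2 ^ (i : ℕ)))
  have h5 : weight (wt k n) (single (inl A) (2 ^ (i : ℕ))) =
      2 ^ (2 * n - 1) + 2 ^ (i : ℕ) := by
    rw [weight_single, smul_eq_mul, wt, elim_inl, mul_add_one, ← pow_add]
    congr 2
    omega
  have h6 : weight (defect k n) (single (inl A) (2 ^ (i : ℕ))) <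
      weight (defect k n) s := by
    obtain ⟨x, hx, hx2⟩ : ∃ x, s x ≠ 0 ∧ ∀ a : Fin k, x = inl a → n < (a : ℕ) → A < a := by
      by_contra! hcon
      exact h2 (eq_single_of_weight hi hA h1 hcon)
    refine lt_of_lt_of_le ?_ (Finsupp.le_weight_of_ne_zero' (defect k n) hx)
    rw [weight_single, smul_eq_mul, defect, elim_inl, if_pos (by omega), ← pow_add]
    have h7 : ∀ m, (A : ℕ) + 2 - n ≤ m →
        2 ^ ((i : ℕ) + n * (A + 1 - n)) < 2 ^ (n * m) := fun m hm => by
      refine pow_lt_pow_right one_lt_two ?_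
      have := Nat.mul_le_mul_left n hm
      have h8 : (A : ℕ) + 2 - n = A + 1 - n + 1 := by omega
      rw [h8, mul_add_one] at this
      omega
    rcases x with a | j
    · rw [elim_inl]
      have := a.2
      split_ifs with ha
      · have := hx2 a rfl ha
        exact h7 _ (by have : (A : ℕ) < a := this; omega)
      · exact h7 _ (by omega)
    · exact h7 _ (by omega)
  rw [h1] at h3
  rw [h5] at h4
  omega

theorem lead_rels (hk : k ≤ 2 * n) (hsq : HasRoots n) (x : Fin k ⊕ Fin (n - 1)) :
    Lead (leadWt k n) (rels k n hk x) (single x (expo k n x)) := by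
  rcases x with a | j
  · have := a.2
    rw [rels, expo, elim_inl, elim_inl]
    split_ifs with h
    · exact lead_relGen hk hsq (i := ⟨2 * n - 1 - a, by omega⟩) (by simp only; omega)
    · exact Lead.self _
  · exact Lead.self _

theorem isRegular_append (hk : k ≤ 2 * n) (hnk : n < k) (hsq : HasRoots n) {m : ℕ}
    {g : Fin m → Fin k} (hg : Injective g) (hgn : ∀ i, n < (g i : ℕ)) :
    IsRegSeq (GenRing k n) (List.ofFn fun i => rels k n hk (inl (g i))) ∧
    IsRegSeq (GenRing k n)
      ((List.ofFn fun i => rels k n hk (inl (g i))) ++ parameterList k n hnk) := by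
  have h1 : (List.ofFn fun i => (inl (g i) : Fin k ⊕ Fin (n - 1))).Nodup :=
    List.nodup_ofFn.mpr fun i j h => hg (Sum.inl.inj h)
  have hl : ∀ l : List (Fin k ⊕ Fin (n - 1)), l.Nodup → _ := fun l =>
    isRegular_of_lead (lead_rels hk hsq) expo_pos l
  constructor
  · have := hl _ h1
    rwa [List.map_ofFn] at this
  · have := hl ((List.ofFn fun i => inl (g i)) ++
      ((List.ofFn fun i : Fin (n + 1) => inl (castLE hnk i)) ++
        List.ofFn fun j : Fin (n - 1) => inr j.rev)) (by
      refine List.nodup_append.mpr ⟨h1, List.nodup_append.mpr ⟨List.nodup_ofFn.mpr fun i j h =>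
        Fin.castLE_injective _ (Sum.inl.inj h), List.nodup_ofFn.mpr fun i j h =>
        Fin.rev_injective (Sum.inr.inj h), ?_⟩, ?_⟩
      · intro a ha b hb
        obtain ⟨i, rfl⟩ := (mem_ofFn' _ _).mp ha
        obtain ⟨j, rfl⟩ := (mem_ofFn' _ _).mp hb
        exact Sum.inl_ne_inr
      · intro a ha b hb
        obtain ⟨i, rfl⟩ := (mem_ofFn' _ _).mp ha
        rcases List.mem_append.mp hb with hb | hb
        · obtain ⟨j, rfl⟩ := (mem_ofFn' _ _).mp hb
          intro h
          have h2 := hgn i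
          rw [Sum.inl.inj h] at h2
          exact absurd h2 (by rw [Fin.val_castLE]; have := j.2; omega)
        · obtain ⟨j, rfl⟩ := (mem_ofFn' _ _).mp hb
          exact Sum.inl_ne_inr)
    rw [List.map_append, List.map_append, List.map_ofFn, List.map_ofFn, List.map_ofFn] at this
    have h2 : rels k n hk ∘ (fun i : Fin (n + 1) => inl (castLE hnk i)) =
        fun i => genXi k n (castLE hnk i) := by
      funext i
      have : ¬ n < ((castLE hnk i : Fin k) : ℕ) := by
        rw [Fin.val_castLE]; have := i.2; omega
      rw [Function.comp_apply, rels, elim_inl, dif_neg this]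
    rw [h2] at this
    exact this

theorem relator_eq_rels (i : Fin (n - 1)) :
    relator n i = rels (2 * n) n le_rfl (inl ⟨2 * n - 1 - i, by omega⟩) := by
  have hi := i.2
  rw [relator_eq, rels, elim_inl, dif_pos (by simp only; omega)]
  congr 1
  exact Fin.ext (by simp only; omega)

theorem elim_ofXi (g : TDagger n) {p : XiRing}
    (hp : p ∈ supported F₂ (Iio (2 * n - 1))) :
    elim n g (ofXi (2 * n) n p) = ofXi (2 * n - 1) n p := by
  refine algHom_eq_of_supported (f := (elim n g).comp (ofXi (2 * n) n)) (fun a ha => ?_) hp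
  have ha : a < 2 * n - 1 := ha
  rw [comp_apply, ofXi_X (show a < 2 * n by omega), ofXi_X ha, genXi, elim,
    maeval_X, elim_inl, dif_pos ha]

theorem elim_genD (g : TDagger n) (j : Fin (n - 1)) :
    elim n g (genD (2 * n) n j) = genD (2 * n - 1) n j := by
  rw [genD, elim, maeval_X, elim_inr]

theorem elim_relGen (hsq : HasRoots n) (g : TDagger n) {i : Fin (n - 1)} (hi : 0 < (i : ℕ)) :
    elim n g (relGen (2 * n) n i) = relGen (2 * n - 1) n i := by
  have hin := i.2
  have hm : ∀ {p : XiRing}, p ∈ supported F₂ (Iic (2 * n - 2)) →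
      p ∈ supported F₂ (Iio (2 * n - 1)) := fun h =>
    supported_Iic_lt (by omega) h
  rw [relGen, relGen, map_add, map_add, map_pow, map_sum, elim_ofXi g (hm (rootColumn_mem (hsq i))),
    elim_ofXi g (MvPolynomial.X_mem_supported.mpr (by simp only [Set.mem_Iio]; omega))]
  congr 2
  refine sum_congr rfl fun j _ => ?_
  rw [map_mul, elim_ofXi g (hm (T_mem n i j)), elim_genD]

theorem reducedRelator_eq (hsq : HasRoots n) (i : Fin (n - 2)) :
    reducedRelator n i = relGen (2 * n - 1) n ⟨i + 1, by omega⟩ := by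
  rw [reducedRelator, relator_eq (n := n) ⟨i + 1, by omega⟩]
  exact elim_relGen hsq _ (Nat.succ_pos _)

theorem reducedRelator_eq_rels (hsq : HasRoots n) (i : Fin (n - 2)) : reducedRelator n i =
    rels (2 * n - 1) n (sub_le _ _) (inl ⟨2 * n - 1 - (i + 1), by omega⟩) := by
  have hi := i.2
  rw [reducedRelator_eq hsq, rels, elim_inl, dif_pos (by simp only; omega)]
  congr 1
  exact Fin.ext (by simp only; omega)

theorem isRegular_relator (hn : 2 ≤ n) (hsq : HasRoots n) :
    IsRegSeq (TStar n) (List.ofFn (relator n)) ∧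
    IsRegSeq (TStar n)
      (List.ofFn (relator n) ++ parameterList (2 * n) n (by omega)) := by
  rw [show relator n = _ from funext relator_eq_rels]
  exact isRegular_append le_rfl (by omega) hsq
    (g := fun i : Fin (n - 1) => ⟨2 * n - 1 - i, by omega⟩)
    (fun i j h => Fin.ext (by have := Fin.val_eq_of_eq h; simp only at this; omega))
    fun i => by simp only; omega

theorem isRegular_reducedRelator (hn : 2 ≤ n) (hsq : HasRoots n) :
    IsRegSeq (TDagger n) (List.ofFn (reducedRelator n)) ∧
    IsRegSeq (TDagger n)
      (List.ofFn (reducedRelator n) ++ parameterList (2 * n - 1) n (by omega)) := by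
  rw [show reducedRelator n = _ from funext (reducedRelator_eq_rels hsq)]
  exact isRegular_append (sub_le _ _) (by omega) hsq
    (g := fun i : Fin (n - 2) => ⟨2 * n - 1 - (i + 1), by omega⟩)
    (fun i j h => Fin.ext (by have := Fin.val_eq_of_eq h; simp only at this; omega))
    fun i => by simp only; omega

theorem relator_notMem (hsq : HasRoots n) (i : Fin (n - 1)) : relator n i ∉ span (relator n '' {i}ᶜ) := by
  have hi := i.2
  intro h
  have h1 : span (relator n '' {i}ᶜ) ≤
      RingHom.ker (keep (inl (⟨2 * n - 1 - i, by omega⟩ : Fin (2 * n)))) := by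
    rw [span_le]
    rintro _ ⟨j, hj, rfl⟩
    rw [relator_eq]
    exact keep_relGen_ne hsq hj rfl
  have h2 := h1 h
  rw [RingHom.mem_ker, relator_eq, keep_relGen hsq rfl] at h2
  exact pow_ne_zero _ X_ne_zero h2

end RegularSequences

section Conductor

/-- Two elements without common factor in an integral factorial extension generate an ideal that
meets a factorial subring in elements without common factor. -/
theorem exists_isRelPrime {P D S : Type*} [CommRing P] [CommRing D] [CommRing S] [IsDomain P]
    [IsDomain D] [IsDomain S] [UniqueFactorizationMonoid P] [UniqueFactorizationMonoid S]
    [Algebra P D] [Algebra D S] [Algebra P S] [IsScalarTower P D S] [Algebra.IsIntegral P D]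
    [Algebra.IsIntegral D S] (hDS : Injective (algebraMap D S)) {u v : D} (hu : u ≠ 0)
    (huv : IsRelPrime (algebraMap D S u) (algebraMap D S v)) :
    ∃ p₁ p₂ : P, p₁ ≠ 0 ∧ p₂ ≠ 0 ∧ IsRelPrime p₁ p₂ ∧ algebraMap P D p₁ ∈ span {u, v} ∧
      algebraMap P D p₂ ∈ span {u, v} := by
  classical
  set b : Ideal D := span {u, v}
  have hub : u ∈ b := subset_span (Or.inl rfl)
  have hvb : v ∈ b := subset_span (Or.inr rfl)
  have hPS : ∀ x : S, IsIntegral P x := fun x => isIntegral_trans (A := D) x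
    (Algebra.IsIntegral.isIntegral x)
  have key : ∀ π : P, Prime π → ¬ b.comap (algebraMap P D) ≤ span {π} := fun π hπ hle => by
    have : (span {π}).IsPrime := (Ideal.span_singleton_prime hπ.ne_zero).mpr hπ
    obtain ⟨Q, hbQ, hQ, hQc⟩ := Ideal.exists_ideal_over_prime_of_isIntegral (span {π}) b hle
    obtain ⟨Q', -, hQ', hQc'⟩ := Ideal.exists_ideal_over_prime_of_isIntegral (S := S) Q ⊥ (by
      rw [← RingHom.ker_eq_comap_bot, (RingHom.injective_iff_ker_eq_bot _).mp hDS]; exact bot_le)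
    have hmem : ∀ x ∈ b, algebraMap D S x ∈ Q' := fun x hx => by
      have := hbQ hx
      rw [← hQc'] at this
      exact this
    have hc : Q'.comap (algebraMap P S) = span {π} := by
      rw [IsScalarTower.algebraMap_eq P D S, ← Ideal.comap_comap, hQc', hQc]
    obtain ⟨t, ht, htp⟩ := hQ'.exists_mem_prime_of_ne_bot fun h => by
      have := hmem u hub
      rw [h, Ideal.mem_bot, ← map_zero (algebraMap D S)] at this
      exact hu (hDS this)
    have htP : (span {t}).IsPrime := (Ideal.span_singleton_prime htp.ne_zero).mpr htp
    obtain ⟨x, hx, hxt⟩ : ∃ x ∈ Q', x ∉ span {t} := by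
      by_contra! hcon
      exact htp.not_isUnit (huv (Ideal.mem_span_singleton.mp (hcon _ (hmem u hub)))
        (Ideal.mem_span_singleton.mp (hcon _ (hmem v hvb))))
    have hlt := Ideal.comap_lt_comap_of_integral_mem_sdiff (R := P)
      ((Ideal.span_singleton_le_iff_mem _).mpr ht) ⟨hx, hxt⟩ (hPS x)
    rw [hc] at hlt
    obtain ⟨τ, hτ, hτp⟩ := (htP.comap (algebraMap P S)).exists_mem_prime_of_ne_bot
      (Ideal.comap_ne_bot_of_integral_mem htp.ne_zero (Ideal.mem_span_singleton_self t) (hPS t))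
    have h1 := Ideal.mem_span_singleton.mp (hlt.le hτ)
    have h2 : τ ∣ π := (hπ.irreducible.dvd_symm hτp.irreducible h1)
    refine hlt.not_ge ((Ideal.span_singleton_le_iff_mem _).mpr (Ideal.mem_of_dvd _ h2 hτ))
  obtain ⟨p₁, hp₁, hp₁0⟩ := Submodule.exists_mem_ne_zero_of_ne_bot
    (Ideal.comap_ne_bot_of_integral_mem hu hub (Algebra.IsIntegral.isIntegral (R := P) u))
  by_cases h1 : IsUnit p₁
  · exact ⟨p₁, p₁, hp₁0, hp₁0, fun d hd _ => isUnit_of_dvd_unit hd h1, hp₁, hp₁⟩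
  by_cases hex : ∃ p₂ ∈ b.comap (algebraMap P D), IsRelPrime p₁ p₂
  · obtain ⟨p₂, hp₂, hrel⟩ := hex
    refine ⟨p₁, p₂, hp₁0, fun h => h1 (hrel dvd_rfl (h ▸ dvd_zero _)), hrel, hp₁, hp₂⟩
  · exfalso
    have hsub : (b.comap (algebraMap P D) : Set P) ⊆
        ⋃ π ∈ ((UniqueFactorizationMonoid.factors p₁).toFinset : Set P), span {π} := by
      intro p₂ hp₂
      have h2 : ¬ IsRelPrime p₁ p₂ := fun h => hex ⟨p₂, hp₂, h⟩
      simp only [IsRelPrime, not_forall] at h2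
      obtain ⟨d, hd1, hd2, hd⟩ := h2
      obtain ⟨π, hπ, hπd⟩ := WfDvdMonoid.exists_irreducible_factor hd
        (ne_zero_of_dvd_ne_zero hp₁0 hd1)
      obtain ⟨π', hπ', hass⟩ := UniqueFactorizationMonoid.exists_mem_factors_of_dvd hp₁0 hπ
        (hπd.trans hd1)
      exact Set.mem_biUnion (Multiset.mem_toFinset.mpr hπ')
        (Ideal.mem_span_singleton.mpr (hass.symm.dvd.trans (hπd.trans hd2)))
    have hpr : ∀ π ∈ (UniqueFactorizationMonoid.factors p₁).toFinset, Prime π := fun π hπ =>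
      UniqueFactorizationMonoid.prime_of_factor π (Multiset.mem_toFinset.mp hπ)
    obtain ⟨π, hπ, hle⟩ := (Ideal.subset_union_prime 0 0 fun π hπ _ _ =>
      (Ideal.span_singleton_prime (hpr π hπ).ne_zero).mpr (hpr π hπ)).mp hsub
    exact key π (hpr π hπ) hle

section Free

variable {ι P A : Type*} [CommRing P] [IsDomain P] [CommRing A] {i : P →+* A}
variable {R : Ideal A} {c : A →+ (ι → P)}

theorem mem_of_mul_mem (h1 : ∀ p f, c (i p * f) = p • c f) (h2 : ∀ f, c f = 0 ↔ f ∈ R) {p : P}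
    (hp : p ≠ 0) {x : A} (hx : i p * x ∈ R) : x ∈ R := by
  rw [← h2, h1] at hx
  exact (h2 x).mp ((smul_eq_zero.mp hx).resolve_left hp)

theorem exists_of_mul_sub_mem [UniqueFactorizationMonoid P] (h0 : Surjective c)
    (h1 : ∀ p f, c (i p * f) = p • c f) (h2 : ∀ f, c f = 0 ↔ f ∈ R) {p₁ p₂ : P} (hp : p₁ ≠ 0)
    (hrel : IsRelPrime p₁ p₂) {x y : A} (h : i p₁ * x - i p₂ * y ∈ R) :
    ∃ e, x - i p₂ * e ∈ R ∧ y - i p₁ * e ∈ R := by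
  rw [← h2, map_sub, h1, h1, sub_eq_zero] at h
  have h3 : ∀ s, p₁ ∣ c y s := fun s =>
    hrel.dvd_of_dvd_mul_left (Dvd.intro _ (congrFun h s))
  choose e he using h3
  obtain ⟨e, rfl⟩ := h0 e
  refine ⟨e, ?_, ?_⟩ <;> rw [← h2, map_sub, h1, sub_eq_zero]
  · funext s
    refine mul_left_cancel₀ hp ((congrFun h s).trans ?_)
    change p₂ * c y s = p₁ * (p₂ * c e s)
    rw [he]
    ring
  · exact funext he

/-- If, up to the ideal `R`, the kernel is killed by elements with images without common factor,
then it is `R`. -/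
theorem ker_le_of_conductor [UniqueFactorizationMonoid P] {S : Type*} [CommRing S] {φ : A →+* S}
    (hφ : R ≤ RingHom.ker φ) (hinj : ∀ p, φ (i p) = 0 → p = 0) (h0 : Surjective c)
    (h1 : ∀ p f, c (i p * f) = p • c f) (h2 : ∀ f, c f = 0 ↔ f ∈ R)
    (hid : ∀ e, e ^ 2 - e ∈ R → e ∈ R ∨ 1 - e ∈ R) {p₁ p₂ : P} (hp₁ : p₁ ≠ 0) (hp₂ : p₂ ≠ 0)
    (hrel : IsRelPrime p₁ p₂) {j₁ j₂ : A} (hj₁ : φ (i p₁) = φ j₁) (hj₂ : φ (i p₂) = φ j₂)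
    (h₁ : ∀ g ∈ RingHom.ker φ, j₁ * g ∈ R) (h₂ : ∀ g ∈ RingHom.ker φ, j₂ * g ∈ R) :
    RingHom.ker φ ≤ R := by
  have hi₁ : i p₁ - j₁ ∈ RingHom.ker φ := by rw [RingHom.mem_ker, map_sub, hj₁, sub_self]
  have hi₂ : i p₂ - j₂ ∈ RingHom.ker φ := by rw [RingHom.mem_ker, map_sub, hj₂, sub_self]
  obtain ⟨e, he₂, he₁⟩ := exists_of_mul_sub_mem h0 h1 h2 hp₁ hrel
    (x := i p₂ - j₂) (y := i p₁ - j₁) (by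
      have := sub_mem (h₁ _ hi₂) (h₂ _ hi₁)
      convert this using 1
      ring)
  have hid2 : e ^ 2 - e ∈ R := by
    refine mem_of_mul_mem h1 h2 hp₁ (mem_of_mul_mem h1 h2 hp₂ ?_)
    have h3 := R.mul_mem_left (i p₂ * e - i p₂) he₁
    have h4 := R.mul_mem_left (i p₁ - j₁) he₂
    have h5 := h₂ _ hi₁
    have h6 : i p₂ * (i p₁ * (e ^ 2 - e)) = -((i p₂ * e - i p₂) * (i p₁ - j₁ - i p₁ * e)) -
      (i p₁ - j₁) * (i p₂ - j₂ - i p₂ * e) - j₂ * (i p₁ - j₁) := by ring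
    rw [h6]
    exact sub_mem (sub_mem (neg_mem h3) h4) h5
  rcases hid e hid2 with he | he
  · intro g hg
    refine mem_of_mul_mem h1 h2 hp₁ ?_
    have h3 : i p₁ - j₁ ∈ R := by
      have := add_mem he₁ (R.mul_mem_left (i p₁) he)
      rwa [sub_add_cancel] at this
    have := add_mem (R.mul_mem_right g h3) (h₁ g hg)
    rwa [sub_mul, sub_add_cancel] at this
  · refine absurd (hinj p₁ ?_) hp₁
    have h3 : i p₁ * e ∈ RingHom.ker φ := by
      have := sub_mem hi₁ (hφ he₁)
      rwa [sub_sub_cancel] at this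
    have := add_mem h3 (hφ (R.mul_mem_left (i p₁) he))
    rwa [mul_sub, mul_one, add_sub_cancel] at this

theorem mem_range_of_conductor [UniqueFactorizationMonoid P] {S : Type*} [CommRing S] [IsDomain S]
    {φ : A →+* S} (hφ : R = RingHom.ker φ) (hinj : ∀ p, φ (i p) = 0 → p = 0)
    (h0 : Surjective c) (h1 : ∀ p f, c (i p * f) = p • c f) (h2 : ∀ f, c f = 0 ↔ f ∈ R)
    {p₁ p₂ : P} (hp₁ : p₁ ≠ 0) (hrel : IsRelPrime p₁ p₂) {f : S} {x₁ x₂ : A}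
    (hx₁ : φ (i p₁) * f = φ x₁) (hx₂ : φ (i p₂) * f = φ x₂) : ∃ e, φ e = f := by
  obtain ⟨e, -, he⟩ := exists_of_mul_sub_mem h0 h1 h2 hp₁ hrel (x := x₂) (y := x₁) (by
    rw [hφ, RingHom.mem_ker, map_sub, map_mul, map_mul, ← hx₁, ← hx₂]
    ring)
  refine ⟨e, ?_⟩
  rw [hφ, RingHom.mem_ker, map_sub, map_mul, ← hx₁, ← mul_sub] at he
  have h3 := (mul_eq_zero.mp he).resolve_left fun h => hp₁ (hinj _ h)
  exact (sub_eq_zero.mp h3).symm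

end Free

end Conductor

section Connected

variable {σ ζ : Type*} {w : σ → ℕ} {r : ζ → Poly σ} {d : ζ → ℕ}

theorem scaleHom_mem (hr : ∀ z, IsWH w (r z) (d z))
    {f : Poly σ} (hf : f ∈ span (Set.range r)) (e : ℕ) :
    (scaleHom w f).coeff e ∈ span (Set.range r) := by
  have : span (Set.range r) ≤ ((span (Set.range r)).map C).comap (scaleHom w) := by
    rw [span_le]
    rintro _ ⟨z, rfl⟩
    change scaleHom w (r z) ∈ (span (Set.range r)).map (C : Poly σ →+* _)
    rw [(scaleHom_eq_iff w).mpr (hr z)]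
    exact Ideal.mul_mem_right _ _ (Ideal.mem_map_of_mem C (subset_span ⟨z, rfl⟩))
  exact Ideal.mem_map_C_iff.mp (this hf) e

theorem eval_one_scaleHom (f : Poly σ) : (scaleHom w f).eval 1 = f := by
  induction f using minduction_on with
  | C a => rw [scaleHom, MvPolynomial.aeval_C]; exact eval_C
  | add p q hp hq => rw [map_add, eval_add, hp, hq]
  | mul_X p x hp =>
    rw [map_mul, eval_mul, hp, scaleHom, maeval_X, eval_mul, eval_C, eval_pow, eval_X,
      one_pow, mul_one]

/-- A graded quotient of a polynomial ring has no idempotents but `0` and `1`. -/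
theorem mem_or_of_sq_sub_mem (hw : ∀ x, 0 < w x)
    (hr : ∀ z, IsWH w (r z) (d z)) {e : Poly σ}
    (he : e ^ 2 - e ∈ span (Set.range r)) :
    e ∈ span (Set.range r) ∨ 1 - e ∈ span (Set.range r) := by
  have key : ∀ e : Poly σ, MvPolynomial.constantCoeff e = 0 →
      e ^ 2 - e ∈ span (Set.range r) → e ∈ span (Set.range r) := fun e h0 he => by
    have h1 : ∀ k, e ^ 2 ^ k - e ∈ span (Set.range r) := fun k => by
      induction k with
      | zero => rw [pow_zero, pow_one, sub_self]; exact zero_mem _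
      | succ k ih =>
        have h2 : e ^ 2 ^ (k + 1) - e = (e ^ 2 ^ k + e) * (e ^ 2 ^ k - e) + (e ^ 2 - e) := by
          rw [pow_succ, pow_mul]; ring
        rw [h2]
        exact add_mem (mul_mem_left _ _ ih) he
    have hX : X ∣ scaleHom w e := by
      have h2 : (Polynomial.constantCoeff.comp (scaleHom w).toRingHom) =
          MvPolynomial.C.comp (MvPolynomial.constantCoeff (R := F₂)) := by
        refine MvPolynomial.ringHom_ext (fun a => ?_) fun x => ?_
        · simp [scaleHom, MvPolynomial.algebraMap_eq]
        · simp [scaleHom, (hw x).ne]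
      have h3 := RingHom.congr_fun h2 e
      rw [X_dvd_iff]
      refine h3.trans ?_
      rw [RingHom.comp_apply, h0, map_zero]
    have h2 : ∀ j, (scaleHom w e).coeff j ∈ span (Set.range r) := fun j => by
      have h3 := scaleHom_mem hr (h1 j) j
      rw [map_sub, map_pow, coeff_sub] at h3
      obtain ⟨u, hu⟩ := pow_dvd_pow_of_dvd hX (2 ^ j)
      rw [hu, coeff_X_pow_mul', if_neg (Nat.not_le.mpr Nat.lt_two_pow_self), zero_sub,
        neg_mem_iff] at h3
      exact h3
    rw [← eval_one_scaleHom (w := w) e, eval_eq_sum_range]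
    exact sum_mem fun j _ => Ideal.mul_mem_right _ _ (h2 j)
  have h01 : ∀ a : F₂, a = 0 ∨ a = 1 := by decide
  rcases h01 (MvPolynomial.constantCoeff e) with h | h
  · exact Or.inl (key e h he)
  · refine Or.inr (key _ (by rw [map_sub, h, map_one, sub_self]) ?_)
    convert he using 1
    ring

end Connected

section Integral

variable {ι P A S : Type*} [Finite ι] [CommRing P] [CommRing A] [CommRing S] [Algebra P S]
variable {i : P →+* A} {R : Ideal A} {c : A →+ (ι → P)} {φ : A →+* S}

theorem isIntegral_of_coeffs (hi : ∀ p, φ (i p) = algebraMap P S p) (hφ : R ≤ RingHom.ker φ)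
    (h0 : Surjective c) (h1 : ∀ p f, c (i p * f) = p • c f) (h2 : ∀ f, c f = 0 ↔ f ∈ R)
    (x : A) : IsIntegral P (φ x) := by
  classical
  cases nonempty_fintype ι
  choose t ht using fun s : ι => h0 (Pi.single s 1)
  let B : Subalgebra P S :=
    { φ.range with algebraMap_mem' := fun p => ⟨i p, hi p⟩ }
  refine IsIntegral.of_mem_of_fg B ⟨Finset.univ.image fun s => φ (t s), ?_⟩ _ ⟨x, rfl⟩
  refine le_antisymm (Submodule.span_le.mpr ?_) ?_
  · intro y hy
    obtain ⟨s, -, rfl⟩ := Finset.mem_image.mp (Finset.mem_coe.mp hy)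
    exact ⟨t s, rfl⟩
  · rintro _ ⟨y, rfl⟩
    have h3 : y - ∑ s, i (c y s) * t s ∈ R := by
      rw [← h2, map_sub, map_sum, sub_eq_zero]
      simp only [h1, ht]
      funext u
      rw [Finset.sum_apply, sum_eq_single u]
      · simp
      · intro v _ hv; simp [hv.symm]
      · exact fun h => absurd (mem_univ u) h
    have h4 := hφ h3
    rw [RingHom.mem_ker, map_sub, sub_eq_zero] at h4
    change φ y ∈ _
    rw [h4, map_sum]
    refine sum_mem fun s _ => ?_
    rw [map_mul, hi, ← smul_def]
    exact smul_mem _ _ (Submodule.subset_span (Finset.mem_coe.mpr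
      (Finset.mem_image.mpr ⟨s, mem_univ s, rfl⟩)))

end Integral

section Elimination

theorem aeval_mem_of_forall {σ B : Type*} [CommRing B] [Algebra F₂ B]
    (f : Poly σ →ₐ[F₂] B) {A : Subalgebra F₂ B}
    (h : ∀ x, f (mX x) ∈ A) (p : Poly σ) : f p ∈ A := by
  induction p using minduction_on with
  | C a => rw [← MvPolynomial.algebraMap_eq, AlgHom.commutes]; exact A.algebraMap_mem a
  | add p q hp hq => rw [map_add]; exact add_mem hp hq
  | mul_X p x hp => rw [map_mul]; exact mul_mem hp (h x)

variable {n : ℕ} {B : Type*} [CommRing B] [Algebra F₂ B] (f : TStar n →ₐ[F₂] B)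

/-- The image of the polynomials in some of the generators. -/
abbrev genRange {τ : Type*} (ρ : τ → Fin (2 * n) ⊕ Fin (n - 1)) : Subalgebra F₂ B :=
  (f.comp (MvPolynomial.rename ρ)).range

theorem X_mem_genRange {τ : Type*} {ρ : τ → Fin (2 * n) ⊕ Fin (n - 1)} (t : τ) :
    f (mX (ρ t)) ∈ genRange f ρ :=
  ⟨mX t, congrArg f (rename_X ρ t)⟩

theorem ofXi_mem {A : Subalgebra F₂ B} {N : ℕ} (hN : N ≤ 2 * n)
    (h : ∀ a : Fin (2 * n), (a : ℕ) < N → f (mX (inl a)) ∈ A) {p : XiRing}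
    (hp : p ∈ supported F₂ (Iio N)) : f (ofXi (2 * n) n p) ∈ A := by
  have : supported F₂ (Iio N) ≤ A.comap (f.comp (ofXi (2 * n) n)) := by
    rw [supported, adjoin_le_iff]
    rintro _ ⟨a, ha, rfl⟩
    have ha : a < N := ha
    change f (ofXi (2 * n) n (mX a)) ∈ A
    rw [ofXi_X (ha.trans_le hN)]
    exact h _ ha
  exact this hp

theorem sum_eq_of_relator (hf : ∀ i, f (relator n i) = 0) (i : Fin (n - 1)) :
    ∑ j : Fin (n - 1), f (ofXi (2 * n) n (T n i j)) * f (genD (2 * n) n j) =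
      -(f (leadPower n i) + f (ofXi (2 * n) n (rootColumn n i))) := by
  have h := hf i
  rw [relator, map_add, map_add, map_sum, add_assoc] at h
  rw [eq_neg_iff_add_eq_zero, ← h]
  congr 1
  exact sum_congr rfl fun j _ => (map_mul f _ _).symm

theorem leadPower_mem {A : Subalgebra F₂ B} {i : Fin (n - 1)}
    (h : f (mX (inl ⟨2 * n - 1 - i, by omega⟩)) ∈ A) : f (leadPower n i) ∈ A := by
  rw [leadPower, map_pow]
  exact pow_mem h _

/-- The product of any element with a power of the determinant is a polynomial in the `ξ`'s. -/
theorem exists_det_pow_mul_mem (hsq : HasRoots n) (hf : ∀ i, f (relator n i) = 0) (g : TStar n) :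
    ∃ k, f (ofXi (2 * n) n (T n).det) ^ k * f g ∈ genRange f inl := by
  have hxi : ∀ a : Fin (2 * n), f (mX (inl a)) ∈ genRange f inl :=
    fun a => X_mem_genRange f a
  have hlt : ∀ {p : XiRing}, p ∈ supported F₂ (Iic (2 * n - 2)) →
      1 < 2 * n → f (ofXi (2 * n) n p) ∈ genRange f inl := fun hp h1 =>
    ofXi_mem f le_rfl (fun a _ => hxi a) (supported_Iic_lt (by omega) hp)
  have hs : f (ofXi (2 * n) n (T n).det) ∈ genRange f inl := by
    rcases Nat.lt_or_ge 1 (2 * n) with h1 | h1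
    · exact hlt (det_mem_of_forall _ fun i j => T_mem n i j) h1
    · haveI : IsEmpty (Fin (n - 1)) := ⟨fun i => by have := i.2; omega⟩
      rw [Matrix.det_isEmpty, map_one, map_one]
      exact one_mem _
  refine mem_satur.mp (aeval_mem_of_forall f (A := satur _ _ hs) (fun x => ?_) g)
  rcases x with a | j
  · exact le_satur (hxi a)
  · have hj := j.2
    refine ⟨1, ?_⟩
    have h1 := det_mul_mem_of_mulVec (M := (T n).map fun p => f (ofXi (2 * n) n p))
      (S := genRange f inl) (fun i j => hlt (T_mem n i j) (by omega))
      (x := fun j => f (genD (2 * n) n j)) (fun i => by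
        change ∑ j : Fin (n - 1), f (ofXi (2 * n) n (T n i j)) * f (genD (2 * n) n j) ∈ _
        rw [sum_eq_of_relator f hf]
        exact neg_mem (add_mem (leadPower_mem f (hxi _))
          (hlt (rootColumn_mem (hsq i)) (by omega)))) j
    rw [pow_one]
    convert h1 using 2
    · exact map_det (f.comp (ofXi (2 * n) n)) _
    · rfl

/-- The generators other than `ξ_{2n-1}`, `d_{n+1}`, …, `d_{2n-2}`, for `n = m + 2`. -/
def outerGen (m : ℕ) : Fin (2 * (m + 2) - 1) ⊕ Unit → Fin (2 * (m + 2)) ⊕ Fin (m + 2 - 1) :=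
  Sum.elim (fun a => inl (castLE (sub_le _ _) a)) fun _ => inr (Fin.last m)

/-- The product of any element with a power of a smaller determinant is a polynomial in the
generators without `ξ_{2n-1}`, `d_{n+1}`, …, `d_{2n-2}`. -/
theorem exists_det_pow_mul_mem' {m : ℕ} (f : TStar (m + 2) →ₐ[F₂] B)
    (hsq : HasRoots (m + 2)) (hf : ∀ i, f (relator (m + 2) i) = 0)
    (g : TStar (m + 2)) : ∃ k, f (ofXi (2 * (m + 2)) (m + 2) ((T (m + 1)).det ^ 2)) ^ k * f g ∈
      genRange f (outerGen m) := by
  have hxi : ∀ a : Fin (2 * (m + 2)), (a : ℕ) < 2 * (m + 2) - 1 →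
      f (mX (inl a)) ∈ genRange f (outerGen m) := fun a ha =>
    X_mem_genRange f (ρ := outerGen m) (inl ⟨a, ha⟩)
  have hlast : f (genD _ _ (Fin.last m)) ∈ genRange f (outerGen m) :=
    X_mem_genRange f (ρ := outerGen m) (inr ())
  have hlt : ∀ {N : ℕ} {p : XiRing}, p ∈ supported F₂ (Iic N) →
      N < 2 * (m + 2) - 1 → f (ofXi (2 * (m + 2)) (m + 2) p) ∈ genRange f (outerGen m) :=
    fun hp hN => ofXi_mem f (sub_le _ _) hxi (supported_Iic_lt hN hp)
  have hs : f (ofXi (2 * (m + 2)) (m + 2) ((T (m + 1)).det ^ 2)) ∈ genRange f (outerGen m) :=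
    hlt (pow_mem (det_mem_of_forall _ fun i j => T_mem (m + 1) i j) 2) (by omega)
  have hd : ∀ j : Fin (m + 1), f (genD (2 * (m + 2)) (m + 2) j) ∈ satur _ _ hs := fun j => by
    induction j using Fin.lastCases with
    | last => exact le_satur hlast
    | cast j =>
      refine ⟨1, ?_⟩
      have h1 := det_mul_mem_of_mulVec (M := (T (m + 1)).map fun p =>
          f (ofXi (2 * (m + 2)) (m + 2) (p ^ 2))) (S := genRange f (outerGen m))
        (fun i j => hlt (pow_mem (T_mem (m + 1) i j) 2) (by omega))
        (x := fun j => f (genD (2 * (m + 2)) (m + 2) (Fin.castSucc j))) (fun i => by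
          have h2 := sum_eq_of_relator f hf (Fin.succ i)
          have h3 := Fin.sum_univ_castSucc (n := m) fun j : Fin (m + 1) =>
            f (ofXi (2 * (m + 2)) (m + 2) (T (m + 2) i.succ j)) * f (genD _ _ j)
          have h4 := eq_sub_of_add_eq (h3.symm.trans h2)
          simp only [T_succ] at h4
          change ∑ j : Fin m, f (ofXi (2 * (m + 2)) (m + 2) (T (m + 1) i j ^ 2)) * f _ ∈ _
          rw [h4]
          refine sub_mem (neg_mem (add_mem (leadPower_mem f (hxi _ ?_)) ?_))
            (mul_mem (hlt (T_mem (m + 2) _ _) (by omega)) hlast)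
          · simp only [val_succ]
            omega
          · exact hlt (rootColumn_mem (hsq _)) (by omega)) j
      rw [pow_one]
      convert h1 using 2
      exact RingHom.map_det ((f.comp (ofXi (2 * (m + 2)) (m + 2))).toRingHom.comp
        (frobenius XiRing 2)) (T (m + 1))
  refine mem_satur.mp (aeval_mem_of_forall f (A := satur _ _ hs) (fun x => ?_) g)
  rcases x with a | j
  · rcases Nat.lt_or_ge (a : ℕ) (2 * (m + 2) - 1) with ha | ha
    · exact le_satur (hxi a ha)
    · have h2 := sum_eq_of_relator f hf (0 : Fin (m + 1))
      have h3 : f (leadPower (m + 2) (0 : Fin (m + 1))) = f (mX (inl a)) := by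
        have : a = ⟨2 * (m + 2) - 1 - ((0 : Fin (m + 1)) : ℕ), by omega⟩ := Fin.ext (by
          have := a.2; simp only [Fin.val_zero]; omega)
        rw [this]
        change f (genXi _ _ _ ^ 2 ^ 0) = _
        rw [pow_zero, pow_one]
        rfl
      rw [← h3]
      have h4 := eq_sub_of_add_eq (neg_eq_iff_eq_neg.mp h2.symm)
      rw [h4]
      exact sub_mem (neg_mem (sum_mem fun j _ => mul_mem
        (le_satur (hlt (T_mem (m + 2) _ _) (by omega))) (hd j)))
        (le_satur (hlt (rootColumn_mem (hsq _)) (by omega)))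
  · exact hd j

end Elimination

theorem exists_isRelPrime_of_ringHom {P A S : Type*} [CommRing P] [CommRing A] [CommRing S]
    [IsDomain P] [IsDomain S] [UniqueFactorizationMonoid P] [UniqueFactorizationMonoid S]
    (i : P →+* A) (φ : A →+* S) (h1 : ∀ x, (φ.comp i).IsIntegralElem (φ x))
    (h2 : ∀ x : S, IsIntegral φ.range x) {u v : A} (hu : φ u ≠ 0)
    (huv : IsRelPrime (φ u) (φ v)) :
    ∃ p₁ p₂ : P, p₁ ≠ 0 ∧ p₂ ≠ 0 ∧ IsRelPrime p₁ p₂ ∧ (∃ x y, φ (i p₁) = φ (x * u + y * v)) ∧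
      ∃ x y, φ (i p₂) = φ (x * u + y * v) := by
  letI : Algebra P φ.range := (φ.rangeRestrict.comp i).toAlgebra
  letI : Algebra P S := (φ.comp i).toAlgebra
  haveI : IsScalarTower P φ.range S := IsScalarTower.of_algebraMap_eq fun _ => rfl
  haveI : Algebra.IsIntegral P φ.range := ⟨by
    rintro ⟨_, x, rfl⟩
    exact (isIntegral_algebraMap_iff (B := S) Subtype.val_injective).mp (h1 x)⟩
  haveI : Algebra.IsIntegral φ.range S := ⟨h2⟩
  obtain ⟨p₁, p₂, hp₁, hp₂, hrel, hm₁, hm₂⟩ := exists_isRelPrime (P := P) (D := φ.range) (S := S)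
    Subtype.val_injective (u := φ.rangeRestrict u) (v := φ.rangeRestrict v)
    (fun h => hu (congrArg Subtype.val h)) huv
  have key : ∀ p : P, algebraMap P φ.range p ∈ span {φ.rangeRestrict u, φ.rangeRestrict v} →
      ∃ x y, φ (i p) = φ (x * u + y * v) := fun p hp => by
    obtain ⟨⟨_, x, rfl⟩, ⟨_, y, rfl⟩, h⟩ := Ideal.mem_span_pair.mp hp
    refine ⟨x, y, ?_⟩
    rw [map_add, map_mul, map_mul]
    exact (congrArg Subtype.val h).symm
  exact ⟨p₁, p₂, hp₁, hp₂, hrel, key p₁ hm₁, key p₂ hm₂⟩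

section Presentation

variable {U : Type*} [AddCommGroup U] [Module F₂ U] [FiniteDimensional F₂ U]
variable {κ : Type*} [Fintype κ] [DecidableEq κ] {q : QuadraticForm F₂ U} {n : ℕ}

theorem presMap_ofXi {k : ℕ} {p : XiRing} (hp : p ∈ supported F₂ (Iio k)) :
    presMap q k n (ofXi k n p) = xiS q p := by
  refine algHom_eq_of_supported (f := (presMap q k n).comp (ofXi k n)) (fun a ha => ?_) hp
  rw [comp_apply, ofXi_X ha, genXi, presMap, maeval_X, xiS,
    maeval_X]
  rfl

theorem presMap_relator (c : Coords q κ) (hn : card κ = n) (hq : IsMinusType q)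
    (hsq : HasRoots n) (i : Fin (n - 1)) : presMap q (2 * n) n (relator n i) = 0 := by
  have hi := i.2
  have hm : ∀ {p : XiRing}, p ∈ supported F₂ (Iic (2 * n - 2)) →
      presMap q (2 * n) n (ofXi (2 * n) n p) = xiS q p := fun hp =>
    presMap_ofXi (supported_Iic_lt (by omega) hp)
  have h1 : rootElem q n i = xiS q (rootColumn n i) := by
    refine sq_injective ?_
    change _ ^ 2 = _ ^ 2
    rw [rootElem_sq c hn hq, ← map_pow, rootColumn, sqrtXi_pow_two (hsq i)]
  have h2 : presMap q (2 * n) n (∑ j : Fin (n - 1), ofXi (2 * n) n (T n i j) * genD (2 * n) n j +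
      leadPower n i) = rootElem q n i := by
    rw [map_add, map_sum, leadPower, map_pow, rootElem]
    congr 1
    · refine sum_congr rfl fun j _ => ?_
      rw [map_mul, hm (T_mem n i j), genD, presMap, maeval_X, elim_inr]
    · rw [genXi, presMap, maeval_X, elim_inl]
  rw [relator, map_add, h2, h1, hm (rootColumn_mem (hsq i)), CharTwo.add_self_eq_zero]

/-- The ideal generated by the relations. -/
abbrev relIdeal (n : ℕ) : Ideal (TStar n) := span (Set.range (relator n))

theorem relIdeal_le (c : Coords q κ) (hn : card κ = n) (hq : IsMinusType q) (hsq : HasRoots n) :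
    relIdeal n ≤ RingHom.ker (presMap q (2 * n) n) := by
  rw [span_le]
  rintro _ ⟨i, rfl⟩
  exact presMap_relator c hn hq hsq i

theorem mem_invariants {f : Sym U} :
    f ∈ invariants q ↔ ∀ g ∈ orthogonalGroup q, symAction g f = f := by
  simp only [invariants, Algebra.mem_iInf]
  rfl

theorem range_le_invariants (c : Coords q κ) (hn : card κ = n) (h0 : n ≠ 0) {k : ℕ} :
    (presMap q k n).range ≤ invariants q := by
  rintro _ ⟨p, rfl⟩
  refine mem_invariants.mpr fun g hg => ?_
  change presMap q k n p ∈ AlgHom.equalizer (symAction g) (AlgHom.id F₂ (Sym U))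
  refine aeval_mem_of_forall (presMap q k n) (fun x => ?_) p
  rw [presMap, maeval_X, AlgHom.mem_equalizer]
  rcases x with a | j
  · exact symAction_xi c hg a
  · rw [elim_inr, add_assoc]
    exact symAction_dInv c hg hn h0 (by have := j.2; omega)

/-- What the elimination of some of the generators says about the kernel and the invariants. -/
theorem conductor (c : Coords q κ) (hn : card κ = n) (h0 : n ≠ 0) (hq : IsMinusType q)
    (hsq : HasRoots n) {τ : Type*} [Fintype τ] {ρ : τ → Fin (2 * n) ⊕ Fin (n - 1)}
    (hcard : card τ = 2 * card κ) {s : TStar n}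
    (hs : s ∈ (MvPolynomial.rename (R := F₂) ρ).range) (hs0 : presMap q (2 * n) n s ≠ 0)
    (H : ∀ g, ∃ k, Ideal.Quotient.mkₐ F₂ (relIdeal n) s ^ k *
      Ideal.Quotient.mkₐ F₂ (relIdeal n) g ∈
        genRange (Ideal.Quotient.mkₐ F₂ (relIdeal n)) ρ)
    (hρ : ∃ t, ρ t = inl ⟨0, by omega⟩) :
    (∃ M, ∀ g ∈ RingHom.ker (presMap q (2 * n) n), s ^ M * g ∈ relIdeal n) ∧
    ∀ f ∈ invariants q, ∃ k, presMap q (2 * n) n s ^ k * f ∈ (presMap q (2 * n) n).range := by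
  have hR := relIdeal_le c hn hq hsq
  set φ := presMap q (2 * n) n with hφ
  let y : τ → Sym U := fun t => φ (mX (ρ t))
  have hy : ∀ p, φ (MvPolynomial.rename ρ p) = maeval y p := fun p => by
    have : φ.comp (MvPolynomial.rename ρ) = maeval y :=
      malgHom_ext fun t => by
        rw [comp_apply, rename_X, maeval_X]
    exact dcongr_fun this p
  have H1 : ∀ g, ∃ k p, s ^ k * g - MvPolynomial.rename ρ p ∈ relIdeal n := fun g => by
    obtain ⟨k, p, hp⟩ := H g
    refine ⟨k, p, Ideal.Quotient.eq.mp ?_⟩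
    rw [map_mul, map_pow]
    exact hp.symm
  have H2 : ∀ g, ∃ k, φ s ^ k * φ g ∈ (maeval (R := F₂) y).range := fun g => by
    obtain ⟨k, p, hp⟩ := H1 g
    have := hR hp
    rw [RingHom.mem_ker, map_sub, sub_eq_zero, map_mul, map_pow, hy] at this
    exact ⟨k, p, this.symm⟩
  have hs' : φ s ∈ (maeval (R := F₂) y).range := by
    obtain ⟨p, rfl⟩ := hs
    exact ⟨p, (hy p).symm⟩
  have hcf : ∀ j, ∃ k, φ s ^ k * cf c.a c.b j ∈ (maeval (R := F₂) y).range := by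
    refine fun j => mem_satur.mp (cf_mem c hn h0 (R := satur _ _ hs') ?_ (fun l => ?_) j)
    · rintro _ ⟨p, rfl⟩
      have := aeval_mem_of_forall (maeval fun i : Fin (2 * n) => xi q i)
        (A := satur _ _ hs') (fun i => by
          have := H2 (mX (inl i))
          rw [hφ, presMap, maeval_X] at this
          rw [maeval_X]
          exact this) p
      exact this
    · refine pow_mem ?_ 2
      rcases l with ⟨_ | l, hl⟩
      · change dInv q n (n + 0) ∈ _
        rw [add_zero, dInv_self c hn h0 hq]
        exact zero_mem _
      · have := H2 (mX (inr ⟨l, by omega⟩))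
        rw [hφ, presMap, maeval_X, elim_inr] at this
        rw [show n + ((⟨l + 1, hl⟩ : Fin n) : ℕ) = n + 1 + l by simp only; ring]
        exact this
  have hind := c.algebraicIndependent hcard hs0 hs' hcf
  constructor
  · have H3 : ∀ g ∈ RingHom.ker φ, ∃ k, s ^ k * g ∈ relIdeal n := fun g hg => by
      obtain ⟨k, p, hp⟩ := H1 g
      have h3 := hR hp
      rw [RingHom.mem_ker, map_sub, map_mul, RingHom.mem_ker.mp hg, mul_zero, zero_sub,
        neg_eq_zero, hy] at h3
      rw [hind (h3.trans (map_zero _).symm), map_zero, sub_zero] at hp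
      exact ⟨k, hp⟩
    obtain ⟨S, hS⟩ := (isNoetherianRing_iff_ideal_fg (TStar n)).mp inferInstance (RingHom.ker φ)
    choose k hk using H3
    classical
    refine ⟨∑ g ∈ S.attach, k g (hS ▸ subset_span g.2), fun g hg => ?_⟩
    rw [← hS] at hg
    refine Submodule.span_induction (fun g hg => ?_) ?_ (fun x y _ _ hx hy => ?_)
      (fun a x _ hx => ?_) hg
    · rw [← Finset.add_sum_erase _ _ (Finset.mem_attach S ⟨g, hg⟩), add_comm, pow_add, mul_assoc]
      exact mul_mem_left _ _ (hk g _)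
    · rw [mul_zero]; exact zero_mem _
    · rw [mul_add]; exact add_mem hx hy
    · rw [smul_eq_mul, mul_left_comm]; exact mul_mem_left _ _ hx
  · intro f hf
    obtain ⟨k, p, hp⟩ := c.exists_pow_mul_mem hcard hs0 hs' hcf (f := f) fun g hg => by
      obtain ⟨t, ht⟩ := hρ
      have h3 := hg t
      simp only [y, ht, hφ, presMap, maeval_X, elim_inl] at h3
      exact mem_invariants.mp hf g (mem_orthogonalGroup_of_fix c h3)
    exact ⟨k, MvPolynomial.rename ρ p, (hy p).trans hp⟩

end Presentation

section Abstract

/-- The kernel and the image of a map that is finite over a polynomial ring, from conductors. -/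
theorem ker_and_mem_range_of_conductors {P A S ι : Type*} [CommRing P] [CommRing A] [CommRing S]
    [IsDomain P] [IsDomain S] [UniqueFactorizationMonoid P] [UniqueFactorizationMonoid S]
    [Finite ι] {R : Ideal A} {c : A →+ (ι → P)} {i : P →+* A} {φ : A →+* S}
    (hR : R ≤ RingHom.ker φ) (hinj : ∀ p, φ (i p) = 0 → p = 0) (h0 : Surjective c)
    (h1 : ∀ p f, c (i p * f) = p • c f) (h2 : ∀ f, c f = 0 ↔ f ∈ R)
    (hid : ∀ e, e ^ 2 - e ∈ R → e ∈ R ∨ 1 - e ∈ R) (hint : ∀ x : S, IsIntegral φ.range x)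
    {s t : A} (hs : φ s ≠ 0) (hst : IsRelPrime (φ s) (φ t)) {M N : ℕ}
    (hM : ∀ g ∈ RingHom.ker φ, s ^ M * g ∈ R) (hN : ∀ g ∈ RingHom.ker φ, t ^ N * g ∈ R) :
    RingHom.ker φ = R ∧ ∀ {f : S} {k l : ℕ} {a b : A}, φ s ^ k * f = φ a → φ t ^ l * f = φ b →
      ∃ e, φ e = f := by
  have hex : ∀ k l, ∃ p₁ p₂, p₁ ≠ 0 ∧ p₂ ≠ 0 ∧ IsRelPrime p₁ p₂ ∧
      (∃ x y, φ (i p₁) = φ (x * s ^ k + y * t ^ l)) ∧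
        ∃ x y, φ (i p₂) = φ (x * s ^ k + y * t ^ l) := fun k l => by
    refine exists_isRelPrime_of_ringHom i φ (fun x => ?_) hint ?_ ?_
    · letI := (φ.comp i).toAlgebra
      exact isIntegral_of_coeffs (P := P) (S := S) (i := i) (φ := φ) (fun _ => rfl) hR h0 h1 h2 x
    · rw [map_pow]; exact pow_ne_zero k hs
    · rw [map_pow, map_pow]; exact hst.pow
  have hker : RingHom.ker φ = R := by
    refine le_antisymm ?_ hR
    obtain ⟨p₁, p₂, hp₁, hp₂, hp, ⟨x₁, y₁, e₁⟩, x₂, y₂, e₂⟩ := hex M N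
    refine ker_le_of_conductor hR hinj h0 h1 h2 hid hp₁ hp₂ hp e₁ e₂ ?_ ?_ <;>
    · intro g hg
      rw [add_mul, mul_assoc, mul_assoc]
      exact add_mem (mul_mem_left _ _ (hM g hg)) (mul_mem_left _ _ (hN g hg))
  refine ⟨hker, fun {f k l a b} ha hb => ?_⟩
  obtain ⟨p₁, p₂, hp₁, -, hp, ⟨x₁, y₁, e₁⟩, x₂, y₂, e₂⟩ := hex k l
  have key : ∀ {p x y}, φ (i p) = φ (x * s ^ k + y * t ^ l) →
      φ (i p) * f = φ (x * a + y * b) := fun {p x y} h => by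
    rw [h, map_add, map_mul, map_mul, map_pow, map_pow, add_mul, mul_assoc, mul_assoc, ha, hb,
      map_add, map_mul, map_mul]
  exact mem_range_of_conductor hker.symm hinj h0 h1 h2 hp₁ hp (key e₁) (key e₂)

/-- A map from a polynomial ring with few variables that makes a polynomial ring algebraic is
injective. -/
theorem injective_of_isIntegral {σ τ : Type*} [Fintype σ] [Fintype τ] {A : Type*} [CommRing A]
    [Algebra F₂ A] (h : card σ ≤ card τ)
    (i : Poly σ →ₐ[F₂] A) (φ : A →ₐ[F₂] Poly τ)
    (h1 : ∀ x, ((φ : A →+* Poly τ).comp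
      (i : Poly σ →+* A)).IsIntegralElem (φ x))
    (h2 : ∀ x : Poly τ, IsIntegral φ.range x) : Injective (φ.comp i) := by
  set y : σ → Poly τ := fun x => φ (i (mX x))
  have hy : φ.comp i = maeval y :=
    malgHom_ext fun x => (maeval_X y x).symm
  have hr : (maeval (R := F₂) y).range ≤ φ.range := by
    rw [← hy]
    rintro _ ⟨p, rfl⟩
    exact ⟨i p, rfl⟩
  letI := (Subalgebra.inclusion hr).toAlgebra
  haveI : IsScalarTower (maeval (R := F₂) y).range φ.range
    (Poly τ) := IsScalarTower.of_algebraMap_eq fun _ => rfl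
  haveI : Algebra.IsIntegral φ.range (Poly τ) := ⟨h2⟩
  haveI : Algebra.IsIntegral (maeval (R := F₂) y).range φ.range := ⟨by
    rintro ⟨_, x, rfl⟩
    refine (isIntegral_algebraMap_iff (B := Poly τ) Subtype.val_injective).mp ?_
    obtain ⟨p, hp, hpx⟩ := h1 x
    have hx : (maeval (R := F₂) y : _ →+* Poly τ).IsIntegralElem
      (φ x) := ⟨p, hp, by rw [← hy]; exact hpx⟩
    obtain ⟨p, hp, hpx⟩ := hx
    refine ⟨p.map ((maeval (R := F₂) y).rangeRestrict : Poly σ →+*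
      (maeval (R := F₂) y).range), hp.map _, ?_⟩
    rw [eval₂_map]
    exact hpx⟩
  have alg : Algebra.IsIntegral (maeval (R := F₂) y).range
    (Poly τ) := Algebra.IsIntegral.trans φ.range
  rw [← Algebra.adjoin_range_eq_range_aeval] at alg
  have := Algebra.IsAlgebraic.isTranscendenceBasis_of_lift_le_trdeg_of_finite F₂ y (by
    rw [MvPolynomial.trdeg_of_isDomain]
    simpa using h)
  rw [hy]
  exact this.1

end Abstract

theorem det_T_ne_zero (m : ℕ) : (T (m + 1)).det ≠ 0 := fun h => by
  have h1 := (det_T_isOmegaMinus m).2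
  rw [h, map_zero, eq_comm, Qminus, Monic.mul_left_eq_zero_iff
    (monic_prod_of_monic _ _ fun x _ => monic_X_add_C _), C_eq_zero, (stdCoords m).dickson_eq,
    ← (stdCoords m).equiv_cf, map_eq_zero_iff _ (stdCoords m).equiv.injective] at h1
  exact cf_zero_ne_zero h1

section Main

variable {U : Type*} [AddCommGroup U] [Module F₂ U] [FiniteDimensional F₂ U]
variable {κ : Type*} [Fintype κ] [DecidableEq κ] {q : QuadraticForm F₂ U} {m n : ℕ}

/-- The variables that occur as leading monomials of relations. -/
abbrev IsLead (n : ℕ) : Fin (2 * n) ⊕ Fin (n - 1) → Prop :=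
  Sum.elim (fun a => n < (a : ℕ)) fun _ => False

instance (n : ℕ) : DecidablePred (IsLead n) := Classical.decPred _

theorem relIdeal_eq (n : ℕ) : relIdeal n =
    span (Set.range fun z : {x // IsLead n x} => rels (2 * n) n le_rfl z) := by
  refine congrArg span (Set.Subset.antisymm ?_ ?_)
  · rintro _ ⟨i, rfl⟩
    have hi := i.2
    exact ⟨⟨inl ⟨2 * n - 1 - i, by omega⟩, by change n < 2 * n - 1 - (i : ℕ); omega⟩,
      (relator_eq_rels i).symm⟩
  · rintro _ ⟨⟨a | j, hx⟩, rfl⟩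
    · have hx : n < (a : ℕ) := hx
      have ha := a.2
      refine ⟨⟨2 * n - 1 - a, by omega⟩, ?_⟩
      rw [relator_eq_rels]
      congr 2
      exact Fin.ext (by simp only; omega)
    · exact hx.elim

theorem card_params (n : ℕ) : card {x // ¬ IsLead n x} ≤ 2 * n := by
  rcases n with _ | n
  · have : IsEmpty (Fin (2 * 0) ⊕ Fin (0 - 1)) := by simp; infer_instance
    simp
  have := Fintype.card_le_of_injective (β := Fin (n + 2) ⊕ Fin n)
    (fun x : {x // ¬ IsLead (n + 1) x} => match x with
      | ⟨inl a, h⟩ => inl ⟨a, Nat.lt_succ_of_le (Nat.not_lt.mp h)⟩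
      | ⟨inr j, _⟩ => inr j) (by
      rintro ⟨a | j, h⟩ ⟨a' | j', h'⟩ heq
      · simp only [Sum.inl.injEq, Fin.mk.injEq] at heq
        exact Subtype.ext (congrArg inl (Fin.ext heq))
      · simp at heq
      · simp at heq
      · exact Subtype.ext (congrArg inr (Sum.inr.inj heq)))
  rw [card_sum, card_fin, card_fin] at this
  omega

/-- The kernel and the image of the map, with the redundant generator. -/
theorem ker_and_range (c : Coords q κ) (hn : card κ = m + 2) (hq : IsMinusType q)
    (hsq : HasRoots (m + 2)) :
    RingHom.ker (presMap q (2 * (m + 2)) (m + 2)) = relIdeal (m + 2) ∧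
      (presMap q (2 * (m + 2)) (m + 2)).range = invariants q := by
  have h0 : m + 2 ≠ 0 := by omega
  have hR := relIdeal_le c hn hq hsq
  have hmk : ∀ i, Ideal.Quotient.mkₐ F₂ (relIdeal (m + 2)) (relator (m + 2) i) = 0 :=
    fun i => Ideal.Quotient.eq_zero_iff_mem.mpr (subset_span ⟨i, rfl⟩)
  set φ := presMap q (2 * (m + 2)) (m + 2) with hφdef
  set s := ofXi (2 * (m + 2)) (m + 2) (T (m + 2)).det with hs
  set s' := ofXi (2 * (m + 2)) (m + 2) ((T (m + 1)).det ^ 2) with hs'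
  have hd : ∀ l ≤ m + 2, (T l).det ∈ supported F₂ (Iio (2 * (m + 2) - 1)) :=
    fun l hl => supported_Iic_lt (show 2 * l - 2 < _ by omega)
      (det_mem_of_forall _ fun i j => T_mem l i j)
  have hd' : ∀ l ≤ m + 2, (T l).det ∈ supported F₂ (Iio (2 * (m + 2))) :=
    fun l hl => supported_mono (Set.Iio_subset_Iio (sub_le _ _)) (hd l hl)
  have hφs : φ s = xiS q (T (m + 2)).det := presMap_ofXi (hd' _ le_rfl)
  have hφs' : φ s' = xiS q (T (m + 1)).det ^ 2 := by
    rw [← map_pow]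
    exact presMap_ofXi (pow_mem (hd' (m + 1) (by omega)) 2)
  have hrel := c.isRelPrime_det (m := m + 1) hn hq
  haveI := c.uniqueFactorizationMonoid
  have hs0 : φ s ≠ 0 := hφs ▸ xiS_det_ne_zero c hn hq
  have hs0' : φ s' ≠ 0 := by
    rw [hφs']
    refine pow_ne_zero 2 fun h => det_T_ne_zero m ?_
    exact xiS_injective c hn h0 hq (hd' _ (by omega)) (zero_mem _) (h.trans (map_zero _).symm)
  have hsr : s ∈ (MvPolynomial.rename (R := F₂)
      (inl : _ → Fin (2 * (m + 2)) ⊕ Fin (m + 2 - 1))).range :=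
    ofXi_mem (A := (MvPolynomial.rename _).range) (AlgHom.id _ _) le_rfl (fun a _ => ⟨_, rename_X _ a⟩) (hd' _ le_rfl)
  have hsr' : s' ∈ (MvPolynomial.rename (R := F₂) (outerGen m)).range :=
    ofXi_mem (A := (MvPolynomial.rename _).range) (AlgHom.id _ _) (sub_le _ _) (fun a ha => ⟨mX (inl ⟨a, ha⟩),
      rename_X _ _⟩) (pow_mem (hd (m + 1) (by omega)) 2)
  obtain ⟨⟨M, hM⟩, hinv⟩ := conductor c hn h0 hq hsq (by rw [card_fin, hn]) hsr hs0
    (exists_det_pow_mul_mem _ hsq hmk) ⟨⟨0, by omega⟩, rfl⟩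
  obtain ⟨⟨M', hM'⟩, hinv'⟩ := conductor c hn h0 hq hsq
    (by rw [card_sum, card_fin, Fintype.card_unit, hn]; omega) hsr' hs0'
    (exists_det_pow_mul_mem' _ hsq hmk) ⟨inl ⟨0, by omega⟩, rfl⟩
  obtain ⟨co, hc0, hc1, hc2⟩ := exists_coeffs (IsLead (m + 2)) (lead_rels le_rfl hsq) expo_pos
    (by
      rintro (a | j) hx
      · have hx : ¬ m + 2 < (a : ℕ) := hx
        rw [rels, expo, elim_inl, elim_inl, dif_neg hx, if_neg hx]
        exact ⟨rfl, rfl⟩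
      · exact ⟨rfl, rfl⟩)
  rw [← relIdeal_eq] at hc2
  let ψ : TStar (m + 2) →ₐ[F₂] PairRing κ := (c.equiv.symm : Sym U →ₐ[F₂] _).comp φ
  have hψ : ∀ x, ψ x = c.equiv.symm (φ x) := fun _ => rfl
  have hker : ∀ x, ψ x = 0 ↔ φ x = 0 := fun x => map_eq_zero_iff _ c.equiv.symm.injective
  have hker' : RingHom.ker (ψ : TStar (m + 2) →+* PairRing κ) = RingHom.ker φ :=
    Ideal.ext hker
  have hdg : ∀ l : Fin (m + 2), dInv q (m + 2) (m + 2 + l) ^ 2 ∈ φ.range := fun l => by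
    refine pow_mem ?_ 2
    rcases l with ⟨_ | l, hl⟩
    · change dInv q (m + 2) (m + 2 + 0) ∈ _
      rw [add_zero, dInv_self c hn h0 hq]
      exact zero_mem _
    · refine ⟨mX (inr ⟨l, by omega⟩), ?_⟩
      change φ (mX _) = _
      rw [hφdef, presMap, maeval_X, elim_inr]
      congr 1
      simp only
      ring
  have hxr : xiRange q (2 * (m + 2)) ≤ φ.range := by
    rintro _ ⟨p, rfl⟩
    refine aeval_mem_of_forall (maeval fun i : Fin (2 * (m + 2)) => xi q i)
      (A := φ.range) (fun i => ⟨mX (inl i), ?_⟩) p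
    change φ (mX _) = _
    rw [hφdef, presMap, maeval_X, maeval_X, elim_inl]
  have hint2 : ∀ x : PairRing κ, IsIntegral ψ.range x := fun x => by
    obtain ⟨k, hk⟩ := exists_isIntegral_pow_mul 1 (one_mem ψ.range) (fun j => ⟨0, by
      rw [c.symm_dk, pow_zero, one_mul]
      obtain ⟨p, hp⟩ := cf_mem c hn h0 hxr hdg j
      exact ⟨p, congrArg c.equiv.symm hp⟩⟩) x
    rwa [one_pow, one_mul] at hk
  have hR' : relIdeal (m + 2) ≤ RingHom.ker (ψ : TStar (m + 2) →+* PairRing κ) :=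
    hker' ▸ hR
  have hint : ∀ x, ((ψ : TStar (m + 2) →+* PairRing κ).comp
      (ofParams (IsLead (m + 2)) : Params (IsLead (m + 2)) →+* TStar (m + 2))).IsIntegralElem (ψ x) := fun x => by
    letI := ((ψ : TStar (m + 2) →+* PairRing κ).comp
      (ofParams (IsLead (m + 2)) : Params (IsLead (m + 2)) →+* TStar (m + 2))).toAlgebra
    exact isIntegral_of_coeffs (P := Params (IsLead (m + 2))) (S := PairRing κ)
      (φ := (ψ : TStar (m + 2) →+* PairRing κ))
      (i := (ofParams (IsLead (m + 2)) : Params (IsLead (m + 2)) →+* TStar (m + 2))) (fun _ => rfl) hR' hc0 hc1 hc2 x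
  have hinj := injective_of_isIntegral (by
    rw [card_sum, hn, ← two_mul]; exact card_params (m + 2)) (ofParams (IsLead (m + 2)))
    ψ hint hint2
  obtain ⟨hk1, hk2⟩ := ker_and_mem_range_of_conductors (s := s) (t := s')
    (φ := (ψ : TStar (m + 2) →+* PairRing κ))
    (i := (ofParams (IsLead (m + 2)) : Params (IsLead (m + 2)) →+* TStar (m + 2))) hR'
    (fun p hp => hinj (hp.trans (map_zero _).symm)) hc0 hc1 hc2
    (fun e he => mem_or_of_sq_sub_mem wt_pos (fun i => relator_eq i ▸ wh_relGen hsq i) he) hint2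
    (fun h => hs0 ((hker s).mp h)) (fun d hd hd' => by
      have h1 : ∀ {x}, d ∣ ψ x → c.equiv d ∣ φ x := fun {x} h => by
        rw [← c.equiv.apply_symm_apply (φ x)]
        exact map_dvd c.equiv h
      have h2 : IsRelPrime (φ s) (φ s') := by
        rw [hφs, hφs']
        exact hrel.pow_right
      exact (MulEquiv.isUnit_map c.equiv).mp (h2 (h1 hd) (h1 hd'))) (hker' ▸ hM) (hker' ▸ hM')
  refine ⟨hker'.symm.trans hk1, le_antisymm (range_le_invariants c hn h0) fun f hf => ?_⟩
  obtain ⟨k, a, ha⟩ := hinv f hf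
  obtain ⟨k', a', ha'⟩ := hinv' f hf
  have tr : ∀ {x k a}, φ x ^ k * f = φ a → ψ x ^ k * c.equiv.symm f = ψ a :=
    fun {x k a} h => by
      rw [hψ, hψ, ← h]
      exact ((map_mul c.equiv.symm _ _).trans (congrArg (· * _) (map_pow c.equiv.symm _ _))).symm
  obtain ⟨e, he⟩ := hk2 (tr ha.symm) (tr ha'.symm)
  exact ⟨e, c.equiv.symm.injective he⟩

end Main

section Elimination

variable {U : Type*} [AddCommGroup U] [Module F₂ U] [FiniteDimensional F₂ U]
variable {κ : Type*} [Fintype κ] [DecidableEq κ] {q : QuadraticForm F₂ U} {n : ℕ}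

/-- The inclusion of the ring without the redundant generator. -/
def incl (n : ℕ) : TDagger n →ₐ[F₂] TStar n :=
  MvPolynomial.rename (Sum.map (castLE (sub_le _ _)) id)

theorem elim_incl (g : TDagger n) (p : TDagger n) : elim n g (incl n p) = p := by
  have : (elim n g).comp (incl n) = AlgHom.id _ _ := malgHom_ext fun x => by
    rw [comp_apply, incl, rename_X, elim, maeval_X]
    rcases x with a | j
    · exact dif_pos a.2
    · rfl
  exact dcongr_fun this p

theorem presMap_incl (p : TDagger n) : presMap q (2 * n) n (incl n p) = presMap q (2 * n - 1) n p := by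
  have : (presMap q (2 * n) n).comp (incl n) = presMap q (2 * n - 1) n :=
    malgHom_ext fun x => by
      rw [comp_apply, incl, rename_X, presMap, presMap, maeval_X,
        maeval_X]
      rcases x with a | j <;> rfl
  exact dcongr_fun this p

theorem incl_ofXi {p : XiRing} (hp : p ∈ supported F₂ (Iio (2 * n - 1))) :
    incl n (ofXi (2 * n - 1) n p) = ofXi (2 * n) n p := by
  refine algHom_eq_of_supported (f := (incl n).comp (ofXi (2 * n - 1) n)) (fun a ha => ?_) hp
  have ha : a < 2 * n - 1 := ha
  rw [comp_apply, ofXi_X (show a < 2 * n by omega), ofXi_X ha, genXi, incl,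
    rename_X]
  rfl

theorem relator_zero (hn : 2 ≤ n) (hsq : HasRoots n) :
    relator n ⟨0, by omega⟩ = incl n (elim n 0 (relator n ⟨0, by omega⟩)) +
      genXi (2 * n) n ⟨2 * n - 1, by omega⟩ := by
  have hm : ∀ {p : XiRing}, p ∈ supported F₂ (Iic (2 * n - 2)) →
      incl n (elim n 0 (ofXi (2 * n) n p)) = ofXi (2 * n) n p := fun h => by
    rw [elim_ofXi 0 (supported_Iic_lt (by omega) h), incl_ofXi (supported_Iic_lt (by omega) h)]
  have hd : ∀ j, incl n (elim n 0 (genD (2 * n) n j)) = genD (2 * n) n j := fun j => by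
    rw [elim_genD, genD, incl, rename_X]
    rfl
  have hl : leadPower n ⟨0, by omega⟩ = genXi (2 * n) n ⟨2 * n - 1, by omega⟩ := by
    rw [leadPower, pow_zero, pow_one]
    rfl
  have h0 : elim n 0 (genXi (2 * n) n ⟨2 * n - 1, by omega⟩) = 0 := by
    rw [genXi, elim, maeval_X, elim_inl, dif_neg (lt_irrefl _)]
  rw [relator, hl, map_add, map_add, map_add, h0, map_add, map_sum, map_sum,
    hm (rootColumn_mem (hsq _)), map_zero, add_zero, add_right_comm]
  congr 2
  refine sum_congr rfl fun j _ => ?_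
  rw [map_mul, map_mul, hm (T_mem n _ j), hd]

/-- The kernel and the image of the map without the redundant generator. -/
theorem ker_and_range_reduced (hn : 2 ≤ n) (hsq : HasRoots n)
    (h : RingHom.ker (presMap q (2 * n) n) = span (Set.range (relator n))) :
    RingHom.ker (presMap q (2 * n - 1) n) = span (Set.range (reducedRelator n)) ∧
      (presMap q (2 * n - 1) n).range = (presMap q (2 * n) n).range := by
  set g := elim n 0 (relator n ⟨0, by omega⟩) with hg
  have h0 := relator_zero hn hsq
  rw [← hg] at h0
  have hr : ∀ i, presMap q (2 * n) n (relator n i) = 0 := fun i => by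
    have : relator n i ∈ RingHom.ker (presMap q (2 * n) n) := h ▸ subset_span ⟨i, rfl⟩
    exact this
  have h1 : elim n g (relator n ⟨0, by omega⟩) = 0 := by
    rw [h0, map_add, elim_incl, genXi, elim, maeval_X, elim_inl,
      dif_neg (lt_irrefl _), CharTwo.add_self_eq_zero]
  have h2 : ∀ p, presMap q (2 * n - 1) n (elim n g p) = presMap q (2 * n) n p := fun p => by
    have : (presMap q (2 * n - 1) n).comp (elim n g) = presMap q (2 * n) n :=
      malgHom_ext fun x => by
        rw [comp_apply, elim, maeval_X]
        rcases x with a | j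
        · rw [elim_inl]
          split_ifs with ha
          · rw [genXi, presMap, presMap, maeval_X, maeval_X]
            rfl
          · have ha : a = ⟨2 * n - 1, by omega⟩ := Fin.ext (by have := a.2; simp only; omega)
            have h3 := hr ⟨0, by omega⟩
            rw [h0, map_add, presMap_incl, CharTwo.add_eq_zero] at h3
            rw [h3, ha]
            rfl
        · rw [elim_inr, genD, presMap, presMap, maeval_X, maeval_X]
          rfl
    exact dcongr_fun this p
  refine ⟨le_antisymm (fun x hx => ?_) ?_, le_antisymm ?_ ?_⟩
  · have h3 : incl n x ∈ span (Set.range (relator n)) := by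
      rw [← h, RingHom.mem_ker, presMap_incl]
      exact hx
    have h4 : span (Set.range (relator n)) ≤
        (span (Set.range (reducedRelator n))).comap (elim n g) := by
      rw [span_le]
      rintro _ ⟨⟨_ | i, hi⟩, rfl⟩
      · exact (congrArg (· ∈ span (Set.range (reducedRelator n))) h1).mpr (zero_mem _)
      · exact subset_span ⟨⟨i, by omega⟩, rfl⟩
    have h5 := h4 h3
    rwa [Ideal.mem_comap, elim_incl] at h5
  · rw [span_le]
    rintro _ ⟨i, rfl⟩
    exact (h2 _).trans (hr _)
  · rintro _ ⟨p, rfl⟩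
    exact ⟨incl n p, presMap_incl p⟩
  · rintro _ ⟨p, rfl⟩
    exact ⟨elim n g p, h2 p⟩

theorem wh_reducedRelator (hsq : HasRoots n) (i : Fin (n - 2)) :
    IsWH (wt (2 * n - 1) n) (reducedRelator n i)
      (2 ^ (2 * n - 1) + 2 ^ ((i : ℕ) + 1)) := by
  rw [reducedRelator_eq hsq]
  exact wh_relGen hsq _

end Elimination

section Degrees

variable {U : Type*} [AddCommGroup U] [Module F₂ U]

theorem mul_mem_degreePart {a b : ℕ} {x y : Sym U} (hx : x ∈ degreePart U a)
    (hy : y ∈ degreePart U b) : x * y ∈ degreePart U (a + b) := by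
  rw [degreePart, pow_add]
  exact Submodule.mul_mem_mul hx hy

theorem pow_mem_degreePart {a : ℕ} {x : Sym U} (hx : x ∈ degreePart U a) (k : ℕ) :
    x ^ k ∈ degreePart U (k * a) := by
  rw [degreePart, mul_comm, pow_mul]
  exact Submodule.pow_mem_pow _ hx k

theorem vec_mem_degreePart (x : Dual F₂ U) : vec x ∈ degreePart U 1 := by
  rw [degreePart, pow_one]
  exact ⟨x, rfl⟩

theorem one_mem_degreePart : (1 : Sym U) ∈ degreePart U 0 := by
  rw [degreePart, pow_zero]
  exact Submodule.one_le.mp le_rfl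

theorem prod_mem_degreePart {ι : Type*} (s : Finset ι) {e : ι → ℕ} {y : ι → Sym U}
    (h : ∀ i ∈ s, y i ∈ degreePart U (e i)) : ∏ i ∈ s, y i ∈ degreePart U (∑ i ∈ s, e i) := by
  classical
  induction s using Finset.induction_on with
  | empty => exact one_mem_degreePart
  | insert a s ha ih =>
    rw [Finset.prod_insert ha, sum_insert ha]
    exact mul_mem_degreePart (h a (Finset.mem_insert_self a s))
      (ih fun i hi => h i (Finset.mem_insert_of_mem hi))

theorem aeval_mem_degreePart {σ : Type*} {w : σ → ℕ} {y : σ → Sym U}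
    (h : ∀ i, y i ∈ degreePart U (w i)) {p : Poly σ} {d : ℕ}
    (hp : IsWH w p d) : maeval y p ∈ degreePart U d := by
  rw [MvPolynomial.aeval_def, MvPolynomial.eval₂_eq]
  refine sum_mem fun s hs => ?_
  rw [← smul_def, ← hp (MvPolynomial.mem_support_iff.mp hs), weight_apply]
  exact smul_mem _ _ (prod_mem_degreePart _ fun i _ => pow_mem_degreePart (h i) _)

theorem esymm_mem_degreePart (s : Multiset (Dual F₂ U)) (k : ℕ) :
    (s.map vec).esymm k ∈ degreePart U k := by
  have h1 : ∀ t : Multiset (Dual F₂ U),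
      (t.map vec).prod ∈ degreePart U (Multiset.card t) := fun t => by
    induction t using Multiset.induction_on with
    | empty => exact one_mem_degreePart
    | cons a t ih =>
      rw [Multiset.map_cons, Multiset.prod_cons, Multiset.card_cons, add_comm]
      exact mul_mem_degreePart (vec_mem_degreePart a) ih
  rw [Multiset.esymm]
  refine multiset_sum_mem _ fun y hy => ?_
  obtain ⟨t, ht, rfl⟩ := Multiset.mem_map.mp hy
  rw [Multiset.powersetCard_map, Multiset.mem_map] at ht
  obtain ⟨t, ht, rfl⟩ := ht
  exact (Multiset.mem_powersetCard.mp ht).2 ▸ h1 t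

variable [FiniteDimensional F₂ U] {q : QuadraticForm F₂ U}
variable {κ : Type*} [Fintype κ] [DecidableEq κ]

theorem xi_mem_degreePart (c : Coords q κ) (i : ℕ) : xi q i ∈ degreePart U (2 ^ i + 1) := by
  cases i with
  | zero =>
    rw [xi, formElem]
    refine add_mem (sum_mem fun i _ => ?_) (sum_mem fun i _ => sum_mem fun j _ => ?_)
    · rw [← smul_def]
      exact smul_mem _ _ (pow_mem_degreePart (vec_mem_degreePart _) 2)
    · rw [← smul_def]
      exact smul_mem _ _
        (mul_mem_degreePart (vec_mem_degreePart _) (vec_mem_degreePart _))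
  | succ i =>
    rw [c.xi_succ, gram]
    have hv := fun x : Dual F₂ U => pow_mem_degreePart (vec_mem_degreePart x) (2 ^ (i + 1))
    simp only [mul_one] at hv
    refine sum_mem fun k _ => add_mem ?_ (mul_mem_degreePart (hv _) (vec_mem_degreePart _))
    rw [add_comm]
    exact mul_mem_degreePart (vec_mem_degreePart _) (hv _)

theorem presMap_mem_degreePart (c : Coords q κ) {k n e : ℕ} {p : GenRing k n}
    (hp : IsWH (wt k n) p e) : presMap q k n p ∈ degreePart U e := by
  refine aeval_mem_degreePart (fun x => ?_) hp
  rcases x with a | j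
  · exact xi_mem_degreePart c a
  · have := esymm_mem_degreePart (minusVectors q).val (2 ^ (2 * n - 1) - 2 ^ (n + 1 + (j : ℕ) - 1))
    rw [show n + 1 + (j : ℕ) - 1 = n + j by omega] at this
    change dInv q n _ ∈ _
    rw [dInv, show n + 1 + (j : ℕ) - 1 = n + j by omega]
    exact this

end Degrees

theorem ringKrullDim_genRing (k n : ℕ) : ringKrullDim (GenRing k n) = (k + (n - 1) : ℕ) := by
  rw [MvPolynomial.ringKrullDim_of_isNoetherianRing, ringKrullDim_eq_zero_of_field, zero_add,
    Nat.card_eq_fintype_card, card_sum, card_fin, card_fin]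

universe u

theorem isCompleteIntersection_of_surjective {A : Type} {R : Type u} [CommRing A] [CommRing R]
    [IsRegularRing A] {f : A →+* R} (hf : Surjective f) {rs : List A}
    (hrs : RingTheory.Sequence.IsWeaklyRegular A rs) (hker : RingHom.ker f = ofList rs) :
    IsCompleteIntersection R := by
  refine ⟨isNoetherianRing_of_surjective A R f hf, fun p _ => ?_⟩
  set P := p.comap f
  let S := ULift.{u} (Localization.AtPrime P)
  haveI : IsLocalization.AtPrime S P :=
    IsLocalization.isLocalization_of_algEquiv P.primeCompl ULift.algEquiv.symm
  let e := RingHom.quotientKerEquivOfSurjective hf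
  have he : (Algebra.algebraMapSubmonoid (A ⧸ RingHom.ker f) P.primeCompl).map e.toMonoidHom =
      p.primeCompl := by
    ext x
    constructor
    · rintro ⟨_, ⟨a, ha, rfl⟩, rfl⟩
      exact ha
    · intro hx
      obtain ⟨a, rfl⟩ := hf x
      exact ⟨_, ⟨a, hx, rfl⟩, rfl⟩
  refine ⟨S, inferInstance, IsRegularLocalRing.of_ringEquiv (ULift.ringEquiv.symm),
    rs.map (algebraMap A S), hrs.isRegular_of_isLocalization_of_mem S P fun r hr => ?_, ⟨?_⟩⟩
  · have : r ∈ RingHom.ker f := hker ▸ subset_span hr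
    exact (congrArg (· ∈ p) this).mpr (zero_mem p)
  · refine (IsLocalization.ringEquivOfRingEquiv (S ⧸ (RingHom.ker f).map (algebraMap A S))
      (Localization.AtPrime p) e he).symm.trans (Ideal.quotEquivOfEq ?_)
    rw [hker, Ideal.map_ofList]

end OrthInv

end

theorem mainTheorem2 {U : Type*} [AddCommGroup U] [Module (ZMod 2) U]
    [FiniteDimensional (ZMod 2) U] (n : ℕ) (hn : 2 ≤ n)
    (hU : Module.finrank (ZMod 2) U = 2 * n)
    (q : QuadraticForm (ZMod 2) U) (hq : OrthInv.IsMinusType q) :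
    -- the map is degree preserving
    (∀ (e : ℕ) (p : OrthInv.TDagger n),
      MvPolynomial.IsWeightedHomogeneous (OrthInv.wt (2 * n - 1) n) p e →
        OrthInv.presMap q (2 * n - 1) n p ∈ OrthInv.degreePart U e) ∧
    -- the image is the ring of invariants
    (OrthInv.presMap q (2 * n - 1) n).range = OrthInv.invariants q ∧
    -- the kernel is generated by the regular sequence of reduced relations
    RingTheory.Sequence.IsRegular (OrthInv.TDagger n) (List.ofFn (OrthInv.reducedRelator n)) ∧
    RingHom.ker (OrthInv.presMap q (2 * n - 1) n) =
      Ideal.span (Set.range (OrthInv.reducedRelator n)) ∧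
    (∀ i : Fin (n - 2), MvPolynomial.IsWeightedHomogeneous (OrthInv.wt (2 * n - 1) n)
      (OrthInv.reducedRelator n i) (2 ^ (2 * n - 1) + 2 ^ ((i : ℕ) + 1))) ∧
    -- the polynomials entering the matrices have their defining properties
    (∀ (m : ℕ) (i : Fin m), OrthInv.IsXiExpression m
      (OrthInv.dicksonRemainder m (OrthInv.K m) i) (OrthInv.E m i)) ∧
    (∀ m : ℕ, OrthInv.Qminus (OrthInv.stdForm m) = ∑ l ∈ Finset.range (m + 1),
      Polynomial.C (OrthInv.dickson (OrthInv.Std m) (m + l)) *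
        OrthInv.spec m (OrthInv.alpha l) ^ 2 ^ (m - l)) ∧
    (∀ i : Fin (n - 1), IsSquare (OrthInv.squareColumn n i)) ∧
    (∀ i j : Fin (n - 1),
      OrthInv.T n i j ∈ MvPolynomial.supported (ZMod 2) (Set.Iic (2 * n - 2))) ∧
    (∀ i : Fin (n - 1),
      OrthInv.rootColumn n i ∈ MvPolynomial.supported (ZMod 2) (Set.Iic (2 * n - 1))) ∧
    -- the determinant of `T_{n-1}`
    OrthInv.IsOmegaMinus (n - 1) (OrthInv.T n).det ∧
    -- the matrix form of the relations, with the redundant generator `ξ_{2n-1}`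
    RingTheory.Sequence.IsRegular (OrthInv.TStar n) (List.ofFn (OrthInv.relator n)) ∧
    RingHom.ker (OrthInv.presMap q (2 * n) n) =
      Ideal.span (Set.range (OrthInv.relator n)) ∧
    (∀ i : Fin (n - 1), MvPolynomial.IsWeightedHomogeneous (OrthInv.wt (2 * n) n)
      (OrthInv.relator n i) (2 ^ (2 * n - 1) + 2 ^ (i : ℕ))) ∧
    (∀ i : Fin (n - 1), MvPolynomial.degreeOf (Sum.inl ⟨2 * n - 1 - i, by omega⟩)
      (OrthInv.relator n i - OrthInv.leadPower n i) < 2 ^ (i : ℕ)) ∧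
    (∀ i : Fin (n - 1),
      OrthInv.relator n i ∉ Ideal.span (OrthInv.relator n '' {i}ᶜ)) ∧
    -- extension to regular sequences of maximal length
    RingTheory.Sequence.IsRegular (OrthInv.TDagger n)
      (List.ofFn (OrthInv.reducedRelator n) ++
        OrthInv.parameterList (2 * n - 1) n (by omega)) ∧
    ringKrullDim (OrthInv.TDagger n) = ((n - 2) + 2 * n : ℕ) ∧
    RingTheory.Sequence.IsRegular (OrthInv.TStar n)
      (List.ofFn (OrthInv.relator n) ++ OrthInv.parameterList (2 * n) n (by omega)) ∧
    ringKrullDim (OrthInv.TStar n) = ((n - 1) + 2 * n : ℕ) ∧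
    -- complete intersection
    OrthInv.IsCompleteIntersection (OrthInv.invariants q) := by
  obtain ⟨κ, _, _, hκ, ⟨c⟩⟩ := OrthInv.exists_coords hq.1 (show n ≠ 0 by omega) hU
  have hsq := OrthInv.isSquare_squareColumn c hκ (by omega) hq
  obtain ⟨m, rfl⟩ := Nat.exists_eq_add_of_le' hn
  obtain ⟨hker, hrange⟩ := OrthInv.ker_and_range c hκ hq hsq
  obtain ⟨hker', hrange'⟩ := OrthInv.ker_and_range_reduced (q := q) hn hsq hker
  obtain ⟨hreg, hpar⟩ := OrthInv.isRegular_relator hn hsq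
  obtain ⟨hreg', hpar'⟩ := OrthInv.isRegular_reducedRelator hn hsq
  refine ⟨fun e p hp => OrthInv.presMap_mem_degreePart c hp, hrange'.trans hrange, hreg', hker',
    OrthInv.wh_reducedRelator hsq, fun m => OrthInv.isXiExpression_E m,
    OrthInv.Qminus_stdForm_eq, hsq, OrthInv.T_mem _, fun i => MvPolynomial.supported_mono
      (Set.Iic_subset_Iic.mpr (by omega)) (OrthInv.rootColumn_mem (hsq i)),
    OrthInv.det_T_isOmegaMinus (m + 1), hreg, hker,
    fun i => OrthInv.relator_eq i ▸ OrthInv.wh_relGen hsq i, fun i => ?_,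
    OrthInv.relator_notMem hsq, hpar', ?_, hpar, ?_, ?_⟩
  · rw [OrthInv.relator_eq]
    exact OrthInv.degreeOf_relGen_sub hsq rfl
  · rw [OrthInv.ringKrullDim_genRing]
    congr 1
    omega
  · rw [OrthInv.ringKrullDim_genRing]
    congr 1
    omega
  · have hr := hrange'.trans hrange
    let f : OrthInv.TDagger (m + 2) →ₐ[ZMod 2] OrthInv.invariants q :=
      (OrthInv.presMap q (2 * (m + 2) - 1) (m + 2)).codRestrict (OrthInv.invariants q)
        fun x => hr.le ⟨x, rfl⟩
    refine OrthInv.isCompleteIntersection_of_surjective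
      (f := (f : OrthInv.TDagger (m + 2) →+* OrthInv.invariants q)) ?_ hreg'.1 ?_
    · rintro ⟨y, hy⟩
      obtain ⟨x, rfl⟩ := hr.ge hy
      exact ⟨x, rfl⟩
    · have h1 : {r | r ∈ List.ofFn (OrthInv.reducedRelator (m + 2))} =
          Set.range (OrthInv.reducedRelator (m + 2)) := Set.ext fun r => List.mem_ofFn
      rw [Ideal.ofList, h1, ← hker']
      exact Ideal.ext fun x => Subtype.ext_iff
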